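/- Let $k$ be a field, $(H,\mathcal R)$ a quasitriangular Hopf algebra over $k$: $\mathcal R=\mathcal R^{(1)}\otimes\mathcal R^{(2)}\in H\otimes H$ is invertible (write $\mathcal R^{-1}=\mathcal R^{-(1)}\otimes\mathcal R^{-(2)}$), $(\Delta\otimes\mathrm{id})\mathcal R=\mathcal R_{13}\mathcal R_{23}$, $(\mathrm{id}\otimes\Delta)\mathcal R=\mathcal R_{13}\mathcal R_{12}$ and $\Delta^{op}(h)\,\mathcal R=\mathcal R\,\Delta(h)$ for all $h\in H$. Let $B$ be a finite-dimensional Hopf algebra in the braided category of right $H$-modules, with braiding $\Psi(v\otimes w)=w\triangleleft\mathcal R^{(1)}\otimes v\triangleleft\mathcal R^{(2)}$. Its coproduct is $b\mapsto b_{(1)}\otimes b_{(2)}$, and its braided antipode $\underline S$ is assumed invertible. Let $B^*$ be the dual space with the left action $\langle h\triangleright c,b\rangle=\langle c,b\triangleleft h\rangle$ and the transposed structure: $\langle cd,b\rangle=\langle c,b_{(1)}\rangle\langle d,b_{(2)}\rangle$, $\langle c,ab\rangle=\langle c_{(1)},a\rangle\langle c_{(2)},b\rangle$, unit $\epsilon_B$,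 counit $c\mapsto\langle c,1\rangle$, antipode $\underline S^*$. (This is the ordinary dual of $B$; it corresponds to taking the categorical dual $C=B^\star$.) Let $\bar C$ be $B^*$ with the same algebra, action and counit, but with coproduct $\bar\Delta c=c_{\bar{(1)}}\otimes c_{\bar{(2)}}=\mathcal R^{-(1)}\triangleright c_{(2)}\otimes\mathcal R^{-(2)}\triangleright c_{(1)}$ and antipode $\bar S=(\underline S^{*})^{-1}$. The double-bosonisation $U(B)$ is the vector space $\bar C\otimes H\otimes B$ with unit $1\otimes1\otimes1$, the tensor product counit, the coproduct $$\Delta(c\otimes h\otimes b)=\bigl(c_{\bar{(1)}}\otimes\mathcal R^{-(1)}h_{(1)}\otimes b_{(1)}\triangleleft\mathcal R^{(1)}\bigr)\otimes\bigl(\mathcal R^{-(2)}\triangleright c_{\bar{(2)}}\otimes h_{(2)}\mathcal R^{(2)}\otimes b_{(2)}\bigr)$$ and the product $$(c\otimes h\otimes b)(d\otimes g\otimes a)=c\,\bigl(h_{(1)}\mathcal R_1^{(2)}\triangleright d_{\bar{(2)}}\bigr)\otimes h_{(2)}\mathcal R_2^{(2)}\mathcal R_1^{-(1)}g_{(1)}\otimes\bigl(b_{(2)}\triangleleft\mathcal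 R_2^{-(1)}g_{(2)}\bigr)a\;\langle\mathcal R_1^{(1)}\triangleright d_{\bar{(1)}},b_{(1)}\triangleleft\mathcal R_2^{(1)}\rangle\,\langle\mathcal R_1^{-(2)}\triangleright\bar S d_{\bar{(3)}},b_{(3)}\triangleleft\mathcal R_2^{-(2)}\rangle ,$$ where $\mathcal R_1,\mathcal R_2$ are distinct copies of $\mathcal R$, and $\mathcal R_1^{-1},\mathcal R_2^{-1}$ are distinct copies of $\mathcal R^{-1}$. Regard $\bar C$, $H$, $B$ as subspaces of $U(B)$ through $c\otimes1\otimes1$, $1\otimes h\otimes1$, $1\otimes1\otimes b$. **Proposition.** $U(B)$ is a Hopf algebra, and it is quasitriangular. For any basis $\{e_a\}$ of $B$ with dual basis $\{f^a\}$, put $\overline{\exp}_B=\sum_a f^a\otimes\underline S e_a\in\bar C\otimes B$. Then a quasitriangular structure on $U(B)$ is $$\mathcal R_U=\overline{\exp}_B\cdot\mathcal R=\sum_a\bigl(f^a\otimes\mathcal R_2^{(1)}\mathcal R_1^{(1)}\otimes1\bigr)\otimes\bigl(1\otimes\mathcal R_1^{(2)}\otimes\underline S e_a\triangleleft\mathcal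 R_2^{(2)}\bigr),$$ where the product $\cdot$ is taken in $U(B)\otimes U(B)$. -/

import Mathlib

open scoped TensorProduct RightActions

universe u v w x

noncomputable section

namespace DoubleBosonisation

section Quasitriangular

variable (k : Type u) [Field k] {A : Type v} [Ring A] [HopfAlgebra k A]

/-- `X₁₂ ∈ A ⊗ A ⊗ A`, i.e. `a ⊗ b ↦ a ⊗ b ⊗ 1`. -/
def leg12 : A ⊗[k] A →ₗ[k] A ⊗[k] (A ⊗[k] A) :=
  LinearMap.lTensor A ((TensorProduct.mk k A A).flip 1)

/-- `X₁₃ ∈ A ⊗ A ⊗ A`, i.e. `a ⊗ b ↦ a ⊗ 1 ⊗ b`. -/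
def leg13 : A ⊗[k] A →ₗ[k] A ⊗[k] (A ⊗[k] A) :=
  LinearMap.lTensor A (TensorProduct.mk k A A 1)

/-- `X₂₃ ∈ A ⊗ A ⊗ A`, i.e. `a ⊗ b ↦ 1 ⊗ a ⊗ b`. -/
def leg23 : A ⊗[k] A →ₗ[k] A ⊗[k] (A ⊗[k] A) :=
  TensorProduct.mk k A (A ⊗[k] A) 1

/-- `R ∈ A ⊗ A` is a quasitriangular structure (universal R-matrix) on the Hopf algebra `A`. -/
structure IsQuasitriangular (R : A ⊗[k] A) : Prop where
  isUnit : IsUnit R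
  /-- `(Δ ⊗ id) R = R₁₃ R₂₃` -/
  comul_left : TensorProduct.assoc k A A A (LinearMap.rTensor A Coalgebra.comul R) =
    leg13 k R * leg23 k R
  /-- `(id ⊗ Δ) R = R₁₃ R₁₂` -/
  comul_right : LinearMap.lTensor A Coalgebra.comul R = leg13 k R * leg12 k R
  /-- `τ (Δ a) = R (Δ a) R⁻¹` -/
  comul_op : ∀ a : A, TensorProduct.comm k A A (Coalgebra.comul a) * R = R * Coalgebra.comul a

end Quasitriangular

variable {k : Type u} [Field k] {H : Type v} [Ring H] [HopfAlgebra k H]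
  {B : Type w} [Ring B] [Algebra k B] [Coalgebra k B] [Module Hᵐᵒᵖ B] [IsScalarTower k Hᵐᵒᵖ B]

/-! ### Braided groups in the category of right `H`-modules -/

variable (k H B) in
/-- The right action of `H` on `B` as a bilinear map: `rAct h b = b ◁ h`. -/
def rAct : H →ₗ[k] B →ₗ[k] B :=
  (Algebra.lsmul k k B).toLinearMap ∘ₗ (MulOpposite.opLinearEquiv k : H ≃ₗ[k] Hᵐᵒᵖ).toLinearMap

/-- The multiplication of the braided tensor product algebra `B ⊗ B`,
`(a ⊗ b) (c ⊗ d) = a (c ◁ R⁽¹⁾) ⊗ (b ◁ R⁽²⁾) d`,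
that is, `a · Ψ(b ⊗ c) · d` for the braiding `Ψ(b ⊗ c) = c ◁ R⁽¹⁾ ⊗ b ◁ R⁽²⁾`. -/
def braidedMul (R : H ⊗[k] H) : (B ⊗[k] B) ⊗[k] (B ⊗[k] B) →ₗ[k] B ⊗[k] B :=
  TensorProduct.map (LinearMap.mul' k B) (LinearMap.mul' k B) ∘ₗ
    TensorProduct.map₂ (LinearMap.lTensorHom B ∘ₗ rAct k H B)
      (LinearMap.rTensorHom B ∘ₗ rAct k H B) R ∘ₗ
    (TensorProduct.tensorTensorTensorComm k B B B B).toLinearMap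

/-- The algebra and coalgebra `B`, with right `H`-action `◁` and braided antipode `S`, is a Hopf
algebra in the braided category of right modules over the quasitriangular Hopf algebra
`(H, R)`. (Associativity, coassociativity, and that `◁` is a `k`-linear right action, are part of
the instances on `B`.) -/
structure IsBraidedGroup (R : H ⊗[k] H) (S : B →ₗ[k] B) : Prop where
  one_act : ∀ h : H, (1 : B) <• h = algebraMap k B (Coalgebra.counit h)
  /-- `(a b) ◁ h = (a ◁ h₍₁₎) (b ◁ h₍₂₎)` -/
  mul_act : ∀ (a b : B) (h : H), (a * b) <• h = LinearMap.mul' k B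
    (TensorProduct.map₂ (rAct k H B) (rAct k H B) (Coalgebra.comul h) (a ⊗ₜ b))
  counit_act : ∀ (b : B) (h : H),
    Coalgebra.counit (R := k) (b <• h) = Coalgebra.counit b * Coalgebra.counit h
  /-- `Δ (b ◁ h) = b₍₁₎ ◁ h₍₁₎ ⊗ b₍₂₎ ◁ h₍₂₎` -/
  comul_act : ∀ (b : B) (h : H), Coalgebra.comul (R := k) (b <• h) =
    TensorProduct.map₂ (rAct k H B) (rAct k H B) (Coalgebra.comul h) (Coalgebra.comul b)
  counit_one : Coalgebra.counit (R := k) (1 : B) = 1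
  counit_mul : ∀ a b : B,
    Coalgebra.counit (R := k) (a * b) = Coalgebra.counit a * Coalgebra.counit b
  comul_one : Coalgebra.comul (R := k) (1 : B) = 1 ⊗ₜ 1
  comul_mul : ∀ a b : B, Coalgebra.comul (R := k) (a * b) =
    braidedMul R (Coalgebra.comul a ⊗ₜ Coalgebra.comul b)
  antipode_act : ∀ (b : B) (h : H), S (b <• h) = S b <• h
  mul_antipode_left : ∀ b : B, LinearMap.mul' k B (LinearMap.rTensor B S (Coalgebra.comul b)) =
    algebraMap k B (Coalgebra.counit b)
  mul_antipode_right : ∀ b : B, LinearMap.mul' k B (LinearMap.lTensor B S (Coalgebra.comul b)) =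
    algebraMap k B (Coalgebra.counit b)

/-! ### The braided group `C̄`

`B* = Module.Dual k B` is the ordinary dual of `B`, a braided group in the category of left
`H`-modules: all of its structure maps are the transposes of those of `B`. `C̄` is `B*` with the
braided-opposite coproduct `Ψ⁻¹ ∘ Δ` and the antipode `S⁻¹`. -/

variable (k H B) in
/-- The left action of `H` on `B*`: `lAct h φ = h ▷ φ`, where `⟨h ▷ φ, b⟩ = ⟨φ, b ◁ h⟩`. -/
def lAct : H →ₗ[k] Module.Dual k B →ₗ[k] Module.Dual k B :=
  Module.Dual.transpose ∘ₗ rAct k H B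

variable (k B) in
/-- The product of `B*`, `⟨φ ψ, b⟩ = ⟨φ, b₍₁₎⟩ ⟨ψ, b₍₂₎⟩`. Its unit is `Coalgebra.counit`. -/
def dualMul : Module.Dual k B →ₗ[k] Module.Dual k B →ₗ[k] Module.Dual k B :=
  TensorProduct.curry
    ((Coalgebra.comul (R := k) (A := B)).dualMap ∘ₗ TensorProduct.dualDistrib k B B)

variable (k B) in
/-- The coproduct of `B*`, determined by `⟨φ, a b⟩ = ⟨φ₍₁₎, a⟩ ⟨φ₍₂₎, b⟩`. -/
def dualComul [FiniteDimensional k B] :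
    Module.Dual k B →ₗ[k] Module.Dual k B ⊗[k] Module.Dual k B :=
  (TensorProduct.dualDistribEquiv k B B).symm.toLinearMap ∘ₗ (LinearMap.mul' k B).dualMap

/-- The coproduct of `C̄`: `Ψ⁻¹ ∘ Δ`, where `Ψ(φ ⊗ ψ) = R⁽²⁾ ▷ ψ ⊗ R⁽¹⁾ ▷ φ` is the braiding of left
`H`-modules, so that `Ψ⁻¹(φ ⊗ ψ) = R⁻⁽¹⁾ ▷ ψ ⊗ R⁻⁽²⁾ ▷ φ`. -/
def barComul [FiniteDimensional k B] (R : (H ⊗[k] H)ˣ) :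
    Module.Dual k B →ₗ[k] Module.Dual k B ⊗[k] Module.Dual k B :=
  TensorProduct.map₂ (lAct k H B) (lAct k H B) (↑R⁻¹ : H ⊗[k] H) ∘ₗ
    (TensorProduct.comm k (Module.Dual k B) (Module.Dual k B)).toLinearMap ∘ₗ dualComul k B

/-- The antipode of `C̄`: the inverse of the antipode of `B*`, i.e. the transpose of the inverse
of the antipode of `B`. -/
def barAntipode (S : B ≃ₗ[k] B) : Module.Dual k B →ₗ[k] Module.Dual k B :=
  Module.Dual.transpose S.symm.toLinearMap

/-! ### The Hopf algebra structure maps of `U(B)` on `C̄ ⊗ H ⊗ B` -/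

variable (k H B) in
/-- The vector space `C̄ ⊗ H ⊗ B`. -/
abbrev Space : Type (max u v w) := Module.Dual k B ⊗[k] (H ⊗[k] B)

/-- Left multiplication in the smash product `C̄ ⋊ H`:
`(c ⊗ h) (d ⊗ g) = c (h₍₁₎ ▷ d) ⊗ h₍₂₎ g`. -/
def smashLeft : Module.Dual k B ⊗[k] H →ₗ[k] Module.End k (Module.Dual k B ⊗[k] H) :=
  TensorProduct.lift ((LinearMap.mul k (Module.End k (Module.Dual k B ⊗[k] H))).compl₁₂
    (LinearMap.rTensorHom H ∘ₗ dualMul k B)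
    (TensorProduct.map₂ (lAct k H B) (LinearMap.mul k H) ∘ₗ Coalgebra.comul))

/-- Right multiplication in the smash product `H ⋉ B`: `smashRight (g ⊗ a) (h ⊗ b)` is
`(h ⊗ b) (g ⊗ a) = h g₍₁₎ ⊗ (b ◁ g₍₂₎) a`. -/
def smashRight : H ⊗[k] B →ₗ[k] Module.End k (H ⊗[k] B) :=
  TensorProduct.lift ((LinearMap.mul k (Module.End k (H ⊗[k] B))).flip.compl₁₂
    (TensorProduct.map₂ (LinearMap.mul k H).flip (rAct k H B) ∘ₗ Coalgebra.comul)
    (LinearMap.lTensorHom H ∘ₗ (LinearMap.mul k B).flip))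

/-- `c ↦ (R⁽¹⁾ ▷ c₍₁₎ ⊗ R⁽²⁾ ▷ c₍₂₎) ⊗ (R⁻⁽¹⁾ ⊗ R⁻⁽²⁾ ▷ S̄ c₍₃₎)`, with the coproduct of `C̄`. -/
def crossLeft [FiniteDimensional k B] (R : (H ⊗[k] H)ˣ) (S : B ≃ₗ[k] B) :
    Module.Dual k B →ₗ[k]
      (Module.Dual k B ⊗[k] Module.Dual k B) ⊗[k] (H ⊗[k] Module.Dual k B) :=
  TensorProduct.map
      (TensorProduct.map₂ (lAct k H B) (lAct k H B) (R : H ⊗[k] H))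
      ((LinearMap.lTensorHom H ∘ₗ (lAct k H B).flip).flip (↑R⁻¹ : H ⊗[k] H) ∘ₗ barAntipode S) ∘ₗ
    LinearMap.rTensor (Module.Dual k B) (barComul R) ∘ₗ barComul R

/-- `b ↦ (b₍₁₎ ◁ R⁽¹⁾ ⊗ R⁽²⁾) ⊗ (b₍₂₎ ◁ R⁻⁽¹⁾ ⊗ b₍₃₎ ◁ R⁻⁽²⁾)`. -/
def crossRight (R : (H ⊗[k] H)ˣ) : B →ₗ[k] (B ⊗[k] H) ⊗[k] (B ⊗[k] B) :=
  TensorProduct.map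
      ((LinearMap.rTensorHom H ∘ₗ (rAct k H B).flip).flip (R : H ⊗[k] H))
      (TensorProduct.map₂ (rAct k H B) (rAct k H B) (↑R⁻¹ : H ⊗[k] H)) ∘ₗ
    LinearMap.lTensor B Coalgebra.comul ∘ₗ Coalgebra.comul

variable (k H B) in
/-- `((c ⊗ d) ⊗ (h ⊗ e), (b ⊗ g) ⊗ (a ⊗ a')) ↦ ⟨c, b⟩ ⟨e, a'⟩ d ⊗ g h ⊗ a`. -/
def contract :
    (Module.Dual k B ⊗[k] Module.Dual k B) ⊗[k] (H ⊗[k] Module.Dual k B) →ₗ[k]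
      (B ⊗[k] H) ⊗[k] (B ⊗[k] B) →ₗ[k] Space k H B :=
  (TensorProduct.map₂
    ((TensorProduct.map₂ (LinearMap.id : Module.Dual k B →ₗ[k] Module.Dual k B)
      (TensorProduct.mk k (Module.Dual k B) H)).compr₂
        (TensorProduct.lid k (Module.Dual k B ⊗[k] H)).toLinearMap)
    ((TensorProduct.map₂ (TensorProduct.mk k H B)
      (LinearMap.id : Module.Dual k B →ₗ[k] Module.Dual k B)).compr₂
        (TensorProduct.rid k (H ⊗[k] B)).toLinearMap)).compr₂
    (LinearMap.lTensor (Module.Dual k B)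
        (LinearMap.rTensor B (LinearMap.mul' k H) ∘ₗ (TensorProduct.assoc k H H B).symm.toLinearMap)
      ∘ₗ (TensorProduct.assoc k (Module.Dual k B) H (H ⊗[k] B)).toLinearMap)

/-- The product `b c` in `U(B)` of `b ∈ B` and `c ∈ C̄`, reordered into `C̄ ⊗ H ⊗ B`:
`b c = (R₁⁽²⁾ ▷ c₍₂₎) ⊗ R₂⁽²⁾ R₁⁻⁽¹⁾ ⊗ (b₍₂₎ ◁ R₂⁻⁽¹⁾)
  ⟨R₁⁽¹⁾ ▷ c₍₁₎, b₍₁₎ ◁ R₂⁽¹⁾⟩ ⟨R₁⁻⁽²⁾ ▷ S̄ c₍₃₎, b₍₃₎ ◁ R₂⁻⁽²⁾⟩`. -/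
def cross [FiniteDimensional k B] (R : (H ⊗[k] H)ˣ) (S : B ≃ₗ[k] B) :
    B →ₗ[k] Module.Dual k B →ₗ[k] Space k H B :=
  ((contract k H B).compl₁₂ (crossLeft R S) (crossRight R)).flip

/-- The product of `U(B)`: `(c ⊗ h ⊗ b) (d ⊗ g ⊗ a) = (c ⊗ h) · (b d) · (g ⊗ a)`, where `b d` is
given by `cross`, `c ⊗ h` multiplies the factor `C̄ ⊗ H` from the left as in `C̄ ⋊ H`, and `g ⊗ a`
multiplies the factor `H ⊗ B` from the right as in `H ⋉ B`. -/
def mul [FiniteDimensional k B] (R : (H ⊗[k] H)ˣ) (S : B ≃ₗ[k] B) :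
    Space k H B →ₗ[k] Space k H B →ₗ[k] Space k H B :=
  TensorProduct.lift ((LinearMap.mul k (Module.End k (Space k H B))).compl₁₂
      ((TensorProduct.assoc k (Module.Dual k B) H B).conj.toLinearMap ∘ₗ
        LinearMap.rTensorHom B ∘ₗ smashLeft)
      (TensorProduct.uncurry (.id k) (Module.Dual k B) (H ⊗[k] B) (Space k H B) ∘ₗ
        (cross R S).compr₂ (LinearMap.lTensorHom (Module.Dual k B) ∘ₗ smashRight).flip)) ∘ₗ
    (TensorProduct.assoc k (Module.Dual k B) H B).symm.toLinearMap

theorem mul_tmul [FiniteDimensional k B] (R : (H ⊗[k] H)ˣ) (S : B ≃ₗ[k] B)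
    (c d : Module.Dual k B) (h g : H) (b a : B) :
    mul R S (c ⊗ₜ (h ⊗ₜ b)) (d ⊗ₜ (g ⊗ₜ a)) =
      TensorProduct.assoc k _ _ _ (LinearMap.rTensor B (smashLeft (c ⊗ₜ h))
        ((TensorProduct.assoc k _ _ _).symm
          (LinearMap.lTensor _ (smashRight (g ⊗ₜ a)) (cross R S b d)))) :=
  rfl

variable (k H B) in
/-- The inclusion of `C̄`, `c ↦ c ⊗ 1 ⊗ 1`. -/
def inclC : Module.Dual k B →ₗ[k] Space k H B :=
  (TensorProduct.mk k (Module.Dual k B) (H ⊗[k] B)).flip (1 ⊗ₜ 1)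

variable (k H B) in
/-- The inclusion of `H`, `h ↦ 1 ⊗ h ⊗ 1`. -/
def inclH : H →ₗ[k] Space k H B :=
  TensorProduct.mk k (Module.Dual k B) (H ⊗[k] B) Coalgebra.counit ∘ₗ
    (TensorProduct.mk k H B).flip 1

variable (k H B) in
/-- The inclusion of `B`, `b ↦ 1 ⊗ 1 ⊗ b`. -/
def inclB : B →ₗ[k] Space k H B :=
  TensorProduct.mk k (Module.Dual k B) (H ⊗[k] B) Coalgebra.counit ∘ₗ TensorProduct.mk k H B 1

variable (k H B) in
/-- The unit `1 ⊗ 1 ⊗ 1` of `U(B)`. -/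
def one : Space k H B := inclH k H B 1

/-- The coproduct of `U(B)`:
`Δ(c ⊗ h ⊗ b) = (c₍₁₎ ⊗ R⁻⁽¹⁾ h₍₁₎ ⊗ b₍₁₎ ◁ R⁽¹⁾) ⊗ (R⁻⁽²⁾ ▷ c₍₂₎ ⊗ h₍₂₎ R⁽²⁾ ⊗ b₍₂₎)`. -/
def comul [FiniteDimensional k B] (R : (H ⊗[k] H)ˣ) :
    Space k H B →ₗ[k] Space k H B ⊗[k] Space k H B :=
  TensorProduct.map₂
      (LinearMap.lTensorHom (Module.Dual k B) ∘ₗ LinearMap.rTensorHom B ∘ₗ LinearMap.mul k H)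
      (LinearMap.rTensorHom (H ⊗[k] B) ∘ₗ lAct k H B) (↑R⁻¹ : H ⊗[k] H) ∘ₗ
    TensorProduct.map₂
      (LinearMap.lTensorHom (Module.Dual k B) ∘ₗ LinearMap.lTensorHom H ∘ₗ rAct k H B)
      (LinearMap.lTensorHom (Module.Dual k B) ∘ₗ LinearMap.rTensorHom B ∘ₗ
        (LinearMap.mul k H).flip) (R : H ⊗[k] H) ∘ₗ
    (TensorProduct.tensorTensorTensorComm k (Module.Dual k B) (Module.Dual k B)
      (H ⊗[k] B) (H ⊗[k] B)).toLinearMap ∘ₗ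
    TensorProduct.map (barComul R)
      ((TensorProduct.tensorTensorTensorComm k H H B B).toLinearMap ∘ₗ
        TensorProduct.map Coalgebra.comul Coalgebra.comul)

variable (k H B) in
/-- The counit of `U(B)`, `c ⊗ h ⊗ b ↦ ⟨c, 1⟩ ε(h) ε(b)`. -/
def counit : Space k H B →ₗ[k] k :=
  LinearMap.mul' k k ∘ₗ TensorProduct.map (Module.Dual.eval k B 1)
    (LinearMap.mul' k k ∘ₗ TensorProduct.map Coalgebra.counit Coalgebra.counit)

/-- The linear isomorphism `θ` identifies the Hopf algebra `U` with the space `C̄ ⊗ H ⊗ B` equipped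
with the structure maps of the double-bosonisation `U(B)`. (An antipode is unique when it exists,
and needs no condition.) -/
structure IsDoubleBosonisation [FiniteDimensional k B] (R : (H ⊗[k] H)ˣ) (S : B ≃ₗ[k] B)
    {U : Type*} [Ring U] [HopfAlgebra k U] (θ : Space k H B ≃ₗ[k] U) : Prop where
  map_one : θ (one k H B) = 1
  map_mul : ∀ x y : Space k H B, θ (mul R S x y) = θ x * θ y
  counit_map : ∀ x : Space k H B, Coalgebra.counit (R := k) (θ x) = counit k H B x
  comul_map : ∀ x : Space k H B,
    Coalgebra.comul (R := k) (θ x) = TensorProduct.map θ.toLinearMap θ.toLinearMap (comul R x)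

/-! ### The quasitriangular structure -/

/-- `∑ fᵃ ⊗ S eₐ ∈ C̄ ⊗ B`, for a basis `eₐ` of `B` with dual basis `fᵃ`. -/
def expBar {ι : Type*} [Fintype ι] (e : Module.Basis ι k B) (S : B ≃ₗ[k] B) :
    Module.Dual k B ⊗[k] B :=
  ∑ a, e.coord a ⊗ₜ[k] S (e a)

/-- The element `expBar · R` of `U ⊗ U`, the product of the images of `expBar ∈ C̄ ⊗ B` and of
`R ∈ H ⊗ H` under the inclusions of `C̄`, `B` and `H` in `U`. -/
def universalR {U : Type*} [Ring U] [HopfAlgebra k U] (θ : Space k H B ≃ₗ[k] U)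
    {ι : Type*} [Fintype ι] (e : Module.Basis ι k B) (R : H ⊗[k] H) (S : B ≃ₗ[k] B) : U ⊗[k] U :=
  TensorProduct.map (θ.toLinearMap ∘ₗ inclC k H B) (θ.toLinearMap ∘ₗ inclB k H B) (expBar e S) *
    TensorProduct.map (θ.toLinearMap ∘ₗ inclH k H B) (θ.toLinearMap ∘ₗ inclH k H B) R

/-- `∑ (fᵃ ⊗ R₂⁽¹⁾ R₁⁽¹⁾ ⊗ 1) ⊗ (1 ⊗ R₁⁽²⁾ ⊗ S eₐ ◁ R₂⁽²⁾)`: the summand is the bilinear map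
`(r ⊗ r', s ⊗ s') ↦ (fᵃ ⊗ s r ⊗ 1) ⊗ (1 ⊗ r' ⊗ S eₐ ◁ s')` at `(R, R)`. -/
def explicitR {ι : Type*} [Fintype ι] (e : Module.Basis ι k B) (R : H ⊗[k] H) (S : B ≃ₗ[k] B) :
    Space k H B ⊗[k] Space k H B :=
  ∑ a, TensorProduct.map₂
    ((LinearMap.mul k H).flip.compr₂
      (TensorProduct.mk k (Module.Dual k B) (H ⊗[k] B) (e.coord a) ∘ₗ
        (TensorProduct.mk k H B).flip 1))
    (((TensorProduct.mk k H B).compl₂ ((rAct k H B).flip (S (e a)))).compr₂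
      (TensorProduct.mk k (Module.Dual k B) (H ⊗[k] B) Coalgebra.counit))
    R R

end DoubleBosonisation

end

set_option linter.unusedSectionVars false
noncomputable section
namespace BraidedDouble
open Coalgebra TensorProduct
open DoubleBosonisation hiding comul counit mul one
variable {k : Type u} [Field k] {H : Type v} [Ring H] [HopfAlgebra k H]
  {B : Type w} [Ring B] [Algebra k B] [Coalgebra k B] [Module Hᵐᵒᵖ B] [IsScalarTower k Hᵐᵒᵖ B]
/-! ### Products of maps into an algebra -/

section MulMap

variable {A : Type*} [Ring A] [Algebra k A]
  {V V' W W' X : Type*} [AddCommGroup V] [Module k V] [AddCommGroup W] [Module k W]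
  [AddCommGroup X] [Module k X] [AddCommGroup V'] [Module k V'] [AddCommGroup W'] [Module k W']

/-! The double-bosonisation is a cocycle twist. If the cross relation between `B` and `C̄` is
replaced by plain commutation, the same coproduct lives on a much simpler algebra, the two-sided
smash product W = C̄ ⋊ H ⋉ B. The pairing σ(x, y) = ⟨toC y, toB x⟩ of the projections to `C̄` and
`B` is a two-cocycle on W, and U(B) is W with the product σ(x₁, y₁) x₂y₂ σ⁻¹(x₃, y₃). Associativity
and multiplicativity of the coproduct then hold as for any cocycle twist
(`IsTwoCocycle.exists_twist`), without touching the long product formula, which is recovered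
afterwards.

The braided group `C̄`. Its coproduct is the transpose of the opposite product m ∘ Ψ⁻¹ on `B`, which
is `twistedMul` at R⁻¹. Associativity of that product and its compatibility with Δ are identities in
H ⊗ H ⊗ H and in the fourth tensor power of `H`. The braided antipode is braided-antimultiplicative,
by uniqueness of convolution inverses (`antipode_mul`), hence multiplicative from the opposite
product to the product; so S⁻¹ is an antipode for the opposite product.

The smash product. W is found inside End(B*) ⊗ H ⊗ End(B)ᵒᵖ (`exists_isSmash`) and is used through
its universal property `IsSmash.lift`. Its coproduct sends c to c₁ · R⁻¹c₂R and b to R⁻¹b₁R · b₂,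
the first parts lying in the left factor of W ⊗ W and the second parts in the right one. In this
conjugated form the smash relations come from R⁻¹Δᵒᵖ R = Δ and the braiding (`isSmashTriple_prod`),
and coassociativity comes from the Yang-Baxter equation (`prodB_assoc`, `prodC_assoc`). Tensor legs
are treated throughout as commuting maps p, q, … into an arbitrary algebra, R_pq being `mulMap p q
R`; one set of lemmas then serves all legs and all numbers of factors.

The twist. `toB` is right linear, `toC` is left linear, and both are coalgebra maps. Hence for y = d
h a both sides of the cocycle identity are toC z evaluated at ((d(β₁)β₂) ◁ h) a with β = toB x
(`isTwoCocycle`); the inverse cocycle is given by S̄. Only products of b followed by c are altered,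
and for them the twist yields the exchange relation b₁c₁R⁻⁽¹⁾⟨c₂, b₂ ◁ R⁻⁽²⁾⟩ = ⟨c₁, b₁ ◁
R⁽¹⁾⟩R⁽²⁾c₂b₂. The outcome is recorded in `IsDouble`. Solving the exchange relation for bc with S̄
gives the stated product (`triple_cross`). The antipode exists because the identification W → U is a
convolution product of three convolution-invertible maps, one for each of `C̄`, `H`, `B`.

The R-matrix. Let T = ∑ fᵃ ⊗ eₐ. Since the product of `B*` is dual to the coproduct of `B`,
convolution becomes multiplication of canonical elements (`canon_conv`), so ∑ fᵃ ⊗ S eₐ is T⁻¹. The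
identity T Δᵒᵖ(x) = R Δ(x) R⁻¹ T (`slotCanon_mul_slotComul`) is, for x in `B` or `C̄`, the exchange
relation read in a basis and, for x in `H`, the invariance of T. Hence T⁻¹R intertwines Δ and Δᵒᵖ.
The two hexagons follow by inverting (Δ ⊗ id)T = R₁₃T₂₃R₁₃⁻¹T₁₃ and (id ⊗ Δ)T = R₂₃⁻¹T₁₂R₂₃T₁₃. The
explicit form comes from moving S eₐ past R. -/

/-- `v ⊗ w ↦ f v * g w`. -/
def mulMap (f : V →ₗ[k] A) (g : W →ₗ[k] A) : V ⊗[k] W →ₗ[k] A :=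
  LinearMap.mul' k A ∘ₗ TensorProduct.map f g

@[simp]
theorem mulMap_tmul (f : V →ₗ[k] A) (g : W →ₗ[k] A) (v : V) (w : W) :
    mulMap f g (v ⊗ₜ w) = f v * g w := rfl

theorem mulMap_map (f : V →ₗ[k] A) (g : W →ₗ[k] A) (f' : V' →ₗ[k] V) (g' : W' →ₗ[k] W)
    (X : V' ⊗[k] W') :
    mulMap f g (TensorProduct.map f' g' X) = mulMap (f ∘ₗ f') (g ∘ₗ g') X := by
  induction X with
  | zero => simp
  | add x y hx hy => simp [hx, hy]
  | tmul => simp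

theorem mulMap_comm (f : V →ₗ[k] A) (g : W →ₗ[k] A) (h : ∀ v w, Commute (f v) (g w))
    (X : V ⊗[k] W) : mulMap g f (TensorProduct.comm k V W X) = mulMap f g X := by
  induction X with
  | zero => simp
  | add x y hx hy => simp [hx, hy]
  | tmul v w => simpa using (h v w).symm.eq

theorem mulMap_lTensor (f : V →ₗ[k] A) (g : W →ₗ[k] A) (g' : W' →ₗ[k] W) (X : V ⊗[k] W') :
    mulMap f g (LinearMap.lTensor V g' X) = mulMap f (g ∘ₗ g') X :=
  mulMap_map f g LinearMap.id g' X

theorem mulMap_rTensor (f : V →ₗ[k] A) (g : W →ₗ[k] A) (f' : V' →ₗ[k] V) (X : V' ⊗[k] W) :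
    mulMap f g (LinearMap.rTensor W f' X) = mulMap (f ∘ₗ f') g X :=
  mulMap_map f g f' LinearMap.id X

theorem mulMap_assoc (f : V →ₗ[k] A) (g : W →ₗ[k] A) (h : X →ₗ[k] A) (Y : (V ⊗[k] W) ⊗[k] X) :
    mulMap f (mulMap g h) (TensorProduct.assoc k V W X Y) = mulMap (mulMap f g) h Y := by
  induction Y with
  | zero => simp
  | add x y hx hy => simp [hx, hy]
  | tmul y x =>
    induction y with
    | zero => simp
    | add x y hx hy => simp [add_tmul, hx, hy]
    | tmul v w => simp [mul_assoc]

theorem commute_mulMap {f : V →ₗ[k] A} {g : W →ₗ[k] A} {a : A} (hf : ∀ v, Commute a (f v))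
    (hg : ∀ w, Commute a (g w)) (Y : V ⊗[k] W) : Commute a (mulMap f g Y) := by
  induction Y with
  | zero => simp
  | add x y hx hy => simpa using hx.add_right hy
  | tmul v w => exact (hf v).mul_right (hg w)

theorem map_mulMap {A' : Type*} [Ring A'] [Algebra k A'] (φ : A →ₐ[k] A') (f : V →ₗ[k] A)
    (g : W →ₗ[k] A) (Y : V ⊗[k] W) :
    φ (mulMap f g Y) = mulMap (φ.toLinearMap ∘ₗ f) (φ.toLinearMap ∘ₗ g) Y := by
  induction Y with
  | zero => simp
  | add x y hx hy => simp [hx, hy]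
  | tmul v w => simp

/-- Convolution product of linear maps from a coalgebra to an algebra. -/
def conv {D : Type*} [AddCommGroup D] [Module k D] [Coalgebra k D] (f g : D →ₗ[k] A) :
    D →ₗ[k] A := mulMap f g ∘ₗ comul

theorem conv_apply {D : Type*} [AddCommGroup D] [Module k D] [Coalgebra k D] (f g : D →ₗ[k] A)
    (d : D) : conv f g d = mulMap f g (comul d) := rfl

theorem conv_assoc {D : Type*} [AddCommGroup D] [Module k D] [Coalgebra k D]
    (f g h : D →ₗ[k] A) : conv f (conv g h) = conv (conv f g) h := by
  ext d
  simp only [conv_apply]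
  conv_lhs => rw [conv, ← mulMap_lTensor, ← coassoc_apply, mulMap_assoc, mulMap_rTensor]
  rfl

/-- Commuting algebra maps factor through the tensor product algebra. This is what lets the
invertibility of R and Δᵒᵖ R = R Δ be read in any pair of commuting copies of `H`. -/
theorem mulMap_mul {P Q : Type*} [Ring P] [Algebra k P] [Ring Q] [Algebra k Q]
    {p : P →ₐ[k] A} {q : Q →ₐ[k] A} (h : ∀ x y, Commute (p x) (q y)) (X Y : P ⊗[k] Q) :
    mulMap p.toLinearMap q.toLinearMap (X * Y) =
      mulMap p.toLinearMap q.toLinearMap X * mulMap p.toLinearMap q.toLinearMap Y :=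
by
  have e : ∀ Z, mulMap p.toLinearMap q.toLinearMap Z = Algebra.TensorProduct.lift p q h Z := by
    intro Z
    induction Z with
    | zero => simp
    | add x y hx hy => simp only [map_add, hx, hy]
    | tmul x y => simp
  rw [e, e, e, map_mul]

theorem mulMap_one {P Q : Type*} [Ring P] [Algebra k P] [Ring Q] [Algebra k Q]
    (p : P →ₐ[k] A) (q : Q →ₐ[k] A) :
    mulMap p.toLinearMap q.toLinearMap (1 : P ⊗[k] Q) = 1 := by
  simp [Algebra.TensorProduct.one_def]

end MulMap

/-! ### The `R`-matrix in an algebra -/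

section RMatrix

variable {A : Type*} [Ring A] [Algebra k A]

theorem mulMap_inv_mul {p q : H →ₐ[k] A} (h : ∀ x y, Commute (p x) (q y)) (R : (H ⊗[k] H)ˣ) :
    mulMap p.toLinearMap q.toLinearMap (↑R⁻¹ : H ⊗[k] H) *
      mulMap p.toLinearMap q.toLinearMap (R : H ⊗[k] H) = 1 := by
  rw [← mulMap_mul h, Units.inv_mul, mulMap_one]

theorem mulMap_mul_inv {p q : H →ₐ[k] A} (h : ∀ x y, Commute (p x) (q y)) (R : (H ⊗[k] H)ˣ) :
    mulMap p.toLinearMap q.toLinearMap (R : H ⊗[k] H) *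
      mulMap p.toLinearMap q.toLinearMap (↑R⁻¹ : H ⊗[k] H) = 1 := by
  rw [← mulMap_mul h, Units.mul_inv, mulMap_one]

/-- This is (Δ ⊗ id)R = R₁₃R₂₃ evaluated in `A`. Only the last leg has to be an algebra map; the
first two are merely linear so that one of them can be a map such as h ↦ f (b ◁ h). -/
theorem mulMap_conv_left {R : H ⊗[k] H} (hR : IsQuasitriangular k R) (p q : H →ₗ[k] A)
    (r : H →ₐ[k] A) (h : ∀ x y, Commute (q x) (r y)) :
    mulMap (conv p q) r.toLinearMap R = mulMap p r.toLinearMap R * mulMap q r.toLinearMap R := by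
  have h1 := congrArg (mulMap p (mulMap q r.toLinearMap)) hR.comul_left
  rw [mulMap_assoc, mulMap_rTensor] at h1
  refine h1.trans ?_
  have h2 : ∀ X Y : H ⊗[k] H, mulMap p (mulMap q r.toLinearMap) (leg13 k X * leg23 k Y) =
      mulMap p r.toLinearMap X * mulMap q r.toLinearMap Y := by
    intro X Y
    induction X with
    | zero => simp
    | add x y hx hy => simp [add_mul, hx, hy]
    | tmul a b =>
      induction Y with
      | zero => simp
      | add x y hx hy => simp only [map_add, mul_add, hx, hy]
      | tmul c d =>
        simp only [leg13, leg23, LinearMap.lTensor_tmul, mk_apply,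
          Algebra.TensorProduct.tmul_mul_tmul, mulMap_tmul, AlgHom.toLinearMap_apply, map_mul,
          mul_one, one_mul]
        rw [mul_assoc, ← mul_assoc (q c), (h c b).eq, mul_assoc]
  exact h2 _ _

theorem mulMap_conv_right {R : H ⊗[k] H} (hR : IsQuasitriangular k R) (p : H →ₐ[k] A)
    (q r : H →ₗ[k] A) (hp : ∀ x y, Commute (p x) (r y)) (hq : ∀ x y, Commute (q x) (r y)) :
    mulMap p.toLinearMap (conv q r) R = mulMap p.toLinearMap r R * mulMap p.toLinearMap q R := by
  have h1 := congrArg (mulMap p.toLinearMap (mulMap q r)) hR.comul_right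
  rw [mulMap_lTensor] at h1
  refine h1.trans ?_
  have h2 : ∀ X Y : H ⊗[k] H, mulMap p.toLinearMap (mulMap q r) (leg13 k X * leg12 k Y) =
      mulMap p.toLinearMap r X * mulMap p.toLinearMap q Y := by
    intro X Y
    induction X with
    | zero => simp
    | add x y hx hy => simp [add_mul, hx, hy]
    | tmul a b =>
      induction Y with
      | zero => simp
      | add x y hx hy => simp only [map_add, mul_add, hx, hy]
      | tmul c d =>
        simp only [leg13, leg12, LinearMap.lTensor_tmul, mk_apply, LinearMap.flip_apply,
          Algebra.TensorProduct.tmul_mul_tmul, mulMap_tmul, AlgHom.toLinearMap_apply, map_mul,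
          mul_one, one_mul]
        rw [(hq d b).eq, mul_assoc, ← mul_assoc (p c), (hp c b).eq, mul_assoc, mul_assoc]
  exact h2 _ _

/-- `Δᵒᵖ(h) R = R Δ(h)`. -/
theorem conv_mul_mulMap {R : H ⊗[k] H} (hR : IsQuasitriangular k R) {p q : H →ₐ[k] A}
    (h : ∀ x y, Commute (p x) (q y)) (a : H) :
    conv q.toLinearMap p.toLinearMap a * mulMap p.toLinearMap q.toLinearMap R =
      mulMap p.toLinearMap q.toLinearMap R * conv p.toLinearMap q.toLinearMap a := by
  have := congrArg (mulMap p.toLinearMap q.toLinearMap) (hR.comul_op a)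
  rw [mulMap_mul h, mulMap_mul h] at this
  rwa [mulMap_comm q.toLinearMap p.toLinearMap (fun v w => (h w v).symm)] at this

/-- The Yang-Baxter equation. -/
theorem yangBaxter {R : H ⊗[k] H} (hR : IsQuasitriangular k R) {p q r : H →ₐ[k] A}
    (hpq : ∀ x y, Commute (p x) (q y)) (hpr : ∀ x y, Commute (p x) (r y))
    (hqr : ∀ x y, Commute (q x) (r y)) :
    mulMap p.toLinearMap q.toLinearMap R * mulMap p.toLinearMap r.toLinearMap R *
        mulMap q.toLinearMap r.toLinearMap R =
      mulMap q.toLinearMap r.toLinearMap R * mulMap p.toLinearMap r.toLinearMap R *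
        mulMap p.toLinearMap q.toLinearMap R := by
  -- In each side two of the factors form R with Δ or Δᵒᵖ on its first leg, so the claim is R Δ(x) =
  -- Δᵒᵖ(x) R applied to that leg, the third leg being a spectator.
  rw [← mulMap_conv_left hR q.toLinearMap p.toLinearMap r (fun x y => hpr x y), mul_assoc,
    ← mulMap_conv_left hR p.toLinearMap q.toLinearMap r (fun x y => hqr x y)]
  have key : ∀ X : H ⊗[k] H, mulMap p.toLinearMap q.toLinearMap R *
      mulMap (conv p.toLinearMap q.toLinearMap) r.toLinearMap X =
      mulMap (conv q.toLinearMap p.toLinearMap) r.toLinearMap X *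
        mulMap p.toLinearMap q.toLinearMap R := by
    intro X
    induction X with
    | zero => simp
    | add x y hx hy => simp only [map_add, mul_add, add_mul, hx, hy]
    | tmul x y =>
      have hc : Commute (r.toLinearMap y) (mulMap p.toLinearMap q.toLinearMap R) :=
        commute_mulMap (fun v => (hpr v y).symm) (fun v => (hqr v y).symm) R
      rw [mulMap_tmul, mulMap_tmul, ← mul_assoc, ← conv_mul_mulMap hR hpq, mul_assoc, mul_assoc,
        hc.eq]
  exact key R

end RMatrix

/-! ### Smash product relations -/

section Relations

variable {A : Type*} [Ring A] [Algebra k A]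

variable (k H) in
/-- `ract b h = b ◁ h`. -/
abbrev ract (b : B) : H →ₗ[k] B := (rAct k H B).flip b

/-- `lact c h = h ▷ c`. -/
abbrev lact (H : Type v) [Ring H] [HopfAlgebra k H] [Module Hᵐᵒᵖ B] [IsScalarTower k Hᵐᵒᵖ B]
    (c : Module.Dual k B) : H →ₗ[k] Module.Dual k B := (lAct k H B).flip c

/-- `f b * p h = p h₍₁₎ * f (b ◁ h₍₂₎)`. -/
def RelRight (f : B →ₗ[k] A) (p : H →ₗ[k] A) : Prop :=
  ∀ b h, f b * p h = mulMap p (f ∘ₗ ract k H b) (comul h)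

/-- `p h * f c = f (h₍₁₎ ▷ c) * p h₍₂₎`. -/
def RelLeft (f : Module.Dual k B →ₗ[k] A) (p : H →ₗ[k] A) : Prop :=
  ∀ h c, p h * f c = mulMap (f ∘ₗ lact H c) p (comul h)

/-- By coassociativity, an extra copy of `H` that commutes with f passes through untouched, so f
satisfies the same relation with the diagonal copy of `H`. -/
theorem RelRight.conv {f : B →ₗ[k] A} {p r : H →ₗ[k] A} (h : RelRight f p)
    (hr : ∀ x y, Commute (f x) (r y)) : RelRight f (conv r p) := by
  intro b a
  have h1 : ∀ X : H ⊗[k] H, f b * mulMap r p X =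
      mulMap r (BraidedDouble.conv p (f ∘ₗ ract k H b)) X := by
    intro X
    induction X with
    | zero => simp
    | add x y hx hy => simp only [map_add, mul_add, hx, hy]
    | tmul x y => rw [mulMap_tmul, mulMap_tmul, ← mul_assoc, (hr b x).eq, mul_assoc, h]; rfl
  rw [conv_apply, h1, ← conv_apply, ← conv_apply, conv_assoc]

theorem RelLeft.conv {f : Module.Dual k B →ₗ[k] A} {p r : H →ₗ[k] A} (h : RelLeft f p)
    (hr : ∀ x y, Commute (f x) (r y)) : RelLeft f (conv p r) := by
  intro a c
  have h1 : ∀ X : H ⊗[k] H, mulMap p r X * f c =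
      mulMap (BraidedDouble.conv (f ∘ₗ lact H c) p) r X := by
    intro X
    induction X with
    | zero => simp
    | add x y hx hy => simp only [map_add, add_mul, hx, hy]
    | tmul x y => rw [mulMap_tmul, mulMap_tmul, mul_assoc, ← (hr c y).eq, ← mul_assoc, h]; rfl
  rw [conv_apply, h1, ← conv_apply, ← conv_apply, conv_assoc]

/-- The map `x ↦ u * f x * v`. -/
def conjMap {V : Type*} [AddCommGroup V] [Module k V] (u v : A) (f : V →ₗ[k] A) : V →ₗ[k] A :=
  LinearMap.mulRight k v ∘ₗ LinearMap.mulLeft k u ∘ₗ f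

@[simp]
theorem conjMap_apply {V : Type*} [AddCommGroup V] [Module k V] (u v : A) (f : V →ₗ[k] A) (x : V) :
    conjMap u v f x = u * f x * v := rfl

theorem mulMap_conjMap {V W : Type*} [AddCommGroup V] [Module k V] [AddCommGroup W] [Module k W]
    {u v : A} (hvu : v * u = 1) (f : V →ₗ[k] A) (g : W →ₗ[k] A) (X : V ⊗[k] W) :
    mulMap (conjMap u v f) (conjMap u v g) X = u * mulMap f g X * v := by
  induction X with
  | zero => simp
  | add x y hx hy => simp only [map_add, mul_add, add_mul, hx, hy]
  | tmul x y =>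
    simp only [mulMap_tmul, conjMap_apply]
    rw [mul_assoc, ← mul_assoc v, ← mul_assoc v, hvu, one_mul]
    simp only [mul_assoc]

theorem eq_conjMap {p q : H →ₗ[k] A} {u v : A} (huv : u * v = 1)
    (hq : ∀ x, p x * v = v * q x) : q = conjMap u v p := by
  ext x
  rw [conjMap_apply, mul_assoc, hq, ← mul_assoc, huv, one_mul]

/-- Conjugation by u is an automorphism, and p x * v = v * q x says that it carries p to q. The use
is u = R⁻¹, which carries Δᵒᵖ to Δ. -/
theorem RelRight.conj {f : B →ₗ[k] A} {p q : H →ₗ[k] A} (h : RelRight f p) {u v : A}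
    (huv : u * v = 1) (hvu : v * u = 1) (hq : ∀ x, p x * v = v * q x) :
    RelRight (conjMap u v f) q := by
  intro b x
  have := mulMap_conjMap hvu p (f ∘ₗ ract k H b) (comul x)
  rw [← h] at this
  rw [eq_conjMap huv hq]
  refine Eq.trans ?_ this.symm
  simp only [conjMap_apply, mul_assoc]
  rw [← mul_assoc v, hvu, one_mul]

theorem RelLeft.conj {f : Module.Dual k B →ₗ[k] A} {p q : H →ₗ[k] A} (h : RelLeft f p) {u v : A}
    (huv : u * v = 1) (hvu : v * u = 1) (hq : ∀ x, p x * v = v * q x) :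
    RelLeft (conjMap u v f) q := by
  intro x c
  have := mulMap_conjMap hvu (f ∘ₗ lact H c) p (comul x)
  rw [← h] at this
  rw [eq_conjMap huv hq]
  refine Eq.trans ?_ this.symm
  simp only [conjMap_apply, mul_assoc]
  rw [← mul_assoc v, hvu, one_mul]

theorem mul_mulMap {V W : Type*} [AddCommGroup V] [Module k V] [AddCommGroup W] [Module k W]
    (a : A) (f f' : V →ₗ[k] A) (g : W →ₗ[k] A) (h : ∀ x, a * f x = f' x) (X : V ⊗[k] W) :
    a * mulMap f g X = mulMap f' g X := by
  induction X with
  | zero => simp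
  | add x y hx hy => simp only [map_add, mul_add, hx, hy]
  | tmul x y => rw [mulMap_tmul, mulMap_tmul, ← mul_assoc, h]

theorem mulMap_mul_right {V W : Type*} [AddCommGroup V] [Module k V] [AddCommGroup W] [Module k W]
    (a : A) (f : V →ₗ[k] A) (g g' : W →ₗ[k] A) (h : ∀ x, g x * a = g' x) (X : V ⊗[k] W) :
    mulMap f g X * a = mulMap f g' X := by
  induction X with
  | zero => simp
  | add x y hx hy => simp only [map_add, add_mul, hx, hy]
  | tmul x y => rw [mulMap_tmul, mulMap_tmul, mul_assoc, h]

theorem mul_mulMap_of_commute {V W : Type*} [AddCommGroup V] [Module k V] [AddCommGroup W]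
    [Module k W] (a : A) (f : V →ₗ[k] A) (g g' : W →ₗ[k] A) (hf : ∀ x, Commute a (f x))
    (h : ∀ x, a * g x = g' x) (X : V ⊗[k] W) :
    a * mulMap f g X = mulMap f g' X := by
  induction X with
  | zero => simp
  | add x y hx hy => simp only [map_add, mul_add, hx, hy]
  | tmul x y => rw [mulMap_tmul, mulMap_tmul, ← mul_assoc, (hf x).eq, mul_assoc, h]

theorem mulMap_mul_right_of_commute {V W : Type*} [AddCommGroup V] [Module k V] [AddCommGroup W]
    [Module k W] (a : A) (f f' : V →ₗ[k] A) (g : W →ₗ[k] A) (hg : ∀ x, Commute a (g x))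
    (h : ∀ x, f x * a = f' x) (X : V ⊗[k] W) :
    mulMap f g X * a = mulMap f' g X := by
  induction X with
  | zero => simp
  | add x y hx hy => simp only [map_add, add_mul, hx, hy]
  | tmul x y => rw [mulMap_tmul, mulMap_tmul, mul_assoc, ← (hg y).eq, ← mul_assoc, h]

/-- `(id ⊗ Δ) R⁻¹ = R₁₂⁻¹ R₁₃⁻¹`. -/
theorem lTensor_comul_inv {R : (H ⊗[k] H)ˣ} (hR : IsQuasitriangular k (R : H ⊗[k] H)) :
    LinearMap.lTensor H comul (↑R⁻¹ : H ⊗[k] H) =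
      leg12 k (↑R⁻¹ : H ⊗[k] H) * leg13 k (↑R⁻¹ : H ⊗[k] H) := by
  let F : H ⊗[k] H →ₐ[k] H ⊗[k] (H ⊗[k] H) :=
    Algebra.TensorProduct.map (AlgHom.id k H) (Bialgebra.comulAlgHom k H)
  let G2 : H ⊗[k] H →ₐ[k] H ⊗[k] (H ⊗[k] H) :=
    Algebra.TensorProduct.map (AlgHom.id k H) Algebra.TensorProduct.includeLeft
  let G3 : H ⊗[k] H →ₐ[k] H ⊗[k] (H ⊗[k] H) :=
    Algebra.TensorProduct.map (AlgHom.id k H) Algebra.TensorProduct.includeRight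
  have hF : F R = G3 R * G2 R := hR.comul_right
  have h1 : ∀ G : H ⊗[k] H →ₐ[k] H ⊗[k] (H ⊗[k] H), G ↑R⁻¹ * G R = 1 := fun G => by
    rw [← map_mul, Units.inv_mul, map_one]
  have h2 : ∀ G : H ⊗[k] H →ₐ[k] H ⊗[k] (H ⊗[k] H), G R * G ↑R⁻¹ = 1 := fun G => by
    rw [← map_mul, Units.mul_inv, map_one]
  change F ↑R⁻¹ = G2 ↑R⁻¹ * G3 ↑R⁻¹
  -- Both sides are inverse to (id ⊗ Δ)R = R₁₃R₁₂, which is why the factors come in the reverse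
  -- order.
  refine left_inv_eq_right_inv (h1 F) ?_
  rw [hF, mul_assoc, ← mul_assoc (G2 _), h2, one_mul, h2]

/-- `(Δ ⊗ id) R⁻¹ = R₂₃⁻¹ R₁₃⁻¹`. -/
theorem rTensor_comul_inv {R : (H ⊗[k] H)ˣ} (hR : IsQuasitriangular k (R : H ⊗[k] H)) :
    TensorProduct.assoc k H H H (LinearMap.rTensor H comul (↑R⁻¹ : H ⊗[k] H)) =
      leg23 k (↑R⁻¹ : H ⊗[k] H) * leg13 k (↑R⁻¹ : H ⊗[k] H) := by
  let F : H ⊗[k] H →ₐ[k] H ⊗[k] (H ⊗[k] H) :=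
    (Algebra.TensorProduct.assoc k k k H H H).toAlgHom.comp
      (Algebra.TensorProduct.map (Bialgebra.comulAlgHom k H) (AlgHom.id k H))
  let G1 : H ⊗[k] H →ₐ[k] H ⊗[k] (H ⊗[k] H) :=
    Algebra.TensorProduct.map (AlgHom.id k H) Algebra.TensorProduct.includeRight
  let G2 : H ⊗[k] H →ₐ[k] H ⊗[k] (H ⊗[k] H) := Algebra.TensorProduct.includeRight
  have hF : F R = G1 R * G2 R := hR.comul_left
  have h1 : ∀ G : H ⊗[k] H →ₐ[k] H ⊗[k] (H ⊗[k] H), G ↑R⁻¹ * G R = 1 := fun G => by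
    rw [← map_mul, Units.inv_mul, map_one]
  have h2 : ∀ G : H ⊗[k] H →ₐ[k] H ⊗[k] (H ⊗[k] H), G R * G ↑R⁻¹ = 1 := fun G => by
    rw [← map_mul, Units.mul_inv, map_one]
  change F ↑R⁻¹ = G2 ↑R⁻¹ * G1 ↑R⁻¹
  refine left_inv_eq_right_inv (h1 F) ?_
  rw [hF, mul_assoc, ← mul_assoc (G2 _), h2, one_mul, h2]

theorem mulMap_conv_right_inv {R : (H ⊗[k] H)ˣ} (hR : IsQuasitriangular k (R : H ⊗[k] H))
    (p : H →ₐ[k] A) (q r : H →ₗ[k] A) (hp : ∀ x y, Commute (p x) (q y)) :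
    mulMap p.toLinearMap (conv q r) (↑R⁻¹ : H ⊗[k] H) =
      mulMap p.toLinearMap q (↑R⁻¹ : H ⊗[k] H) * mulMap p.toLinearMap r (↑R⁻¹ : H ⊗[k] H) := by
  have h1 := congrArg (mulMap p.toLinearMap (mulMap q r)) (lTensor_comul_inv hR)
  rw [mulMap_lTensor] at h1
  refine h1.trans ?_
  have h2 : ∀ X Y : H ⊗[k] H, mulMap p.toLinearMap (mulMap q r) (leg12 k X * leg13 k Y) =
      mulMap p.toLinearMap q X * mulMap p.toLinearMap r Y := by
    intro X Y
    induction X with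
    | zero => simp
    | add x y hx hy => simp [add_mul, hx, hy]
    | tmul a b =>
      induction Y with
      | zero => simp
      | add x y hx hy => simp only [map_add, mul_add, hx, hy]
      | tmul c d =>
        simp only [leg13, leg12, LinearMap.lTensor_tmul, mk_apply, LinearMap.flip_apply,
          Algebra.TensorProduct.tmul_mul_tmul, mulMap_tmul, AlgHom.toLinearMap_apply, map_mul,
          mul_one, one_mul]
        rw [mul_assoc, ← mul_assoc (p c), (hp c b).eq, mul_assoc, mul_assoc]
  exact h2 _ _

/-! ### Moving elements of `B` and `B*` past the R-matrix -/

section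

variable {R : (H ⊗[k] H)ˣ} (hR : IsQuasitriangular k (R : H ⊗[k] H)) {p q : H →ₐ[k] A}
  (hpq : ∀ x y, Commute (p x) (q y))

/-- Moving b past the first leg h of R produces h₁ and b ◁ h₂, and (Δ ⊗ id)R = R₁₃R₂₃ splits this
into R and a second copy of R acting on b. Hence R⁻¹bR = (b ◁ R⁽¹⁾) ⊗ R⁽²⁾, the form in which R
enters the coproduct of U(B). -/
theorem RelRight.mul_rmat {R : H ⊗[k] H} (hR : IsQuasitriangular k R) {f : B →ₗ[k] A}
    (hf : RelRight f p.toLinearMap) (hfq : ∀ b y, Commute (f b) (q y)) (b : B) :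
    f b * mulMap p.toLinearMap q.toLinearMap R =
      mulMap p.toLinearMap q.toLinearMap R * mulMap (f ∘ₗ ract k H b) q.toLinearMap R := by
  rw [← mulMap_conv_left hR _ _ _ fun x y => hfq _ y]
  exact mul_mulMap _ _ _ _ (hf b) _

theorem RelLeft.rmat_mul {R : H ⊗[k] H} (hR : IsQuasitriangular k R)
    (hpq : ∀ x y, Commute (p x) (q y)) {f : Module.Dual k B →ₗ[k] A}
    (hf : RelLeft f p.toLinearMap) (hfq : ∀ b y, Commute (f b) (q y)) (c : Module.Dual k B) :
    mulMap p.toLinearMap q.toLinearMap R * f c =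
      mulMap (f ∘ₗ lact H c) q.toLinearMap R * mulMap p.toLinearMap q.toLinearMap R := by
  rw [← mulMap_conv_left hR _ _ _ hpq]
  exact mulMap_mul_right_of_commute _ _ _ _ (fun y => hfq c y) (fun x => hf x c) _

include hR hpq

theorem RelRight.mul_rmat_inv {f : B →ₗ[k] A}
    (hf : RelRight f q.toLinearMap) (hfp : ∀ b y, Commute (f b) (p y)) (b : B) :
    f b * mulMap p.toLinearMap q.toLinearMap (↑R⁻¹ : H ⊗[k] H) =
      mulMap p.toLinearMap q.toLinearMap (↑R⁻¹ : H ⊗[k] H) *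
        mulMap p.toLinearMap (f ∘ₗ ract k H b) (↑R⁻¹ : H ⊗[k] H) := by
  rw [← mulMap_conv_right_inv hR _ _ _ hpq]
  exact mul_mulMap_of_commute _ _ _ _ (fun x => hfp b x) (hf b) _

theorem RelLeft.rmat_inv_mul {f : Module.Dual k B →ₗ[k] A}
    (hf : RelLeft f q.toLinearMap) (hfp : ∀ b y, Commute (f b) (p y)) (c : Module.Dual k B) :
    mulMap p.toLinearMap q.toLinearMap (↑R⁻¹ : H ⊗[k] H) * f c =
      mulMap p.toLinearMap (f ∘ₗ lact H c) (↑R⁻¹ : H ⊗[k] H) *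
        mulMap p.toLinearMap q.toLinearMap (↑R⁻¹ : H ⊗[k] H) := by
  rw [← mulMap_conv_right_inv hR _ _ _ fun x y => (hfp _ x).symm]
  exact mulMap_mul_right _ _ _ _ (fun x => hf x c) _

end

end Relations

/-! ### Contractions of the `R`-matrix with the counit -/

/-- Applying ε to the first leg of (Δ ⊗ id)R = R₁₃R₂₃ gives R = (1 ⊗ (ε ⊗ id)R) R, and R can be
cancelled. -/
theorem counit_left_rmat {R : (H ⊗[k] H)ˣ} (hR : IsQuasitriangular k (R : H ⊗[k] H)) :
    TensorProduct.lid k H (LinearMap.rTensor H counit (R : H ⊗[k] H)) = 1 := by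
  let E : H ⊗[k] (H ⊗[k] H) →ₐ[k] H ⊗[k] H :=
    (Algebra.TensorProduct.lid k (H ⊗[k] H)).toAlgHom.comp
      (Algebra.TensorProduct.map (Bialgebra.counitAlgHom k H) (AlgHom.id k (H ⊗[k] H)))
  let e : H ⊗[k] H →ₐ[k] H := (Algebra.TensorProduct.lid k H).toAlgHom.comp
      (Algebra.TensorProduct.map (Bialgebra.counitAlgHom k H) (AlgHom.id k H))
  have h := congrArg E hR.comul_left
  rw [map_mul] at h
  have h1 : ∀ X : H ⊗[k] H, E (TensorProduct.assoc k H H H (LinearMap.rTensor H comul X)) = X := by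
    intro X
    have h1' : ∀ (Y : H ⊗[k] H) (z : H), E (TensorProduct.assoc k H H H (Y ⊗ₜ z)) =
        (TensorProduct.lid k H (LinearMap.rTensor H counit Y)) ⊗ₜ z := by
      intro Y z
      induction Y with
      | zero => simp
      | add x y hx hy => simp only [map_add, add_tmul, hx, hy]
      | tmul x y => simp [E, smul_tmul']
    induction X with
    | zero => simp
    | add x y hx hy => simp only [map_add, hx, hy]
    | tmul x y => rw [LinearMap.rTensor_tmul, h1']; simp
  have h2 : ∀ X : H ⊗[k] H, E (leg23 k X) = X := by
    intro X; simp [E, leg23]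
  have h3 : ∀ X : H ⊗[k] H, E (leg13 k X) = 1 ⊗ₜ e X := by
    intro X
    induction X with
    | zero => simp
    | add x y hx hy => simp only [map_add, tmul_add, hx, hy]
    | tmul x y => simp [E, e, leg13]
  rw [h1, h2, h3] at h
  have h4 : (1 : H) ⊗ₜ[k] e R = 1 := by
    have := congrArg (· * (↑R⁻¹ : H ⊗[k] H)) h
    simpa [mul_assoc] using this.symm
  have := congrArg e h4
  have h5 : e (1 ⊗ₜ e R) = e R := by simp [e]
  rw [map_one, h5] at this
  exact this

theorem counit_right_rmat {R : (H ⊗[k] H)ˣ} (hR : IsQuasitriangular k (R : H ⊗[k] H)) :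
    TensorProduct.rid k H (LinearMap.lTensor H counit (R : H ⊗[k] H)) = 1 := by
  let E : H ⊗[k] (H ⊗[k] H) →ₐ[k] H ⊗[k] H :=
      (Algebra.TensorProduct.map (AlgHom.id k H) ((Algebra.TensorProduct.rid k k H).toAlgHom.comp
      (Algebra.TensorProduct.map (AlgHom.id k H) (Bialgebra.counitAlgHom k H))))
  let e : H ⊗[k] H →ₐ[k] H := (Algebra.TensorProduct.rid k k H).toAlgHom.comp
      (Algebra.TensorProduct.map (AlgHom.id k H) (Bialgebra.counitAlgHom k H))
  have h := congrArg E hR.comul_right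
  rw [map_mul] at h
  have h1 : ∀ X : H ⊗[k] H, E (LinearMap.lTensor H comul X) = X := by
    intro X
    have h1' : ∀ (Y : H ⊗[k] H) (z : H), E (z ⊗ₜ Y) =
        z ⊗ₜ (TensorProduct.rid k H (LinearMap.lTensor H counit Y)) := by
      intro Y z
      induction Y with
      | zero => simp
      | add x y hx hy => simp only [map_add, tmul_add, hx, hy]
      | tmul x y => simp [E]
    induction X with
    | zero => simp
    | add x y hx hy => simp only [map_add, hx, hy]
    | tmul x y => rw [LinearMap.lTensor_tmul, h1']; simp
  have h2 : ∀ X : H ⊗[k] H, E (leg12 k X) = X := by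
    intro X
    induction X with
    | zero => simp
    | add x y hx hy => simp only [map_add, hx, hy]
    | tmul x y => simp [E, leg12]
  have h3 : ∀ X : H ⊗[k] H, E (leg13 k X) = e X ⊗ₜ 1 := by
    intro X
    induction X with
    | zero => simp
    | add x y hx hy => simp only [map_add, add_tmul, hx, hy]
    | tmul x y => simp [E, e, leg13, smul_tmul]
  rw [h1, h2, h3] at h
  have h4 : e R ⊗ₜ[k] (1 : H) = 1 := by
    have := congrArg (· * (↑R⁻¹ : H ⊗[k] H)) h
    simpa [mul_assoc] using this.symm
  have := congrArg e h4
  have h5 : e (e R ⊗ₜ 1) = e R := by simp [e]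
  rw [map_one, h5] at this
  exact this

/-- `(ε ⊗ id) X = 1` and `(id ⊗ ε) X = 1`. -/
structure Normalized (X : H ⊗[k] H) : Prop where
  left : TensorProduct.lid k H (LinearMap.rTensor H counit X) = 1
  right : TensorProduct.rid k H (LinearMap.lTensor H counit X) = 1

theorem normalized_rmat {R : (H ⊗[k] H)ˣ} (hR : IsQuasitriangular k (R : H ⊗[k] H)) :
    Normalized (R : H ⊗[k] H) := ⟨counit_left_rmat hR, counit_right_rmat hR⟩

theorem normalized_rmat_inv {R : (H ⊗[k] H)ˣ} (hR : IsQuasitriangular k (R : H ⊗[k] H)) :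
    Normalized (↑R⁻¹ : H ⊗[k] H) := by
  constructor
  · let e : H ⊗[k] H →ₐ[k] H := (Algebra.TensorProduct.lid k H).toAlgHom.comp
      (Algebra.TensorProduct.map (Bialgebra.counitAlgHom k H) (AlgHom.id k H))
    have h1 : e R = 1 := counit_left_rmat hR
    have h2 : e ↑R⁻¹ * e R = 1 := by rw [← map_mul, Units.inv_mul, map_one]
    rwa [h1, mul_one] at h2
  · let e : H ⊗[k] H →ₐ[k] H := (Algebra.TensorProduct.rid k k H).toAlgHom.comp
      (Algebra.TensorProduct.map (AlgHom.id k H) (Bialgebra.counitAlgHom k H))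
    have h1 : e R = 1 := counit_right_rmat hR
    have h2 : e ↑R⁻¹ * e R = 1 := by rw [← map_mul, Units.inv_mul, map_one]
    rwa [h1, mul_one] at h2

/-- The map is only additive, with the needed scalar compatibility as a hypothesis, because the
application is to expressions in X that are not packaged as linear maps, such as `midBraid X` at
fixed vectors. -/
theorem Normalized.additive_left {X : H ⊗[k] H} (hX : Normalized X) {M : Type*} [AddCommGroup M]
    [Module k M] (G : H ⊗[k] H → M) (h0 : G 0 = 0) (hadd : ∀ X Y, G (X + Y) = G X + G Y)
    (hG : ∀ x y, G (x ⊗ₜ y) = counit (R := k) x • G (1 ⊗ₜ y))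
    (hsmul : ∀ (r : k) y, G (1 ⊗ₜ (r • y)) = r • G (1 ⊗ₜ y)) : G X = G (1 ⊗ₜ 1) := by
  have h : ∀ Y : H ⊗[k] H, G Y =
      G (1 ⊗ₜ TensorProduct.lid k H (LinearMap.rTensor H counit Y)) := by
    intro Y
    induction Y with
    | zero => simp [h0]
    | add x y hx hy => simp only [map_add, tmul_add, hadd, hx, hy]
    | tmul x y => rw [hG, LinearMap.rTensor_tmul, TensorProduct.lid_tmul, hsmul]
  rw [h, hX.left]

theorem Normalized.additive_right {X : H ⊗[k] H} (hX : Normalized X) {M : Type*} [AddCommGroup M]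
    [Module k M] (G : H ⊗[k] H → M) (h0 : G 0 = 0) (hadd : ∀ X Y, G (X + Y) = G X + G Y)
    (hG : ∀ x y, G (x ⊗ₜ y) = counit (R := k) y • G (x ⊗ₜ 1))
    (hsmul : ∀ (r : k) x, G ((r • x) ⊗ₜ 1) = r • G (x ⊗ₜ 1)) : G X = G (1 ⊗ₜ 1) := by
  have h : ∀ Y : H ⊗[k] H, G Y =
      G (TensorProduct.rid k H (LinearMap.lTensor H counit Y) ⊗ₜ 1) := by
    intro Y
    induction Y with
    | zero => simp [h0]
    | add x y hx hy => simp only [map_add, add_tmul, hadd, hx, hy]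
    | tmul x y => rw [hG, LinearMap.lTensor_tmul, TensorProduct.rid_tmul, hsmul]
  rw [h, hX.right]

theorem Normalized.apply_left {X : H ⊗[k] H} (hX : Normalized X) {M : Type*} [AddCommGroup M]
    [Module k M] (G : H ⊗[k] H →ₗ[k] M) (hG : ∀ x y, G (x ⊗ₜ y) = counit (R := k) x • G (1 ⊗ₜ y)) :
    G X = G (1 ⊗ₜ 1) :=
  hX.additive_left G (map_zero G) (map_add G) hG fun r y => by rw [tmul_smul, map_smul]

theorem Normalized.apply_right {X : H ⊗[k] H} (hX : Normalized X) {M : Type*} [AddCommGroup M]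
    [Module k M] (G : H ⊗[k] H →ₗ[k] M) (hG : ∀ x y, G (x ⊗ₜ y) = counit (R := k) y • G (x ⊗ₜ 1)) :
    G X = G (1 ⊗ₜ 1) :=
  hX.additive_right G (map_zero G) (map_add G) hG fun r y => by rw [← smul_tmul', map_smul]

theorem map₂_apply {M N P M' N' P' : Type*} [AddCommGroup M] [Module k M] [AddCommGroup N]
    [Module k N] [AddCommGroup P] [Module k P] [AddCommGroup M'] [Module k M'] [AddCommGroup N']
    [Module k N'] [AddCommGroup P'] [Module k P'] (f : M →ₗ[k] N →ₗ[k] P)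
    (g : M' →ₗ[k] N' →ₗ[k] P') (X : M ⊗[k] M') (a : N) (b : N') :
    TensorProduct.map₂ f g X (a ⊗ₜ b) = TensorProduct.map (f.flip a) (g.flip b) X := by
  induction X with
  | zero => simp
  | add x y hx hy => simp only [map_add, LinearMap.add_apply, hx, hy]
  | tmul x y => simp [map₂_apply_tmul]

/-! ### The braided-opposite product -/

theorem rAct_mul (x y : H) (b : B) : rAct k H B (x * y) b = rAct k H B y (rAct k H B x b) := by
  simp [rAct]

@[simp]
theorem rAct_one (b : B) : rAct k H B 1 b = b := by
  simp [rAct]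

theorem rAct_apply (h : H) (b : B) : rAct k H B h b = b <• h := rfl

/-- The product `(b ◁ X⁽²⁾) (a ◁ X⁽¹⁾)` on `B`. -/
def twistedMul (X : H ⊗[k] H) : B ⊗[k] B →ₗ[k] B :=
  LinearMap.mul' k B ∘ₗ (TensorProduct.comm k B B).toLinearMap ∘ₗ
    TensorProduct.map₂ (rAct k H B) (rAct k H B) X

theorem twistedMul_tmul (X : H ⊗[k] H) (a b : B) :
    twistedMul X (a ⊗ₜ b) = mulMap (ract k H b) (ract k H a) (TensorProduct.comm k H H X) := by
  rw [twistedMul, LinearMap.comp_apply, LinearMap.comp_apply, map₂_apply, mulMap,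
    LinearMap.comp_apply]
  congr 1
  exact (TensorProduct.map_comm _ _ X).symm

theorem twistedMul_add (X Y : H ⊗[k] H) :
    (twistedMul (X + Y) : B ⊗[k] B →ₗ[k] B) = twistedMul X + twistedMul Y := by
  simp only [twistedMul, map_add, LinearMap.comp_add]

@[simp]
theorem twistedMul_zero : (twistedMul (0 : H ⊗[k] H) : B ⊗[k] B →ₗ[k] B) = 0 := by
  simp [twistedMul]

theorem twistedMul_tmul_tmul (x y : H) (a b : B) :
    twistedMul (x ⊗ₜ[k] y) (a ⊗ₜ b) = rAct k H B y b * rAct k H B x a := by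
  simp [twistedMul_tmul]

section BraidedGroup

variable {R : (H ⊗[k] H)ˣ} {S : B →ₗ[k] B}

theorem one_rAct (hB : IsBraidedGroup (R : H ⊗[k] H) S) (h : H) :
    rAct k H B h 1 = algebraMap k B (counit h) := hB.one_act h

theorem mul_rAct (hB : IsBraidedGroup (R : H ⊗[k] H) S) (a b : B) (h : H) :
    rAct k H B h (a * b) = mulMap (ract k H a) (ract k H b) (comul h) := by
  rw [rAct_apply, hB.mul_act, map₂_apply]; rfl

theorem counit_rAct (hB : IsBraidedGroup (R : H ⊗[k] H) S) (b : B) (h : H) :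
    counit (R := k) (rAct k H B h b) = counit (R := k) b * counit (R := k) h := hB.counit_act b h

theorem twistedMul_one_left (hB : IsBraidedGroup (R : H ⊗[k] H) S) {X : H ⊗[k] H}
    (hX : Normalized X) (b : B) : twistedMul X (1 ⊗ₜ b) = b := by
  have := hX.apply_left
    (mulMap (ract k H b) (ract k H (1 : B)) ∘ₗ (TensorProduct.comm k H H).toLinearMap)
    (fun x y => by
      simp [one_rAct hB, Algebra.algebraMap_eq_smul_one])
  simpa [twistedMul_tmul] using this

theorem twistedMul_one_right (hB : IsBraidedGroup (R : H ⊗[k] H) S) {X : H ⊗[k] H}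
    (hX : Normalized X) (b : B) : twistedMul X (b ⊗ₜ 1) = b := by
  have := hX.apply_right
    (mulMap (ract k H (1 : B)) (ract k H b) ∘ₗ (TensorProduct.comm k H H).toLinearMap)
    (fun x y => by
      simp [one_rAct hB, Algebra.algebraMap_eq_smul_one])
  simpa [twistedMul_tmul] using this

theorem counit_twistedMul (hB : IsBraidedGroup (R : H ⊗[k] H) S) {X : H ⊗[k] H}
    (hX : Normalized X) (a b : B) :
    counit (R := k) (twistedMul X (a ⊗ₜ b)) = counit (R := k) a * counit (R := k) b := by
  have := hX.apply_right
    (counit (R := k) (A := B) ∘ₗ mulMap (ract k H b) (ract k H a) ∘ₗ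
      (TensorProduct.comm k H H).toLinearMap)
    (fun x y => by
      simp [hB.counit_mul, counit_rAct hB]; ring)
  simpa [twistedMul_tmul, hB.counit_mul, mul_comm] using this

/-- The inverse braiding is a morphism of `H`-modules because Δ(h)R⁻¹ = R⁻¹Δᵒᵖ(h). As `H` acts on
the right, a product in H ⊗ H records the actions in the order in which they are applied. -/
theorem twistedMul_equivariant (hR : IsQuasitriangular k (R : H ⊗[k] H))
    (hB : IsBraidedGroup (R : H ⊗[k] H) S) (h : H) (T : B ⊗[k] B) :
    twistedMul (↑R⁻¹ : H ⊗[k] H) (TensorProduct.map₂ (rAct k H B) (rAct k H B) (comul h) T) =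
      rAct k H B h (twistedMul (↑R⁻¹ : H ⊗[k] H) T) := by
  have hcomm : comul (R := k) h * (↑R⁻¹ : H ⊗[k] H) =
      (↑R⁻¹ : H ⊗[k] H) * TensorProduct.comm k H H (comul h) := by
    have := congrArg (fun Z => (↑R⁻¹ : H ⊗[k] H) * Z * (↑R⁻¹ : H ⊗[k] H)) (hR.comul_op h)
    simpa [mul_assoc] using this.symm
  have h1 : ∀ X Y : H ⊗[k] H, ∀ T : B ⊗[k] B,
      twistedMul X (TensorProduct.map₂ (rAct k H B) (rAct k H B) Y T) = twistedMul (Y * X) T := by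
    intro X Y T
    induction T with
    | zero => simp
    | add x y hx hy => simp only [map_add, hx, hy]
    | tmul a b =>
      induction Y with
      | zero => simp
      | add x y hx hy => simp only [map_add, LinearMap.add_apply, add_mul, hx, hy, twistedMul_add]
      | tmul y y' =>
        induction X with
        | zero => simp
        | add x y hx hy => simp only [mul_add, LinearMap.add_apply, twistedMul_add, hx, hy]
        | tmul x x' => simp [map₂_apply_tmul, twistedMul_tmul, rAct_mul]
  have h2 : ∀ X : H ⊗[k] H, ∀ T : B ⊗[k] B,
      rAct k H B h (twistedMul X T) = twistedMul (X * TensorProduct.comm k H H (comul h)) T := by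
    intro X T
    induction T with
    | zero => simp
    | add x y hx hy => simp only [map_add, hx, hy]
    | tmul a b =>
      induction X with
      | zero => simp
      | add x y hx hy => simp only [map_add, LinearMap.add_apply, add_mul, twistedMul_add, hx, hy]
      | tmul x x' =>
        rw [twistedMul_tmul_tmul, mul_rAct hB]
        generalize comul (R := k) h = Z
        induction Z with
        | zero => simp
        | add x y hx hy => simp only [map_add, mul_add, twistedMul_add, LinearMap.add_apply, hx, hy]
        | tmul z z' => simp [twistedMul_tmul, rAct_mul]
  rw [h1, h2, hcomm]

end BraidedGroup

/-! ### Legs in triple and fourfold tensor powers -/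

section Legs

variable {A : Type*} [Ring A] [Algebra k A]

theorem yangBaxter_inv {R : (H ⊗[k] H)ˣ} (hR : IsQuasitriangular k (R : H ⊗[k] H))
    {p q r : H →ₐ[k] A}
    (hpq : ∀ x y, Commute (p x) (q y)) (hpr : ∀ x y, Commute (p x) (r y))
    (hqr : ∀ x y, Commute (q x) (r y)) :
    mulMap p.toLinearMap q.toLinearMap (↑R⁻¹ : H ⊗[k] H) *
        mulMap p.toLinearMap r.toLinearMap (↑R⁻¹ : H ⊗[k] H) *
        mulMap q.toLinearMap r.toLinearMap (↑R⁻¹ : H ⊗[k] H) =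
      mulMap q.toLinearMap r.toLinearMap (↑R⁻¹ : H ⊗[k] H) *
        mulMap p.toLinearMap r.toLinearMap (↑R⁻¹ : H ⊗[k] H) *
        mulMap p.toLinearMap q.toLinearMap (↑R⁻¹ : H ⊗[k] H) := by
  have h := yangBaxter hR hpq hpr hqr
  have i1 := mulMap_inv_mul hpq R
  have i2 := mulMap_inv_mul hpr R
  have i3 := mulMap_inv_mul hqr R
  have j1 := mulMap_mul_inv hpq R
  have j2 := mulMap_mul_inv hpr R
  have j3 := mulMap_mul_inv hqr R
  refine left_inv_eq_right_inv (a := mulMap q.toLinearMap r.toLinearMap (R : H ⊗[k] H) *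
    mulMap p.toLinearMap r.toLinearMap (R : H ⊗[k] H) *
    mulMap p.toLinearMap q.toLinearMap (R : H ⊗[k] H)) ?_ ?_
  · simp only [mul_assoc]
    rw [← mul_assoc _ _ (mulMap p.toLinearMap r.toLinearMap (R : H ⊗[k] H) * _), i3, one_mul,
      ← mul_assoc _ _ (mulMap p.toLinearMap q.toLinearMap (R : H ⊗[k] H)), i2, one_mul, i1]
  · rw [← h]
    simp only [mul_assoc]
    rw [← mul_assoc _ _ (mulMap p.toLinearMap r.toLinearMap (↑R⁻¹ : H ⊗[k] H) * _), j3, one_mul,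
      ← mul_assoc _ _ (mulMap p.toLinearMap q.toLinearMap (↑R⁻¹ : H ⊗[k] H)), j2, one_mul, j1]

theorem mulMap_conv_left_inv {R : (H ⊗[k] H)ˣ} (hR : IsQuasitriangular k (R : H ⊗[k] H))
    (p q : H →ₗ[k] A) (r : H →ₐ[k] A) (hpq : ∀ x y, Commute (p x) (q y))
    (hpr : ∀ x y, Commute (p x) (r y)) :
    mulMap (conv p q) r.toLinearMap (↑R⁻¹ : H ⊗[k] H) =
      mulMap q r.toLinearMap (↑R⁻¹ : H ⊗[k] H) * mulMap p r.toLinearMap (↑R⁻¹ : H ⊗[k] H) := by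
  have h1 := congrArg (mulMap p (mulMap q r.toLinearMap)) (rTensor_comul_inv hR)
  rw [mulMap_assoc, mulMap_rTensor] at h1
  refine h1.trans ?_
  have h2 : ∀ X Y : H ⊗[k] H, mulMap p (mulMap q r.toLinearMap) (leg23 k X * leg13 k Y) =
      mulMap q r.toLinearMap X * mulMap p r.toLinearMap Y := by
    intro X Y
    induction X with
    | zero => simp
    | add x y hx hy => simp only [map_add, add_mul, hx, hy]
    | tmul a b =>
      induction Y with
      | zero => simp
      | add x y hx hy => simp only [map_add, mul_add, hx, hy]
      | tmul c d =>
        simp only [leg13, leg23, LinearMap.lTensor_tmul, mk_apply,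
          Algebra.TensorProduct.tmul_mul_tmul, mulMap_tmul, AlgHom.toLinearMap_apply, map_mul,
          mul_one, one_mul]
        rw [← mul_assoc, ← mul_assoc, (hpq c a).eq, mul_assoc (q a), (hpr c b).eq]
        simp only [mul_assoc]
  exact h2 _ _

variable (k A) in
/-- The embedding of `A` as the first factor of `A ⊗ (A ⊗ A)`. -/
def ι₁ : A →ₐ[k] A ⊗[k] (A ⊗[k] A) := Algebra.TensorProduct.includeLeft

variable (k A) in
/-- The embedding of `A` as the second factor of `A ⊗ (A ⊗ A)`. -/
def ι₂ : A →ₐ[k] A ⊗[k] (A ⊗[k] A) :=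
  Algebra.TensorProduct.includeRight.comp Algebra.TensorProduct.includeLeft

variable (k A) in
/-- The embedding of `A` as the third factor of `A ⊗ (A ⊗ A)`. -/
def ι₃ : A →ₐ[k] A ⊗[k] (A ⊗[k] A) :=
  Algebra.TensorProduct.includeRight.comp Algebra.TensorProduct.includeRight

theorem ι₁_apply (a : A) : ι₁ k A a = a ⊗ₜ (1 ⊗ₜ 1) := rfl
theorem ι₂_apply (a : A) : ι₂ k A a = 1 ⊗ₜ (a ⊗ₜ 1) := rfl
theorem ι₃_apply (a : A) : ι₃ k A a = 1 ⊗ₜ (1 ⊗ₜ a) := rfl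

theorem commute_ι₁_ι₂ (a b : A) : Commute (ι₁ k A a) (ι₂ k A b) := by
  simp [commute_iff_eq, ι₁_apply, ι₂_apply]
theorem commute_ι₁_ι₃ (a b : A) : Commute (ι₁ k A a) (ι₃ k A b) := by
  simp [commute_iff_eq, ι₁_apply, ι₃_apply]
theorem commute_ι₂_ι₃ (a b : A) : Commute (ι₂ k A a) (ι₃ k A b) := by
  simp [commute_iff_eq, ι₂_apply, ι₃_apply]

/-- `p ⋆ q` for commuting algebra maps, as an algebra map. -/
def convHom (p q : H →ₐ[k] A) (h : ∀ x y, Commute (p x) (q y)) : H →ₐ[k] A :=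
  (Algebra.TensorProduct.lift p q h).comp (Bialgebra.comulAlgHom k H)

theorem convHom_toLinearMap (p q : H →ₐ[k] A) (h : ∀ x y, Commute (p x) (q y)) :
    (convHom p q h).toLinearMap = conv p.toLinearMap q.toLinearMap := by
  ext x
  change Algebra.TensorProduct.lift p q h (comul x) = mulMap _ _ (comul x)
  generalize comul (R := k) x = Z
  induction Z with
  | zero => simp
  | add x y hx hy => simp only [map_add, hx, hy]
  | tmul x y => simp

end Legs

/-! ### Associativity of the opposite product m ∘ Ψ⁻¹ -/

section BraidedGroup

variable {R : (H ⊗[k] H)ˣ} {S : B →ₗ[k] B}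

/-- Each bracketing is one element of H ⊗ H ⊗ H acting on c ⊗ b ⊗ a, followed by multiplication; the
two elements are the two sides of the Yang-Baxter equation for R⁻¹. -/
theorem twistedMul_assoc (hR : IsQuasitriangular k (R : H ⊗[k] H))
    (hB : IsBraidedGroup (R : H ⊗[k] H) S) (a b c : B) :
    twistedMul (↑R⁻¹ : H ⊗[k] H) (twistedMul (↑R⁻¹ : H ⊗[k] H) (a ⊗ₜ b) ⊗ₜ c) =
      twistedMul (↑R⁻¹ : H ⊗[k] H) (a ⊗ₜ twistedMul (↑R⁻¹ : H ⊗[k] H) (b ⊗ₜ c)) := by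
  let Θ : H ⊗[k] (H ⊗[k] H) →ₗ[k] B :=
    mulMap (ract k H c) (mulMap (ract k H b) (ract k H a))
  -- The legs act on the factors of c (b a), so a, b, c occupy the legs 3, 2, 1.
  let p := ι₃ k H
  let q := ι₂ k H
  let r := ι₁ k H
  have hpq : ∀ x y, Commute (p x) (q y) := fun x y => (commute_ι₂_ι₃ y x).symm
  have hpr : ∀ x y, Commute (p x) (r y) := fun x y => (commute_ι₁_ι₃ y x).symm
  have hqr : ∀ x y, Commute (q x) (r y) := fun x y => (commute_ι₁_ι₂ y x).symm
  have h1 : ∀ X Y : H ⊗[k] H, twistedMul Y (twistedMul X (a ⊗ₜ b) ⊗ₜ c) =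
      Θ (mulMap p.toLinearMap q.toLinearMap X *
        mulMap (conv q.toLinearMap p.toLinearMap) r.toLinearMap Y) := by
    intro X Y
    induction X with
    | zero => simp
    | add x y hx hy =>
      simp only [map_add, LinearMap.add_apply, add_tmul, add_mul, twistedMul_add, hx, hy]
    | tmul x x' =>
      induction Y with
      | zero => simp
      | add x y hx hy => simp only [map_add, LinearMap.add_apply, mul_add, twistedMul_add, hx, hy]
      | tmul y y' =>
        rw [twistedMul_tmul_tmul, twistedMul_tmul_tmul, mul_rAct hB, mulMap_tmul, mulMap_tmul, conv_apply]
        generalize comul (R := k) y = Z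
        induction Z with
        | zero => simp
        | add x y hx hy => simp only [map_add, mul_add, add_mul, hx, hy]
        | tmul z z' =>
          simp [Θ, p, q, r, ι₁_apply, ι₂_apply, ι₃_apply, rAct_mul]
  have h2 : ∀ X Y : H ⊗[k] H, twistedMul Y (a ⊗ₜ twistedMul X (b ⊗ₜ c)) =
      Θ (mulMap q.toLinearMap r.toLinearMap X *
        mulMap p.toLinearMap (conv r.toLinearMap q.toLinearMap) Y) := by
    intro X Y
    induction X with
    | zero => simp
    | add x y hx hy =>
      simp only [map_add, LinearMap.add_apply, tmul_add, add_mul, twistedMul_add, hx, hy]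
    | tmul x x' =>
      induction Y with
      | zero => simp
      | add x y hx hy => simp only [map_add, LinearMap.add_apply, mul_add, twistedMul_add, hx, hy]
      | tmul y y' =>
        rw [twistedMul_tmul_tmul, twistedMul_tmul_tmul, mul_rAct hB, mulMap_tmul, mulMap_tmul, conv_apply]
        generalize comul (R := k) y' = Z
        induction Z with
        | zero => simp
        | add x y hx hy => simp only [map_add, mul_add, add_mul, hx, hy]
        | tmul z z' =>
          simp [Θ, p, q, r, ι₁_apply, ι₂_apply, ι₃_apply, rAct_mul, mul_assoc]
  rw [h1, h2, mulMap_conv_left_inv hR _ _ _ (fun x y => (hpq y x).symm) hqr,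
    mulMap_conv_right_inv hR _ _ _ hpr, ← mul_assoc, ← mul_assoc, yangBaxter_inv hR hpq hpr hqr]

end BraidedGroup

/-! ### The braided coproduct of the braided-opposite product -/

section Legs

variable {A : Type*} [Ring A] [Algebra k A]

variable (k A) in
/-- The embeddings of `A` in `(A ⊗ A) ⊗ (A ⊗ A)`. -/
def κ₁ : A →ₐ[k] (A ⊗[k] A) ⊗[k] (A ⊗[k] A) :=
  Algebra.TensorProduct.includeLeft.comp Algebra.TensorProduct.includeLeft

variable (k A) in
/-- The embeddings of `A` in `(A ⊗ A) ⊗ (A ⊗ A)`. -/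
def κ₂ : A →ₐ[k] (A ⊗[k] A) ⊗[k] (A ⊗[k] A) :=
  Algebra.TensorProduct.includeLeft.comp Algebra.TensorProduct.includeRight

variable (k A) in
/-- The embeddings of `A` in `(A ⊗ A) ⊗ (A ⊗ A)`. -/
def κ₃ : A →ₐ[k] (A ⊗[k] A) ⊗[k] (A ⊗[k] A) :=
  Algebra.TensorProduct.includeRight.comp Algebra.TensorProduct.includeLeft

variable (k A) in
/-- The embeddings of `A` in `(A ⊗ A) ⊗ (A ⊗ A)`. -/
def κ₄ : A →ₐ[k] (A ⊗[k] A) ⊗[k] (A ⊗[k] A) :=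
  Algebra.TensorProduct.includeRight.comp Algebra.TensorProduct.includeRight

theorem κ₁_apply (a : A) : κ₁ k A a = (a ⊗ₜ 1) ⊗ₜ (1 ⊗ₜ 1) := rfl
theorem κ₂_apply (a : A) : κ₂ k A a = (1 ⊗ₜ a) ⊗ₜ (1 ⊗ₜ 1) := rfl
theorem κ₃_apply (a : A) : κ₃ k A a = (1 ⊗ₜ 1) ⊗ₜ (a ⊗ₜ 1) := rfl
theorem κ₄_apply (a : A) : κ₄ k A a = (1 ⊗ₜ 1) ⊗ₜ (1 ⊗ₜ a) := rfl

theorem commute_κ₁_κ₂ (a b : A) : Commute (κ₁ k A a) (κ₂ k A b) := by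
  simp [commute_iff_eq, κ₁_apply, κ₂_apply]
theorem commute_κ₁_κ₃ (a b : A) : Commute (κ₁ k A a) (κ₃ k A b) := by
  simp [commute_iff_eq, κ₁_apply, κ₃_apply]
theorem commute_κ₁_κ₄ (a b : A) : Commute (κ₁ k A a) (κ₄ k A b) := by
  simp [commute_iff_eq, κ₁_apply, κ₄_apply]
theorem commute_κ₂_κ₃ (a b : A) : Commute (κ₂ k A a) (κ₃ k A b) := by
  simp [commute_iff_eq, κ₂_apply, κ₃_apply]
theorem commute_κ₂_κ₄ (a b : A) : Commute (κ₂ k A a) (κ₄ k A b) := by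
  simp [commute_iff_eq, κ₂_apply, κ₄_apply]
theorem commute_κ₃_κ₄ (a b : A) : Commute (κ₃ k A a) (κ₄ k A b) := by
  simp [commute_iff_eq, κ₃_apply, κ₄_apply]

/-- `(Δ ⊗ Δ)(R⁻¹) R₁₄ = R₂₃⁻¹ R₁₃⁻¹ R₂₄⁻¹`. -/
theorem mulMap_conv_conv_inv {R : (H ⊗[k] H)ˣ} (hR : IsQuasitriangular k (R : H ⊗[k] H))
    {a₁ a₂ b₁ b₂ : H →ₐ[k] A} (h₁₂ : ∀ x y, Commute (a₁ x) (a₂ y))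
    (h₁₃ : ∀ x y, Commute (a₁ x) (b₁ y)) (h₁₄ : ∀ x y, Commute (a₁ x) (b₂ y))
    (h₂₃ : ∀ x y, Commute (a₂ x) (b₁ y)) :
    mulMap (conv a₁.toLinearMap a₂.toLinearMap) (conv b₁.toLinearMap b₂.toLinearMap)
        (↑R⁻¹ : H ⊗[k] H) * mulMap a₁.toLinearMap b₂.toLinearMap (R : H ⊗[k] H) =
      mulMap a₂.toLinearMap b₁.toLinearMap (↑R⁻¹ : H ⊗[k] H) *
        (mulMap a₁.toLinearMap b₁.toLinearMap (↑R⁻¹ : H ⊗[k] H) *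
        mulMap a₂.toLinearMap b₂.toLinearMap (↑R⁻¹ : H ⊗[k] H)) := by
  rw [← convHom_toLinearMap a₁ a₂ h₁₂, mulMap_conv_right_inv hR,
    convHom_toLinearMap, mulMap_conv_left_inv hR _ _ _ h₁₂ h₁₃,
    mulMap_conv_left_inv hR _ _ _ h₁₂ h₁₄]
  · simp only [mul_assoc]
    rw [mulMap_inv_mul h₁₄, mul_one]
  · intro x y
    rw [← AlgHom.toLinearMap_apply, convHom_toLinearMap, conv_apply]
    exact (commute_mulMap (fun v => (h₁₃ v y).symm) (fun v => (h₂₃ v y).symm) _).symm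

end Legs

section BraidedGroup

variable {R : (H ⊗[k] H)ˣ} {S : B →ₗ[k] B}

theorem comul_rAct (hB : IsBraidedGroup (R : H ⊗[k] H) S) (b : B) (h : H) :
    comul (R := k) (rAct k H B h b) =
      TensorProduct.map₂ (rAct k H B) (rAct k H B) (comul h) (comul b) := hB.comul_act b h

/-- `(a ⊗ a') ⊗ (b ⊗ b') ↦ (a ⊗ b ◁ X⁽²⁾) ⊗ (a' ◁ X⁽¹⁾ ⊗ b')`. -/
def midBraid (X : H ⊗[k] H) : (B ⊗[k] B) ⊗[k] (B ⊗[k] B) →ₗ[k] (B ⊗[k] B) ⊗[k] (B ⊗[k] B) :=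
  TensorProduct.map₂ (LinearMap.lTensorHom B ∘ₗ rAct k H B)
      (LinearMap.rTensorHom B ∘ₗ rAct k H B) (TensorProduct.comm k H H X) ∘ₗ
    (TensorProduct.tensorTensorTensorComm k B B B B).toLinearMap

theorem midBraid_add (X Y : H ⊗[k] H) :
    (midBraid (X + Y) : (B ⊗[k] B) ⊗[k] (B ⊗[k] B) →ₗ[k] _) = midBraid X + midBraid Y := by
  simp only [midBraid, map_add, LinearMap.add_comp]

@[simp]
theorem midBraid_zero :
    (midBraid (0 : H ⊗[k] H) : (B ⊗[k] B) ⊗[k] (B ⊗[k] B) →ₗ[k] _) = 0 := by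
  simp [midBraid]

theorem midBraid_tmul (x y : H) (a a' b b' : B) :
    midBraid (x ⊗ₜ[k] y) ((a ⊗ₜ a') ⊗ₜ (b ⊗ₜ b')) =
      (a ⊗ₜ rAct k H B y b) ⊗ₜ (rAct k H B x a' ⊗ₜ b') := by
  simp [midBraid, map₂_apply_tmul]

theorem braidedMul_add (X Y : H ⊗[k] H) :
    (braidedMul (X + Y) : (B ⊗[k] B) ⊗[k] (B ⊗[k] B) →ₗ[k] _) = braidedMul X + braidedMul Y := by
  simp only [braidedMul, map_add, LinearMap.comp_add, LinearMap.add_comp]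

@[simp]
theorem braidedMul_zero :
    (braidedMul (0 : H ⊗[k] H) : (B ⊗[k] B) ⊗[k] (B ⊗[k] B) →ₗ[k] _) = 0 := by
  simp [braidedMul]

theorem braidedMul_tmul (x y : H) (a a' b b' : B) :
    braidedMul (x ⊗ₜ[k] y) ((a ⊗ₜ a') ⊗ₜ (b ⊗ₜ b')) =
      (a * rAct k H B x b) ⊗ₜ (rAct k H B y a' * b') := by
  simp [braidedMul, map₂_apply_tmul]

/-- `Δ` is multiplicative for the braided-opposite product and the inverse braiding. -/
theorem comul_twistedMul (hR : IsQuasitriangular k (R : H ⊗[k] H))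
    (hB : IsBraidedGroup (R : H ⊗[k] H) S) (a b : B) :
    comul (R := k) (twistedMul (↑R⁻¹ : H ⊗[k] H) (a ⊗ₜ b)) =
      TensorProduct.map (twistedMul (↑R⁻¹ : H ⊗[k] H)) (twistedMul (↑R⁻¹ : H ⊗[k] H))
        (midBraid (↑R⁻¹ : H ⊗[k] H) (comul a ⊗ₜ comul b)) := by
  -- legs: `a₁, a₂, b₁, b₂`
  let a₁ := κ₁ k H
  let a₂ := κ₂ k H
  let b₁ := κ₃ k H
  let b₂ := κ₄ k H
  let Θ : B ⊗[k] B → B ⊗[k] B → (H ⊗[k] H) ⊗[k] (H ⊗[k] H) →ₗ[k] B ⊗[k] B := fun T U =>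
    TensorProduct.map (LinearMap.mul' k B ∘ₗ (TensorProduct.comm k B B).toLinearMap)
      (LinearMap.mul' k B ∘ₗ (TensorProduct.comm k B B).toLinearMap) ∘ₗ
    (TensorProduct.tensorTensorTensorComm k B B B B).toLinearMap ∘ₗ
    TensorProduct.map ((TensorProduct.map₂ (rAct k H B) (rAct k H B)).flip T)
      ((TensorProduct.map₂ (rAct k H B) (rAct k H B)).flip U)
  have Θadd₁ : ∀ T T' U, Θ (T + T') U = Θ T U + Θ T' U := fun T T' U => by
    simp only [Θ, map_add, TensorProduct.map_add_left, LinearMap.comp_add]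
  have Θadd₂ : ∀ T U U', Θ T (U + U') = Θ T U + Θ T U' := fun T U U' => by
    simp only [Θ, map_add, TensorProduct.map_add_right, LinearMap.comp_add]
  have Θz₁ : ∀ U, Θ 0 U = 0 := fun U => by simp [Θ]
  have Θz₂ : ∀ T, Θ T 0 = 0 := fun U => by simp [Θ]
  have h1 : ∀ (X Y : H ⊗[k] H) (T U : B ⊗[k] B),
      braidedMul Y (TensorProduct.map₂ (TensorProduct.map₂ (rAct k H B) (rAct k H B))
        (TensorProduct.map₂ (rAct k H B) (rAct k H B)) (TensorProduct.map comul comul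
          (TensorProduct.comm k H H X)) (U ⊗ₜ T)) =
      Θ T U (mulMap (A := (H ⊗[k] H) ⊗[k] (H ⊗[k] H)) (conv a₁.toLinearMap a₂.toLinearMap) (conv b₁.toLinearMap b₂.toLinearMap) X *
        mulMap a₁.toLinearMap b₂.toLinearMap Y) := by
    intro X Y T U
    induction X with
    | zero => simp
    | add x y hx hy => simp only [map_add, LinearMap.add_apply, add_mul, hx, hy]
    | tmul x x' =>
      rw [TensorProduct.comm_tmul, TensorProduct.map_tmul, mulMap_tmul, map₂_apply_tmul,
        TensorProduct.map_tmul, conv_apply, conv_apply]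
      generalize comul (R := k) x = Z
      generalize comul (R := k) x' = W
      induction Z with
      | zero => simp
      | add x y hx hy => simp only [map_add, LinearMap.add_apply, tmul_add, add_mul, hx, hy]
      | tmul z z' =>
      induction W with
      | zero => simp
      | add x y hx hy => simp only [map_add, LinearMap.add_apply, add_tmul, mul_add, add_mul, hx, hy]
      | tmul w w' =>
      induction Y with
      | zero => simp
      | add x y hx hy => simp only [map_add, LinearMap.add_apply, mul_add, braidedMul_add, hx, hy]
      | tmul y y' =>
      induction T with
      | zero => simp [Θz₁]
      | add x y hx hy => simp only [map_add, tmul_add, hx, hy, Θadd₁, LinearMap.add_apply]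
      | tmul t t' =>
      induction U with
      | zero => simp [Θz₂]
      | add x y hx hy => simp only [map_add, add_tmul, hx, hy, Θadd₂, LinearMap.add_apply]
      | tmul u u' =>
        simp [Θ, map₂_apply_tmul, braidedMul_tmul, a₁, a₂, b₁, b₂, κ₁_apply, κ₂_apply, κ₃_apply,
          κ₄_apply, rAct_mul]
  have h2 : ∀ (X Y Z : H ⊗[k] H) (T U : B ⊗[k] B),
      TensorProduct.map (twistedMul X) (twistedMul Y) (midBraid Z (T ⊗ₜ U)) =
      Θ T U (mulMap (A := (H ⊗[k] H) ⊗[k] (H ⊗[k] H)) a₂.toLinearMap b₁.toLinearMap Z *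
        (mulMap a₁.toLinearMap b₁.toLinearMap X * mulMap a₂.toLinearMap b₂.toLinearMap Y)) := by
    intro X Y Z T U
    induction X with
    | zero => simp
    | add x y hx hy => simp only [twistedMul_add, map_add, TensorProduct.map_add_left,
        LinearMap.add_apply, add_mul, mul_add, hx, hy]
    | tmul x x' =>
    induction Y with
    | zero => simp
    | add x y hx hy => simp only [twistedMul_add, map_add, TensorProduct.map_add_right,
        LinearMap.add_apply, mul_add, hx, hy]
    | tmul y y' =>
    induction Z with
    | zero => simp
    | add x y hx hy => simp only [midBraid_add, map_add,
        LinearMap.add_apply, add_mul, hx, hy]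
    | tmul z z' =>
    induction T with
    | zero => simp [Θz₁]
    | add x y hx hy => simp only [map_add, add_tmul, hx, hy, Θadd₁, LinearMap.add_apply]
    | tmul t t' =>
    induction U with
    | zero => simp [Θz₂]
    | add x y hx hy => simp only [map_add, tmul_add, hx, hy, Θadd₂, LinearMap.add_apply]
    | tmul u u' =>
      simp [Θ, map₂_apply_tmul, midBraid_tmul, twistedMul_tmul, a₁, a₂, b₁, b₂, κ₁_apply, κ₂_apply,
        κ₃_apply, κ₄_apply, rAct_mul]
  have h3 : ∀ X : H ⊗[k] H, comul (R := k) (twistedMul X (a ⊗ₜ b)) =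
      braidedMul (R : H ⊗[k] H)
        (TensorProduct.map₂ (TensorProduct.map₂ (rAct k H B) (rAct k H B))
        (TensorProduct.map₂ (rAct k H B) (rAct k H B)) (TensorProduct.map comul comul
          (TensorProduct.comm k H H X)) (comul b ⊗ₜ comul a)) := by
    intro X
    induction X with
    | zero => simp
    | add x y hx hy => simp only [twistedMul_add, map_add, LinearMap.add_apply, hx, hy]
    | tmul x x' =>
      rw [twistedMul_tmul_tmul, hB.comul_mul, comul_rAct hB, comul_rAct hB, TensorProduct.comm_tmul,
        TensorProduct.map_tmul, map₂_apply_tmul, TensorProduct.map_tmul]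
  -- Both sides are now the same multilinear map `Θ` of Δa and Δb, evaluated at elements of the
  -- fourth tensor power of `H`. Only the identity (Δ ⊗ Δ)(R⁻¹) R₁₄ = R₂₃⁻¹R₁₃⁻¹R₂₄⁻¹ is left: the
  -- R₁₄ is the braiding in the braided product, and R₂₃⁻¹ the inverse braiding in `midBraid`.
  rw [h3, h1, h2]
  congr 1
  exact mulMap_conv_conv_inv hR commute_κ₁_κ₂ commute_κ₁_κ₃ commute_κ₁_κ₄ commute_κ₂_κ₃

end BraidedGroup

/-! ### The braided coproduct of `B ⊗ B` and the antipode -/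

section BraidedGroup

variable {R : (H ⊗[k] H)ˣ} {S : B →ₗ[k] B}

/-- `a ⊗ b ↦ (a₍₁₎ ⊗ b₍₁₎ ◁ X⁽¹⁾) ⊗ (a₍₂₎ ◁ X⁽²⁾ ⊗ b₍₂₎)`. -/
def braidedComul (X : H ⊗[k] H) : B ⊗[k] B →ₗ[k] (B ⊗[k] B) ⊗[k] (B ⊗[k] B) :=
  midBraid (TensorProduct.comm k H H X) ∘ₗ TensorProduct.map comul comul

theorem braidedComul_tmul (X : H ⊗[k] H) (a b : B) :
    braidedComul X (a ⊗ₜ b) = midBraid (TensorProduct.comm k H H X) (comul a ⊗ₜ comul b) := rfl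

theorem midBraid_smul (r : k) (X : H ⊗[k] H) :
    (midBraid (r • X) : (B ⊗[k] B) ⊗[k] (B ⊗[k] B) →ₗ[k] _) = r • midBraid X := by
  simp only [midBraid, map_smul, LinearMap.smul_comp]

theorem braidedMul_eq (X : H ⊗[k] H) : (braidedMul X : (B ⊗[k] B) ⊗[k] (B ⊗[k] B) →ₗ[k] _) =
    TensorProduct.map (LinearMap.mul' k B) (LinearMap.mul' k B) ∘ₗ
      midBraid (TensorProduct.comm k H H X) := by
  ext a a' b b'
  induction X with
  | zero => simp
  | add x y hx hy =>
    simpa only [braidedMul_add, map_add, midBraid_add, LinearMap.comp_add, LinearMap.add_apply,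
      AlgebraTensorModule.curry_apply, curry_apply, LinearMap.restrictScalars_self,
      LinearMap.comp_apply] using congrArg₂ (· + ·) hx hy
  | tmul x y => simp [braidedMul_tmul, midBraid_tmul]

-- With aᵢ and bⱼ the parts of the iterated coproducts of a and b, the two sides involve
-- R_{b₁a₃}R_{b₂a₃}R_{b₁a₂} and R_{b₁a₃}R_{b₁a₂}R_{b₂a₃}. The last two factors have no leg in common
-- and commute.
set_option maxHeartbeats 1000000 in
theorem braidedComul_coassoc (hR : IsQuasitriangular k (R : H ⊗[k] H))
    (hB : IsBraidedGroup (R : H ⊗[k] H) S) (a b : B) :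
    TensorProduct.assoc k _ _ _ (LinearMap.rTensor _ (braidedComul (R : H ⊗[k] H))
        (braidedComul (R : H ⊗[k] H) (a ⊗ₜ[k] b))) =
      LinearMap.lTensor _ (braidedComul (R : H ⊗[k] H))
        (braidedComul (R : H ⊗[k] H) (a ⊗ₜ[k] b)) := by
  let b₁ := κ₁ k H
  let b₂ := κ₂ k H
  let a₂ := κ₃ k H
  let a₃ := κ₄ k H
  let Θ : B ⊗[k] (B ⊗[k] B) → B ⊗[k] (B ⊗[k] B) →
      (H ⊗[k] H) ⊗[k] (H ⊗[k] H) →ₗ[k] (B ⊗[k] B) ⊗[k] ((B ⊗[k] B) ⊗[k] (B ⊗[k] B)) := fun T U =>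
    LinearMap.lTensor _ (TensorProduct.tensorTensorTensorComm k B B B B).toLinearMap ∘ₗ
    (TensorProduct.tensorTensorTensorComm k B (B ⊗[k] B) B (B ⊗[k] B)).toLinearMap ∘ₗ
    (TensorProduct.comm k _ _).toLinearMap ∘ₗ
    TensorProduct.map
      ((TensorProduct.map₂ (rAct k H B) (LinearMap.rTensorHom B ∘ₗ rAct k H B)).flip U)
      ((LinearMap.lTensorHom B ∘ₗ TensorProduct.map₂ (rAct k H B) (rAct k H B)).flip T)
  have Θadd₁ : ∀ T T' U, Θ (T + T') U = Θ T U + Θ T' U := fun T T' U => by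
    simp only [Θ, map_add, TensorProduct.map_add_right, LinearMap.comp_add]
  have Θadd₂ : ∀ T U U', Θ T (U + U') = Θ T U + Θ T U' := fun T U U' => by
    simp only [Θ, map_add, TensorProduct.map_add_left, LinearMap.comp_add]
  have Θz₁ : ∀ U, Θ 0 U = 0 := fun U => by simp [Θ]
  have Θz₂ : ∀ T, Θ T 0 = 0 := fun U => by simp [Θ]
  have h1 : ∀ (X Y : H ⊗[k] H) (T U : B ⊗[k] B),
      TensorProduct.assoc k _ _ _ (LinearMap.rTensor _ (braidedComul Y)
        (midBraid (TensorProduct.comm k H H X) (T ⊗ₜ U))) =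
      Θ (TensorProduct.assoc k _ _ _ (LinearMap.rTensor B comul T))
        (TensorProduct.assoc k _ _ _ (LinearMap.rTensor B comul U))
        (mulMap (A := (H ⊗[k] H) ⊗[k] (H ⊗[k] H)) (conv b₁.toLinearMap b₂.toLinearMap)
          a₃.toLinearMap X * mulMap b₁.toLinearMap a₂.toLinearMap Y) := by
    intro X Y T U
    induction X with
    | zero => simp
    | add x y hx hy => simp only [map_add, midBraid_add, LinearMap.add_apply, add_mul, hx, hy]
    | tmul x x' =>
    induction T with
    | zero => simp [Θz₁]
    | add x y hx hy => simp only [map_add, add_tmul, hx, hy, Θadd₁, LinearMap.add_apply]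
    | tmul t t' =>
    induction U with
    | zero => simp [Θz₂]
    | add x y hx hy => simp only [map_add, tmul_add, hx, hy, Θadd₂, LinearMap.add_apply]
    | tmul u u' =>
      rw [TensorProduct.comm_tmul, midBraid_tmul, LinearMap.rTensor_tmul, LinearMap.rTensor_tmul,
        LinearMap.rTensor_tmul, braidedComul_tmul, comul_rAct hB, mulMap_tmul, conv_apply]
      generalize comul (R := k) x = Z
      generalize comul (R := k) t = T
      generalize comul (R := k) u = U
      induction Z with
      | zero => simp
      | add x y hx hy => simp only [map_add, LinearMap.add_apply, tmul_add, add_tmul, add_mul, hx, hy]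
      | tmul z z' =>
      induction T with
      | zero => simp [Θz₁]
      | add x y hx hy => simp only [map_add, add_tmul, hx, hy, Θadd₁, LinearMap.add_apply]
      | tmul s s' =>
      induction U with
      | zero => simp [Θz₂]
      | add x y hx hy =>
        simp only [map_add, add_tmul, tmul_add, hx, hy, Θadd₂, LinearMap.add_apply]
      | tmul v v' =>
      induction Y with
      | zero => simp
      | add x y hx hy =>
        simp only [map_add, midBraid_add, LinearMap.add_apply, add_tmul, mul_add, hx, hy]
      | tmul y y' =>
        simp [Θ, map₂_apply_tmul, midBraid_tmul, a₂, a₃, b₁, b₂, κ₁_apply, κ₂_apply, κ₃_apply,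
          κ₄_apply, rAct_mul]
  have h2 : ∀ (X Y : H ⊗[k] H) (T U : B ⊗[k] B),
      LinearMap.lTensor _ (braidedComul Y)
        (midBraid (TensorProduct.comm k H H X) (T ⊗ₜ U)) =
      Θ (LinearMap.lTensor B comul T) (LinearMap.lTensor B comul U)
        (mulMap (A := (H ⊗[k] H) ⊗[k] (H ⊗[k] H)) b₁.toLinearMap
          (conv a₂.toLinearMap a₃.toLinearMap) X * mulMap b₂.toLinearMap a₃.toLinearMap Y) := by
    intro X Y T U
    induction X with
    | zero => simp
    | add x y hx hy => simp only [map_add, midBraid_add, LinearMap.add_apply, add_mul, hx, hy]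
    | tmul x x' =>
    induction T with
    | zero => simp [Θz₁]
    | add x y hx hy => simp only [map_add, add_tmul, hx, hy, Θadd₁, LinearMap.add_apply]
    | tmul t t' =>
    induction U with
    | zero => simp [Θz₂]
    | add x y hx hy => simp only [map_add, tmul_add, hx, hy, Θadd₂, LinearMap.add_apply]
    | tmul u u' =>
      rw [TensorProduct.comm_tmul, midBraid_tmul, LinearMap.lTensor_tmul, LinearMap.lTensor_tmul,
        LinearMap.lTensor_tmul, braidedComul_tmul, comul_rAct hB, mulMap_tmul, conv_apply]
      generalize comul (R := k) x' = Z
      generalize comul (R := k) t' = T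
      generalize comul (R := k) u' = U
      induction Z with
      | zero => simp
      | add x y hx hy =>
        simp only [map_add, LinearMap.add_apply, tmul_add, add_tmul, add_mul, mul_add, hx, hy]
      | tmul z z' =>
      induction T with
      | zero => simp [Θz₁]
      | add x y hx hy => simp only [map_add, add_tmul, tmul_add, hx, hy, Θadd₁, LinearMap.add_apply]
      | tmul s s' =>
      induction U with
      | zero => simp [Θz₂]
      | add x y hx hy =>
        simp only [map_add, tmul_add, hx, hy, Θadd₂, LinearMap.add_apply]
      | tmul v v' =>
      induction Y with
      | zero => simp
      | add x y hx hy =>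
        simp only [map_add, midBraid_add, LinearMap.add_apply, tmul_add, mul_add, hx, hy]
      | tmul y y' =>
        simp [Θ, map₂_apply_tmul, midBraid_tmul, a₂, a₃, b₁, b₂, κ₁_apply, κ₂_apply, κ₃_apply,
          κ₄_apply, rAct_mul]
  rw [braidedComul_tmul, h1, h2, coassoc_apply, coassoc_apply]
  congr 1
  rw [mulMap_conv_left hR _ _ _ commute_κ₂_κ₄,
    mulMap_conv_right hR _ _ _ commute_κ₁_κ₄ commute_κ₃_κ₄, mul_assoc, mul_assoc]
  congr 1
  exact commute_mulMap (fun v => (commute_mulMap (fun w => (commute_κ₁_κ₂ v w))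
    (fun w => commute_κ₁_κ₄ v w) _).symm)
    (fun v => (commute_mulMap (fun w => (commute_κ₂_κ₃ w v).symm)
    (fun w => commute_κ₃_κ₄ v w) _).symm) _

/-- Associativity of convolution on Hom(B ⊗ B, B), the setting in which left and right inverses of
the multiplication can be compared. -/
theorem mulMap_braidedComul_assoc (hR : IsQuasitriangular k (R : H ⊗[k] H))
    (hB : IsBraidedGroup (R : H ⊗[k] H) S) (F G K : B ⊗[k] B →ₗ[k] B) :
    mulMap F (mulMap G K ∘ₗ braidedComul (R : H ⊗[k] H)) ∘ₗ braidedComul (R : H ⊗[k] H) =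
      mulMap (mulMap F G ∘ₗ braidedComul (R : H ⊗[k] H)) K ∘ₗ braidedComul (R : H ⊗[k] H) := by
  ext a b
  simp only [AlgebraTensorModule.curry_apply, curry_apply, LinearMap.restrictScalars_self,
    LinearMap.comp_apply]
  rw [← mulMap_lTensor, ← braidedComul_coassoc hR hB, mulMap_assoc, mulMap_rTensor]

theorem antipode_one (hB : IsBraidedGroup (R : H ⊗[k] H) S) : S 1 = 1 := by
  simpa [hB.comul_one, hB.counit_one] using hB.mul_antipode_left 1

/-- The braided antipode is braided-antimultiplicative: `S (a b) = (S b ◁ R⁽¹⁾) (S a ◁ R⁽²⁾)`. -/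
theorem antipode_mul (hR : IsQuasitriangular k (R : H ⊗[k] H))
    (hB : IsBraidedGroup (R : H ⊗[k] H) S) (a b : B) :
    S (a * b) = mulMap (ract k H (S b)) (ract k H (S a)) (R : H ⊗[k] H) := by
  let m : B ⊗[k] B →ₗ[k] B := LinearMap.mul' k B
  let F : B ⊗[k] B →ₗ[k] B := S ∘ₗ m
  let G : H ⊗[k] H → B ⊗[k] B →ₗ[k] B := fun X =>
    LinearMap.mul' k B ∘ₗ TensorProduct.map₂ (rAct k H B) (rAct k H B) X ∘ₗ
      (TensorProduct.comm k B B).toLinearMap ∘ₗ TensorProduct.map S S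
  have hG : ∀ X a b, G X (a ⊗ₜ b) = mulMap (ract k H (S b)) (ract k H (S a)) X := by
    intro X a b
    simp only [G, LinearMap.comp_apply, TensorProduct.map_tmul, LinearEquiv.coe_coe,
      TensorProduct.comm_tmul, map₂_apply]
    rfl
  let E : B ⊗[k] B →ₗ[k] B := Algebra.linearMap k B ∘ₗ LinearMap.mul' k k ∘ₗ
    TensorProduct.map counit counit
  have hE : ∀ a b, E (a ⊗ₜ b) = algebraMap k B (counit a * counit b) := fun a b => rfl
  -- S ∘ m is a right convolution inverse of m: Δ(ab) is the braided product of Δa and Δb, so this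
  -- is the right antipode axiom at ab.
  have hmF : mulMap m F ∘ₗ braidedComul (R : H ⊗[k] H) = E := by
    ext a b
    simp only [AlgebraTensorModule.curry_apply, curry_apply, LinearMap.restrictScalars_self,
      LinearMap.comp_apply, hE]
    have := hB.mul_antipode_right (a * b)
    rw [hB.comul_mul, braidedMul_eq, hB.counit_mul] at this
    rw [← this, braidedComul_tmul, LinearMap.lTensor, LinearMap.comp_apply]
    change _ = mulMap LinearMap.id S _
    rw [mulMap_map]
    rfl
  -- One copy of R comes from the braided coproduct and one from `G`. By (id ⊗ Δ)R = R₁₃R₁₂ they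
  -- merge into a single R whose second leg acts on S(a₁)a₂, a scalar; normalisation removes R and
  -- leaves S(b₁)b₂.
  have hGm : mulMap (G R) m ∘ₗ braidedComul (R : H ⊗[k] H) = E := by
    ext a b
    simp only [AlgebraTensorModule.curry_apply, curry_apply, LinearMap.restrictScalars_self,
      LinearMap.comp_apply, hE]
    rw [braidedComul_tmul]
    have h1 : ∀ (X Y : H ⊗[k] H) (t t' u u' : B),
        mulMap (G Y) m (midBraid (TensorProduct.comm k H H X) ((t ⊗ₜ t') ⊗ₜ (u ⊗ₜ u'))) =
        mulMap (ract k H (S u)) (mulMap (ract k H (S t)) (ract k H t'))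
          (mulMap (ι₁ k H).toLinearMap (ι₃ k H).toLinearMap X *
            mulMap (ι₁ k H).toLinearMap (ι₂ k H).toLinearMap Y) * u' := by
      intro X Y t t' u u'
      induction X with
      | zero => simp
      | add x y hx hy => simp only [map_add, midBraid_add, LinearMap.add_apply, add_mul, hx, hy]
      | tmul x x' =>
      induction Y with
      | zero => simp [G, midBraid_tmul]
      | add x y hx hy =>
        simp only [TensorProduct.comm_tmul, midBraid_tmul, mulMap_tmul, hG, map_add, mul_add,
          add_mul] at hx hy ⊢
        rw [hx, hy]
      | tmul y y' =>
        simp [midBraid_tmul, hG, m, ι₁_apply, ι₂_apply, ι₃_apply, mul_assoc,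
          rAct_apply, hB.antipode_act, mul_smul]
    have h2 : ∀ (X : H ⊗[k] H) (t t' u u' : B),
        mulMap (ract k H (S u)) (mulMap (ract k H (S t)) (ract k H t'))
          (mulMap (ι₁ k H).toLinearMap (conv (ι₂ k H).toLinearMap (ι₃ k H).toLinearMap) X) * u' =
        mulMap (ract k H (S u)) (ract k H (S t * t')) X * u' := by
      intro X t t' u u'
      induction X with
      | zero => simp
      | add x y hx hy => simp only [map_add, add_mul, hx, hy]
      | tmul x x' =>
        rw [mulMap_tmul, mulMap_tmul, conv_apply, LinearMap.flip_apply, LinearMap.flip_apply,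
          mul_rAct hB]
        generalize comul (R := k) x' = Z
        induction Z with
        | zero => simp
        | add x y hx hy => simp only [map_add, mul_add, add_mul, hx, hy]
        | tmul z z' => simp [ι₁_apply, ι₂_apply, ι₃_apply]
    have h3 : ∀ (T : B ⊗[k] B) (u u' : B),
        mulMap (G R) m (midBraid (TensorProduct.comm k H H R) (T ⊗ₜ (u ⊗ₜ u'))) =
        mulMap (ract k H (S u)) (ract k H (LinearMap.mul' k B (LinearMap.rTensor B S T)))
          (R : H ⊗[k] H) * u' := by
      intro T u u'
      induction T with
      | zero => simp [mulMap]
      | add x y hx hy =>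
        have h0 : ∀ (X : H ⊗[k] H) (c c' : B), mulMap (ract k H (S u)) (ract k H (c + c')) X =
            mulMap (ract k H (S u)) (ract k H c) X +
              mulMap (ract k H (S u)) (ract k H c') X := fun X c c' => by
          induction X with
          | zero => simp
          | add x y hx hy => rw [map_add, map_add, map_add, hx, hy]; abel
          | tmul x y => simp [mul_add]
        rw [add_tmul, map_add, map_add, hx, hy, map_add, map_add, h0, add_mul]
      | tmul t t' =>
        rw [h1, ← mulMap_conv_right hR _ _ _ commute_ι₁_ι₃ commute_ι₂_ι₃, h2]
        simp
    have h4 : ∀ U : B ⊗[k] B,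
        mulMap (G R) m (midBraid (TensorProduct.comm k H H R) (comul a ⊗ₜ U)) =
        counit (R := k) a • LinearMap.mul' k B (LinearMap.rTensor B S U) := by
      intro U
      induction U with
      | zero => simp
      | add x y hx hy => simp only [map_add, tmul_add, hx, hy, smul_add]
      | tmul u u' =>
        rw [h3, hB.mul_antipode_left, (normalized_rmat hR).apply_right
          (mulMap (ract k H (S u)) (ract k H (algebraMap k B (counit a))))]
        · simp [Algebra.algebraMap_eq_smul_one]
        · intro x y
          simp [Algebra.algebraMap_eq_smul_one, one_rAct hB, smul_smul, mul_comm]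
    rw [h4, hB.mul_antipode_left, map_mul, Algebra.smul_def]
  have hEF : ∀ K : B ⊗[k] B →ₗ[k] B, mulMap E K ∘ₗ braidedComul (R : H ⊗[k] H) = K := by
    intro K
    ext a b
    simp only [AlgebraTensorModule.curry_apply, curry_apply, LinearMap.restrictScalars_self,
      LinearMap.comp_apply]
    have h1 : ∀ T U : B ⊗[k] B,
        mulMap E K (midBraid (TensorProduct.comm k H H R) (T ⊗ₜ U)) =
        K (TensorProduct.lid k B (LinearMap.rTensor B counit T) ⊗ₜ
          TensorProduct.lid k B (LinearMap.rTensor B counit U)) := by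
      intro T U
      induction T with
      | zero => simp
      | add x y hx hy => simp only [map_add, add_tmul, hx, hy]
      | tmul t t' =>
      induction U with
      | zero => simp
      | add x y hx hy => simp only [map_add, tmul_add, hx, hy]
      | tmul u u' =>
        rw [(normalized_rmat hR).additive_left (fun X => mulMap E K
          (midBraid (TensorProduct.comm k H H X) ((t ⊗ₜ t') ⊗ₜ (u ⊗ₜ u'))))]
        · simp [midBraid_tmul, hE, Algebra.algebraMap_eq_smul_one, smul_tmul, smul_smul, mul_comm]
        · simp
        · intro X Y; simp only [map_add, midBraid_add, LinearMap.add_apply]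
        · intro x y
          simp [midBraid_tmul, hE, counit_rAct hB, Algebra.algebraMap_eq_smul_one, smul_smul,
            mul_comm, mul_left_comm]
        · intro r y
          rw [tmul_smul, map_smul, midBraid_smul, LinearMap.smul_apply, map_smul]
    rw [braidedComul_tmul, h1]
    simp
  have hFE : ∀ K : B ⊗[k] B →ₗ[k] B, mulMap K E ∘ₗ braidedComul (R : H ⊗[k] H) = K := by
    intro K
    ext a b
    simp only [AlgebraTensorModule.curry_apply, curry_apply, LinearMap.restrictScalars_self,
      LinearMap.comp_apply]
    have h1 : ∀ T U : B ⊗[k] B,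
        mulMap K E (midBraid (TensorProduct.comm k H H R) (T ⊗ₜ U)) =
        K (TensorProduct.rid k B (LinearMap.lTensor B counit T) ⊗ₜ
          TensorProduct.rid k B (LinearMap.lTensor B counit U)) := by
      intro T U
      induction T with
      | zero => simp
      | add x y hx hy => simp only [map_add, add_tmul, hx, hy]
      | tmul t t' =>
      induction U with
      | zero => simp
      | add x y hx hy => simp only [map_add, tmul_add, hx, hy]
      | tmul u u' =>
        rw [(normalized_rmat hR).additive_right (fun X => mulMap K E
          (midBraid (TensorProduct.comm k H H X) ((t ⊗ₜ t') ⊗ₜ (u ⊗ₜ u'))))]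
        · simp [midBraid_tmul, hE, Algebra.algebraMap_eq_smul_one, smul_tmul, smul_smul, mul_comm]
        · simp
        · intro X Y; simp only [map_add, midBraid_add, LinearMap.add_apply]
        · intro x y
          simp [midBraid_tmul, hE, counit_rAct hB, Algebra.algebraMap_eq_smul_one, smul_smul,
            mul_comm, mul_left_comm]
        · intro r y
          rw [← smul_tmul', map_smul, midBraid_smul, LinearMap.smul_apply, map_smul]
    rw [braidedComul_tmul, h1]
    simp
  -- `E` is the convolution unit, so the left inverse `G R` and the right inverse `F` of m coincide.
  have := mulMap_braidedComul_assoc hR hB (G R) m F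
  rw [hmF, hGm, hEF, hFE] at this
  rw [← hG, this]
  rfl

/-- `S` is multiplicative from the braided-opposite product to the product. -/
theorem antipode_twistedMul (hR : IsQuasitriangular k (R : H ⊗[k] H))
    (hB : IsBraidedGroup (R : H ⊗[k] H) S) (a b : B) :
    S (twistedMul (↑R⁻¹ : H ⊗[k] H) (a ⊗ₜ b)) = S a * S b := by
  have h1 : ∀ X : H ⊗[k] H, S (twistedMul X (a ⊗ₜ b)) =
      mulMap (ract k H (S a)) (ract k H (S b)) (X * R) := by
    intro X
    induction X with
    | zero => simp
    | add x y hx hy => simp only [twistedMul_add, LinearMap.add_apply, map_add, add_mul, hx, hy]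
    | tmul x y =>
      rw [twistedMul_tmul_tmul, antipode_mul hR hB]
      generalize (R : H ⊗[k] H) = Z
      induction Z with
      | zero => simp
      | add x y hx hy => simp only [map_add, mul_add, hx, hy]
      | tmul z z' => simp [rAct_apply, hB.antipode_act, mul_smul]
  rw [h1, Units.inv_mul, Algebra.TensorProduct.one_def]
  simp

variable {T : B ≃ₗ[k] B}

/-- S carries the opposite product to the product (`antipode_twistedMul`), so applying S turns the
claim into S(b₁)b₂ = ε(b). -/
theorem twistedMul_antipode_right (hR : IsQuasitriangular k (R : H ⊗[k] H))
    (hB : IsBraidedGroup (R : H ⊗[k] H) T.toLinearMap) (b : B) :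
    twistedMul (↑R⁻¹ : H ⊗[k] H) (LinearMap.lTensor B T.symm.toLinearMap (comul b)) =
      algebraMap k B (counit b) := by
  apply T.injective
  have h : ∀ X : B ⊗[k] B,
      T (twistedMul (↑R⁻¹ : H ⊗[k] H) (LinearMap.lTensor B T.symm.toLinearMap X)) =
        LinearMap.mul' k B (LinearMap.rTensor B T.toLinearMap X) := by
    intro X
    induction X with
    | zero => simp
    | add x y hx hy => simp only [map_add, hx, hy]
    | tmul x y =>
      have := antipode_twistedMul hR hB x (T.symm y)
      simp only [LinearEquiv.coe_coe, LinearEquiv.apply_symm_apply] at this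
      simp [this]
  have h1 : T 1 = 1 := antipode_one hB
  rw [h, hB.mul_antipode_left, Algebra.algebraMap_eq_smul_one, map_smul, h1]

theorem twistedMul_antipode_left (hR : IsQuasitriangular k (R : H ⊗[k] H))
    (hB : IsBraidedGroup (R : H ⊗[k] H) T.toLinearMap) (b : B) :
    twistedMul (↑R⁻¹ : H ⊗[k] H) (LinearMap.rTensor B T.symm.toLinearMap (comul b)) =
      algebraMap k B (counit b) := by
  apply T.injective
  have h : ∀ X : B ⊗[k] B,
      T (twistedMul (↑R⁻¹ : H ⊗[k] H) (LinearMap.rTensor B T.symm.toLinearMap X)) =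
        LinearMap.mul' k B (LinearMap.lTensor B T.toLinearMap X) := by
    intro X
    induction X with
    | zero => simp
    | add x y hx hy => simp only [map_add, hx, hy]
    | tmul x y =>
      have := antipode_twistedMul hR hB (T.symm x) y
      simp only [LinearEquiv.coe_coe, LinearEquiv.apply_symm_apply] at this
      simp [this]
  have h1 : T 1 = 1 := antipode_one hB
  rw [h, hB.mul_antipode_right, Algebra.algebraMap_eq_smul_one, map_smul, h1]

end BraidedGroup

/-! ### The braided group `C̄` -/

section DualPairing

variable {M N P : Type*} [AddCommGroup M] [Module k M] [AddCommGroup N] [Module k N]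
  [AddCommGroup P] [Module k P]

theorem dualDistrib_map {M' N' : Type*} [AddCommGroup M'] [Module k M'] [AddCommGroup N']
    [Module k N'] (f : M →ₗ[k] M') (g : N →ₗ[k] N')
    (X : Module.Dual k M' ⊗[k] Module.Dual k N') (T : M ⊗[k] N) :
    dualDistrib k M N (TensorProduct.map f.dualMap g.dualMap X) T =
      dualDistrib k M' N' X (TensorProduct.map f g T) := by
  induction X with
  | zero => simp
  | add x y hx hy => simp only [map_add, LinearMap.add_apply, hx, hy]
  | tmul x y =>
    induction T with
    | zero => simp
    | add x y hx hy => simp only [map_add, hx, hy]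
    | tmul m n => simp

theorem dualDistrib_ext [FiniteDimensional k M] [FiniteDimensional k N]
    {X Y : Module.Dual k M ⊗[k] Module.Dual k N}
    (h : ∀ m n, dualDistrib k M N X (m ⊗ₜ n) = dualDistrib k M N Y (m ⊗ₜ n)) : X = Y := by
  apply (TensorProduct.dualDistribEquiv k M N).injective
  apply TensorProduct.ext'
  exact h

theorem dualDistrib_ext₃ [FiniteDimensional k M] [FiniteDimensional k N] [FiniteDimensional k P]
    {X Y : Module.Dual k M ⊗[k] (Module.Dual k N ⊗[k] Module.Dual k P)}
    (h : ∀ m n p,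
      dualDistrib k M (N ⊗[k] P) (LinearMap.lTensor _ (dualDistrib k N P) X) (m ⊗ₜ (n ⊗ₜ p)) =
      dualDistrib k M (N ⊗[k] P) (LinearMap.lTensor _ (dualDistrib k N P) Y) (m ⊗ₜ (n ⊗ₜ p))) :
    X = Y := by
  have h1 : LinearMap.lTensor (Module.Dual k M) (dualDistrib k N P) X =
      LinearMap.lTensor (Module.Dual k M) (dualDistrib k N P) Y := by
    apply dualDistrib_ext
    intro m T
    induction T with
    | zero => simp
    | add x y hx hy => simp only [tmul_add, map_add, hx, hy]
    | tmul n p => exact h m n p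
  exact (LinearEquiv.lTensor (Module.Dual k M) (TensorProduct.dualDistribEquiv k N P)).injective h1

end DualPairing

section Bar

variable {R : (H ⊗[k] H)ˣ} {S : B ≃ₗ[k] B}

theorem lAct_apply (h : H) (c : Module.Dual k B) (b : B) :
    lAct k H B h c b = c (rAct k H B h b) := rfl

theorem lAct_mul (x y : H) (c : Module.Dual k B) :
    lAct k H B (x * y) c = lAct k H B x (lAct k H B y c) := by
  ext b; simp only [lAct_apply, rAct_mul]

@[simp]
theorem lAct_one (c : Module.Dual k B) : lAct k H B 1 c = c := by
  ext b; simp only [lAct_apply, rAct_one]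

theorem dualDistrib_lAct (Y : H ⊗[k] H) (X : Module.Dual k B ⊗[k] Module.Dual k B)
    (T : B ⊗[k] B) :
    dualDistrib k B B (TensorProduct.map₂ (lAct k H B) (lAct k H B) Y X) T =
      dualDistrib k B B X (TensorProduct.map₂ (rAct k H B) (rAct k H B) Y T) := by
  induction Y with
  | zero => simp
  | add x y hx hy => simp only [map_add, LinearMap.add_apply, hx, hy]
  | tmul x y =>
    rw [map₂_apply_tmul, map₂_apply_tmul]
    exact dualDistrib_map _ _ X T

theorem dualMul_apply (c d : Module.Dual k B) (b : B) :
    dualMul k B c d b = dualDistrib k B B (c ⊗ₜ d) (comul b) := rfl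

theorem dualMul_assoc (c d e : Module.Dual k B) :
    dualMul k B (dualMul k B c d) e = dualMul k B c (dualMul k B d e) := by
  ext b
  have h1 : ∀ T : B ⊗[k] B, dualDistrib k B B (dualMul k B c d ⊗ₜ e) T =
      dualDistrib k B (B ⊗[k] B) (c ⊗ₜ dualDistrib k B B (d ⊗ₜ e))
        (TensorProduct.assoc k B B B (LinearMap.rTensor B comul T)) := by
    intro T
    induction T with
    | zero => simp
    | add x y hx hy => simp only [map_add, hx, hy]
    | tmul x y =>
      rw [dualDistrib_apply, dualMul_apply, LinearMap.rTensor_tmul]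
      generalize comul (R := k) x = Z
      induction Z with
      | zero => simp
      | add x y hx hy => simp only [map_add, add_tmul, add_mul, hx, hy]
      | tmul x y => simp [mul_assoc]
  have h2 : ∀ T : B ⊗[k] B, dualDistrib k B B (c ⊗ₜ dualMul k B d e) T =
      dualDistrib k B (B ⊗[k] B) (c ⊗ₜ dualDistrib k B B (d ⊗ₜ e))
        (LinearMap.lTensor B comul T) := by
    intro T
    induction T with
    | zero => simp
    | add x y hx hy => simp only [map_add, hx, hy]
    | tmul x y => rfl
  rw [dualMul_apply, dualMul_apply, h1, h2, coassoc_apply]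

theorem counit_dualMul (c : Module.Dual k B) : dualMul k B counit c = c := by
  ext b
  have h1 : ∀ T : B ⊗[k] B, dualDistrib k B B (counit ⊗ₜ c) T =
      c (TensorProduct.lid k B (LinearMap.rTensor B counit T)) := by
    intro T
    induction T with
    | zero => simp
    | add x y hx hy => simp only [map_add, hx, hy]
    | tmul x y => simp
  rw [dualMul_apply, h1]; simp

theorem dualMul_counit (c : Module.Dual k B) : dualMul k B c counit = c := by
  ext b
  have h1 : ∀ T : B ⊗[k] B, dualDistrib k B B (c ⊗ₜ counit) T =
      c (TensorProduct.rid k B (LinearMap.lTensor B counit T)) := by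
    intro T
    induction T with
    | zero => simp
    | add x y hx hy => simp only [map_add, hx, hy]
    | tmul x y => simp [mul_comm]
  rw [dualMul_apply, h1]; simp

theorem lAct_counit {S : B →ₗ[k] B} (hB : IsBraidedGroup (R : H ⊗[k] H) S) (h : H) :
    lAct k H B h counit = counit (R := k) h • counit := by
  ext b
  simp [lAct_apply, counit_rAct hB, mul_comm]

theorem lAct_dualMul {S : B →ₗ[k] B} (hB : IsBraidedGroup (R : H ⊗[k] H) S) (h : H)
    (c d : Module.Dual k B) :
    lAct k H B h (dualMul k B c d) = TensorProduct.lift (dualMul k B)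
      (TensorProduct.map₂ (lAct k H B) (lAct k H B) (comul h) (c ⊗ₜ d)) := by
  ext b
  rw [lAct_apply, dualMul_apply, comul_rAct hB, ← dualDistrib_lAct]
  generalize TensorProduct.map₂ (lAct k H B) (lAct k H B) (comul h) (c ⊗ₜ d) = X
  induction X with
  | zero => simp
  | add x y hx hy => simp only [map_add, LinearMap.add_apply, hx, hy]
  | tmul x y => rfl

theorem dualMul_apply_one {S : B →ₗ[k] B} (hB : IsBraidedGroup (R : H ⊗[k] H) S)
    (c d : Module.Dual k B) : dualMul k B c d 1 = c 1 * d 1 := by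
  rw [dualMul_apply, hB.comul_one, dualDistrib_apply]

theorem lAct_apply_one {S : B →ₗ[k] B} (hB : IsBraidedGroup (R : H ⊗[k] H) S) (h : H)
    (c : Module.Dual k B) : lAct k H B h c 1 = counit (R := k) h * c 1 := by
  rw [lAct_apply, one_rAct hB, Algebra.algebraMap_eq_smul_one, map_smul, smul_eq_mul]

variable [FiniteDimensional k B]

/-- The Ψ⁻¹ in the coproduct of `C̄` transposes to the Ψ⁻¹ in the opposite product. Through this
identity the coalgebra properties of `C̄` are transposes of properties of `twistedMul` at R⁻¹. -/
theorem dualDistrib_barComul (c : Module.Dual k B) (T : B ⊗[k] B) :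
    dualDistrib k B B (barComul R c) T = c (twistedMul (↑R⁻¹ : H ⊗[k] H) T) := by
  have h1 : dualDistrib k B B (dualComul k B c) = c ∘ₗ LinearMap.mul' k B :=
    (TensorProduct.dualDistribEquiv k B B).apply_symm_apply _
  simp only [barComul, LinearMap.comp_apply, LinearEquiv.coe_coe]
  rw [dualDistrib_lAct, ← dualDistrib_apply_comm, h1]
  rfl

theorem barComul_coassoc (hR : IsQuasitriangular k (R : H ⊗[k] H))
    (hB : IsBraidedGroup (R : H ⊗[k] H) S.toLinearMap) (c : Module.Dual k B) :
    TensorProduct.assoc k _ _ _ (LinearMap.rTensor _ (barComul R) (barComul R c)) =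
      LinearMap.lTensor _ (barComul R) (barComul R c) := by
  apply dualDistrib_ext₃
  intro x y z
  have h1 : ∀ X : Module.Dual k B ⊗[k] Module.Dual k B,
      dualDistrib k B (B ⊗[k] B) (LinearMap.lTensor _ (dualDistrib k B B)
        (TensorProduct.assoc k _ _ _ (LinearMap.rTensor _ (barComul R) X))) (x ⊗ₜ (y ⊗ₜ z)) =
      dualDistrib k B B X (twistedMul (↑R⁻¹ : H ⊗[k] H) (x ⊗ₜ y) ⊗ₜ z) := by
    intro X
    induction X with
    | zero => simp
    | add x y hx hy => simp only [map_add, LinearMap.add_apply, hx, hy]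
    | tmul c d =>
      rw [dualDistrib_apply, ← dualDistrib_barComul, LinearMap.rTensor_tmul]
      generalize barComul R c = Z
      induction Z with
      | zero => simp
      | add x y hx hy => simp only [map_add, add_tmul, LinearMap.add_apply, add_mul, hx, hy]
      | tmul e f => simp [mul_assoc]
  have h2 : ∀ X : Module.Dual k B ⊗[k] Module.Dual k B,
      dualDistrib k B (B ⊗[k] B) (LinearMap.lTensor _ (dualDistrib k B B)
        (LinearMap.lTensor _ (barComul R) X)) (x ⊗ₜ (y ⊗ₜ z)) =
      dualDistrib k B B X (x ⊗ₜ twistedMul (↑R⁻¹ : H ⊗[k] H) (y ⊗ₜ z)) := by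
    intro X
    induction X with
    | zero => simp
    | add x y hx hy => simp only [map_add, LinearMap.add_apply, hx, hy]
    | tmul c d =>
      rw [LinearMap.lTensor_tmul, LinearMap.lTensor_tmul, dualDistrib_apply, dualDistrib_apply,
        dualDistrib_barComul]
  rw [h1, h2, dualDistrib_barComul, dualDistrib_barComul, twistedMul_assoc hR hB]

/-- The coalgebra `C̄`. -/
@[reducible]
def barCoalgebra (hR : IsQuasitriangular k (R : H ⊗[k] H))
    (hB : IsBraidedGroup (R : H ⊗[k] H) S.toLinearMap) : Coalgebra k (Module.Dual k B) where
  comul := barComul R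
  counit := Module.Dual.eval k B 1
  coassoc := LinearMap.ext (barComul_coassoc hR hB)
  rTensor_counit_comp_comul := by
    ext c
    have h1 : ∀ X : Module.Dual k B ⊗[k] Module.Dual k B, ∀ b : B,
        TensorProduct.lid k _ (LinearMap.rTensor _ (Module.Dual.eval k B 1) X) b =
          dualDistrib k B B X (1 ⊗ₜ b) := by
      intro X b
      induction X with
      | zero => simp
      | add x y hx hy => simp only [map_add, LinearMap.add_apply, hx, hy]
      | tmul x y => simp
    apply (TensorProduct.lid k _).injective
    ext b
    rw [LinearMap.comp_apply, h1, dualDistrib_barComul,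
      twistedMul_one_left hB (normalized_rmat_inv hR)]
    simp
  lTensor_counit_comp_comul := by
    ext c
    have h1 : ∀ X : Module.Dual k B ⊗[k] Module.Dual k B, ∀ b : B,
        TensorProduct.rid k _ (LinearMap.lTensor _ (Module.Dual.eval k B 1) X) b =
          dualDistrib k B B X (b ⊗ₜ 1) := by
      intro X b
      induction X with
      | zero => simp
      | add x y hx hy => simp only [map_add, LinearMap.add_apply, hx, hy]
      | tmul x y => simp [mul_comm]
    apply (TensorProduct.rid k _).injective
    ext b
    rw [LinearMap.comp_apply, h1, dualDistrib_barComul,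
      twistedMul_one_right hB (normalized_rmat_inv hR)]
    simp

theorem barComul_lAct (hR : IsQuasitriangular k (R : H ⊗[k] H))
    (hB : IsBraidedGroup (R : H ⊗[k] H) S.toLinearMap) (h : H) (c : Module.Dual k B) :
    barComul R (lAct k H B h c) =
      TensorProduct.map₂ (lAct k H B) (lAct k H B) (comul h) (barComul R c) := by
  apply dualDistrib_ext
  intro a b
  rw [dualDistrib_barComul, dualDistrib_lAct, dualDistrib_barComul, twistedMul_equivariant hR hB]
  rfl

theorem barComul_counit (hR : IsQuasitriangular k (R : H ⊗[k] H))
    (hB : IsBraidedGroup (R : H ⊗[k] H) S.toLinearMap) :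
    barComul R (counit (R := k) (A := B)) = counit ⊗ₜ counit := by
  apply dualDistrib_ext
  intro a b
  rw [dualDistrib_barComul, dualDistrib_apply, counit_twistedMul hB (normalized_rmat_inv hR)]

/-- `(c ⊗ c') ⊗ (d ⊗ d') ↦ (c ⊗ X⁽¹⁾ ▷ d) ⊗ (X⁽²⁾ ▷ c' ⊗ d')`. -/
def barMidBraid (X : H ⊗[k] H) :
    (Module.Dual k B ⊗[k] Module.Dual k B) ⊗[k] (Module.Dual k B ⊗[k] Module.Dual k B) →ₗ[k]
      (Module.Dual k B ⊗[k] Module.Dual k B) ⊗[k] (Module.Dual k B ⊗[k] Module.Dual k B) :=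
  TensorProduct.map₂ (LinearMap.lTensorHom _ ∘ₗ lAct k H B)
      (LinearMap.rTensorHom _ ∘ₗ lAct k H B) X ∘ₗ
    (TensorProduct.tensorTensorTensorComm k _ _ _ _).toLinearMap

theorem barMidBraid_tmul (x y : H) (c c' d d' : Module.Dual k B) :
    barMidBraid (x ⊗ₜ[k] y) ((c ⊗ₜ c') ⊗ₜ (d ⊗ₜ d')) =
      (c ⊗ₜ lAct k H B x d) ⊗ₜ (lAct k H B y c' ⊗ₜ d') := by
  simp [barMidBraid, map₂_apply_tmul]

theorem barMidBraid_add (X Y : H ⊗[k] H) :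
    (barMidBraid (B := B) (X + Y)) = barMidBraid X + barMidBraid Y := by
  simp only [barMidBraid, map_add, LinearMap.add_comp]

/-- The transpose of `comul_twistedMul`. It is the inverse braiding of `B*` that appears, since `C̄`
is a braided group for R⁻¹ in opposite order. -/
theorem barComul_dualMul (hR : IsQuasitriangular k (R : H ⊗[k] H))
    (hB : IsBraidedGroup (R : H ⊗[k] H) S.toLinearMap) (c d : Module.Dual k B) :
    barComul R (dualMul k B c d) =
      TensorProduct.map (TensorProduct.lift (dualMul k B)) (TensorProduct.lift (dualMul k B))
        (barMidBraid (↑R⁻¹ : H ⊗[k] H) (barComul R c ⊗ₜ barComul R d)) := by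
  apply dualDistrib_ext
  intro a b
  rw [dualDistrib_barComul, dualMul_apply, comul_twistedMul hR hB]
  let E : (Module.Dual k B ⊗[k] Module.Dual k B) ⊗[k] (Module.Dual k B ⊗[k] Module.Dual k B) →ₗ[k]
      Module.Dual k ((B ⊗[k] B) ⊗[k] (B ⊗[k] B)) :=
    dualDistrib k (B ⊗[k] B) (B ⊗[k] B) ∘ₗ
      TensorProduct.map (dualDistrib k B B) (dualDistrib k B B)
  have h1 : ∀ T : (B ⊗[k] B) ⊗[k] (B ⊗[k] B), dualDistrib k B B (c ⊗ₜ d)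
      (TensorProduct.map (twistedMul (↑R⁻¹ : H ⊗[k] H)) (twistedMul (↑R⁻¹ : H ⊗[k] H)) T) =
      E (barComul R c ⊗ₜ barComul R d) T := by
    intro T
    induction T with
    | zero => simp
    | add x y hx hy => simp only [map_add, hx, hy]
    | tmul x y => simp [E, dualDistrib_barComul]
  have h2 : ∀ X : (Module.Dual k B ⊗[k] Module.Dual k B) ⊗[k]
      (Module.Dual k B ⊗[k] Module.Dual k B),
      dualDistrib k B B (TensorProduct.map (TensorProduct.lift (dualMul k B))
        (TensorProduct.lift (dualMul k B)) X) (a ⊗ₜ b) = E X (comul a ⊗ₜ comul b) := by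
    intro X
    induction X with
    | zero => simp
    | add x y hx hy => simp only [map_add, LinearMap.add_apply, hx, hy]
    | tmul x y =>
      have h3 : ∀ (x : Module.Dual k B ⊗[k] Module.Dual k B) (b : B),
          TensorProduct.lift (dualMul k B) x b = dualDistrib k B B x (comul b) := by
        intro x b
        induction x with
        | zero => simp
        | add x y hx hy => simp only [map_add, LinearMap.add_apply, hx, hy]
        | tmul x y => rfl
      simp [E, h3]
  rw [h1, h2]
  generalize (↑R⁻¹ : H ⊗[k] H) = Z
  generalize barComul R c = X
  generalize barComul R d = Y
  generalize comul (R := k) a = T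
  generalize comul (R := k) b = U
  induction Z with
  | zero => simp [barMidBraid]
  | add x y hx hy =>
    simp only [midBraid_add, barMidBraid_add, LinearMap.add_apply, map_add, hx, hy]
  | tmul z z' =>
  induction X with
  | zero => simp
  | add x y hx hy => simp only [LinearMap.add_apply, map_add, add_tmul, hx, hy]
  | tmul x x' =>
  induction Y with
  | zero => simp
  | add x y hx hy => simp only [LinearMap.add_apply, map_add, tmul_add, hx, hy]
  | tmul y y' =>
  induction T with
  | zero => simp
  | add x y hx hy => simp only [map_add, add_tmul, hx, hy]
  | tmul t t' =>
  induction U with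
  | zero => simp
  | add x y hx hy => simp only [map_add, tmul_add, hx, hy]
  | tmul u u' =>
    simp [midBraid_tmul, barMidBraid_tmul, E, lAct_apply]
    ring

theorem dualMul_barAntipode_left (hR : IsQuasitriangular k (R : H ⊗[k] H))
    (hB : IsBraidedGroup (R : H ⊗[k] H) S.toLinearMap) (c : Module.Dual k B) :
    TensorProduct.lift (dualMul k B) (LinearMap.rTensor _ (barAntipode S) (barComul R c)) =
      c 1 • counit := by
  ext b
  have h1 : ∀ X : Module.Dual k B ⊗[k] Module.Dual k B,
      TensorProduct.lift (dualMul k B) (LinearMap.rTensor _ (barAntipode S) X) b =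
      dualDistrib k B B X (LinearMap.rTensor B S.symm.toLinearMap (comul b)) := by
    intro X
    induction X with
    | zero => simp
    | add x y hx hy => simp only [map_add, LinearMap.add_apply, hx, hy]
    | tmul x y =>
      rw [LinearMap.rTensor_tmul, lift.tmul, dualMul_apply]
      generalize comul (R := k) b = T
      induction T with
      | zero => simp
      | add x y hx hy => simp only [map_add, hx, hy]
      | tmul x y => rfl
  rw [h1, dualDistrib_barComul, twistedMul_antipode_left hR hB, Algebra.algebraMap_eq_smul_one,
    map_smul, LinearMap.smul_apply, smul_eq_mul, smul_eq_mul, mul_comm]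

theorem dualMul_barAntipode_right (hR : IsQuasitriangular k (R : H ⊗[k] H))
    (hB : IsBraidedGroup (R : H ⊗[k] H) S.toLinearMap) (c : Module.Dual k B) :
    TensorProduct.lift (dualMul k B) (LinearMap.lTensor _ (barAntipode S) (barComul R c)) =
      c 1 • counit := by
  ext b
  have h1 : ∀ X : Module.Dual k B ⊗[k] Module.Dual k B,
      TensorProduct.lift (dualMul k B) (LinearMap.lTensor _ (barAntipode S) X) b =
      dualDistrib k B B X (LinearMap.lTensor B S.symm.toLinearMap (comul b)) := by
    intro X
    induction X with
    | zero => simp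
    | add x y hx hy => simp only [map_add, LinearMap.add_apply, hx, hy]
    | tmul x y =>
      rw [LinearMap.lTensor_tmul, lift.tmul, dualMul_apply]
      generalize comul (R := k) b = T
      induction T with
      | zero => simp
      | add x y hx hy => simp only [map_add, hx, hy]
      | tmul x y => rfl
  rw [h1, dualDistrib_barComul, twistedMul_antipode_right hR hB, Algebra.algebraMap_eq_smul_one,
    map_smul, LinearMap.smul_apply, smul_eq_mul, smul_eq_mul, mul_comm]

end Bar

/-! ### Triples of maps satisfying the relations of the two-sided smash product -/

section Triple

variable {A : Type*} [Ring A] [Algebra k A]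

/-- Maps from `C̄`, `H`, `B` to an algebra that satisfy the relations of the two-sided smash product
`C̄ ⋊ H ⋉ B`, in which `C̄` and `B` commute. -/
structure IsSmashTriple (gC : Module.Dual k B →ₗ[k] A) (gH : H →ₐ[k] A) (gB : B →ₗ[k] A) :
    Prop where
  map_dualMul : ∀ c d, gC (dualMul k B c d) = gC c * gC d
  map_counit : gC counit = 1
  map_mul : ∀ a b, gB (a * b) = gB a * gB b
  map_one : gB 1 = 1
  relLeft : RelLeft gC gH.toLinearMap
  relRight : RelRight gB gH.toLinearMap
  comm : ∀ c b, Commute (gC c) (gB b)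

/-- `c ⊗ h ⊗ b ↦ gC c * (gH h * gB b)`. -/
def triple (gC : Module.Dual k B →ₗ[k] A) (gH : H →ₐ[k] A) (gB : B →ₗ[k] A) :
    Space k H B →ₗ[k] A := mulMap gC (mulMap gH.toLinearMap gB)

theorem triple_tmul (gC : Module.Dual k B →ₗ[k] A) (gH : H →ₐ[k] A) (gB : B →ₗ[k] A)
    (c : Module.Dual k B) (h : H) (b : B) :
    triple gC gH gB (c ⊗ₜ (h ⊗ₜ b)) = gC c * (gH h * gB b) := rfl

/-- Linear maps out of `C̄ ⊗ H ⊗ B` agree if they agree on pure tensors. -/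
theorem Space.ext {M : Type*} [AddCommGroup M] [Module k M] {f g : Space k H B →ₗ[k] M}
    (h : ∀ c h b, f (c ⊗ₜ (h ⊗ₜ b)) = g (c ⊗ₜ (h ⊗ₜ b))) : f = g := by
  apply TensorProduct.ext'
  intro c T
  induction T with
  | zero => simp
  | add x y hx hy => simp only [tmul_add, map_add, hx, hy]
  | tmul x y => exact h c x y

@[elab_as_elim]
theorem Space.induction {p : Space k H B → Prop} (zero : p 0)
    (add : ∀ x y, p x → p y → p (x + y)) (tmul : ∀ c h b, p (c ⊗ₜ (h ⊗ₜ b)))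
    (x : Space k H B) : p x := by
  refine TensorProduct.induction_on x zero (fun c T => ?_) add
  induction T with
  | zero => simpa using zero
  | add x y hx hy => rw [tmul_add]; exact add _ _ hx hy
  | tmul h b => exact tmul c h b

variable (H) in
/-- Left multiplication by `c ∈ C̄` on `C̄ ⋊ H ⋉ B`. -/
def leftC (c : Module.Dual k B) : Space k H B →ₗ[k] Space k H B :=
  LinearMap.rTensor _ (dualMul k B c)

/-- Left multiplication by `h ∈ H` on `C̄ ⋊ H ⋉ B`. -/
def leftH (h : H) : Space k H B →ₗ[k] Space k H B :=
  TensorProduct.map₂ (lAct k H B) (LinearMap.rTensorHom B ∘ₗ LinearMap.mul k H) (comul h)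

variable (H) in
/-- Left multiplication by `b ∈ B` on `C̄ ⋊ H ⋉ B`. -/
def leftB (b : B) : Space k H B →ₗ[k] Space k H B :=
  LinearMap.lTensor _ (LinearMap.lTensor H (LinearMap.mul' k B) ∘ₗ
    (TensorProduct.assoc k H B B).toLinearMap ∘ₗ
    LinearMap.rTensor B (LinearMap.lTensor H (ract k H b) ∘ₗ comul))

variable {gC : Module.Dual k B →ₗ[k] A} {gH : H →ₐ[k] A} {gB : B →ₗ[k] A}

/-- The operators `leftC`, `leftH`, `leftB` on C̄ ⊗ H ⊗ B do not depend on the target algebra, yet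
become left multiplications in every algebra carrying a smash triple. They replace a direct
definition of the product on C̄ ⊗ H ⊗ B. -/
theorem IsSmashTriple.triple_leftC (hg : IsSmashTriple gC gH gB) (c : Module.Dual k B)
    (x : Space k H B) : triple gC gH gB (leftC H c x) = gC c * triple gC gH gB x := by
  suffices h : triple gC gH gB ∘ₗ leftC H c = LinearMap.mulLeft k (gC c) ∘ₗ triple gC gH gB from
    LinearMap.congr_fun h x
  apply Space.ext
  intro d h b
  simp [leftC, triple_tmul, hg.map_dualMul, mul_assoc]

theorem IsSmashTriple.triple_leftH (hg : IsSmashTriple gC gH gB) (h : H)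
    (x : Space k H B) : triple gC gH gB (leftH h x) = gH h * triple gC gH gB x := by
  suffices h : triple gC gH gB ∘ₗ leftH h = LinearMap.mulLeft k (gH h) ∘ₗ triple gC gH gB from
    LinearMap.congr_fun h x
  apply Space.ext
  intro d g b
  have h1 : ∀ X : H ⊗[k] H, triple gC gH gB (TensorProduct.map₂ (lAct k H B)
      (LinearMap.rTensorHom B ∘ₗ LinearMap.mul k H) X (d ⊗ₜ (g ⊗ₜ b))) =
      mulMap (gC ∘ₗ lact H d) gH.toLinearMap X * (gH g * gB b) := by
    intro X
    induction X with
    | zero => simp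
    | add x y hx hy => simp only [map_add, LinearMap.add_apply, add_mul, hx, hy]
    | tmul x y => simp [map₂_apply_tmul, triple_tmul, mul_assoc]
  have h2 := hg.relLeft h d
  simp only [LinearMap.comp_apply, LinearMap.mulLeft_apply, triple_tmul, leftH]
  rw [h1, ← h2]
  simp only [AlgHom.toLinearMap_apply, mul_assoc]

theorem IsSmashTriple.triple_leftB (hg : IsSmashTriple gC gH gB) (b : B)
    (x : Space k H B) : triple gC gH gB (leftB H b x) = gB b * triple gC gH gB x := by
  suffices h : triple gC gH gB ∘ₗ leftB H b = LinearMap.mulLeft k (gB b) ∘ₗ triple gC gH gB from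
    LinearMap.congr_fun h x
  apply Space.ext
  intro d g a
  have h1 : ∀ X : H ⊗[k] H, triple gC gH gB (d ⊗ₜ LinearMap.lTensor H (LinearMap.mul' k B)
      (TensorProduct.assoc k H B B (LinearMap.lTensor H (ract k H b) X ⊗ₜ a))) =
      gC d * (mulMap gH.toLinearMap (gB ∘ₗ ract k H b) X * gB a) := by
    intro X
    induction X with
    | zero => simp
    | add x y hx hy => simp only [map_add, add_tmul, tmul_add, add_mul, mul_add, hx, hy]
    | tmul x y => simp [triple_tmul, mul_assoc, hg.map_mul]
  have h2 := hg.relRight b g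
  simp only [LinearMap.comp_apply, LinearMap.mulLeft_apply, triple_tmul, leftB,
    LinearMap.lTensor_tmul, LinearMap.rTensor_tmul, LinearEquiv.coe_coe]
  rw [h1, ← h2, ← mul_assoc, ← mul_assoc, ← mul_assoc, (hg.comm d b).eq, ← mul_assoc]
  rfl

/-- The algebra `A` is the two-sided smash product `C̄ ⋊ H ⋉ B`. -/
structure IsSmash (gC : Module.Dual k B →ₗ[k] A) (gH : H →ₐ[k] A) (gB : B →ₗ[k] A) : Prop
    extends IsSmashTriple gC gH gB where
  bijective : Function.Bijective (triple gC gH gB)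

/-! ### Universal property of the two-sided smash product -/

namespace IsSmash

/-- The linear isomorphism `C̄ ⊗ H ⊗ B → A`. -/
def equiv (hg : IsSmash gC gH gB) : Space k H B ≃ₗ[k] A :=
  LinearEquiv.ofBijective _ hg.bijective

theorem equiv_apply (hg : IsSmash gC gH gB) (x : Space k H B) :
    hg.equiv x = triple gC gH gB x := rfl

theorem equiv_tmul (hg : IsSmash gC gH gB) (c : Module.Dual k B) (h : H) (b : B) :
    hg.equiv (c ⊗ₜ (h ⊗ₜ b)) = gC c * (gH h * gB b) := rfl

@[elab_as_elim]
theorem induction (hg : IsSmash gC gH gB) {p : A → Prop} (zero : p 0)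
    (add : ∀ x y, p x → p y → p (x + y)) (mul : ∀ c h b, p (gC c * (gH h * gB b))) (x : A) :
    p x := by
  obtain ⟨s, rfl⟩ := hg.equiv.surjective x
  induction s using Space.induction with
  | zero => simpa using zero
  | add x y hx hy => rw [map_add]; exact add _ _ hx hy
  | tmul c h b => exact mul c h b

theorem linearMap_ext (hg : IsSmash gC gH gB) {M : Type*} [AddCommGroup M] [Module k M]
    {f g : A →ₗ[k] M} (h : ∀ c h b, f (gC c * (gH h * gB b)) = g (gC c * (gH h * gB b))) :
    f = g := by
  ext x
  induction x using hg.induction with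
  | zero => simp
  | add x y hx hy => simp only [map_add, hx, hy]
  | mul c x b => exact h c x b

theorem algHom_ext (hg : IsSmash gC gH gB) {D : Type*} [Ring D] [Algebra k D] {f g : A →ₐ[k] D}
    (hC : ∀ c, f (gC c) = g (gC c)) (hH : ∀ h, f (gH h) = g (gH h))
    (hB : ∀ b, f (gB b) = g (gB b)) : f = g := by
  ext x
  induction x using hg.induction with
  | zero => simp
  | add x y hx hy => simp only [map_add, hx, hy]
  | mul c x b => simp only [map_mul, hC, hH, hB]

variable {D : Type*} [Ring D] [Algebra k D] {fC : Module.Dual k B →ₗ[k] D} {fH : H →ₐ[k] D}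
  {fB : B →ₗ[k] D}

/-- The universal property of the two-sided smash product. -/
def lift (hg : IsSmash gC gH gB) (hf : IsSmashTriple fC fH fB) : A →ₐ[k] D :=
  AlgHom.ofLinearMap (triple fC fH fB ∘ₗ hg.equiv.symm.toLinearMap)
    (by
      have h : hg.equiv.symm 1 = (counit ⊗ₜ (1 ⊗ₜ 1) : Space k H B) := by
        rw [LinearEquiv.symm_apply_eq, equiv_tmul]
        simp [hg.map_counit, hg.map_one]
      simp [h, triple_tmul, hf.map_counit, hf.map_one])
    (by
      intro x y
      obtain ⟨s, rfl⟩ := hg.equiv.surjective y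
      induction x using hg.induction with
      | zero => simp
      | add x y hx hy => simp only [map_add, add_mul, hx, hy]
      | mul c h b =>
        -- Left multiplication by a generator is given by the same operator on C̄ ⊗ H ⊗ B in the
        -- source and in the target, so the map that matches these coordinates is multiplicative.
        have h1 : gC c * (gH h * gB b) * hg.equiv s =
            hg.equiv (leftC H c (leftH h (leftB H b s))) := by
          simp only [equiv_apply, hg.triple_leftC, hg.triple_leftH, hg.triple_leftB, mul_assoc]
        have h2 : gC c * (gH h * gB b) = hg.equiv (c ⊗ₜ (h ⊗ₜ b)) := rfl
        rw [h1, h2]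
        simp only [LinearMap.comp_apply, LinearEquiv.coe_coe, LinearEquiv.symm_apply_apply,
          hf.triple_leftC, hf.triple_leftH, hf.triple_leftB, triple_tmul, mul_assoc])

theorem lift_mul (hg : IsSmash gC gH gB) (hf : IsSmashTriple fC fH fB) (c : Module.Dual k B)
    (h : H) (b : B) : hg.lift hf (gC c * (gH h * gB b)) = fC c * (fH h * fB b) := by
  change triple fC fH fB (hg.equiv.symm (hg.equiv (c ⊗ₜ (h ⊗ₜ b)))) = _
  rw [LinearEquiv.symm_apply_apply, triple_tmul]

theorem lift_C (hg : IsSmash gC gH gB) (hf : IsSmashTriple fC fH fB) (c : Module.Dual k B) :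
    hg.lift hf (gC c) = fC c := by
  simpa [hf.map_one, hg.map_one] using hg.lift_mul hf c 1 1

theorem lift_H (hg : IsSmash gC gH gB) (hf : IsSmashTriple fC fH fB) (h : H) :
    hg.lift hf (gH h) = fH h := by
  simpa [hf.map_one, hg.map_one, hf.map_counit, hg.map_counit] using hg.lift_mul hf counit h 1

theorem lift_B (hg : IsSmash gC gH gB) (hf : IsSmashTriple fC fH fB) (b : B) :
    hg.lift hf (gB b) = fB b := by
  simpa [hf.map_counit, hg.map_counit] using hg.lift_mul hf counit 1 b

end IsSmash

/-- The image of a triple, as a subalgebra. -/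
def IsSmashTriple.range (hg : IsSmashTriple gC gH gB) : Subalgebra k A where
  carrier := LinearMap.range (triple gC gH gB)
  add_mem' := Submodule.add_mem _
  algebraMap_mem' r := by
    rw [Algebra.algebraMap_eq_smul_one]
    refine Submodule.smul_mem _ r ⟨counit ⊗ₜ (1 ⊗ₜ 1), ?_⟩
    simp [triple_tmul, hg.map_counit, hg.map_one]
  mul_mem' := by
    rintro _ y ⟨s, rfl⟩ ⟨t, rfl⟩
    change _ ∈ LinearMap.range (triple gC gH gB)
    induction s using Space.induction with
    | zero => simp
    | add x y hx hy => rw [map_add, add_mul]; exact Submodule.add_mem _ hx hy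
    | tmul c h b =>
      refine ⟨leftC H c (leftH h (leftB H b t)), ?_⟩
      simp only [hg.triple_leftC, hg.triple_leftH, hg.triple_leftB, triple_tmul, mul_assoc]

/-- The image of an injective triple is a concrete model, so existence of the smash product amounts
to one faithful representation. -/
theorem IsSmashTriple.exists_isSmash (hg : IsSmashTriple gC gH gB)
    (hinj : Function.Injective (triple gC gH gB)) :
    ∃ (jC : Module.Dual k B →ₗ[k] hg.range) (jH : H →ₐ[k] hg.range) (jB : B →ₗ[k] hg.range),
      IsSmash jC jH jB := by
  have hC : ∀ c, gC c ∈ hg.range := fun c =>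
    ⟨c ⊗ₜ (1 ⊗ₜ 1), by simp [triple_tmul, hg.map_one]⟩
  have hH : ∀ h, gH h ∈ hg.range := fun h =>
    ⟨counit ⊗ₜ (h ⊗ₜ 1), by simp [triple_tmul, hg.map_one, hg.map_counit]⟩
  have hB : ∀ b, gB b ∈ hg.range := fun b =>
    ⟨counit ⊗ₜ (1 ⊗ₜ b), by simp [triple_tmul, hg.map_counit]⟩
  let jC : Module.Dual k B →ₗ[k] hg.range := gC.codRestrict (Subalgebra.toSubmodule hg.range) hC
  let jH : H →ₐ[k] hg.range := gH.codRestrict hg.range hH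
  let jB : B →ₗ[k] hg.range := gB.codRestrict (Subalgebra.toSubmodule hg.range) hB
  have hval : ∀ x : Space k H B, (triple jC jH jB x : A) = triple gC gH gB x := by
    intro x
    suffices h : hg.range.val.toLinearMap ∘ₗ triple jC jH jB = triple gC gH gB from
      LinearMap.congr_fun h x
    apply Space.ext
    intro c h b
    rfl
  refine ⟨jC, jH, jB, ⟨?_, ?_, ?_, ?_, ?_, ?_, ?_⟩, ?_, ?_⟩
  · exact fun c d => Subtype.ext (hg.map_dualMul c d)
  · exact Subtype.ext hg.map_counit
  · exact fun c d => Subtype.ext (hg.map_mul c d)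
  · exact Subtype.ext hg.map_one
  · intro h c
    apply Subtype.ext
    refine (hg.relLeft h c).trans ?_
    exact (map_mulMap hg.range.val (jC ∘ₗ lact H c) jH.toLinearMap (comul h)).symm
  · intro b h
    apply Subtype.ext
    refine (hg.relRight b h).trans ?_
    exact (map_mulMap hg.range.val jH.toLinearMap (jB ∘ₗ ract k H b) (comul h)).symm
  · exact fun c b => Subtype.ext (hg.comm c b)
  · intro x y hxy
    exact hinj (by rw [← hval, ← hval, hxy])
  · rintro ⟨_, s, rfl⟩
    exact ⟨s, Subtype.ext (hval s)⟩

/-! ### Existence of the two-sided smash product -/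

section Existence

variable {E E' : Type*} [Ring E] [Algebra k E] [Ring E'] [Algebra k E']

variable (H E E') in
/-- The inclusion of `E` in `E ⊗ (H ⊗ E')`. -/
def incl₁ : E →ₐ[k] E ⊗[k] (H ⊗[k] E') := Algebra.TensorProduct.includeLeft

variable (H E E') in
/-- The inclusion of `H` in `E ⊗ (H ⊗ E')`. -/
def incl₂ : H →ₐ[k] E ⊗[k] (H ⊗[k] E') :=
  (Algebra.TensorProduct.includeRight (A := E) (B := H ⊗[k] E')).comp
    (Algebra.TensorProduct.includeLeft (A := H) (B := E'))

variable (H E E') in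
/-- The inclusion of `E'` in `E ⊗ (H ⊗ E')`. -/
def incl₃ : E' →ₐ[k] E ⊗[k] (H ⊗[k] E') :=
  (Algebra.TensorProduct.includeRight (A := E) (B := H ⊗[k] E')).comp
    (Algebra.TensorProduct.includeRight (A := H) (B := E'))

theorem incl₁_apply (x : E) : incl₁ (k := k) H E E' x = x ⊗ₜ (1 ⊗ₜ 1) := rfl
theorem incl₂_apply (x : H) : incl₂ (k := k) H E E' x = 1 ⊗ₜ (x ⊗ₜ 1) := rfl
theorem incl₃_apply (x : E') : incl₃ (k := k) H E E' x = 1 ⊗ₜ (1 ⊗ₜ x) := rfl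

theorem commute_incl₁_incl₂ (x : E) (y : H) :
    Commute (incl₁ (k := k) H E E' x) (incl₂ H E E' y) := by
  simp [commute_iff_eq, incl₁_apply, incl₂_apply]

theorem commute_incl₁_incl₃ (x : E) (y : E') :
    Commute (incl₁ (k := k) H E E' x) (incl₃ H E E' y) := by
  simp [commute_iff_eq, incl₁_apply, incl₃_apply]

theorem commute_incl₂_incl₃ (x : H) (y : E') :
    Commute (incl₂ (k := k) H E E' x) (incl₃ H E E' y) := by
  simp [commute_iff_eq, incl₂_apply, incl₃_apply]

theorem commute_conv {D : Type*} [AddCommGroup D] [Module k D] [Coalgebra k D]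
    {A : Type*} [Ring A] [Algebra k A] {f g : D →ₗ[k] A} {a : A}
    (hf : ∀ v, Commute a (f v)) (hg : ∀ w, Commute a (g w)) (d : D) : Commute a (conv f g d) :=
  commute_mulMap hf hg _

theorem RelLeft.map {A A' : Type*} [Ring A] [Algebra k A] [Ring A'] [Algebra k A']
    {f : Module.Dual k B →ₗ[k] A} {p : H →ₗ[k] A} (h : RelLeft f p) (φ : A →ₐ[k] A') :
    RelLeft (φ.toLinearMap ∘ₗ f) (φ.toLinearMap ∘ₗ p) := fun x c => by
  have := congrArg φ (h x c)
  rw [map_mul, map_mulMap] at this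
  exact this

theorem RelRight.map {A A' : Type*} [Ring A] [Algebra k A] [Ring A'] [Algebra k A']
    {f : B →ₗ[k] A} {p : H →ₗ[k] A} (h : RelRight f p) (φ : A →ₐ[k] A') :
    RelRight (φ.toLinearMap ∘ₗ f) (φ.toLinearMap ∘ₗ p) := fun x c => by
  have := congrArg φ (h x c)
  rw [map_mul, map_mulMap] at this
  exact this

/-- Three commuting representations of `H`, the outer two of which extend to `C̄ ⋊ H` and to `H ⋉ B`,
combine to a representation of `C̄ ⋊ H ⋉ B`. -/
theorem exists_injective_triple {A : Type*} [Ring A] [Algebra k A]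
    {fC : Module.Dual k B →ₗ[k] A} {p₁ p₂ p₃ : H →ₐ[k] A} {fB : B →ₗ[k] A}
    (map_dualMul : ∀ c d, fC (dualMul k B c d) = fC c * fC d) (map_counit : fC counit = 1)
    (map_mul' : ∀ a b, fB (a * b) = fB a * fB b) (map_one' : fB 1 = 1)
    (relLeft : RelLeft fC p₁.toLinearMap) (relRight : RelRight fB p₃.toLinearMap)
    (c₁₂ : ∀ x y, Commute (p₁ x) (p₂ y)) (c₁₃ : ∀ x y, Commute (p₁ x) (p₃ y))
    (c₂₃ : ∀ x y, Commute (p₂ x) (p₃ y)) (hC₂ : ∀ c x, Commute (fC c) (p₂ x))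
    (hC₃ : ∀ c x, Commute (fC c) (p₃ x)) (hB₁ : ∀ b x, Commute (fB b) (p₁ x))
    (hB₂ : ∀ b x, Commute (fB b) (p₂ x)) (hCB : ∀ c b, Commute (fC c) (fB b))
    (K : A →ₗ[k] Space k H B) (hK : ∀ c x y z b, K (fC c * (p₁ x * (p₂ y * p₃ z) * fB b)) =
      (counit (R := k) x * counit (R := k) z) • (c ⊗ₜ (y ⊗ₜ b))) :
    ∃ fH : H →ₐ[k] A, IsSmashTriple fC fH fB ∧ Function.Injective (triple fC fH fB) := by
  -- `H` is embedded diagonally, h ↦ p₁(h₁)p₂(h₂)p₃(h₃). The outer copies produce the actions on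
  -- `C̄` and `B`, the middle one keeps `H` faithful, and `K` removes the outer two by the counit.
  let p : H →ₐ[k] A := convHom p₂ p₃ c₂₃
  have hp : p.toLinearMap = conv p₂.toLinearMap p₃.toLinearMap := convHom_toLinearMap _ _ _
  have c : ∀ x y, Commute (p₁ x) (p y) := fun x y => by
    change Commute (p₁ x) (p.toLinearMap y)
    rw [hp]
    exact commute_conv (fun v => c₁₂ x v) (fun v => c₁₃ x v) y
  let q : H →ₐ[k] A := convHom p₁ p c
  have hq : q.toLinearMap = conv p₁.toLinearMap (conv p₂.toLinearMap p₃.toLinearMap) :=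
    (convHom_toLinearMap _ _ _).trans (by rw [hp])
  have ht : IsSmashTriple fC q fB := by
    refine ⟨map_dualMul, map_counit, map_mul', map_one', ?_, ?_, hCB⟩
    · rw [hq]
      exact RelLeft.conv relLeft fun x y => commute_conv (fun v => hC₂ x v) (fun v => hC₃ x v) y
    · rw [hq, conv_assoc]
      exact RelRight.conv relRight fun x y => commute_conv (fun v => hB₁ x v) (fun v => hB₂ x v) y
  refine ⟨q, ht, ?_⟩
  apply Function.LeftInverse.injective (g := K)
  intro x
  have h1 : ∀ c b, ∀ X : H ⊗[k] (H ⊗[k] H), K (fC c *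
      (mulMap p₁.toLinearMap (mulMap p₂.toLinearMap p₃.toLinearMap) X * fB b)) =
      c ⊗ₜ (TensorProduct.lid k H (LinearMap.rTensor H counit
        (LinearMap.lTensor H ((TensorProduct.rid k H).toLinearMap ∘ₗ
          LinearMap.lTensor H counit) X)) ⊗ₜ b) := by
    intro c b X
    induction X with
    | zero => simp
    | add x y hx hy => simp only [map_add, add_mul, mul_add, add_tmul, tmul_add, hx, hy]
    | tmul x Y =>
      induction Y with
      | zero => simp
      | add x y hx hy => simp only [map_add, add_mul, mul_add, add_tmul, tmul_add, hx, hy]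
      | tmul y z => simp [hK, smul_smul, ← smul_tmul', mul_comm]
  have h2 : ∀ h, q h = mulMap p₁.toLinearMap (mulMap p₂.toLinearMap p₃.toLinearMap)
        (LinearMap.lTensor H comul (comul h)) := by
    intro h
    have := LinearMap.congr_fun hq h
    rw [AlgHom.toLinearMap_apply] at this
    rw [this, mulMap_lTensor]
    rfl
  have h3 : (TensorProduct.rid k H).toLinearMap ∘ₗ (TensorProduct.mk k H k).flip 1 =
      LinearMap.id := by ext; simp
  induction x using Space.induction with
  | zero => simp
  | add x y hx hy => rw [map_add, map_add, hx, hy]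
  | tmul c h b =>
    rw [triple_tmul, h2, h1, ← LinearMap.lTensor_comp_apply, LinearMap.comp_assoc,
      lTensor_counit_comp_comul, h3]
    simp

/-- `F` and `G` play the role of evaluation at a unit vector: they recover c and b and see `H` only
through its counit, which gives the left inverse of the triple map. -/
theorem exists_isSmash_of_faithful {gC : Module.Dual k B →ₗ[k] E} {a : H →ₐ[k] E}
    {gB : B →ₗ[k] E'} {a' : H →ₐ[k] E'}
    (map_dualMul : ∀ c d, gC (dualMul k B c d) = gC c * gC d) (map_counit : gC counit = 1)
    (map_mul' : ∀ a b, gB (a * b) = gB a * gB b) (map_one' : gB 1 = 1)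
    (relLeft : RelLeft gC a.toLinearMap) (relRight : RelRight gB a'.toLinearMap)
    (F : E →ₗ[k] Module.Dual k B) (hF : ∀ c h, F (gC c * a h) = counit (R := k) h • c)
    (G : E' →ₗ[k] B) (hG : ∀ b h, G (a' h * gB b) = counit (R := k) h • b) :
    ∃ (W : Subalgebra k (E ⊗[k] (H ⊗[k] E'))) (jC : Module.Dual k B →ₗ[k] W)
      (jH : H →ₐ[k] W) (jB : B →ₗ[k] W), IsSmash (A := W) jC jH jB := by
  obtain ⟨fH, ht, hinj⟩ := exists_injective_triple (A := E ⊗[k] (H ⊗[k] E'))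
    (fC := (incl₁ (k := k) H E E').toLinearMap ∘ₗ gC) (p₁ := (incl₁ (k := k) H E E').comp a)
    (p₂ := incl₂ (k := k) H E E') (p₃ := (incl₃ (k := k) H E E').comp a')
    (fB := (incl₃ (k := k) H E E').toLinearMap ∘ₗ gB)
    (fun c d => by simp [map_dualMul]) (by simp [map_counit]) (fun a b => by simp [map_mul'])
    (by simp [map_one']) (relLeft.map _) (relRight.map _)
    (fun x y => commute_incl₁_incl₂ _ _) (fun x y => commute_incl₁_incl₃ _ _)
    (fun x y => commute_incl₂_incl₃ _ _) (fun x y => commute_incl₁_incl₂ _ _)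
    (fun x y => commute_incl₁_incl₃ _ _) (fun x y => (commute_incl₁_incl₃ _ _).symm)
    (fun x y => (commute_incl₂_incl₃ _ _).symm) (fun x y => commute_incl₁_incl₃ _ _)
    (TensorProduct.map F (LinearMap.lTensor H G)) (fun c x y z b => by
      simp [incl₁_apply, incl₂_apply, incl₃_apply, hF, hG, smul_tmul, mul_comm, smul_smul])
  exact ⟨_, ht.exists_isSmash hinj⟩

variable {R : (H ⊗[k] H)ˣ} {S : B →ₗ[k] B}

/-- The two-sided smash product `C̄ ⋊ H ⋉ B` exists. -/
theorem exists_isSmash (hB : IsBraidedGroup (R : H ⊗[k] H) S) :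
    ∃ (W : Type (max u v w)) (_ : Ring W) (_ : Algebra k W) (jC : Module.Dual k B →ₗ[k] W)
      (jH : H →ₐ[k] W) (jB : B →ₗ[k] W), IsSmash jC jH jB := by
  -- `B` acts on itself by right multiplication and `H` acts on the right, so both become
  -- multiplicative only in the opposite endomorphism algebra.
  let o : Module.End k B →ₗ[k] (Module.End k B)ᵐᵒᵖ := (MulOpposite.opLinearEquiv k).toLinearMap
  obtain ⟨W, h⟩ := exists_isSmash_of_faithful (k := k) (H := H) (B := B)
    (E := Module.End k (Module.Dual k B)) (E' := (Module.End k B)ᵐᵒᵖ) (gC := dualMul k B)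
    (a := AlgHom.ofLinearMap (lAct k H B) (LinearMap.ext lAct_one)
      fun x y => LinearMap.ext (lAct_mul x y))
    (gB := o ∘ₗ (LinearMap.mul k B).flip)
    (a' := AlgHom.ofLinearMap (o ∘ₗ rAct k H B) (congrArg MulOpposite.op (LinearMap.ext rAct_one))
      fun x y => congrArg MulOpposite.op (LinearMap.ext (rAct_mul x y)))
    (fun c d => LinearMap.ext (dualMul_assoc c d)) (LinearMap.ext counit_dualMul)
    (fun a b => congrArg MulOpposite.op (LinearMap.ext fun x => (mul_assoc x a b).symm))
    (congrArg MulOpposite.op (LinearMap.ext mul_one))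
    (by
      intro h c
      apply LinearMap.ext
      intro d
      change lAct k H B h (dualMul k B c d) = _
      rw [lAct_dualMul hB]
      generalize comul (R := k) h = X
      induction X with
      | zero => simp
      | add x y hx hy =>
        simp only [map_add, LinearMap.add_apply, hx, hy]
      | tmul x y =>
        rw [map₂_apply_tmul]
        rfl)
    (by
      intro b h
      apply MulOpposite.unop_injective
      apply LinearMap.ext
      intro a
      change rAct k H B h (a * b) = _
      rw [mul_rAct hB]
      generalize comul (R := k) h = X
      induction X with
      | zero => simp
      | add x y hx hy =>
        simp only [map_add, hx, hy, MulOpposite.unop_add]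
        exact (LinearMap.add_apply _ _ _).symm
      | tmul x y => rfl)
    -- The unit of `B*` is the counit of `B`, and `H` acts on it by ε, so evaluation there sends c h
    -- to ε(h) c.
    (LinearMap.applyₗ (counit : Module.Dual k B))
    (fun c h => by
      change dualMul k B c (lAct k H B h counit) = _
      rw [lAct_counit hB, map_smul, dualMul_counit])
    (LinearMap.applyₗ (1 : B) ∘ₗ (MulOpposite.opLinearEquiv k).symm.toLinearMap)
    (fun b h => by
      change rAct k H B h 1 * b = _
      rw [one_rAct hB, Algebra.algebraMap_eq_smul_one, smul_mul_assoc, one_mul])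
  exact ⟨W, inferInstance, inferInstance, h⟩

end Existence

end Triple

/-! ### The coproduct of the two-sided smash product -/

section Exchange

variable {A : Type*} [Ring A] [Algebra k A] {R : (H ⊗[k] H)ˣ}

theorem mulMap_add_left {V W : Type*} [AddCommGroup V] [Module k V] [AddCommGroup W] [Module k W]
    (f f' : V →ₗ[k] A) (g : W →ₗ[k] A) : mulMap (f + f') g = mulMap f g + mulMap f' g := by
  simp only [mulMap, TensorProduct.map_add_left, LinearMap.comp_add]

theorem mulMap_add_right {V W : Type*} [AddCommGroup V] [Module k V] [AddCommGroup W] [Module k W]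
    (f : V →ₗ[k] A) (g g' : W →ₗ[k] A) : mulMap f (g + g') = mulMap f g + mulMap f g' := by
  simp only [mulMap, TensorProduct.map_add_right, LinearMap.comp_add]

@[simp]
theorem mulMap_zero_left {V W : Type*} [AddCommGroup V] [Module k V] [AddCommGroup W] [Module k W]
    (g : W →ₗ[k] A) : mulMap (0 : V →ₗ[k] A) g = 0 := by
  simp [mulMap]

@[simp]
theorem mulMap_zero_right {V W : Type*} [AddCommGroup V] [Module k V] [AddCommGroup W]
    [Module k W] (f : V →ₗ[k] A) : mulMap f (0 : W →ₗ[k] A) = 0 := by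
  simp [mulMap]

/-- F b = f(b ◁ R⁽¹⁾) q(R⁽²⁾) is the shape of R⁻¹bR. By (id ⊗ Δ)R = R₁₃R₁₂, a coproduct on the
second leg lets one copy of R be absorbed in F while the other continues to act. -/
theorem mulMap_ract_conv (hR : IsQuasitriangular k (R : H ⊗[k] H)) {f F : B →ₗ[k] A}
    {q : H →ₗ[k] A} (hF : ∀ b, F b = mulMap (f ∘ₗ ract k H b) q (R : H ⊗[k] H))
    (r : H →ₗ[k] A) (b : B) :
    mulMap (f ∘ₗ ract k H b) (conv q r) (R : H ⊗[k] H) =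
      mulMap (F ∘ₗ ract k H b) r (R : H ⊗[k] H) := by
  have h1 : ∀ (x x' : H) (Y : H ⊗[k] H), mulMap (f ∘ₗ ract k H b) (mulMap q r)
      (leg13 k (x ⊗ₜ[k] x') * leg12 k Y) =
      mulMap (f ∘ₗ ract k H (rAct k H B x b)) q Y * r x' := by
    intro x x' Y
    induction Y with
    | zero => simp
    | add x y hx hy => simp only [map_add, mul_add, add_mul, hx, hy]
    | tmul y y' => simp [leg13, leg12, rAct_mul, mul_assoc]
  have h2 : ∀ X : H ⊗[k] H, mulMap (f ∘ₗ ract k H b) (mulMap q r)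
      (leg13 k X * leg12 k (R : H ⊗[k] H)) = mulMap (F ∘ₗ ract k H b) r X := by
    intro X
    induction X with
    | zero => simp
    | add x y hx hy => simp only [map_add, add_mul, hx, hy]
    | tmul x x' => rw [h1, ← hF]; rfl
  rw [← h2, ← hR.comul_right, mulMap_lTensor]
  rfl

theorem mulMap_lact_conv (hR : IsQuasitriangular k (R : H ⊗[k] H))
    {f F : Module.Dual k B →ₗ[k] A}
    {q : H →ₗ[k] A} (hF : ∀ c, F c = mulMap (f ∘ₗ lact H c) q (R : H ⊗[k] H))
    {r : H →ₗ[k] A} (hr : ∀ x c, Commute (r x) (f c)) (c : Module.Dual k B) :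
    mulMap (f ∘ₗ lact H c) (conv r q) (R : H ⊗[k] H) =
      mulMap r (F ∘ₗ lact H c) (TensorProduct.comm k H H (R : H ⊗[k] H)) := by
  have h1 : ∀ (y y' : H) (X : H ⊗[k] H), mulMap (f ∘ₗ lact H c) (mulMap r q)
      (leg13 k X * leg12 k (y ⊗ₜ[k] y')) =
      r y' * mulMap (f ∘ₗ lact H (lAct k H B y c)) q X := by
    intro y y' X
    induction X with
    | zero => simp
    | add x y hx hy => simp only [map_add, mul_add, add_mul, hx, hy]
    | tmul x x' =>
      simp only [leg13, leg12, LinearMap.lTensor_tmul, LinearMap.flip_apply, mk_apply,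
        Algebra.TensorProduct.tmul_mul_tmul, one_mul, mul_one, mulMap_tmul, LinearMap.comp_apply,
        lAct_mul]
      rw [← mul_assoc, ← (hr y' _).eq, mul_assoc]
  have h2 : ∀ Y : H ⊗[k] H, mulMap (f ∘ₗ lact H c) (mulMap r q)
      (leg13 k (R : H ⊗[k] H) * leg12 k Y) =
      mulMap r (F ∘ₗ lact H c) (TensorProduct.comm k H H Y) := by
    intro X
    induction X with
    | zero => simp
    | add x y hx hy => simp only [map_add, mul_add, hx, hy]
    | tmul x x' => rw [h1, ← hF]; rfl
  rw [← h2, ← hR.comul_right, mulMap_lTensor]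
  rfl

/-- A convolution product of maps which satisfy the exchange relation is multiplicative. -/
theorem conv_map_mul {S : B →ₗ[k] B} (hB : IsBraidedGroup (R : H ⊗[k] H) S) {F f : B →ₗ[k] A}
    (hF : ∀ a b, F (a * b) = F a * F b) (hf : ∀ a b, f (a * b) = f a * f b)
    (h : ∀ b c, f b * F c = mulMap (F ∘ₗ ract k H c) (f ∘ₗ ract k H b) (R : H ⊗[k] H)) (a b : B) :
    conv F f (a * b) = conv F f a * conv F f b := by
  have h1 : ∀ (t t' u u' : B) (X : H ⊗[k] H), mulMap F f (braidedMul X ((t ⊗ₜ t') ⊗ₜ (u ⊗ₜ u'))) =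
      F t * mulMap (F ∘ₗ ract k H u) (f ∘ₗ ract k H t') X * f u' := by
    intro t t' u u' X
    induction X with
    | zero => simp
    | add x y hx hy =>
      simp only [braidedMul_add, LinearMap.add_apply, map_add, mul_add, add_mul, hx, hy]
    | tmul x x' => simp [braidedMul_tmul, hF, hf, mul_assoc]
  rw [conv_apply, hB.comul_mul, conv_apply, conv_apply]
  generalize comul (R := k) a = T
  generalize comul (R := k) b = U
  induction T with
  | zero => simp
  | add x y hx hy => simp only [add_tmul, map_add, add_mul, hx, hy]
  | tmul t t' =>
    induction U with
    | zero => simp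
    | add x y hx hy => simp only [tmul_add, map_add, mul_add, hx, hy]
    | tmul u u' => rw [h1, ← h, mulMap_tmul, mulMap_tmul, mul_assoc, mul_assoc, mul_assoc]

theorem RelRight.conv_map {S : B →ₗ[k] B} (hB : IsBraidedGroup (R : H ⊗[k] H) S)
    {f g : B →ₗ[k] A} {p : H →ₗ[k] A} (hf : RelRight f p) (hg : RelRight g p) :
    RelRight (BraidedDouble.conv f g) p := by
  intro b h
  have h1 : ∀ T : B ⊗[k] B, mulMap f g T * p h = mulMap p
      (mulMap f g ∘ₗ (TensorProduct.map₂ (rAct k H B) (rAct k H B)).flip T ∘ₗ comul)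
      (comul h) := by
    intro T
    induction T with
    | zero => simp
    | add x y hx hy =>
      simp only [map_add, add_mul, hx, hy, LinearMap.add_comp, LinearMap.comp_add,
        mulMap_add_right, LinearMap.add_apply]
    | tmul t t' =>
      have h2 : mulMap f g ∘ₗ (TensorProduct.map₂ (rAct k H B) (rAct k H B)).flip (t ⊗ₜ t') ∘ₗ
          comul = BraidedDouble.conv (f ∘ₗ ract k H t) (g ∘ₗ ract k H t') := by
        ext x
        simp only [LinearMap.comp_apply, LinearMap.flip_apply, conv_apply]
        rw [map₂_apply, mulMap_map]
      rw [h2, ← conv_apply, conv_assoc, mulMap_tmul, mul_assoc, hg, conv_apply]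
      exact mul_mulMap _ _ _ _ (hf t) _
  rw [conv_apply, h1]
  congr 2
  ext x
  simp only [LinearMap.comp_apply, LinearMap.flip_apply, conv_apply, comul_rAct hB]

end Exchange

/-! ### Convolution products of maps out of `C̄` -/

section Bar

variable [FiniteDimensional k B] [Coalgebra k (Module.Dual k B)]

/-- `B` is a braided group over `(H, R)`, and the coalgebra structure on its dual is that
of `C̄`. -/
structure IsBarDual (R : (H ⊗[k] H)ˣ) (S : B ≃ₗ[k] B) : Prop where
  quasitriangular : IsQuasitriangular k (R : H ⊗[k] H)
  group : IsBraidedGroup (R : H ⊗[k] H) S.toLinearMap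
  comul_eq : ∀ c : Module.Dual k B, comul c = barComul R c
  counit_eq : ∀ c : Module.Dual k B, counit (R := k) c = c 1

variable {A : Type*} [Ring A] [Algebra k A] {R : (H ⊗[k] H)ˣ} {S : B ≃ₗ[k] B}

/-- The coproduct of `C̄` is multiplicative for the inverse braiding, so the two convolved maps have
to exchange through R⁻¹ where `conv_map_mul` has R. -/
theorem barConv_map_mul (hD : IsBarDual R S) {g G : Module.Dual k B →ₗ[k] A}
    (hg : ∀ c d, g (dualMul k B c d) = g c * g d) (hG : ∀ c d, G (dualMul k B c d) = G c * G d)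
    (h : ∀ c d, mulMap (g ∘ₗ lact H d) (G ∘ₗ lact H c) (↑R⁻¹ : H ⊗[k] H) = G c * g d)
    (c d : Module.Dual k B) :
    conv g G (dualMul k B c d) = conv g G c * conv g G d := by
  have h1 : ∀ (t t' u u' : Module.Dual k B) (X : H ⊗[k] H),
      mulMap g G (TensorProduct.map (TensorProduct.lift (dualMul k B))
        (TensorProduct.lift (dualMul k B)) (barMidBraid X ((t ⊗ₜ t') ⊗ₜ (u ⊗ₜ u')))) =
      g t * mulMap (g ∘ₗ lact H u) (G ∘ₗ lact H t') X * G u' := by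
    intro t t' u u' X
    induction X with
    | zero => simp [barMidBraid]
    | add x y hx hy =>
      simp only [barMidBraid_add, LinearMap.add_apply, map_add, mul_add, add_mul, hx, hy]
    | tmul x x' => simp [barMidBraid_tmul, hg, hG, mul_assoc]
  rw [conv_apply, hD.comul_eq, barComul_dualMul hD.quasitriangular hD.group, conv_apply,
    conv_apply, ← hD.comul_eq, ← hD.comul_eq]
  generalize comul (R := k) c = T
  generalize comul (R := k) d = U
  induction T with
  | zero => simp
  | add x y hx hy => simp only [add_tmul, map_add, add_mul, hx, hy]
  | tmul t t' =>
    induction U with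
    | zero => simp
    | add x y hx hy => simp only [tmul_add, map_add, mul_add, hx, hy]
    | tmul u u' => rw [h1, h, mulMap_tmul, mulMap_tmul, mul_assoc, mul_assoc, mul_assoc]

theorem RelLeft.conv_map (hD : IsBarDual R S)
    {f g : Module.Dual k B →ₗ[k] A} {p : H →ₗ[k] A} (hf : RelLeft f p) (hg : RelLeft g p) :
    RelLeft (BraidedDouble.conv f g) p := by
  intro h c
  have h1 : ∀ T : Module.Dual k B ⊗[k] Module.Dual k B, p h * mulMap f g T = mulMap
      (mulMap f g ∘ₗ (TensorProduct.map₂ (lAct k H B) (lAct k H B)).flip T ∘ₗ comul) p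
      (comul h) := by
    intro T
    induction T with
    | zero => simp
    | add x y hx hy =>
      simp only [map_add, mul_add, hx, hy, LinearMap.add_comp, LinearMap.comp_add,
        mulMap_add_left, LinearMap.add_apply]
    | tmul t t' =>
      have h2 : mulMap f g ∘ₗ (TensorProduct.map₂ (lAct k H B) (lAct k H B)).flip (t ⊗ₜ t') ∘ₗ
          comul = BraidedDouble.conv (f ∘ₗ lact H t) (g ∘ₗ lact H t') := by
        ext x
        simp only [LinearMap.comp_apply, LinearMap.flip_apply, conv_apply]
        rw [map₂_apply, mulMap_map]
      rw [h2, ← conv_apply, ← conv_assoc, mulMap_tmul, ← mul_assoc, hf, conv_apply]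
      exact mulMap_mul_right _ _ _ _ (fun x => hg x t') _
  rw [conv_apply, h1]
  congr 2
  ext x
  simp only [LinearMap.comp_apply, LinearMap.flip_apply, conv_apply, hD.comul_eq,
    barComul_lAct hD.quasitriangular hD.group]

/-! ### The coproduct of the smash product, in two commuting slots -/

section TwoSlots

variable {W : Type*} [Ring W] [Algebra k W] {jC : Module.Dual k B →ₗ[k] W} {jH : H →ₐ[k] W}
  {jB : B →ₗ[k] W} {φ₁ φ₂ : W →ₐ[k] A}

variable (jH φ₁ φ₂) in
/-- The image of `X ∈ H ⊗ H` under `φ₁ ∘ jH` and `φ₂ ∘ jH`. -/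
def rmat (X : H ⊗[k] H) : A := mulMap (φ₁.comp jH).toLinearMap (φ₂.comp jH).toLinearMap X

variable (jC jH φ₁ φ₂) in
/-- `c ↦ c₍₁₎ R⁻¹ c₍₂₎ R`. -/
def prodC (R : (H ⊗[k] H)ˣ) : Module.Dual k B →ₗ[k] A :=
  conv (φ₁.toLinearMap ∘ₗ jC)
    (conjMap (rmat jH φ₁ φ₂ ↑R⁻¹) (rmat jH φ₁ φ₂ R) (φ₂.toLinearMap ∘ₗ jC))

variable (jB jH φ₁ φ₂) in
/-- `b ↦ R⁻¹ b₍₁₎ R b₍₂₎`. -/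
def prodB (R : (H ⊗[k] H)ˣ) : B →ₗ[k] A :=
  conv (conjMap (rmat jH φ₁ φ₂ ↑R⁻¹) (rmat jH φ₁ φ₂ R) (φ₁.toLinearMap ∘ₗ jB))
    (φ₂.toLinearMap ∘ₗ jB)

theorem rmat_inv_mul (h : ∀ x y, Commute (φ₁ x) (φ₂ y)) :
    rmat jH φ₁ φ₂ ↑R⁻¹ * rmat jH φ₁ φ₂ R = 1 := mulMap_inv_mul (fun _ _ => h _ _) R

theorem rmat_mul_inv (h : ∀ x y, Commute (φ₁ x) (φ₂ y)) :
    rmat jH φ₁ φ₂ R * rmat jH φ₁ φ₂ ↑R⁻¹ = 1 := mulMap_mul_inv (fun _ _ => h _ _) R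

/-- `R⁻¹ b R = ∑ (b ◁ R⁽¹⁾) ⊗ R⁽²⁾` for `b` in the first factor. -/
theorem conj_rmat_B (hR : IsQuasitriangular k (R : H ⊗[k] H))
    (hj : RelRight jB jH.toLinearMap)
    (h : ∀ x y, Commute (φ₁ x) (φ₂ y)) (b : B) :
    conjMap (rmat jH φ₁ φ₂ ↑R⁻¹) (rmat jH φ₁ φ₂ R) (φ₁.toLinearMap ∘ₗ jB) b =
      mulMap ((φ₁.toLinearMap ∘ₗ jB) ∘ₗ ract k H b) (φ₂.comp jH).toLinearMap R := by
  have := RelRight.mul_rmat hR (p := φ₁.comp jH) (q := φ₂.comp jH)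
    (hj.map φ₁) (fun b y => h _ _) b
  rw [conjMap_apply, rmat, rmat, mul_assoc, this, ← mul_assoc,
    mulMap_inv_mul (p := φ₁.comp jH) (q := φ₂.comp jH) (fun _ _ => h _ _) R, one_mul]

/-- `R⁻¹ c R = ∑ R⁻⁽¹⁾ ⊗ R⁻⁽²⁾ ▷ c` for `c` in the second factor. -/
theorem conj_rmat_C (hR : IsQuasitriangular k (R : H ⊗[k] H))
    (hj : RelLeft jC jH.toLinearMap)
    (h : ∀ x y, Commute (φ₁ x) (φ₂ y)) (c : Module.Dual k B) :
    conjMap (rmat jH φ₁ φ₂ ↑R⁻¹) (rmat jH φ₁ φ₂ R) (φ₂.toLinearMap ∘ₗ jC) c =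
      mulMap (φ₁.comp jH).toLinearMap ((φ₂.toLinearMap ∘ₗ jC) ∘ₗ lact H c) (↑R⁻¹ : H ⊗[k] H) := by
  have := RelLeft.rmat_inv_mul hR (p := φ₁.comp jH) (q := φ₂.comp jH)
    (fun _ _ => h _ _) (hj.map φ₂) (fun b y => (h _ _).symm) c
  rw [conjMap_apply, rmat, rmat]
  refine (congrArg (· * _) this).trans ?_
  rw [mul_assoc, mulMap_inv_mul (p := φ₁.comp jH) (q := φ₂.comp jH) (fun _ _ => h _ _) R, mul_one]

/-- `R c R⁻¹ = ∑ (R⁽¹⁾ ▷ c) ⊗ R⁽²⁾` for `c` in the first factor. -/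
theorem conj_rmat_C' (hR : IsQuasitriangular k (R : H ⊗[k] H))
    (hj : RelLeft jC jH.toLinearMap)
    (h : ∀ x y, Commute (φ₁ x) (φ₂ y)) (c : Module.Dual k B) :
    conjMap (rmat jH φ₁ φ₂ R) (rmat jH φ₁ φ₂ ↑R⁻¹) (φ₁.toLinearMap ∘ₗ jC) c =
      mulMap ((φ₁.toLinearMap ∘ₗ jC) ∘ₗ lact H c) (φ₂.comp jH).toLinearMap (R : H ⊗[k] H) := by
  have := RelLeft.rmat_mul hR (p := φ₁.comp jH) (q := φ₂.comp jH)
    (fun _ _ => h _ _) (hj.map φ₁) (fun b y => h _ _) c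
  rw [conjMap_apply, rmat, rmat]
  refine (congrArg (· * _) this).trans ?_
  rw [mul_assoc, mulMap_mul_inv (p := φ₁.comp jH) (q := φ₂.comp jH) (fun _ _ => h _ _) R, mul_one]

/-- `R b R⁻¹ = ∑ R⁻⁽¹⁾ ⊗ (b ◁ R⁻⁽²⁾)` for `b` in the second factor. -/
theorem conj_rmat_B' (hR : IsQuasitriangular k (R : H ⊗[k] H))
    (hj : RelRight jB jH.toLinearMap)
    (h : ∀ x y, Commute (φ₁ x) (φ₂ y)) (b : B) :
    conjMap (rmat jH φ₁ φ₂ R) (rmat jH φ₁ φ₂ ↑R⁻¹) (φ₂.toLinearMap ∘ₗ jB) b =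
      mulMap (φ₁.comp jH).toLinearMap ((φ₂.toLinearMap ∘ₗ jB) ∘ₗ ract k H b)
        (↑R⁻¹ : H ⊗[k] H) := by
  have := RelRight.mul_rmat_inv hR (p := φ₁.comp jH) (q := φ₂.comp jH)
    (fun _ _ => h _ _) (hj.map φ₂) (fun b y => (h _ _).symm) b
  rw [conjMap_apply, rmat, rmat, mul_assoc, this, ← mul_assoc,
    mulMap_mul_inv (p := φ₁.comp jH) (q := φ₂.comp jH) (fun _ _ => h _ _) R, one_mul]

theorem conjMap_mul {D : Type*} [AddCommGroup D] [Module k D] {u v : A} (hvu : v * u = 1)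
    {f : D →ₗ[k] A} {a b ab : D} (h : f ab = f a * f b) :
    conjMap u v f ab = conjMap u v f a * conjMap u v f b := by
  simp only [conjMap_apply, h, mul_assoc]
  rw [← mul_assoc v u, hvu, one_mul]

theorem commute_conjMap {D D' : Type*} [AddCommGroup D] [Module k D] [AddCommGroup D'] [Module k D']
    {u v : A} (hvu : v * u = 1) {f : D →ₗ[k] A} {g : D' →ₗ[k] A} {x : D} {y : D'}
    (h : Commute (f x) (g y)) : Commute (conjMap u v f x) (conjMap u v g y) := by
  simp only [conjMap_apply, commute_iff_eq, mul_assoc]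
  rw [← mul_assoc v u, ← mul_assoc v u, hvu, one_mul, one_mul, ← mul_assoc (f x), h.eq, mul_assoc]

/-- In R⁻¹cR = (c ◁ R⁽¹⁾) ⊗ R⁽²⁾, an element b of the second slot commutes with the first part and
meets only R⁽²⁾. Passing it produces the braiding of b with c, which is what multiplicativity of the
braided coproduct of `B` requires. -/
theorem prodB_mul (hD : IsBarDual R S) (hj : IsSmashTriple jC jH jB)
    (h : ∀ x y, Commute (φ₁ x) (φ₂ y)) (a b : B) :
    prodB jH jB φ₁ φ₂ R (a * b) = prodB jH jB φ₁ φ₂ R a * prodB jH jB φ₁ φ₂ R b := by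
  refine conv_map_mul hD.group (fun a b => conjMap_mul (rmat_mul_inv h) (by simp [hj.map_mul]))
    (fun a b => by simp [hj.map_mul]) (fun b c => ?_) a b
  rw [conj_rmat_B hD.quasitriangular hj.relRight h c, ← mulMap_ract_conv hD.quasitriangular (conj_rmat_B hD.quasitriangular hj.relRight h)]
  exact mul_mulMap_of_commute _ _ _ _ (fun x => (h _ _).symm) (fun x => hj.relRight.map φ₂ b x) _

theorem prodC_mul (hD : IsBarDual R S) (hj : IsSmashTriple jC jH jB)
    (h : ∀ x y, Commute (φ₁ x) (φ₂ y)) (c d : Module.Dual k B) :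
    prodC jC jH φ₁ φ₂ R (dualMul k B c d) = prodC jC jH φ₁ φ₂ R c * prodC jC jH φ₁ φ₂ R d := by
  refine barConv_map_mul hD (fun a b => by simp [hj.map_dualMul])
    (fun a b => conjMap_mul (rmat_mul_inv h) (by simp [hj.map_dualMul])) (fun c d => ?_) c d
  set u := rmat jH φ₁ φ₂ ↑R⁻¹
  set v := rmat jH φ₁ φ₂ R
  have huv : u * v = 1 := rmat_inv_mul h
  have hvu : v * u = 1 := rmat_mul_inv h
  set g₁ := φ₁.toLinearMap ∘ₗ jC with hg₁
  set g₂ := φ₂.toLinearMap ∘ₗ jC with hg₂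
  -- Conjugating by R moves the twist to the first slot, where RcR⁻¹ = (R⁽¹⁾ ▷ c) ⊗ R⁽²⁾ involves R
  -- and not R⁻¹. The exchange relation is proved there with R, inverted, and conjugated back.
  set f := conjMap v u g₁ with hf
  have h1 : ∀ c d, f d * g₂ c = mulMap (g₂ ∘ₗ lact H c) (f ∘ₗ lact H d)
      (TensorProduct.comm k H H (R : H ⊗[k] H)) := by
    intro c d
    rw [← mulMap_lact_conv hD.quasitriangular (conj_rmat_C' hD.quasitriangular hj.relLeft h) (fun x c => (h _ _).symm),
      hf, conj_rmat_C' hD.quasitriangular hj.relLeft h d]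
    exact mulMap_mul_right _ _ _ _ (fun x => hj.relLeft.map φ₂ x c) _
  have h2 : ∀ X : H ⊗[k] H, mulMap (f ∘ₗ lact H d) (g₂ ∘ₗ lact H c) X =
      mulMap (g₂ ∘ₗ lact H c) (f ∘ₗ lact H d) (TensorProduct.comm k H H (R * X)) := by
    intro X
    induction X with
    | zero => simp
    | add x y hx hy => simp only [map_add, mul_add, hx, hy]
    | tmul x x' =>
      rw [mulMap_tmul, LinearMap.comp_apply, LinearMap.comp_apply, h1]
      generalize (R : H ⊗[k] H) = Y
      induction Y with
      | zero => simp
      | add x y hx hy => simp only [map_add, add_mul, hx, hy]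
      | tmul y y' => simp [lAct_mul]
  have h3 : mulMap (f ∘ₗ lact H d) (g₂ ∘ₗ lact H c) (↑R⁻¹ : H ⊗[k] H) = g₂ c * f d := by
    rw [h2, Units.mul_inv, Algebra.TensorProduct.one_def]
    simp
  have h4 : g₁ = conjMap u v f := by
    ext x
    simp only [hf, conjMap_apply]
    simp only [mul_assoc, huv, mul_one]
    rw [← mul_assoc, huv, one_mul]
  have h5 := mulMap_conjMap hvu (f ∘ₗ lact H d) (g₂ ∘ₗ lact H c) (↑R⁻¹ : H ⊗[k] H)
  rw [h4]
  refine h5.trans ?_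
  rw [h3]
  simp only [conjMap_apply, mul_assoc]
  rw [← mul_assoc v u, hvu, one_mul]

variable (jH) in
theorem commute_comp (h : ∀ x y, Commute (φ₁ x) (φ₂ y)) (x y : H) :
    Commute ((φ₁.comp jH) x) ((φ₂.comp jH) y) := h _ _

variable (jH) in
/-- `h ↦ h₍₁₎ ⊗ h₍₂₎`. -/
def prodH (h : ∀ x y, Commute (φ₁ x) (φ₂ y)) : H →ₐ[k] A :=
  convHom (φ₁.comp jH) (φ₂.comp jH) (commute_comp jH h)

/-- The relations with `H` hold because R⁻¹Δᵒᵖ(h)R = Δ(h): before conjugation the conjugated factor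
satisfies them with Δᵒᵖ. For the commutation of c and b there are four pairs of factors: the two
conjugated ones commute before conjugation, the two unconjugated ones lie in different slots, and in
the mixed pairs R is first expanded as an action. -/
theorem isSmashTriple_prod (hD : IsBarDual R S) (hj : IsSmashTriple jC jH jB)
    (h : ∀ x y, Commute (φ₁ x) (φ₂ y)) :
    IsSmashTriple (prodC jC jH φ₁ φ₂ R) (prodH jH h) (prodB jH jB φ₁ φ₂ R) where
  map_dualMul := prodC_mul hD hj h
  map_mul := prodB_mul hD hj h
  map_counit := by
    rw [prodC, conv_apply, hD.comul_eq, barComul_counit hD.quasitriangular hD.group]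
    simp [hj.map_counit, rmat_inv_mul h]
  map_one := by
    rw [prodB, conv_apply, hD.group.comul_one]
    simp [hj.map_one, rmat_inv_mul h]
  relLeft := by
    rw [prodH, convHom_toLinearMap]
    refine RelLeft.conv_map hD ((hj.relLeft.map φ₁).conv fun x y => h _ _) ?_
    refine (RelLeft.conv (r := (φ₁.comp jH).toLinearMap) (hj.relLeft.map φ₂)
      fun x y => (h _ _).symm).conj (rmat_inv_mul h)
      (rmat_mul_inv h) fun x => ?_
    exact conv_mul_mulMap hD.quasitriangular (commute_comp jH h) x
  relRight := by
    rw [prodH, convHom_toLinearMap]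
    refine RelRight.conv_map hD.group ?_ ((hj.relRight.map φ₂).conv fun x y => (h _ _).symm)
    refine (RelRight.conv (r := (φ₂.comp jH).toLinearMap) (hj.relRight.map φ₁)
      fun x y => h _ _).conj (rmat_inv_mul h)
      (rmat_mul_inv h) fun x => ?_
    exact conv_mul_mulMap hD.quasitriangular (commute_comp jH h) x
  comm c b := by
    refine commute_conv (fun v => ?_) (fun v => ?_) b
    · refine (commute_conv (fun w => ?_) (fun w => ?_) c).symm
      · rw [conj_rmat_B hD.quasitriangular hj.relRight h]
        exact (commute_mulMap (fun x => (hj.comm _ _).map φ₁) (fun x => h _ _) _).symm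
      · exact commute_conjMap (rmat_mul_inv h) (h _ _)
    · refine (commute_conv (fun w => ?_) (fun w => ?_) c).symm
      · exact (h _ _).symm
      · rw [conj_rmat_C hD.quasitriangular hj.relLeft h]
        exact commute_mulMap (fun x => (h _ _).symm) (fun x => ((hj.comm _ _).map φ₂).symm) _

end TwoSlots

end Bar

section Conj

variable {A : Type*} [Ring A] [Algebra k A] {D : Type*} [AddCommGroup D] [Module k D]

theorem conjMap_conv [Coalgebra k D] {u v : A} (hvu : v * u = 1) (f g : D →ₗ[k] A) :
    conjMap u v (conv f g) = conv (conjMap u v f) (conjMap u v g) := by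
  ext x
  rw [conv_apply, mulMap_conjMap hvu]
  rfl

theorem conjMap_conjMap (u v u' v' : A) (f : D →ₗ[k] A) :
    conjMap u v (conjMap u' v' f) = conjMap (u * u') (v' * v) f := by
  ext x
  simp only [conjMap_apply, mul_assoc]

theorem conjMap_mul_of_commute {u v a a' : A} (ha : a * a' = 1) {f : D →ₗ[k] A}
    (h : ∀ x, Commute a (f x)) : conjMap (u * a) (a' * v) f = conjMap u v f := by
  ext x
  simp only [conjMap_apply, mul_assoc]
  rw [← mul_assoc a, (h x).eq, mul_assoc, ← mul_assoc a, ha, one_mul]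

@[simp]
theorem conjMap_one_one (f : D →ₗ[k] A) : conjMap 1 1 f = f := by
  ext x
  simp

theorem map_conv [Coalgebra k D] {A' : Type*} [Ring A'] [Algebra k A'] (ψ : A →ₐ[k] A')
    (f g : D →ₗ[k] A) :
    ψ.toLinearMap ∘ₗ conv f g = conv (ψ.toLinearMap ∘ₗ f) (ψ.toLinearMap ∘ₗ g) := by
  ext x
  exact map_mulMap ψ f g (comul x)

theorem map_conjMap {A' : Type*} [Ring A'] [Algebra k A'] (ψ : A →ₐ[k] A') (u v : A)
    (f : D →ₗ[k] A) :
    ψ.toLinearMap ∘ₗ conjMap u v f = conjMap (ψ u) (ψ v) (ψ.toLinearMap ∘ₗ f) := by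
  ext x
  simp

end Conj

section Bar

variable [FiniteDimensional k B] [Coalgebra k (Module.Dual k B)]
  {A : Type*} [Ring A] [Algebra k A] {R : (H ⊗[k] H)ˣ} {S : B ≃ₗ[k] B}
  {W : Type*} [Ring W] [Algebra k W] {jC : Module.Dual k B →ₗ[k] W} {jH : H →ₐ[k] W}
  {jB : B →ₗ[k] W} {φ₁ φ₂ φ₃ δ₁₂ δ₂₃ : W →ₐ[k] A}

theorem map_rmat {A' : Type*} [Ring A'] [Algebra k A'] (ψ : A →ₐ[k] A') (X : H ⊗[k] H) :
    ψ (rmat jH φ₁ φ₂ X) = rmat jH (ψ.comp φ₁) (ψ.comp φ₂) X :=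
  map_mulMap ψ _ _ X

theorem map_prodC {A' : Type*} [Ring A'] [Algebra k A'] (ψ : A →ₐ[k] A') :
    ψ.toLinearMap ∘ₗ prodC jC jH φ₁ φ₂ R = prodC jC jH (ψ.comp φ₁) (ψ.comp φ₂) R := by
  rw [prodC, map_conv, map_conjMap, map_rmat, map_rmat]
  rfl

theorem map_prodB {A' : Type*} [Ring A'] [Algebra k A'] (ψ : A →ₐ[k] A') :
    ψ.toLinearMap ∘ₗ prodB jH jB φ₁ φ₂ R = prodB jH jB (ψ.comp φ₁) (ψ.comp φ₂) R := by
  rw [prodB, map_conv, map_conjMap, map_rmat, map_rmat]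
  rfl

/-! ### Coassociativity, in three commuting slots -/

section ThreeSlots

variable (hR : IsQuasitriangular k (R : H ⊗[k] H))
  (h₁₂ : ∀ x y, Commute (φ₁ x) (φ₂ y)) (h₁₃ : ∀ x y, Commute (φ₁ x) (φ₃ y))
  (h₂₃ : ∀ x y, Commute (φ₂ x) (φ₃ y))
  (h₁₂H : (δ₁₂.comp jH).toLinearMap = conv (φ₁.comp jH).toLinearMap (φ₂.comp jH).toLinearMap)
  (h₂₃H : (δ₂₃.comp jH).toLinearMap = conv (φ₂.comp jH).toLinearMap (φ₃.comp jH).toLinearMap)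

include hR

theorem rmat_left (h₂₃ : ∀ x y, Commute (φ₂ x) (φ₃ y))
    (h₁₂H : (δ₁₂.comp jH).toLinearMap = conv (φ₁.comp jH).toLinearMap (φ₂.comp jH).toLinearMap) :
    rmat jH δ₁₂ φ₃ (R : H ⊗[k] H) = rmat jH φ₁ φ₃ R * rmat jH φ₂ φ₃ R := by
  rw [rmat, h₁₂H, mulMap_conv_left hR _ _ _ fun x y => h₂₃ _ _]
  rfl

theorem rmat_left_inv (h₁₂ : ∀ x y, Commute (φ₁ x) (φ₂ y)) (h₁₃ : ∀ x y, Commute (φ₁ x) (φ₃ y))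
    (h₁₂H : (δ₁₂.comp jH).toLinearMap = conv (φ₁.comp jH).toLinearMap (φ₂.comp jH).toLinearMap) :
    rmat jH δ₁₂ φ₃ (↑R⁻¹ : H ⊗[k] H) = rmat jH φ₂ φ₃ ↑R⁻¹ * rmat jH φ₁ φ₃ ↑R⁻¹ := by
  rw [rmat, h₁₂H, mulMap_conv_left_inv hR _ _ _ (fun x y => h₁₂ _ _) fun x y => h₁₃ _ _]
  rfl

theorem rmat_right (h₁₃ : ∀ x y, Commute (φ₁ x) (φ₃ y)) (h₂₃ : ∀ x y, Commute (φ₂ x) (φ₃ y))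
    (h₂₃H : (δ₂₃.comp jH).toLinearMap = conv (φ₂.comp jH).toLinearMap (φ₃.comp jH).toLinearMap) :
    rmat jH φ₁ δ₂₃ (R : H ⊗[k] H) = rmat jH φ₁ φ₃ R * rmat jH φ₁ φ₂ R := by
  rw [rmat, h₂₃H, mulMap_conv_right hR _ _ _ (fun x y => h₁₃ _ _) fun x y => h₂₃ _ _]
  rfl

theorem rmat_right_inv (h₁₂ : ∀ x y, Commute (φ₁ x) (φ₂ y))
    (h₂₃H : (δ₂₃.comp jH).toLinearMap = conv (φ₂.comp jH).toLinearMap (φ₃.comp jH).toLinearMap) :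
    rmat jH φ₁ δ₂₃ (↑R⁻¹ : H ⊗[k] H) = rmat jH φ₁ φ₂ ↑R⁻¹ * rmat jH φ₁ φ₃ ↑R⁻¹ := by
  rw [rmat, h₂₃H, mulMap_conv_right_inv hR _ _ _ (fun x y => h₁₂ _ _)]
  rfl

include h₁₂ h₁₃ h₂₃

theorem rmat_yangBaxter :
    rmat jH φ₁ φ₂ R * rmat jH φ₁ φ₃ R * rmat jH φ₂ φ₃ R =
      rmat jH φ₂ φ₃ R * rmat jH φ₁ φ₃ R * rmat jH φ₁ φ₂ (R : H ⊗[k] H) :=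
  yangBaxter hR (fun _ _ => h₁₂ _ _) (fun _ _ => h₁₃ _ _) (fun _ _ => h₂₃ _ _)

theorem rmat_yangBaxter_inv :
    rmat jH φ₁ φ₂ ↑R⁻¹ * rmat jH φ₁ φ₃ ↑R⁻¹ * rmat jH φ₂ φ₃ ↑R⁻¹ =
      rmat jH φ₂ φ₃ ↑R⁻¹ * rmat jH φ₁ φ₃ ↑R⁻¹ * rmat jH φ₁ φ₂ (↑R⁻¹ : H ⊗[k] H) :=
  yangBaxter_inv hR (fun _ _ => h₁₂ _ _) (fun _ _ => h₁₃ _ _) (fun _ _ => h₂₃ _ _)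

include h₁₂H h₂₃H

/-- Both sides are products of conjugates of b₁, b₂, b₃. On b₁ the conjugators agree by the
Yang-Baxter equation once R₂₃, which commutes with the first slot, is dropped; on b₂ the conjugation
by R₁₃ is trivial. -/
theorem prodB_assoc (h₁₂B : δ₁₂.toLinearMap ∘ₗ jB = prodB jH jB φ₁ φ₂ R)
    (h₂₃B : δ₂₃.toLinearMap ∘ₗ jB = prodB jH jB φ₂ φ₃ R) (h : ∀ x y, Commute (δ₁₂ x) (φ₃ y)) :
    prodB jH jB δ₁₂ φ₃ R = prodB jH jB φ₁ δ₂₃ R := by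
  rw [prodB, prodB, h₁₂B, h₂₃B, prodB, prodB, conjMap_conv (rmat_mul_inv h), conv_assoc,
    conjMap_conjMap, rmat_left hR h₂₃ h₁₂H, rmat_left_inv hR h₁₂ h₁₃ h₁₂H,
    rmat_right hR h₁₃ h₂₃ h₂₃H, rmat_right_inv hR h₁₂ h₂₃H]
  congr 2
  · rw [← rmat_yangBaxter_inv hR h₁₂ h₁₃ h₂₃, ← mul_assoc, rmat_yangBaxter hR h₁₂ h₁₃ h₂₃,
      mul_assoc (rmat jH φ₂ φ₃ _), conjMap_mul_of_commute (rmat_inv_mul h₂₃)]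
    exact fun x => (commute_mulMap (fun v => h₁₂ _ _) (fun v => h₁₃ _ _) _).symm
  · rw [conjMap_mul_of_commute (rmat_inv_mul h₁₃)]
    exact fun x => (commute_mulMap (fun v => (h₁₂ _ _).symm) (fun v => h₂₃ _ _) _).symm

theorem prodC_assoc (h₁₂C : δ₁₂.toLinearMap ∘ₗ jC = prodC jC jH φ₁ φ₂ R)
    (h₂₃C : δ₂₃.toLinearMap ∘ₗ jC = prodC jC jH φ₂ φ₃ R) (h : ∀ x y, Commute (φ₁ x) (δ₂₃ y)) :
    prodC jC jH δ₁₂ φ₃ R = prodC jC jH φ₁ δ₂₃ R := by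
  rw [prodC, prodC, h₁₂C, h₂₃C, prodC, prodC, conjMap_conv (rmat_mul_inv h), conv_assoc,
    conjMap_conjMap, rmat_left hR h₂₃ h₁₂H, rmat_left_inv hR h₁₂ h₁₃ h₁₂H,
    rmat_right hR h₁₃ h₂₃ h₂₃H, rmat_right_inv hR h₁₂ h₂₃H]
  congr 1
  · congr 1
    rw [conjMap_mul_of_commute (rmat_inv_mul h₁₃)]
    exact fun x => commute_mulMap (fun v => (h₁₂ _ _).symm) (fun v => h₂₃ _ _) _ |>.symm
  · rw [rmat_yangBaxter_inv hR h₁₂ h₁₃ h₂₃, ← mul_assoc (rmat jH φ₂ φ₃ _) (rmat jH φ₁ φ₃ _),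
      ← rmat_yangBaxter hR h₁₂ h₁₃ h₂₃, mul_assoc (rmat jH φ₁ φ₂ _),
      conjMap_mul_of_commute (rmat_inv_mul h₁₂)]
    exact fun x => (commute_mulMap (fun v => (h₁₃ _ _).symm) (fun v => (h₂₃ _ _).symm) _).symm

end ThreeSlots

/-! ### The counit -/

section Counit

/-- `e` is the counit followed by the unit. -/
theorem rmat_counit_left {X : H ⊗[k] H}
    (hX : Normalized X) (he : ∀ h, φ₁ (jH h) = algebraMap k A (counit h)) :
    rmat jH φ₁ φ₂ X = 1 := by
  rw [rmat, hX.apply_left]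
  · simp
  · intro x y
    simp [he, Algebra.algebraMap_eq_smul_one]

theorem rmat_counit_right {X : H ⊗[k] H}
    (hX : Normalized X) (he : ∀ h, φ₂ (jH h) = algebraMap k A (counit h)) :
    rmat jH φ₁ φ₂ X = 1 := by
  rw [rmat, hX.apply_right]
  · simp
  · intro x y
    simp [he, Algebra.algebraMap_eq_smul_one]

theorem conv_counit_left {D : Type*} [AddCommGroup D] [Module k D] [Coalgebra k D]
    {f g : D →ₗ[k] A} (hf : ∀ x, f x = algebraMap k A (counit x)) : conv f g = g := by
  ext x
  have h : ∀ T : D ⊗[k] D, mulMap f g T = g (TensorProduct.lid k D (LinearMap.rTensor D counit T)) := by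
    intro T
    induction T with
    | zero => simp
    | add x y hx hy => simp only [map_add, hx, hy]
    | tmul x y => simp [hf, Algebra.smul_def]
  rw [conv_apply, h]
  simp

theorem conv_counit_right {D : Type*} [AddCommGroup D] [Module k D] [Coalgebra k D]
    {f g : D →ₗ[k] A} (hg : ∀ x, g x = algebraMap k A (counit x)) : conv f g = f := by
  ext x
  have h : ∀ T : D ⊗[k] D, mulMap f g T = f (TensorProduct.rid k D (LinearMap.lTensor D counit T)) := by
    intro T
    induction T with
    | zero => simp
    | add x y hx hy => simp only [map_add, hx, hy]
    | tmul x y => simp [hg, Algebra.smul_def, Algebra.commutes]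
  rw [conv_apply, h]
  simp

theorem isSmashTriple_counit (hB : IsBraidedGroup (R : H ⊗[k] H) S.toLinearMap) :
    IsSmashTriple (Module.Dual.eval k B 1) (Bialgebra.counitAlgHom k H)
      (counit (R := k) (A := B)) where
  map_dualMul c d := dualMul_apply_one hB c d
  map_counit := hB.counit_one
  map_mul := hB.counit_mul
  map_one := hB.counit_one
  relLeft h c := by
    have : ∀ X : H ⊗[k] H, mulMap (Module.Dual.eval k B 1 ∘ₗ lact H c)
        (Bialgebra.counitAlgHom k H).toLinearMap X =
        counit (R := k) (TensorProduct.lid k H (LinearMap.rTensor H counit X)) * c 1 := by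
      intro X
      induction X with
      | zero => simp
      | add x y hx hy => simp only [map_add, add_mul, hx, hy]
      | tmul x y => simp [lAct_apply_one hB]; ring
    rw [this]
    simp
  relRight b h := by
    have : ∀ X : H ⊗[k] H, mulMap (Bialgebra.counitAlgHom k H).toLinearMap
        (counit (R := k) (A := B) ∘ₗ ract k H b) X =
        counit (R := k) b * counit (R := k)
          (TensorProduct.lid k H (LinearMap.rTensor H counit X)) := by
      intro X
      induction X with
      | zero => simp
      | add x y hx hy => simp only [map_add, mul_add, hx, hy]
      | tmul x y => simp [counit_rAct hB]; ring
    rw [this]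
    simp
  comm _ _ := Commute.all _ _

end Counit

variable (k W) in
/-- The inclusion of the left factor. -/
def inl : W →ₐ[k] W ⊗[k] W := Algebra.TensorProduct.includeLeft

variable (k W) in
/-- The inclusion of the right factor. -/
def inr : W →ₐ[k] W ⊗[k] W := Algebra.TensorProduct.includeRight

theorem inl_apply (x : W) : inl k W x = x ⊗ₜ 1 := rfl
theorem inr_apply (x : W) : inr k W x = 1 ⊗ₜ x := rfl

theorem commute_inl_inr (x y : W) : Commute (inl k W x) (inr k W y) := by
  simp [commute_iff_eq, inl_apply, inr_apply]

/-! ### Passage from slots to the coalgebra structure on the smash product -/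

namespace IsSmash

variable (hg : IsSmash jC jH jB) (hD : IsBarDual R S)

include hg in
theorem isSmashTriple_inl_inr (hD : IsBarDual R S) :
    IsSmashTriple (prodC jC jH (inl k W) (inr k W) R) (prodH jH commute_inl_inr)
      (prodB jH jB (inl k W) (inr k W) R) :=
  isSmashTriple_prod hD hg.toIsSmashTriple commute_inl_inr

/-- The coproduct of the two-sided smash product. -/
def comulHom : W →ₐ[k] W ⊗[k] W := hg.lift (hg.isSmashTriple_inl_inr hD)

/-- The counit of the two-sided smash product. -/
def counitHom : W →ₐ[k] k := hg.lift (isSmashTriple_counit hD.group)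

theorem comulHom_C : (hg.comulHom hD).toLinearMap ∘ₗ jC = prodC jC jH (inl k W) (inr k W) R :=
  LinearMap.ext (hg.lift_C (hg.isSmashTriple_inl_inr hD))

theorem comulHom_B : (hg.comulHom hD).toLinearMap ∘ₗ jB = prodB jH jB (inl k W) (inr k W) R :=
  LinearMap.ext (hg.lift_B (hg.isSmashTriple_inl_inr hD))

theorem comulHom_H : (hg.comulHom hD).toLinearMap ∘ₗ jH.toLinearMap =
    conv ((inl k W).comp jH).toLinearMap ((inr k W).comp jH).toLinearMap := by
  rw [← convHom_toLinearMap _ _ (commute_comp jH commute_inl_inr)]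
  exact LinearMap.ext (hg.lift_H (hg.isSmashTriple_inl_inr hD))

theorem counitHom_C (c : Module.Dual k B) : hg.counitHom hD (jC c) = c 1 := hg.lift_C _ c

theorem counitHom_B (b : B) : hg.counitHom hD (jB b) = counit b := hg.lift_B _ b

theorem counitHom_H (h : H) : hg.counitHom hD (jH h) = counit h :=
  hg.lift_H (isSmashTriple_counit hD.group) h

/-- Both iterates are algebra maps and are compared on generators. There each is the coproduct
formula with one slot replaced by a coproduct, the situation of `prodB_assoc` and `prodC_assoc`. -/
theorem comulHom_coassoc :
    (Algebra.TensorProduct.assoc k k k W W W).toAlgHom.comp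
      ((Algebra.TensorProduct.map (hg.comulHom hD) (.id k W)).comp (hg.comulHom hD)) =
    (Algebra.TensorProduct.map (.id k W) (hg.comulHom hD)).comp (hg.comulHom hD) := by
  let φ₁ := ι₁ k W
  let φ₂ := ι₂ k W
  let φ₃ := ι₃ k W
  let Φ : W ⊗[k] W →ₐ[k] W ⊗[k] (W ⊗[k] W) := (Algebra.TensorProduct.assoc k k k W W W).toAlgHom.comp
    (Algebra.TensorProduct.map (hg.comulHom hD) (.id k W))
  let Ψ : W ⊗[k] W →ₐ[k] W ⊗[k] (W ⊗[k] W) :=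
    Algebra.TensorProduct.map (.id k W) (hg.comulHom hD)
  let θ₁₂ : W ⊗[k] W →ₐ[k] W ⊗[k] (W ⊗[k] W) :=
    Algebra.TensorProduct.map (.id k W) (inl k W)
  let θ₂₃ : W ⊗[k] W →ₐ[k] W ⊗[k] (W ⊗[k] W) := Algebra.TensorProduct.includeRight
  have hΦ₁ : Φ.comp (inl k W) = θ₁₂.comp (hg.comulHom hD) := by
    ext x
    have : ∀ T : W ⊗[k] W, Algebra.TensorProduct.assoc k k k W W W (T ⊗ₜ 1) = θ₁₂ T := by
      intro T
      induction T with
      | zero => simp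
      | add x y hx hy => simp only [map_add, add_tmul, hx, hy]
      | tmul x y => rfl
    simp only [Φ, AlgHom.comp_apply, inl_apply, Algebra.TensorProduct.map_tmul, map_one]
    exact this _
  have hΦ₂ : Φ.comp (inr k W) = φ₃ := by
    ext x
    simp only [Φ, AlgHom.comp_apply, inr_apply, Algebra.TensorProduct.map_tmul, map_one]
    rfl
  have hΨ₁ : Ψ.comp (inl k W) = φ₁ := by
    ext x
    simp only [Ψ, AlgHom.comp_apply, inl_apply, Algebra.TensorProduct.map_tmul, map_one]
    rfl
  have hΨ₂ : Ψ.comp (inr k W) = θ₂₃.comp (hg.comulHom hD) := by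
    ext x
    simp only [Ψ, AlgHom.comp_apply, inr_apply, Algebra.TensorProduct.map_tmul, map_one]
    rfl
  have e1 : θ₁₂.comp (inl k W) = φ₁ := by
    ext x
    simp only [θ₁₂, AlgHom.comp_apply, inl_apply, Algebra.TensorProduct.map_tmul, map_one]
    rfl
  have e2 : θ₁₂.comp (inr k W) = φ₂ := by
    ext x
    simp only [θ₁₂, AlgHom.comp_apply, inr_apply, Algebra.TensorProduct.map_tmul, map_one]
    rfl
  have e3 : θ₂₃.comp (inl k W) = φ₂ := rfl
  have e4 : θ₂₃.comp (inr k W) = φ₃ := rfl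
  have hH₁₂ : ((θ₁₂.comp (hg.comulHom hD)).comp jH).toLinearMap =
      conv (φ₁.comp jH).toLinearMap (φ₂.comp jH).toLinearMap := by
    have := congrArg (θ₁₂.toLinearMap ∘ₗ ·) (hg.comulHom_H hD)
    simp only [map_conv] at this
    rw [← e1, ← e2]
    exact this
  have hH₂₃ : ((θ₂₃.comp (hg.comulHom hD)).comp jH).toLinearMap =
      conv (φ₂.comp jH).toLinearMap (φ₃.comp jH).toLinearMap := by
    have := congrArg (θ₂₃.toLinearMap ∘ₗ ·) (hg.comulHom_H hD)
    simp only [map_conv] at this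
    exact this
  have h₁₃ : ∀ x y, Commute (φ₁ x) (φ₃ y) := commute_ι₁_ι₃
  have h₂₃ : ∀ x y, Commute (φ₂ x) (φ₃ y) := commute_ι₂_ι₃
  have hR := hD.quasitriangular
  refine hg.algHom_ext (fun c => ?_) (fun x => ?_) (fun b => ?_)
  · have h1 := map_prodC (jC := jC) (jH := jH) (φ₁ := inl k W) (φ₂ := inr k W) (R := R) Φ
    have h2 := map_prodC (jC := jC) (jH := jH) (φ₁ := inl k W) (φ₂ := inr k W) (R := R) Ψ
    have h3 := map_prodC (jC := jC) (jH := jH) (φ₁ := inl k W) (φ₂ := inr k W) (R := R) θ₁₂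
    have h4 := map_prodC (jC := jC) (jH := jH) (φ₁ := inl k W) (φ₂ := inr k W) (R := R) θ₂₃
    rw [← hg.comulHom_C hD] at h1 h2 h3 h4
    rw [hΦ₁, hΦ₂] at h1
    rw [e1, e2] at h3
    rw [hΨ₁, hΨ₂, ← prodC_assoc hR commute_ι₁_ι₂ h₁₃ h₂₃ hH₁₂ hH₂₃ h3 h4,
      ← h1] at h2
    · exact (LinearMap.congr_fun h2 c).symm
    · intro x y
      simp only [ι₁_apply, θ₂₃, commute_iff_eq, AlgHom.comp_apply,
        Algebra.TensorProduct.includeRight_apply, Algebra.TensorProduct.tmul_mul_tmul,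
        ← Algebra.TensorProduct.one_def, one_mul, mul_one]
  · have h1 := congrArg (Φ.toLinearMap ∘ₗ ·) (hg.comulHom_H hD)
    have h2 := congrArg (Ψ.toLinearMap ∘ₗ ·) (hg.comulHom_H hD)
    simp only [map_conv] at h1 h2
    have h3 : Φ.toLinearMap ∘ₗ ((inl k W).comp jH).toLinearMap =
        conv (φ₁.comp jH).toLinearMap (φ₂.comp jH).toLinearMap := by
      rw [← hH₁₂, ← hΦ₁]; rfl
    have h4 : Ψ.toLinearMap ∘ₗ ((inr k W).comp jH).toLinearMap =
        conv (φ₂.comp jH).toLinearMap (φ₃.comp jH).toLinearMap := by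
      rw [← hH₂₃, ← hΨ₂]; rfl
    have h5 : Φ.toLinearMap ∘ₗ ((inr k W).comp jH).toLinearMap = (φ₃.comp jH).toLinearMap := by
      rw [← hΦ₂]; rfl
    have h6 : Ψ.toLinearMap ∘ₗ ((inl k W).comp jH).toLinearMap = (φ₁.comp jH).toLinearMap := by
      rw [← hΨ₁]; rfl
    rw [h3, h5] at h1
    rw [h4, h6, conv_assoc, ← h1] at h2
    exact (LinearMap.congr_fun h2 x).symm
  · have h1 := map_prodB (jB := jB) (jH := jH) (φ₁ := inl k W) (φ₂ := inr k W) (R := R) Φ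
    have h2 := map_prodB (jB := jB) (jH := jH) (φ₁ := inl k W) (φ₂ := inr k W) (R := R) Ψ
    have h3 := map_prodB (jB := jB) (jH := jH) (φ₁ := inl k W) (φ₂ := inr k W) (R := R) θ₁₂
    have h4 := map_prodB (jB := jB) (jH := jH) (φ₁ := inl k W) (φ₂ := inr k W) (R := R) θ₂₃
    rw [← hg.comulHom_B hD] at h1 h2 h3 h4
    rw [hΦ₁, hΦ₂] at h1
    rw [e1, e2] at h3
    rw [hΨ₁, hΨ₂, ← prodB_assoc hR commute_ι₁_ι₂ h₁₃ h₂₃ hH₁₂ hH₂₃ h3 h4,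
      ← h1] at h2
    · exact (LinearMap.congr_fun h2 b).symm
    · intro x y
      have : ∀ T : W ⊗[k] W, Commute (θ₁₂ T) (φ₃ y) := by
        intro T
        induction T with
        | zero => simp
        | add x y hx hy => rw [map_add]; exact hx.add_left hy
        | tmul x y => simp [φ₃, ι₃_apply, θ₁₂, commute_iff_eq, inl_apply]
      exact this _

theorem counit_comulHom_left (x : W) :
    (Algebra.TensorProduct.map (hg.counitHom hD) (.id k W)) (hg.comulHom hD x) = 1 ⊗ₜ x := by
  let Φ : W ⊗[k] W →ₐ[k] W := (Algebra.TensorProduct.lid k W).toAlgHom.comp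
    (Algebra.TensorProduct.map (hg.counitHom hD) (.id k W))
  have h1 : ∀ x, Φ (inl k W x) = algebraMap k W (hg.counitHom hD x) := fun x => by
    simp [Φ, inl_apply, Algebra.algebraMap_eq_smul_one]
  have h2 : Φ.comp (inr k W) = .id k W := by
    ext x
    simp [Φ, inr_apply]
  have hH : ∀ h, (Φ.comp (inl k W)) (jH h) = algebraMap k W (counit h) := fun h => by
    rw [AlgHom.comp_apply, h1, counitHom_H]
  have hR := hD.quasitriangular
  suffices h : Φ.comp (hg.comulHom hD) = .id k W by
    apply (Algebra.TensorProduct.lid k W).injective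
    rw [Algebra.TensorProduct.lid_tmul, one_smul]
    exact DFunLike.congr_fun h x
  refine hg.algHom_ext (fun c => ?_) (fun x => ?_) (fun b => ?_)
  · have := map_prodC (jC := jC) (jH := jH) (φ₁ := inl k W) (φ₂ := inr k W) (R := R) Φ
    rw [← hg.comulHom_C hD, h2, prodC, rmat_counit_left (normalized_rmat_inv hR) hH,
      rmat_counit_left (normalized_rmat hR) hH, conjMap_one_one, conv_counit_left] at this
    · exact LinearMap.congr_fun this c
    · intro c
      change Φ (inl k W (jC c)) = _
      rw [h1, counitHom_C, hD.counit_eq]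
  · have := congrArg (Φ.toLinearMap ∘ₗ ·) (hg.comulHom_H hD)
    simp only [map_conv] at this
    rw [conv_counit_left] at this
    · have h3 := LinearMap.congr_fun this x
      exact h3.trans (DFunLike.congr_fun h2 (jH x))
    · exact hH
  · have := map_prodB (jB := jB) (jH := jH) (φ₁ := inl k W) (φ₂ := inr k W) (R := R) Φ
    rw [← hg.comulHom_B hD, h2, prodB, rmat_counit_left (normalized_rmat_inv hR) hH,
      rmat_counit_left (normalized_rmat hR) hH, conjMap_one_one, conv_counit_left] at this
    · exact LinearMap.congr_fun this b
    · intro c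
      change Φ (inl k W (jB c)) = _
      rw [h1, counitHom_B]

theorem counit_comulHom_right (x : W) :
    (Algebra.TensorProduct.map (.id k W) (hg.counitHom hD)) (hg.comulHom hD x) = x ⊗ₜ 1 := by
  let Φ : W ⊗[k] W →ₐ[k] W := (Algebra.TensorProduct.rid k k W).toAlgHom.comp
    (Algebra.TensorProduct.map (.id k W) (hg.counitHom hD))
  have h1 : ∀ x, Φ (inr k W x) = algebraMap k W (hg.counitHom hD x) := fun x => by
    simp [Φ, inr_apply, Algebra.algebraMap_eq_smul_one]
  have h2 : Φ.comp (inl k W) = .id k W := by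
    ext x
    simp [Φ, inl_apply]
  have hH : ∀ h, (Φ.comp (inr k W)) (jH h) = algebraMap k W (counit h) := fun h => by
    rw [AlgHom.comp_apply, h1, counitHom_H]
  have hR := hD.quasitriangular
  suffices h : Φ.comp (hg.comulHom hD) = .id k W by
    apply (Algebra.TensorProduct.rid k k W).injective
    rw [Algebra.TensorProduct.rid_tmul, one_smul]
    exact DFunLike.congr_fun h x
  refine hg.algHom_ext (fun c => ?_) (fun x => ?_) (fun b => ?_)
  · have := map_prodC (jC := jC) (jH := jH) (φ₁ := inl k W) (φ₂ := inr k W) (R := R) Φ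
    rw [← hg.comulHom_C hD, h2, prodC, rmat_counit_right (normalized_rmat_inv hR) hH,
      rmat_counit_right (normalized_rmat hR) hH, conjMap_one_one, conv_counit_right] at this
    · exact LinearMap.congr_fun this c
    · intro c
      change Φ (inr k W (jC c)) = _
      rw [h1, counitHom_C, hD.counit_eq]
  · have := congrArg (Φ.toLinearMap ∘ₗ ·) (hg.comulHom_H hD)
    simp only [map_conv] at this
    rw [conv_counit_right] at this
    · have h3 := LinearMap.congr_fun this x
      exact h3.trans (DFunLike.congr_fun h2 (jH x))
    · exact hH
  · have := map_prodB (jB := jB) (jH := jH) (φ₁ := inl k W) (φ₂ := inr k W) (R := R) Φ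
    rw [← hg.comulHom_B hD, h2, prodB, rmat_counit_right (normalized_rmat_inv hR) hH,
      rmat_counit_right (normalized_rmat hR) hH, conjMap_one_one, conv_counit_right] at this
    · exact LinearMap.congr_fun this b
    · intro c
      change Φ (inr k W (jB c)) = _
      rw [h1, counitHom_B]

/-- The bialgebra structure of the two-sided smash product. -/
@[reducible]
def bialgebra : Bialgebra k W :=
  Bialgebra.ofAlgHom (hg.comulHom hD) (hg.counitHom hD) (hg.comulHom_coassoc hD)
    (AlgHom.ext (hg.counit_comulHom_left hD)) (AlgHom.ext (hg.counit_comulHom_right hD))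

end IsSmash

end Bar

/-! ### Twisting the product of a bialgebra by a two-cocycle -/

section CoalgebraActions

variable {D : Type*} [AddCommGroup D] [Module k D] [Coalgebra k D]
  {E : Type*} [AddCommGroup E] [Module k E] [Coalgebra k E]

/-- `x ↦ α(x₍₁₎) x₍₂₎`. -/
def leftAct (α : D →ₗ[k] k) : D →ₗ[k] D :=
  (TensorProduct.lid k D).toLinearMap ∘ₗ LinearMap.rTensor D α ∘ₗ comul

/-- `x ↦ x₍₁₎ α(x₍₂₎)`. -/
def rightAct (α : D →ₗ[k] k) : D →ₗ[k] D :=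
  (TensorProduct.rid k D).toLinearMap ∘ₗ LinearMap.lTensor D α ∘ₗ comul

theorem leftAct_apply (α : D →ₗ[k] k) (x : D) :
    leftAct α x = TensorProduct.lid k D (LinearMap.rTensor D α (comul x)) := rfl

theorem rightAct_apply (α : D →ₗ[k] k) (x : D) :
    rightAct α x = TensorProduct.rid k D (LinearMap.lTensor D α (comul x)) := rfl

theorem apply_leftAct (α β : D →ₗ[k] k) (x : D) : β (leftAct α x) = conv α β x := by
  rw [leftAct_apply, conv_apply]
  generalize comul (R := k) x = T
  induction T with
  | zero => simp
  | add x y hx hy => simp only [map_add, hx, hy]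
  | tmul x y => simp

theorem apply_rightAct (α β : D →ₗ[k] k) (x : D) : α (rightAct β x) = conv α β x := by
  rw [rightAct_apply, conv_apply]
  generalize comul (R := k) x = T
  induction T with
  | zero => simp
  | add x y hx hy => simp only [map_add, hx, hy]
  | tmul x y => simp [mul_comm]

theorem comp_leftAct (α β : D →ₗ[k] k) : β ∘ₗ leftAct α = conv α β :=
  LinearMap.ext (apply_leftAct α β)

theorem comp_rightAct (α β : D →ₗ[k] k) : α ∘ₗ rightAct β = conv α β :=
  LinearMap.ext (apply_rightAct α β)

-- Functionals separate vectors, and a functional composed with `leftAct` or `rightAct` is a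
-- convolution product. Identities between these operators thereby reduce to associativity in the
-- convolution algebra D*.
omit [Coalgebra k D] in
theorem ext_functional {M : Type*} [AddCommGroup M] [Module k M] {f g : M →ₗ[k] D}
    (h : ∀ φ : D →ₗ[k] k, φ ∘ₗ f = φ ∘ₗ g) : f = g := by
  ext x
  rw [← sub_eq_zero, ← Module.forall_dual_apply_eq_zero_iff k]
  intro φ
  rw [map_sub, sub_eq_zero]
  exact LinearMap.congr_fun (h φ) x

theorem counit_conv (α : D →ₗ[k] k) : conv counit α = α :=
  conv_counit_left fun _ => rfl

theorem conv_counit (α : D →ₗ[k] k) : conv α counit = α :=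
  conv_counit_right fun _ => rfl

theorem leftAct_counit : leftAct (counit : D →ₗ[k] k) = LinearMap.id :=
  ext_functional fun φ => by rw [comp_leftAct, counit_conv, LinearMap.comp_id]

theorem rightAct_counit : rightAct (counit : D →ₗ[k] k) = LinearMap.id :=
  ext_functional fun φ => by rw [comp_rightAct, conv_counit, LinearMap.comp_id]

theorem leftAct_comp_leftAct (α β : D →ₗ[k] k) :
    leftAct β ∘ₗ leftAct α = leftAct (conv α β) :=
  ext_functional fun φ => by
    rw [← LinearMap.comp_assoc, comp_leftAct, comp_leftAct, comp_leftAct, conv_assoc]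

theorem rightAct_comp_rightAct (α β : D →ₗ[k] k) :
    rightAct α ∘ₗ rightAct β = rightAct (conv α β) :=
  ext_functional fun φ => by
    rw [← LinearMap.comp_assoc, comp_rightAct, comp_rightAct, comp_rightAct, conv_assoc]

theorem leftAct_comp_rightAct (α β : D →ₗ[k] k) :
    leftAct α ∘ₗ rightAct β = rightAct β ∘ₗ leftAct α :=
  ext_functional fun φ => by
    rw [← LinearMap.comp_assoc, ← LinearMap.comp_assoc, comp_rightAct, comp_leftAct, comp_leftAct,
      comp_rightAct, conv_assoc]

theorem conv_comp (f : D →ₗc[k] E) (α β : E →ₗ[k] k) :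
    conv α β ∘ₗ f.toLinearMap = conv (α ∘ₗ f.toLinearMap) (β ∘ₗ f.toLinearMap) := by
  ext x
  simp only [LinearMap.comp_apply, conv_apply]
  rw [← mulMap_map]
  exact congrArg (mulMap α β) (LinearMap.congr_fun f.map_comp_comul x).symm

theorem leftAct_comp (f : D →ₗc[k] E) (α : E →ₗ[k] k) :
    leftAct α ∘ₗ f.toLinearMap = f.toLinearMap ∘ₗ leftAct (α ∘ₗ f.toLinearMap) :=
  ext_functional fun φ => by
    rw [← LinearMap.comp_assoc, ← LinearMap.comp_assoc, comp_leftAct, comp_leftAct, conv_comp]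

theorem rightAct_comp (f : D →ₗc[k] E) (α : E →ₗ[k] k) :
    rightAct α ∘ₗ f.toLinearMap = f.toLinearMap ∘ₗ rightAct (α ∘ₗ f.toLinearMap) :=
  ext_functional fun φ => by
    rw [← LinearMap.comp_assoc, ← LinearMap.comp_assoc, comp_rightAct, comp_rightAct, conv_comp]

theorem comul_leftAct (α : D →ₗ[k] k) (x : D) :
    comul (leftAct α x) = LinearMap.rTensor D (leftAct α) (comul (R := k) x) := by
  let K : D ⊗[k] (D ⊗[k] D) →ₗ[k] D ⊗[k] D :=
    (TensorProduct.lid k _).toLinearMap ∘ₗ LinearMap.rTensor _ α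
  have h1 : ∀ T : D ⊗[k] D, comul (R := k) (TensorProduct.lid k D (LinearMap.rTensor D α T)) =
      K (LinearMap.lTensor D comul T) := by
    intro T
    induction T with
    | zero => simp
    | add x y hx hy => simp only [map_add, hx, hy]
    | tmul x y => simp [K]
  have h2 : ∀ T : D ⊗[k] D, LinearMap.rTensor D (leftAct α) T =
      K (TensorProduct.assoc k D D D (LinearMap.rTensor D comul T)) := by
    intro T
    induction T with
    | zero => simp
    | add x y hx hy => simp only [map_add, hx, hy]
    | tmul x y =>
      simp only [LinearMap.rTensor_tmul, leftAct_apply]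
      generalize comul (R := k) x = U
      induction U with
      | zero => simp
      | add x y hx hy => simp only [map_add, add_tmul, hx, hy]
      | tmul u v => simp [K, smul_tmul']
  rw [h2, coassoc_apply, ← h1, leftAct_apply]

theorem comul_rightAct (α : D →ₗ[k] k) (x : D) :
    comul (rightAct α x) = LinearMap.lTensor D (rightAct α) (comul (R := k) x) := by
  let K : D ⊗[k] (D ⊗[k] D) →ₗ[k] D ⊗[k] D :=
    LinearMap.lTensor D ((TensorProduct.rid k _).toLinearMap ∘ₗ LinearMap.lTensor _ α)
  have h1 : ∀ T : D ⊗[k] D, comul (R := k) (TensorProduct.rid k D (LinearMap.lTensor D α T)) =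
      K (TensorProduct.assoc k D D D (LinearMap.rTensor D comul T)) := by
    intro T
    induction T with
    | zero => simp
    | add x y hx hy => simp only [map_add, hx, hy]
    | tmul x y =>
      simp only [LinearMap.rTensor_tmul, LinearMap.lTensor_tmul, TensorProduct.rid_tmul, map_smul]
      generalize comul (R := k) x = U
      induction U with
      | zero => simp
      | add x y hx hy => simp only [map_add, add_tmul, smul_add, hx, hy]
      | tmul u v => simp [K]
  have h2 : ∀ T : D ⊗[k] D, LinearMap.lTensor D (rightAct α) T =
      K (LinearMap.lTensor D comul T) := by
    intro T
    induction T with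
    | zero => simp
    | add x y hx hy => simp only [map_add, hx, hy]
    | tmul x y => rfl
  rw [h2, ← coassoc_apply, ← h1, rightAct_apply]

/-- By coassociativity α is applied to the middle part of the iterated coproduct in both cases; this
moves a functional from one tensor factor to the other. -/
theorem rTensor_rightAct_comul (α : D →ₗ[k] k) (x : D) :
    LinearMap.rTensor D (rightAct α) (comul (R := k) x) =
      LinearMap.lTensor D (leftAct α) (comul (R := k) x) := by
  let K : D ⊗[k] (D ⊗[k] D) →ₗ[k] D ⊗[k] D :=
    LinearMap.lTensor D ((TensorProduct.lid k _).toLinearMap ∘ₗ LinearMap.rTensor _ α)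
  have h1 : ∀ T : D ⊗[k] D, LinearMap.lTensor D (leftAct α) T = K (LinearMap.lTensor D comul T) := by
    intro T
    induction T with
    | zero => simp
    | add x y hx hy => simp only [map_add, hx, hy]
    | tmul x y => rfl
  have h2 : ∀ T : D ⊗[k] D, LinearMap.rTensor D (rightAct α) T =
      K (TensorProduct.assoc k D D D (LinearMap.rTensor D comul T)) := by
    intro T
    induction T with
    | zero => simp
    | add x y hx hy => simp only [map_add, hx, hy]
    | tmul x y =>
      simp only [LinearMap.rTensor_tmul, rightAct_apply]
      generalize comul (R := k) x = U
      induction U with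
      | zero => simp
      | add x y hx hy => simp only [map_add, add_tmul, hx, hy]
      | tmul u v => simp [K, smul_tmul']
  rw [h2, coassoc_apply, ← h1]

/-- The counit on the other factor turns an operator on one tensor factor into the action of a
functional on the tensor product coalgebra, where convolution calculus applies. -/
theorem rTensor_leftAct (α : D →ₗ[k] k) :
    LinearMap.rTensor E (leftAct α) = leftAct (mulMap α (counit : E →ₗ[k] k)) := by
  apply TensorProduct.ext'
  intro x y
  have h : ∀ (T : D ⊗[k] D) (U : E ⊗[k] E), TensorProduct.lid k _ (LinearMap.rTensor _
      (mulMap α (counit : E →ₗ[k] k)) (TensorProduct.tensorTensorTensorComm k D D E E (T ⊗ₜ U))) =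
      TensorProduct.lid k D (LinearMap.rTensor D α T) ⊗ₜ
        TensorProduct.lid k E (LinearMap.rTensor E counit U) := by
    intro T U
    induction T with
    | zero => simp
    | add x y hx hy => simp only [map_add, add_tmul, hx, hy]
    | tmul x x' =>
      induction U with
      | zero => simp
      | add x y hx hy => simp only [map_add, tmul_add, hx, hy]
      | tmul y y' => simp [smul_tmul', smul_smul, mul_comm]
  rw [leftAct_apply, TensorProduct.comul_tmul]
  refine Eq.trans ?_ (h _ _).symm
  simp [leftAct_apply]

theorem lTensor_leftAct (α : D →ₗ[k] k) :
    LinearMap.lTensor E (leftAct α) = leftAct (mulMap (counit : E →ₗ[k] k) α) := by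
  apply TensorProduct.ext'
  intro y x
  have h : ∀ (U : E ⊗[k] E) (T : D ⊗[k] D), TensorProduct.lid k _ (LinearMap.rTensor _
      (mulMap (counit : E →ₗ[k] k) α) (TensorProduct.tensorTensorTensorComm k E E D D (U ⊗ₜ T))) =
      TensorProduct.lid k E (LinearMap.rTensor E counit U) ⊗ₜ
        TensorProduct.lid k D (LinearMap.rTensor D α T) := by
    intro U T
    induction T with
    | zero => simp
    | add x y hx hy => simp only [map_add, tmul_add, hx, hy]
    | tmul x x' =>
      induction U with
      | zero => simp
      | add x y hx hy => simp only [map_add, add_tmul, hx, hy]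
      | tmul y y' => simp [smul_tmul', smul_smul, mul_comm]
  rw [leftAct_apply, TensorProduct.comul_tmul]
  refine Eq.trans ?_ (h _ _).symm
  simp [leftAct_apply]

theorem rTensor_rightAct (α : D →ₗ[k] k) :
    LinearMap.rTensor E (rightAct α) = rightAct (mulMap α (counit : E →ₗ[k] k)) := by
  apply TensorProduct.ext'
  intro x y
  have h : ∀ (T : D ⊗[k] D) (U : E ⊗[k] E), TensorProduct.rid k _ (LinearMap.lTensor _
      (mulMap α (counit : E →ₗ[k] k)) (TensorProduct.tensorTensorTensorComm k D D E E (T ⊗ₜ U))) =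
      TensorProduct.rid k D (LinearMap.lTensor D α T) ⊗ₜ
        TensorProduct.rid k E (LinearMap.lTensor E counit U) := by
    intro T U
    induction T with
    | zero => simp
    | add x y hx hy => simp only [map_add, add_tmul, hx, hy]
    | tmul x x' =>
      induction U with
      | zero => simp
      | add x y hx hy => simp only [map_add, tmul_add, hx, hy]
      | tmul y y' => simp [smul_tmul', smul_smul, mul_comm]
  rw [rightAct_apply, TensorProduct.comul_tmul]
  refine Eq.trans ?_ (h _ _).symm
  simp [rightAct_apply]

theorem lTensor_rightAct (α : D →ₗ[k] k) :
    LinearMap.lTensor E (rightAct α) = rightAct (mulMap (counit : E →ₗ[k] k) α) := by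
  apply TensorProduct.ext'
  intro y x
  have h : ∀ (U : E ⊗[k] E) (T : D ⊗[k] D), TensorProduct.rid k _ (LinearMap.lTensor _
      (mulMap (counit : E →ₗ[k] k) α) (TensorProduct.tensorTensorTensorComm k E E D D (U ⊗ₜ T))) =
      TensorProduct.rid k E (LinearMap.lTensor E counit U) ⊗ₜ
        TensorProduct.rid k D (LinearMap.lTensor D α T) := by
    intro U T
    induction T with
    | zero => simp
    | add x y hx hy => simp only [map_add, tmul_add, hx, hy]
    | tmul x x' =>
      induction U with
      | zero => simp
      | add x y hx hy => simp only [map_add, add_tmul, hx, hy]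
      | tmul y y' => simp [smul_tmul', smul_smul, mul_comm]
  rw [rightAct_apply, TensorProduct.comul_tmul]
  refine Eq.trans ?_ (h _ _).symm
  simp [rightAct_apply]

theorem conv_mulMap_counit (α β : D →ₗ[k] k) :
    conv (mulMap α (counit : E →ₗ[k] k)) (mulMap β (counit : E →ₗ[k] k)) =
      mulMap (conv α β) counit := by
  rw [← comp_leftAct, ← rTensor_leftAct, ← comp_leftAct]
  exact LinearMap.ext (mulMap_rTensor _ _ _)

theorem conv_counit_mulMap (α β : D →ₗ[k] k) :
    conv (mulMap (counit : E →ₗ[k] k) α) (mulMap (counit : E →ₗ[k] k) β) =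
      mulMap counit (conv α β) := by
  rw [← comp_leftAct, ← lTensor_leftAct, ← comp_leftAct]
  exact LinearMap.ext (mulMap_lTensor _ _ _)

theorem mulMap_counit_counit :
    mulMap (counit : D →ₗ[k] k) (counit : E →ₗ[k] k) = counit := by
  apply TensorProduct.ext'
  intro x y
  simp [mul_comm]

end CoalgebraActions

/-! ### Two-cocycles and the twisted product -/

section Twist

variable {W : Type x} [Ring W] [Bialgebra k W]

/-- `σ` is a normalized left two-cocycle on the bialgebra `W`, with convolution inverse `τ`. -/
structure IsTwoCocycle (σ τ : W ⊗[k] W →ₗ[k] k) : Prop where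
  conv_inv : conv σ τ = counit
  inv_conv : conv τ σ = counit
  one_left : ∀ x, σ (1 ⊗ₜ x) = counit x
  one_right : ∀ x, σ (x ⊗ₜ 1) = counit x
  /-- `σ(x₍₁₎, y₍₁₎) σ(x₍₂₎ y₍₂₎, z) = σ(y₍₁₎, z₍₁₎) σ(x, y₍₂₎ z₍₂₎)` -/
  cocycle : ∀ x y z, σ (LinearMap.mul' k W (leftAct σ (x ⊗ₜ y)) ⊗ₜ z) =
    σ (x ⊗ₜ LinearMap.mul' k W (leftAct σ (y ⊗ₜ z)))

/-- `x ⊗ y ↦ σ(x₍₁₎, y₍₁₎) x₍₂₎ y₍₂₎ τ(x₍₃₎, y₍₃₎)`. -/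
def cocycleMul (σ τ : W ⊗[k] W →ₗ[k] k) : W ⊗[k] W →ₗ[k] W :=
  LinearMap.mul' k W ∘ₗ leftAct σ ∘ₗ rightAct τ

variable {σ τ : W ⊗[k] W →ₗ[k] k}

namespace IsTwoCocycle

variable (k W) in
/-- `y ↦ 1 ⊗ y` as a coalgebra map. -/
def oneTmul : W →ₗc[k] W ⊗[k] W where
  __ := TensorProduct.mk k W W 1
  counit_comp := by ext x; simp
  map_comp_comul := by
    ext y
    simp only [LinearMap.comp_apply, TensorProduct.mk_apply, TensorProduct.comul_tmul,
      Bialgebra.comul_one, Algebra.TensorProduct.one_def]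
    generalize comul (R := k) y = T
    induction T with
    | zero => simp
    | add x y hx hy => simp only [map_add, tmul_add, hx, hy]
    | tmul x y => simp

variable (k W) in
/-- `y ↦ y ⊗ 1` as a coalgebra map. -/
def tmulOne : W →ₗc[k] W ⊗[k] W where
  __ := (TensorProduct.mk k W W).flip 1
  counit_comp := by ext x; simp
  map_comp_comul := by
    ext y
    simp only [LinearMap.comp_apply, LinearMap.flip_apply, TensorProduct.mk_apply,
      TensorProduct.comul_tmul, Bialgebra.comul_one, Algebra.TensorProduct.one_def]
    generalize comul (R := k) y = T
    induction T with
    | zero => simp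
    | add x y hx hy => simp only [map_add, add_tmul, hx, hy]
    | tmul x y => simp

/-- Along a coalgebra map τ remains the convolution inverse of σ, so it is trivial wherever σ is. In
this way τ inherits the normalisation. -/
theorem comp_eq_counit {D : Type*} [AddCommGroup D] [Module k D] [Coalgebra k D]
    (hσ : IsTwoCocycle σ τ) (f : D →ₗc[k] W ⊗[k] W) (h : σ ∘ₗ f.toLinearMap = counit) :
    τ ∘ₗ f.toLinearMap = counit := by
  have := conv_comp f σ τ
  rw [hσ.conv_inv, h, counit_conv] at this
  rw [← this]
  exact f.counit_comp

theorem inv_one_left (hσ : IsTwoCocycle σ τ) : τ ∘ₗ (oneTmul k W).toLinearMap = counit :=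
  hσ.comp_eq_counit _ (LinearMap.ext hσ.one_left)

theorem inv_one_right (hσ : IsTwoCocycle σ τ) : τ ∘ₗ (tmulOne k W).toLinearMap = counit :=
  hσ.comp_eq_counit _ (LinearMap.ext hσ.one_right)

theorem one_mul (hσ : IsTwoCocycle σ τ) (y : W) : cocycleMul σ τ (1 ⊗ₜ y) = y := by
  have h1 := LinearMap.congr_fun (rightAct_comp (oneTmul k W) τ) y
  have h2 := LinearMap.congr_fun (leftAct_comp (oneTmul k W) σ) y
  have h3 : σ ∘ₗ (oneTmul k W).toLinearMap = counit := LinearMap.ext hσ.one_left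
  rw [hσ.inv_one_left, rightAct_counit] at h1
  rw [h3, leftAct_counit] at h2
  refine (congrArg (fun z => LinearMap.mul' k W (leftAct σ z)) h1).trans ?_
  refine (congrArg (LinearMap.mul' k W) h2).trans ?_
  exact _root_.one_mul y

theorem mul_one (hσ : IsTwoCocycle σ τ) (y : W) : cocycleMul σ τ (y ⊗ₜ 1) = y := by
  have h1 := LinearMap.congr_fun (rightAct_comp (tmulOne k W) τ) y
  have h2 := LinearMap.congr_fun (leftAct_comp (tmulOne k W) σ) y
  have h3 : σ ∘ₗ (tmulOne k W).toLinearMap = counit := LinearMap.ext hσ.one_right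
  rw [hσ.inv_one_right, rightAct_counit] at h1
  rw [h3, leftAct_counit] at h2
  refine (congrArg (fun z => LinearMap.mul' k W (leftAct σ z)) h1).trans ?_
  refine (congrArg (LinearMap.mul' k W) h2).trans ?_
  exact _root_.mul_one y

theorem comp_conv_inv {D : Type*} [AddCommGroup D] [Module k D] [Coalgebra k D]
    (hσ : IsTwoCocycle σ τ) (f : D →ₗc[k] W ⊗[k] W) :
    conv (τ ∘ₗ f.toLinearMap) (σ ∘ₗ f.toLinearMap) = counit := by
  rw [← conv_comp, hσ.inv_conv]
  exact f.counit_comp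

theorem comp_conv_inv' {D : Type*} [AddCommGroup D] [Module k D] [Coalgebra k D]
    (hσ : IsTwoCocycle σ τ) (f : D →ₗc[k] W ⊗[k] W) :
    conv (σ ∘ₗ f.toLinearMap) (τ ∘ₗ f.toLinearMap) = counit := by
  rw [← conv_comp, hσ.conv_inv]
  exact f.counit_comp

variable (k W) in
/-- `x ⊗ y ⊗ z ↦ x y ⊗ z` as a coalgebra map. -/
def mulLeftHom : (W ⊗[k] W) ⊗[k] W →ₗc[k] W ⊗[k] W :=
  Coalgebra.TensorProduct.map (Bialgebra.mulCoalgHom k W) (CoalgHom.id k W)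

variable (k W) in
/-- `x ⊗ y ⊗ z ↦ x ⊗ y z` as a coalgebra map. -/
def mulRightHom : (W ⊗[k] W) ⊗[k] W →ₗc[k] W ⊗[k] W :=
  (Coalgebra.TensorProduct.map (CoalgHom.id k W) (Bialgebra.mulCoalgHom k W)).comp
    (Coalgebra.TensorProduct.assoc k k W W W).toCoalgHom

variable (k W) in
/-- The associator as a coalgebra map. -/
def assocHom : (W ⊗[k] W) ⊗[k] W →ₗc[k] W ⊗[k] (W ⊗[k] W) :=
  (Coalgebra.TensorProduct.assoc k k W W W).toCoalgHom

theorem mulLeftHom_toLinearMap :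
    (mulLeftHom k W).toLinearMap = LinearMap.rTensor W (LinearMap.mul' k W) := rfl

/-- Twisting twice is a single twist of the threefold product: functionals pass through m ⊗ id by
naturality under coalgebra maps, and left actions commute with right actions. -/
theorem cocycleMul_rTensor :
    cocycleMul σ τ ∘ₗ LinearMap.rTensor W (cocycleMul σ τ) =
      (LinearMap.mul' k W ∘ₗ (mulLeftHom k W).toLinearMap) ∘ₗ
        leftAct (conv (mulMap σ counit) (σ ∘ₗ (mulLeftHom k W).toLinearMap)) ∘ₗ
          rightAct (conv (τ ∘ₗ (mulLeftHom k W).toLinearMap) (mulMap τ counit)) := by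
  simp only [cocycleMul, LinearMap.rTensor_comp, rTensor_leftAct, rTensor_rightAct,
    ← mulLeftHom_toLinearMap]
  rw [← leftAct_comp_leftAct, ← rightAct_comp_rightAct]
  set F := mulLeftHom k W
  have h1 := leftAct_comp F σ
  have h2 := rightAct_comp F τ
  have h3 := leftAct_comp_rightAct (mulMap σ (counit : W →ₗ[k] k)) (τ ∘ₗ F.toLinearMap)
  refine LinearMap.ext fun z => ?_
  simp only [LinearMap.comp_apply]
  have h1' := fun z => LinearMap.congr_fun h1 z
  have h2' := fun z => LinearMap.congr_fun h2 z
  have h3' := fun z => LinearMap.congr_fun h3 z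
  simp only [LinearMap.comp_apply] at h1' h2' h3'
  rw [h2', h1', h3']

theorem cocycleMul_lTensor :
    cocycleMul σ τ ∘ₗ LinearMap.lTensor W (cocycleMul σ τ) ∘ₗ (assocHom k W).toLinearMap =
      (LinearMap.mul' k W ∘ₗ (mulRightHom k W).toLinearMap) ∘ₗ
        leftAct (conv (mulMap counit σ ∘ₗ (assocHom k W).toLinearMap)
          (σ ∘ₗ (mulRightHom k W).toLinearMap)) ∘ₗ
          rightAct (conv (τ ∘ₗ (mulRightHom k W).toLinearMap)
            (mulMap counit τ ∘ₗ (assocHom k W).toLinearMap)) := by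
  simp only [cocycleMul, LinearMap.lTensor_comp, lTensor_leftAct, lTensor_rightAct]
  rw [← leftAct_comp_leftAct, ← rightAct_comp_rightAct]
  set F := mulRightHom k W with hF
  set α := assocHom k W
  have h1 := leftAct_comp F σ
  have h2 := rightAct_comp F τ
  have h3 := leftAct_comp_rightAct (mulMap (counit : W →ₗ[k] k) σ ∘ₗ α.toLinearMap)
    (τ ∘ₗ F.toLinearMap)
  have h4 := leftAct_comp α (mulMap (counit : W →ₗ[k] k) σ)
  have h5 := rightAct_comp α (mulMap (counit : W →ₗ[k] k) τ)
  have h6 : F.toLinearMap = LinearMap.lTensor W (LinearMap.mul' k W) ∘ₗ α.toLinearMap := rfl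
  refine LinearMap.ext fun z => ?_
  have h1' := fun z => LinearMap.congr_fun h1 z
  have h2' := fun z => LinearMap.congr_fun h2 z
  have h3' := fun z => LinearMap.congr_fun h3 z
  have h4' := fun z => LinearMap.congr_fun h4 z
  have h5' := fun z => LinearMap.congr_fun h5 z
  have h6' := fun z => LinearMap.congr_fun h6 z
  simp only [LinearMap.comp_apply] at h1' h2' h3' h4' h5' h6' ⊢
  rw [h5', h4', ← h6', h2', h1', h3']

/-- The cocycle identity as an equation in the convolution algebra of the threefold tensor power of
W, where it can be inverted. -/
theorem cocycle_conv (hσ : IsTwoCocycle σ τ) :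
    conv (mulMap σ counit) (σ ∘ₗ (mulLeftHom k W).toLinearMap) =
      conv (mulMap counit σ ∘ₗ (assocHom k W).toLinearMap)
        (σ ∘ₗ (mulRightHom k W).toLinearMap) := by
  rw [← comp_leftAct, ← comp_leftAct, ← rTensor_leftAct]
  have h := leftAct_comp (assocHom k W) (mulMap (counit : W →ₗ[k] k) σ)
  have h6 : (mulRightHom k W).toLinearMap =
    LinearMap.lTensor W (LinearMap.mul' k W) ∘ₗ (assocHom k W).toLinearMap := rfl
  rw [h6, LinearMap.comp_assoc, LinearMap.comp_assoc, LinearMap.comp_assoc, ← h, ← lTensor_leftAct]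
  apply TensorProduct.ext_threefold
  intro x y z
  exact hσ.cocycle x y z

/-- The two sides are the convolution inverses of the two sides of `cocycle_conv`. -/
theorem cocycle_conv_inv (hσ : IsTwoCocycle σ τ) :
    conv (τ ∘ₗ (mulLeftHom k W).toLinearMap) (mulMap τ counit) =
      conv (τ ∘ₗ (mulRightHom k W).toLinearMap)
        (mulMap counit τ ∘ₗ (assocHom k W).toLinearMap) := by
  set a := mulMap σ (counit : W →ₗ[k] k)
  set a' := mulMap τ (counit : W →ₗ[k] k)
  set b := σ ∘ₗ (mulLeftHom k W).toLinearMap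
  set b' := τ ∘ₗ (mulLeftHom k W).toLinearMap
  set c := mulMap (counit : W →ₗ[k] k) σ ∘ₗ (assocHom k W).toLinearMap with hc
  set c' := mulMap (counit : W →ₗ[k] k) τ ∘ₗ (assocHom k W).toLinearMap with hc'
  set d := σ ∘ₗ (mulRightHom k W).toLinearMap
  set d' := τ ∘ₗ (mulRightHom k W).toLinearMap
  have h : conv a b = conv c d := hσ.cocycle_conv
  have ha : conv a' a = counit := by
    rw [conv_mulMap_counit, hσ.inv_conv, mulMap_counit_counit]
  have hb : conv b' b = counit := hσ.comp_conv_inv _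
  have hd : conv d d' = counit := hσ.comp_conv_inv' _
  have hcc : conv c c' = counit := by
    rw [hc, hc', ← conv_comp, conv_counit_mulMap, hσ.conv_inv, mulMap_counit_counit]
    exact (assocHom k W).counit_comp
  calc conv b' a' = conv (conv b' a') (conv (conv c d) (conv d' c')) := by
        rw [conv_assoc (conv c d), ← conv_assoc c, hd, conv_counit, hcc, conv_counit]
    _ = conv d' c' := by
        rw [← h, conv_assoc, conv_assoc (conv b' a'), ← conv_assoc b', ha, conv_counit, hb,
          counit_conv]

theorem mul_assoc (hσ : IsTwoCocycle σ τ) (x y z : W) :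
    cocycleMul σ τ (cocycleMul σ τ (x ⊗ₜ y) ⊗ₜ z) =
      cocycleMul σ τ (x ⊗ₜ cocycleMul σ τ (y ⊗ₜ z)) := by
  have h1 := cocycleMul_rTensor (σ := σ) (τ := τ)
  have h2 := cocycleMul_lTensor (σ := σ) (τ := τ)
  have h3 : LinearMap.mul' k W ∘ₗ (mulLeftHom k W).toLinearMap =
      LinearMap.mul' k W ∘ₗ (mulRightHom k W).toLinearMap := by
    apply TensorProduct.ext_threefold
    intro x y z
    exact _root_.mul_assoc x y z
  rw [hσ.cocycle_conv, hσ.cocycle_conv_inv, h3, ← h2] at h1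
  exact LinearMap.congr_fun h1 ((x ⊗ₜ y) ⊗ₜ z)

theorem counit_cocycleMul (hσ : IsTwoCocycle σ τ) (z : W ⊗[k] W) :
    counit (R := k) (cocycleMul σ τ z) = counit (R := k) z := by
  have h1 : ∀ z : W ⊗[k] W, counit (R := k) (LinearMap.mul' k W z) = counit (R := k) z :=
    LinearMap.congr_fun (Bialgebra.mulCoalgHom k W).counit_comp
  simp only [cocycleMul, LinearMap.comp_apply]
  rw [h1, apply_leftAct, conv_counit, apply_rightAct, hσ.conv_inv]

/-- The coproduct of σ(x₁, y₁) x₂y₂ τ(x₃, y₃) carries only the outer σ and τ. Inserting τ * σ = ε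
between the two tensor factors supplies the inner pair. -/
theorem comul_cocycleMul (hσ : IsTwoCocycle σ τ) (z : W ⊗[k] W) :
    comul (R := k) (cocycleMul σ τ z) =
      TensorProduct.map (cocycleMul σ τ) (cocycleMul σ τ) (comul (R := k) z) := by
  have h1 : ∀ z : W ⊗[k] W, comul (R := k) (LinearMap.mul' k W z) =
      TensorProduct.map (LinearMap.mul' k W) (LinearMap.mul' k W) (comul (R := k) z) :=
    fun z => (LinearMap.congr_fun (Bialgebra.mulCoalgHom k W).map_comp_comul z).symm
  have h2 : comul (R := k) z = LinearMap.rTensor _ (rightAct τ)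
      (LinearMap.lTensor _ (leftAct σ) (comul (R := k) z)) := by
    have : ∀ T : (W ⊗[k] W) ⊗[k] (W ⊗[k] W), LinearMap.rTensor _ (rightAct τ)
        (LinearMap.lTensor _ (leftAct σ) T) = LinearMap.lTensor _ (leftAct σ)
          (LinearMap.rTensor _ (rightAct τ) T) := by
      intro T
      rw [← LinearMap.comp_apply, ← LinearMap.comp_apply, LinearMap.rTensor_comp_lTensor,
        LinearMap.lTensor_comp_rTensor]
    rw [this, rTensor_rightAct_comul, ← LinearMap.lTensor_comp_apply, leftAct_comp_leftAct,
      hσ.inv_conv, leftAct_counit, LinearMap.lTensor_id, LinearMap.id_apply]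
  have h3 : cocycleMul σ τ = LinearMap.mul' k W ∘ₗ rightAct τ ∘ₗ leftAct σ := by
    rw [cocycleMul, leftAct_comp_rightAct]
  calc comul (R := k) (cocycleMul σ τ z)
      = TensorProduct.map (LinearMap.mul' k W) (LinearMap.mul' k W)
          (LinearMap.rTensor _ (leftAct σ) (LinearMap.lTensor _ (rightAct τ)
            (comul (R := k) z))) := by
        simp only [cocycleMul, LinearMap.comp_apply]
        rw [h1, comul_leftAct, comul_rightAct]
    _ = TensorProduct.map (cocycleMul σ τ) (cocycleMul σ τ) (comul (R := k) z) := by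
        conv_lhs => rw [h2]
        generalize comul (R := k) z = T
        induction T with
        | zero => simp
        | add x y hx hy => simp only [map_add, hx, hy]
        | tmul x y =>
          simp only [LinearMap.rTensor_tmul, LinearMap.lTensor_tmul, TensorProduct.map_tmul]
          conv_rhs => rw [h3]
          conv_rhs => lhs; rw [← h3]
          rfl

end IsTwoCocycle

/-- The coalgebra `W`, as the underlying space of the twisted bialgebra. -/
@[nolint unusedArguments]
def Twisted (_σ _τ : W ⊗[k] W →ₗ[k] k) : Type x := W

instance : AddCommGroup (Twisted σ τ) := inferInstanceAs (AddCommGroup W)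

instance : Module k (Twisted σ τ) := inferInstanceAs (Module k W)

instance : Coalgebra k (Twisted σ τ) := inferInstanceAs (Coalgebra k W)

variable (σ τ) in
/-- The identity map. -/
def toTwisted : W ≃ₗ[k] Twisted σ τ := LinearEquiv.refl k W

theorem counit_toTwisted (x : W) : counit (R := k) (toTwisted σ τ x) = counit (R := k) x := rfl

theorem comul_toTwisted (x : W) : comul (R := k) (toTwisted σ τ x) =
    TensorProduct.map (toTwisted σ τ).toLinearMap (toTwisted σ τ).toLinearMap
      (comul (R := k) x) :=
  (LinearMap.congr_fun (TensorProduct.map_id (R := k) (M := W) (N := W)) (comul (R := k) x)).symm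

variable (σ τ) in
/-- The twisted product. -/
def twistedMap : Twisted σ τ →ₗ[k] Twisted σ τ →ₗ[k] Twisted σ τ :=
  ((TensorProduct.mk k W W).compl₁₂ (toTwisted σ τ).symm.toLinearMap
    (toTwisted σ τ).symm.toLinearMap).compr₂ ((toTwisted σ τ).toLinearMap ∘ₗ cocycleMul σ τ)

/-- The twisted ring structure. -/
@[reducible]
def IsTwoCocycle.ring (hσ : IsTwoCocycle σ τ) : Ring (Twisted σ τ) where
  __ := (inferInstance : AddCommGroup (Twisted σ τ))
  one := toTwisted σ τ 1
  mul x y := twistedMap σ τ x y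
  one_mul x := hσ.one_mul x
  mul_one x := hσ.mul_one x
  mul_assoc x y z := hσ.mul_assoc x y z
  left_distrib x y z := map_add (twistedMap σ τ x) y z
  right_distrib x y z := LinearMap.map_add₂ (twistedMap σ τ) x y z
  zero_mul x := LinearMap.map_zero₂ (twistedMap σ τ) x
  mul_zero x := map_zero (twistedMap σ τ x)

/-- The twisted algebra structure. -/
@[reducible]
def IsTwoCocycle.algebra (hσ : IsTwoCocycle σ τ) :
    letI := hσ.ring
    Algebra k (Twisted σ τ) :=
  letI := hσ.ring
  Algebra.ofModule (fun r x y => LinearMap.map_smul₂ (twistedMap σ τ) r x y)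
    (fun r x y => map_smul (twistedMap σ τ x) r y)

/-- The bialgebra obtained from `W` by twisting the product by a two-cocycle. -/
theorem IsTwoCocycle.exists_twist (hσ : IsTwoCocycle σ τ) :
    ∃ (U : Type x) (_ : Ring U) (_ : Bialgebra k U) (e : W ≃ₗ[k] U), e 1 = 1 ∧
      (∀ x y, e (cocycleMul σ τ (x ⊗ₜ y)) = e x * e y) ∧
      (∀ x, counit (R := k) (e x) = counit (R := k) x) ∧
      ∀ x, comul (R := k) (e x) = TensorProduct.map e.toLinearMap e.toLinearMap
        (comul (R := k) x) := by
  let _ := hσ.ring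
  let _ := hσ.algebra
  have h1 : ∀ x y : W, toTwisted σ τ (cocycleMul σ τ (x ⊗ₜ y)) =
    toTwisted σ τ x * toTwisted σ τ y := fun _ _ => rfl
  have h2 : ∀ T T' : W ⊗[k] W,
      TensorProduct.map (toTwisted σ τ).toLinearMap (toTwisted σ τ).toLinearMap
        (TensorProduct.map (cocycleMul σ τ) (cocycleMul σ τ)
          (TensorProduct.tensorTensorTensorComm k W W W W (T ⊗ₜ T'))) =
      TensorProduct.map (toTwisted σ τ).toLinearMap (toTwisted σ τ).toLinearMap T *
        TensorProduct.map (toTwisted σ τ).toLinearMap (toTwisted σ τ).toLinearMap T' := by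
    intro T T'
    induction T with
    | zero => simp
    | add x y hx hy => simp only [map_add, add_tmul, add_mul, hx, hy]
    | tmul x y =>
      induction T' with
      | zero => simp
      | add x y hx hy => simp only [map_add, tmul_add, mul_add, hx, hy]
      | tmul x' y' => simp [h1]
  refine ⟨Twisted σ τ, hσ.ring, Bialgebra.mk' k (Twisted σ τ) ?_ ?_ ?_ ?_, toTwisted σ τ, rfl,
    fun _ _ => rfl, counit_toTwisted, comul_toTwisted⟩
  · exact Bialgebra.counit_one (R := k) (A := W)
  · intro a b
    obtain ⟨x, rfl⟩ := (toTwisted σ τ).surjective a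
    obtain ⟨y, rfl⟩ := (toTwisted σ τ).surjective b
    rw [← h1, counit_toTwisted, counit_toTwisted, counit_toTwisted, hσ.counit_cocycleMul,
      TensorProduct.counit_tmul, smul_eq_mul, mul_comm]
  · exact (comul_toTwisted (1 : W)).trans (by rw [Bialgebra.comul_one]; rfl)
  · intro a b
    obtain ⟨x, rfl⟩ := (toTwisted σ τ).surjective a
    obtain ⟨y, rfl⟩ := (toTwisted σ τ).surjective b
    rw [← h1, comul_toTwisted, comul_toTwisted, comul_toTwisted, hσ.comul_cocycleMul,
      TensorProduct.comul_tmul, ← h2]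
    rfl

end Twist

/-! ### The two-sided smash product as a bialgebra -/

section Bar

variable [FiniteDimensional k B] [Coalgebra k (Module.Dual k B)]

/-- The expression defining the coproduct of `U(B)`, with general tensors in place of the coproducts
and of `R⁻¹` and `R`. -/
def comulTensor (X Y : H ⊗[k] H) (T : Module.Dual k B ⊗[k] Module.Dual k B) (U : H ⊗[k] H)
    (V : B ⊗[k] B) : Space k H B ⊗[k] Space k H B :=
  TensorProduct.map₂
      (LinearMap.lTensorHom (Module.Dual k B) ∘ₗ LinearMap.rTensorHom B ∘ₗ LinearMap.mul k H)
      (LinearMap.rTensorHom (H ⊗[k] B) ∘ₗ lAct k H B) X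
    (TensorProduct.map₂
      (LinearMap.lTensorHom (Module.Dual k B) ∘ₗ LinearMap.lTensorHom H ∘ₗ rAct k H B)
      (LinearMap.lTensorHom (Module.Dual k B) ∘ₗ LinearMap.rTensorHom B ∘ₗ
        (LinearMap.mul k H).flip) Y
    (TensorProduct.tensorTensorTensorComm k (Module.Dual k B) (Module.Dual k B)
      (H ⊗[k] B) (H ⊗[k] B) (T ⊗ₜ TensorProduct.tensorTensorTensorComm k H H B B (U ⊗ₜ V))))

theorem comul_eq_comulTensor (R : (H ⊗[k] H)ˣ) (c : Module.Dual k B) (h : H) (b : B) :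
    DoubleBosonisation.comul R (c ⊗ₜ (h ⊗ₜ b)) =
      comulTensor (↑R⁻¹ : H ⊗[k] H) R (barComul R c) (comul h) (comul b) := rfl

theorem comulTensor_tmul (x x' y y' u u' : H) (t t' : Module.Dual k B) (v v' : B) :
    comulTensor (x ⊗ₜ[k] x') (y ⊗ₜ[k] y') (t ⊗ₜ t') (u ⊗ₜ u') (v ⊗ₜ v') =
      (t ⊗ₜ ((x * u) ⊗ₜ rAct k H B y v)) ⊗ₜ (lAct k H B x' t' ⊗ₜ ((u' * y') ⊗ₜ v')) := by
  simp [comulTensor]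

/-- A multilinear identity in `comulTensor` may be checked on pure tensors. -/
theorem comulTensor_induction {M : Type*} [AddCommMonoid M] [Module k M]
    (Φ : Space k H B ⊗[k] Space k H B →ₗ[k] M)
    (Ψ : H ⊗[k] H → H ⊗[k] H → Module.Dual k B ⊗[k] Module.Dual k B → H ⊗[k] H → B ⊗[k] B → M)
    (add₁ : ∀ X X' Y T U V, Ψ (X + X') Y T U V = Ψ X Y T U V + Ψ X' Y T U V)
    (add₂ : ∀ X Y Y' T U V, Ψ X (Y + Y') T U V = Ψ X Y T U V + Ψ X Y' T U V)
    (add₃ : ∀ X Y T T' U V, Ψ X Y (T + T') U V = Ψ X Y T U V + Ψ X Y T' U V)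
    (add₄ : ∀ X Y T U U' V, Ψ X Y T (U + U') V = Ψ X Y T U V + Ψ X Y T U' V)
    (add₅ : ∀ X Y T U V V', Ψ X Y T U (V + V') = Ψ X Y T U V + Ψ X Y T U V')
    (z₁ : ∀ Y T U V, Ψ 0 Y T U V = 0) (z₂ : ∀ X T U V, Ψ X 0 T U V = 0)
    (z₃ : ∀ X Y U V, Ψ X Y 0 U V = 0) (z₄ : ∀ X Y T V, Ψ X Y T 0 V = 0)
    (z₅ : ∀ X Y T U, Ψ X Y T U 0 = 0)
    (h : ∀ (x x' y y' : H) (t t' : Module.Dual k B) (u u' : H) (v v' : B),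
      Φ ((t ⊗ₜ ((x * u) ⊗ₜ rAct k H B y v)) ⊗ₜ (lAct k H B x' t' ⊗ₜ ((u' * y') ⊗ₜ v'))) =
        Ψ (x ⊗ₜ x') (y ⊗ₜ y') (t ⊗ₜ t') (u ⊗ₜ u') (v ⊗ₜ v'))
    (X Y : H ⊗[k] H) (T : Module.Dual k B ⊗[k] Module.Dual k B) (U : H ⊗[k] H) (V : B ⊗[k] B) :
    Φ (comulTensor X Y T U V) = Ψ X Y T U V := by
  induction X with
  | zero => simp [comulTensor, z₁]
  | add x y hx hy =>
    simp only [comulTensor, map_add, LinearMap.add_apply] at hx hy ⊢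
    rw [hx, hy, add₁]
  | tmul x x' =>
  induction Y with
  | zero => simp [comulTensor, z₂]
  | add x y hx hy =>
    simp only [comulTensor, map_add, LinearMap.add_apply] at hx hy ⊢
    rw [hx, hy, add₂]
  | tmul y y' =>
  induction T with
  | zero => simp [comulTensor, z₃]
  | add x y hx hy =>
    simp only [comulTensor, map_add, add_tmul] at hx hy ⊢
    rw [hx, hy, add₃]
  | tmul t t' =>
  induction U with
  | zero => simp [comulTensor, z₄]
  | add x y hx hy =>
    simp only [comulTensor, map_add, add_tmul, tmul_add] at hx hy ⊢
    rw [hx, hy, add₄]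
  | tmul u u' =>
  induction V with
  | zero => simp [comulTensor, z₅]
  | add x y hx hy =>
    simp only [comulTensor, map_add, tmul_add] at hx hy ⊢
    rw [hx, hy, add₅]
  | tmul v v' => rw [comulTensor_tmul, h]

variable (k H B) in
/-- The projection `c ⊗ h ⊗ b ↦ ⟨c, 1⟩ ε(h) b`. -/
def projB : Space k H B →ₗ[k] B :=
  (TensorProduct.lid k B).toLinearMap ∘ₗ TensorProduct.map (Module.Dual.eval k B 1)
    ((TensorProduct.lid k B).toLinearMap ∘ₗ LinearMap.rTensor B counit)

variable (k H B) in
/-- The projection `c ⊗ h ⊗ b ↦ c ε(h) ε(b)`. -/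
def projC : Space k H B →ₗ[k] Module.Dual k B :=
  (TensorProduct.rid k _).toLinearMap ∘ₗ LinearMap.lTensor _
    (LinearMap.mul' k k ∘ₗ TensorProduct.map counit counit)

theorem projB_tmul (c : Module.Dual k B) (h : H) (b : B) :
    projB k H B (c ⊗ₜ (h ⊗ₜ b)) = c 1 • counit (R := k) h • b := rfl

theorem projC_tmul (c : Module.Dual k B) (h : H) (b : B) :
    projC k H B (c ⊗ₜ (h ⊗ₜ b)) = (counit (R := k) h * counit (R := k) b) • c := by
  simp [projC]

/-! ### Projections of the two factors of the coproduct -/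

section Projections

variable {R : (H ⊗[k] H)ˣ} {S : B ≃ₗ[k] B} (hD : IsBarDual R S)
include hD

/-- `projC` on the left factor applies the counit to a leg of R⁻¹ and to a leg of R, so
normalisation removes both. The same happens for `projB` on the right factor, whereas `projB` on the
left keeps R and `projC` on the right keeps R⁻¹; these survivors end up in the exchange relation. -/
theorem rTensor_projC_comul (c : Module.Dual k B) (h : H) (b : B) :
    LinearMap.rTensor _ (projC k H B) (DoubleBosonisation.comul R (c ⊗ₜ (h ⊗ₜ b))) =
      LinearMap.lTensor _ ((TensorProduct.mk k _ _).flip (h ⊗ₜ b)) (barComul R c) := by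
  rw [comul_eq_comulTensor, comulTensor_induction (LinearMap.rTensor _ (projC k H B))
    (fun X Y T U V => LinearMap.lTensor _ ((TensorProduct.mk k _ _).flip
      ((TensorProduct.lid k H (LinearMap.rTensor H counit U) *
        TensorProduct.lid k H (LinearMap.rTensor H counit Y)) ⊗ₜ
          TensorProduct.lid k B (LinearMap.rTensor B counit V)) ∘ₗ
        lAct k H B (TensorProduct.lid k H (LinearMap.rTensor H counit X))) T)]
  · rw [(normalized_rmat hD.quasitriangular).left, (normalized_rmat_inv hD.quasitriangular).left]
    have : lAct k H B 1 = LinearMap.id := LinearMap.ext lAct_one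
    simp [this]
  · intros; simp [LinearMap.comp_add]
  · intros; simp [mul_add, add_tmul, LinearMap.add_comp]
  · intros; simp
  · intros; simp [add_mul, add_tmul, LinearMap.add_comp]
  · intros; simp [tmul_add, LinearMap.add_comp]
  · intros; simp
  · intros; simp
  · intros; simp
  · intros; simp
  · intros; simp
  · intros
    simp only [LinearMap.rTensor_tmul, projC_tmul, counit_rAct hD.group, Bialgebra.counit_mul,
      TensorProduct.lid_tmul, LinearMap.lTensor_tmul, LinearMap.comp_apply, LinearMap.flip_apply,
      TensorProduct.mk_apply, map_smul, LinearMap.smul_apply, smul_mul_assoc, mul_smul_comm,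
      tmul_smul, ← smul_tmul', smul_smul]
    congr 1
    ring

theorem lTensor_projB_comul (c : Module.Dual k B) (h : H) (b : B) :
    LinearMap.lTensor _ (projB k H B) (DoubleBosonisation.comul R (c ⊗ₜ (h ⊗ₜ b))) =
      LinearMap.rTensor _ (TensorProduct.mk k _ _ c ∘ₗ TensorProduct.mk k H B h) (comul b) := by
  rw [comul_eq_comulTensor, comulTensor_induction (M := Space k H B ⊗[k] B)
    (LinearMap.lTensor _ (projB k H B))
    (fun X Y T U V => LinearMap.rTensor B (TensorProduct.mk k _ (H ⊗[k] B)
      (TensorProduct.rid k _ (LinearMap.lTensor _ (Module.Dual.eval k B 1) T)) ∘ₗ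
        TensorProduct.mk k H B (TensorProduct.rid k H (LinearMap.lTensor H counit X) *
          TensorProduct.rid k H (LinearMap.lTensor H counit U)) ∘ₗ
        rAct k H B (TensorProduct.rid k H (LinearMap.lTensor H counit Y))) V)]
  · rw [(normalized_rmat hD.quasitriangular).right, (normalized_rmat_inv hD.quasitriangular).right]
    have : rAct k H B 1 = LinearMap.id := LinearMap.ext rAct_one
    have h2 : (Module.Dual.eval k B 1 : Module.Dual k B →ₗ[k] k) = counit :=
      LinearMap.ext fun c => (hD.counit_eq c).symm
    rw [h2, ← hD.comul_eq]
    simp [this]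
  · intros; simp [add_mul, LinearMap.comp_add, LinearMap.add_comp]
  · intros; simp [LinearMap.comp_add]
  · intros; simp [LinearMap.add_comp]
  · intros; simp [mul_add, LinearMap.add_comp, LinearMap.comp_add]
  · intros; simp
  · intros; simp
  · intros; simp
  · intros; simp
  · intros; simp
  · intros; simp
  · intros
    simp only [LinearMap.lTensor_tmul, projB_tmul, lAct_apply_one hD.group, Bialgebra.counit_mul,
      TensorProduct.rid_tmul, LinearMap.rTensor_tmul, LinearMap.comp_apply,
      TensorProduct.mk_apply, map_smul, LinearMap.smul_apply, smul_mul_assoc, mul_smul_comm,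
      tmul_smul, smul_smul, Module.Dual.eval_apply, ← smul_tmul']
    congr 1
    ring

theorem rTensor_projB_comul (c : Module.Dual k B) (h : H) (b : B) :
    LinearMap.rTensor _ (projB k H B) (DoubleBosonisation.comul R (c ⊗ₜ (h ⊗ₜ b))) =
      LinearMap.lTensor B (TensorProduct.mk k _ _ c ∘ₗ LinearMap.rTensor B (LinearMap.mulLeft k h))
        (TensorProduct.map₂ (rAct k H B) (TensorProduct.mk k H B) (R : H ⊗[k] H) (comul b)) := by
  rw [comul_eq_comulTensor, comulTensor_induction (LinearMap.rTensor _ (projB k H B))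
    (fun X Y T U V => LinearMap.lTensor B (TensorProduct.mk k _ (H ⊗[k] B)
      (lAct k H B (TensorProduct.lid k H (LinearMap.rTensor H counit X))
      (TensorProduct.lid k _ (LinearMap.rTensor _ (Module.Dual.eval k B 1) T))) ∘ₗ
        LinearMap.rTensor B (LinearMap.mul k H
          (TensorProduct.lid k H (LinearMap.rTensor H counit U))))
        (TensorProduct.map₂ (rAct k H B) (TensorProduct.mk k H B) Y V))]
  · rw [(normalized_rmat_inv hD.quasitriangular).left]
    have h2 : (Module.Dual.eval k B 1 : Module.Dual k B →ₗ[k] k) = counit :=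
      LinearMap.ext fun c => (hD.counit_eq c).symm
    rw [h2, ← hD.comul_eq]
    simp
    rfl
  · intros; simp [LinearMap.add_comp]
  · intros; simp
  · intros; simp [LinearMap.add_comp]
  · intros; simp [LinearMap.comp_add]
  · intros; simp
  · intros; simp
  · intros; simp
  · intros; simp
  · intros; simp
  · intros; simp
  · intros
    simp only [LinearMap.rTensor_tmul, LinearMap.lTensor_tmul, projB_tmul, Bialgebra.counit_mul,
      TensorProduct.lid_tmul, LinearMap.comp_apply, TensorProduct.map₂_apply_tmul,
      TensorProduct.map_tmul, TensorProduct.mk_apply, map_smul, LinearMap.smul_apply,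
      tmul_smul, smul_smul, Module.Dual.eval_apply, ← smul_tmul', LinearMap.mul_apply']
    congr 1
    ring

theorem lTensor_projC_comul (c : Module.Dual k B) (h : H) (b : B) :
    LinearMap.lTensor _ (projC k H B) (DoubleBosonisation.comul R (c ⊗ₜ (h ⊗ₜ b))) =
      LinearMap.rTensor _ (LinearMap.lTensor _
          ((TensorProduct.mk k H B).flip b ∘ₗ LinearMap.mulRight k h))
        (TensorProduct.map₂ (TensorProduct.mk k _ _).flip (lAct k H B) (↑R⁻¹ : H ⊗[k] H)
          (barComul R c)) := by
  rw [comul_eq_comulTensor, comulTensor_induction (M := Space k H B ⊗[k] Module.Dual k B)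
    (LinearMap.lTensor _ (projC k H B))
    (fun X Y T U V => LinearMap.rTensor (Module.Dual k B) (LinearMap.lTensor (Module.Dual k B)
      ((TensorProduct.mk k H B).flip (rAct k H B (TensorProduct.rid k H
        (LinearMap.lTensor H counit Y)) (TensorProduct.rid k B (LinearMap.lTensor B counit V))) ∘ₗ
        (LinearMap.mul k H).flip (TensorProduct.rid k H (LinearMap.lTensor H counit U))))
          (TensorProduct.map₂ (TensorProduct.mk k _ _).flip (lAct k H B) X T))]
  · rw [(normalized_rmat hD.quasitriangular).right]
    simp
    rfl
  · intros; simp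
  · intros; simp [LinearMap.add_comp]
  · intros; simp
  · intros; simp [LinearMap.comp_add]
  · intros; simp [LinearMap.add_comp]
  · intros; simp
  · intros; simp
  · intros; simp
  · intros; simp
  · intros; simp
  · intros
    simp only [LinearMap.lTensor_tmul, LinearMap.rTensor_tmul, projC_tmul, Bialgebra.counit_mul,
      TensorProduct.rid_tmul, LinearMap.comp_apply, TensorProduct.map₂_apply_tmul,
      LinearMap.flip_apply, TensorProduct.map_tmul,
      TensorProduct.mk_apply, map_smul, LinearMap.smul_apply,
      tmul_smul, smul_smul, ← smul_tmul', LinearMap.mul_apply']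
    congr 1
    ring

end Projections

end Bar

/-! ### The smash product as a bialgebra determined on generators -/

section Bar

variable [FiniteDimensional k B] [Coalgebra k (Module.Dual k B)]
  {R : (H ⊗[k] H)ˣ} {S : B ≃ₗ[k] B}
  {W : Type*} [Ring W] [Bialgebra k W]

/-- The bialgebra `W` is the two-sided smash product `C̄ ⋊ H ⋉ B`. -/
structure IsSmashBialgebra (R : (H ⊗[k] H)ˣ) (jC : Module.Dual k B →ₗ[k] W) (jH : H →ₐ[k] W)
    (jB : B →ₗ[k] W) : Prop extends IsSmash jC jH jB where
  comul_C : ∀ c, comul (R := k) (jC c) = prodC jC jH (inl k W) (inr k W) R c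
  comul_H : ∀ h, comul (R := k) (jH h) =
    conv ((inl k W).comp jH).toLinearMap ((inr k W).comp jH).toLinearMap h
  comul_B : ∀ b, comul (R := k) (jB b) = prodB jH jB (inl k W) (inr k W) R b
  counit_C : ∀ c, counit (R := k) (jC c) = c 1
  counit_H : ∀ h, counit (R := k) (jH h) = counit (R := k) h
  counit_B : ∀ b, counit (R := k) (jB b) = counit (R := k) b

/-- Writing R⁻¹c₂R as an action of R⁻¹ makes the coproduct linear in R⁻¹, so that it can be compared
with other expressions by induction on tensors. -/
theorem prodC_eq {A : Type*} [Ring A] [Algebra k A] {iC : Module.Dual k B →ₗ[k] A} {iH : H →ₐ[k] A}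
    {A' : Type*} [Ring A'] [Algebra k A'] {φ₁ φ₂ : A →ₐ[k] A'}
    (hR : IsQuasitriangular k (R : H ⊗[k] H)) (hi : RelLeft iC iH.toLinearMap)
    (h : ∀ x y, Commute (φ₁ x) (φ₂ y)) (c : Module.Dual k B) :
    prodC iC iH φ₁ φ₂ R c = mulMap (φ₁.toLinearMap ∘ₗ iC)
      (mulMap (φ₁.comp iH).toLinearMap (φ₂.toLinearMap ∘ₗ iC) ∘ₗ
        (LinearMap.lTensorHom H ∘ₗ (lAct k H B).flip).flip ↑R⁻¹) (comul c) := by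
  rw [prodC, conv_apply]
  congr 2
  refine LinearMap.ext fun c => (conj_rmat_C hR hi h c).trans ?_
  exact (mulMap_lTensor _ _ _ _).symm

theorem prodB_eq {A : Type*} [Ring A] [Algebra k A] {iB : B →ₗ[k] A} {iH : H →ₐ[k] A}
    {A' : Type*} [Ring A'] [Algebra k A'] {φ₁ φ₂ : A →ₐ[k] A'}
    (hR : IsQuasitriangular k (R : H ⊗[k] H)) (hi : RelRight iB iH.toLinearMap)
    (h : ∀ x y, Commute (φ₁ x) (φ₂ y)) (b : B) :
    prodB iH iB φ₁ φ₂ R b =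
      mulMap (mulMap (φ₁.toLinearMap ∘ₗ iB) (φ₂.comp iH).toLinearMap ∘ₗ
        (LinearMap.rTensorHom H ∘ₗ (rAct k H B).flip).flip ↑R) (φ₂.toLinearMap ∘ₗ iB)
        (comul b) := by
  rw [prodB, conv_apply]
  congr 2
  refine LinearMap.ext fun b => (conj_rmat_B hR hi h b).trans ?_
  exact (mulMap_rTensor _ _ _ _).symm

/-- The image of the coproduct of `U(B)`, as a product of the coproducts of the three factors. -/
theorem map_triple_comul {A : Type*} [Ring A] [Algebra k A] {iC : Module.Dual k B →ₗ[k] A}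
    {iH : H →ₐ[k] A} {iB : B →ₗ[k] A} (hD : IsBarDual R S) (hl : RelLeft iC iH.toLinearMap)
    (hr : RelRight iB iH.toLinearMap) (c : Module.Dual k B) (h : H) (b : B) :
    TensorProduct.map (triple iC iH iB) (triple iC iH iB)
      (DoubleBosonisation.comul R (c ⊗ₜ (h ⊗ₜ b))) =
    prodC iC iH (inl k A) (inr k A) R c *
      (conv ((inl k A).comp iH).toLinearMap ((inr k A).comp iH).toLinearMap h *
        prodB iH iB (inl k A) (inr k A) R b) := by
  rw [comul_eq_comulTensor, comulTensor_induction
    (TensorProduct.map (triple iC iH iB) (triple iC iH iB)) (fun X Y T U V =>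
      mulMap ((inl k A).toLinearMap ∘ₗ iC)
        (mulMap ((inl k A).comp iH).toLinearMap ((inr k A).toLinearMap ∘ₗ iC) ∘ₗ
          (LinearMap.lTensorHom H ∘ₗ (lAct k H B).flip).flip X) T *
      (mulMap ((inl k A).comp iH).toLinearMap ((inr k A).comp iH).toLinearMap U *
      mulMap (mulMap ((inl k A).toLinearMap ∘ₗ iB) ((inr k A).comp iH).toLinearMap ∘ₗ
          (LinearMap.rTensorHom H ∘ₗ (rAct k H B).flip).flip Y) ((inr k A).toLinearMap ∘ₗ iB) V))
    (by intros; simp [LinearMap.comp_add, mulMap_add_right, add_mul])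
    (by intros; simp [LinearMap.comp_add, mulMap_add_left, mul_add])
    (by intros; simp [add_mul])
    (by intros; simp [add_mul, mul_add])
    (by intros; simp [mul_add])
    (by intros; simp) (by intros; simp) (by intros; simp) (by intros; simp) (by intros; simp)
    (by
      intros
      simp [triple_tmul, inl_apply, inr_apply, mul_assoc])
    (↑R⁻¹ : H ⊗[k] H) (R : H ⊗[k] H) (barComul R c) (comul h) (comul b),
    prodC_eq hD.quasitriangular hl commute_inl_inr, prodB_eq hD.quasitriangular hr commute_inl_inr,
    conv_apply, hD.comul_eq]

theorem exists_isSmashBialgebra (hD : IsBarDual R S) :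
    ∃ (W : Type (max u v w)) (_ : Ring W) (_ : Bialgebra k W) (jC : Module.Dual k B →ₗ[k] W)
      (jH : H →ₐ[k] W) (jB : B →ₗ[k] W), IsSmashBialgebra R jC jH jB := by
  obtain ⟨W, _, _, jC, jH, jB, hg⟩ := exists_isSmash hD.group
  refine ⟨W, inferInstance, hg.bialgebra hD, jC, jH, jB, ?_⟩
  let _ := hg.bialgebra hD
  exact
    { hg with
      comul_C := LinearMap.congr_fun (hg.comulHom_C hD)
      comul_H := LinearMap.congr_fun (hg.comulHom_H hD)
      comul_B := LinearMap.congr_fun (hg.comulHom_B hD)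
      counit_C := hg.counitHom_C hD
      counit_H := hg.counitHom_H hD
      counit_B := hg.counitHom_B hD }

variable {jC : Module.Dual k B →ₗ[k] W} {jH : H →ₐ[k] W} {jB : B →ₗ[k] W}

namespace IsSmashBialgebra

variable (hW : IsSmashBialgebra R jC jH jB) (hD : IsBarDual R S)
include hW

include hD

theorem comul_equiv (s : Space k H B) : comul (R := k) (hW.equiv s) =
    TensorProduct.map hW.equiv.toLinearMap hW.equiv.toLinearMap (DoubleBosonisation.comul R s) := by
  induction s using Space.induction with
  | zero => simp
  | add x y hx hy => simp only [map_add, hx, hy]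
  | tmul c h b =>
    have h1 : hW.equiv.toLinearMap = triple jC jH jB := rfl
    rw [h1, map_triple_comul hD hW.relLeft hW.relRight, IsSmash.equiv_tmul, Bialgebra.comul_mul,
      Bialgebra.comul_mul, hW.comul_C, hW.comul_H, hW.comul_B]

end IsSmashBialgebra

end Bar

section Bar

variable [FiniteDimensional k B] [Coalgebra k (Module.Dual k B)]
  {R : (H ⊗[k] H)ˣ} {S : B ≃ₗ[k] B}
  {W : Type*} [Ring W] [Bialgebra k W]
  {jC : Module.Dual k B →ₗ[k] W} {jH : H →ₐ[k] W} {jB : B →ₗ[k] W}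

-- R cancels the R⁻¹ of the opposite product, and only the reversed order of the factors remains.
omit [FiniteDimensional k B] [Coalgebra k (Module.Dual k B)] in
theorem twistedMul_inv_map₂ (a b : B) :
    twistedMul (↑R⁻¹ : H ⊗[k] H)
      (TensorProduct.map₂ (rAct k H B) (rAct k H B) (R : H ⊗[k] H) (a ⊗ₜ b)) = b * a := by
  have h : ∀ X Y : H ⊗[k] H, twistedMul X (TensorProduct.map₂ (rAct k H B) (rAct k H B) Y
      (a ⊗ₜ b)) = twistedMul (Y * X) (a ⊗ₜ b) := by
    intro X Y
    induction X with
    | zero => simp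
    | add x y hx hy => simp only [twistedMul_add, LinearMap.add_apply, mul_add, hx, hy]
    | tmul x x' =>
      induction Y with
      | zero => simp
      | add x y hx hy =>
        simp only [twistedMul_add, LinearMap.add_apply, add_mul, map_add, hx, hy]
      | tmul y y' => simp [twistedMul_tmul_tmul, rAct_mul]
  rw [h, Units.mul_inv, Algebra.TensorProduct.one_def, twistedMul_tmul_tmul, rAct_one, rAct_one]

section Transfer

omit [FiniteDimensional k B] [Coalgebra k (Module.Dual k B)]
variable {V V' M : Type*} [AddCommMonoid V] [Module k V] [AddCommMonoid V'] [Module k V']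
  [AddCommMonoid M] [Module k M]

theorem rTensor_map_equiv (f : V →ₗ[k] M) (e : V ≃ₗ[k] V') (T : V ⊗[k] V) :
    LinearMap.rTensor V' (f ∘ₗ e.symm.toLinearMap)
      (TensorProduct.map e.toLinearMap e.toLinearMap T) =
      LinearMap.lTensor M e.toLinearMap (LinearMap.rTensor V f T) := by
  induction T with
  | zero => simp
  | add x y hx hy => simp only [map_add, hx, hy]
  | tmul x y => simp

theorem lTensor_map_equiv (f : V →ₗ[k] M) (e : V ≃ₗ[k] V') (T : V ⊗[k] V) :
    LinearMap.lTensor V' (f ∘ₗ e.symm.toLinearMap)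
      (TensorProduct.map e.toLinearMap e.toLinearMap T) =
      LinearMap.rTensor M e.toLinearMap (LinearMap.lTensor V f T) := by
  induction T with
  | zero => simp
  | add x y hx hy => simp only [map_add, hx, hy]
  | tmul x y => simp

end Transfer

/-! ### The projections to `B` and `C̄` as module and coalgebra maps -/

namespace IsSmashBialgebra

variable (hW : IsSmashBialgebra R jC jH jB) (hD : IsBarDual R S)

/-- The projection of the two-sided smash product to `B`. -/
def toB : W →ₗ[k] B := projB k H B ∘ₗ hW.equiv.symm.toLinearMap

/-- The projection of the two-sided smash product to `C̄`. -/
def toC : W →ₗ[k] Module.Dual k B := projC k H B ∘ₗ hW.equiv.symm.toLinearMap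

theorem toB_equiv (s : Space k H B) : hW.toB (hW.equiv s) = projB k H B s := by
  simp [toB]

theorem toC_equiv (s : Space k H B) : hW.toC (hW.equiv s) = projC k H B s := by
  simp [toC]

theorem toB_apply (c : Module.Dual k B) (h : H) (b : B) :
    hW.toB (jC c * (jH h * jB b)) = c 1 • counit (R := k) h • b := by
  rw [← hW.equiv_tmul, toB_equiv, projB_tmul]

theorem toC_apply (c : Module.Dual k B) (h : H) (b : B) :
    hW.toC (jC c * (jH h * jB b)) = (counit (R := k) h * counit (R := k) b) • c := by
  rw [← hW.equiv_tmul, toC_equiv, projC_tmul]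

/-- Together with `toB_mul_H` and `toB_mul_C` this makes `toB` right linear, W acting on `B` by
multiplication, by ◁ and, for `C̄`, through the counit. The lemmas on `toC` are the left-handed
counterparts. -/
theorem toB_mul_B (x : W) (a : B) : hW.toB (x * jB a) = hW.toB x * a := by
  induction x using hW.toIsSmash.induction with
  | zero => simp
  | add x y hx hy => simp only [map_add, add_mul, hx, hy]
  | mul c h b => rw [mul_assoc, mul_assoc, ← hW.map_mul, toB_apply, toB_apply]; simp

theorem toC_C_mul (c : Module.Dual k B) (x : W) :
    hW.toC (jC c * x) = dualMul k B c (hW.toC x) := by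
  induction x using hW.toIsSmash.induction with
  | zero => simp
  | add x y hx hy => simp only [map_add, mul_add, hx, hy]
  | mul d h b => rw [← mul_assoc, ← hW.map_dualMul, toC_apply, toC_apply]; simp

theorem toB_mul_H (x : W) (g : H) : hW.toB (x * jH g) = rAct k H B g (hW.toB x) := by
  induction x using hW.toIsSmash.induction with
  | zero => simp
  | add x y hx hy => simp only [map_add, add_mul, hx, hy]
  | mul c h b =>
    have h1 : ∀ X : H ⊗[k] H, hW.toB (jC c * (jH h * mulMap jH.toLinearMap (jB ∘ₗ ract k H b) X)) =
        c 1 • counit (R := k) h •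
          rAct k H B (TensorProduct.lid k H (LinearMap.rTensor H counit X)) b := by
      intro X
      induction X with
      | zero => simp
      | add x y hx hy => simp only [map_add, mul_add, LinearMap.add_apply, smul_add, hx, hy]
      | tmul x y =>
        rw [mulMap_tmul, ← mul_assoc (jH h), AlgHom.toLinearMap_apply, ← map_mul,
          LinearMap.comp_apply, toB_apply]
        simp [smul_smul]
    have h2 := hW.relRight b g
    rw [AlgHom.toLinearMap_apply] at h2
    rw [mul_assoc, mul_assoc, h2, h1, toB_apply]
    simp

theorem toC_H_mul (g : H) (x : W) : hW.toC (jH g * x) = lAct k H B g (hW.toC x) := by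
  induction x using hW.toIsSmash.induction with
  | zero => simp
  | add x y hx hy => simp only [map_add, mul_add, hx, hy]
  | mul c h b =>
    have h1 : ∀ X : H ⊗[k] H, hW.toC (mulMap (jC ∘ₗ lact H c) jH.toLinearMap X * (jH h * jB b)) =
        (counit (R := k) h * counit (R := k) b) •
          lAct k H B (TensorProduct.rid k H (LinearMap.lTensor H counit X)) c := by
      intro X
      induction X with
      | zero => simp
      | add x y hx hy => simp only [map_add, add_mul, LinearMap.add_apply, smul_add, hx, hy]
      | tmul x y =>
        rw [mulMap_tmul, mul_assoc, ← mul_assoc (jH.toLinearMap y), AlgHom.toLinearMap_apply,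
          ← map_mul, LinearMap.comp_apply, toC_apply]
        simp [smul_smul]
        congr 1
        ring
    have h2 := hW.relLeft g c
    rw [AlgHom.toLinearMap_apply] at h2
    rw [← mul_assoc, h2, h1, toC_apply]
    simp

theorem toB_mul_C (hD : IsBarDual R S) (x : W) (d : Module.Dual k B) :
    hW.toB (x * jC d) = d 1 • hW.toB x := by
  induction x using hW.toIsSmash.induction with
  | zero => simp
  | add x y hx hy => simp only [map_add, add_mul, smul_add, hx, hy]
  | mul c h b =>
    have h1 : ∀ X : H ⊗[k] H, hW.toB (jC c * (mulMap (jC ∘ₗ lact H d) jH.toLinearMap X * jB b)) =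
        (d 1 * c 1 * counit (TensorProduct.lid k H (LinearMap.rTensor H counit X))) • b := by
      intro X
      induction X with
      | zero => simp
      | add x y hx hy => simp only [map_add, add_mul, mul_add, add_smul, hx, hy]
      | tmul x y =>
        rw [mulMap_tmul, mul_assoc, ← mul_assoc (jC c), AlgHom.toLinearMap_apply,
          LinearMap.comp_apply, ← hW.map_dualMul, toB_apply, dualMul_apply_one hD.group]
        simp [smul_smul, lAct_apply_one hD.group]
        congr 1
        ring
    have h2 := hW.relLeft h d
    rw [AlgHom.toLinearMap_apply] at h2
    rw [mul_assoc, mul_assoc, ← (hW.comm d b).eq, ← mul_assoc (jH h), h2, h1, toB_apply]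
    simp [smul_smul, mul_assoc]

theorem toC_B_mul (hD : IsBarDual R S) (b : B) (x : W) :
    hW.toC (jB b * x) = counit (R := k) b • hW.toC x := by
  induction x using hW.toIsSmash.induction with
  | zero => simp
  | add x y hx hy => simp only [map_add, mul_add, smul_add, hx, hy]
  | mul c h a =>
    have h1 : ∀ X : H ⊗[k] H, hW.toC (jC c * (mulMap jH.toLinearMap (jB ∘ₗ ract k H b) X * jB a)) =
        (counit (R := k) b * (counit (R := k) a *
          counit (TensorProduct.lid k H (LinearMap.rTensor H counit X)))) • c := by
      intro X
      induction X with
      | zero => simp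
      | add x y hx hy => simp only [map_add, add_mul, mul_add, add_smul, hx, hy]
      | tmul x y =>
        rw [mulMap_tmul, mul_assoc, AlgHom.toLinearMap_apply,
          LinearMap.comp_apply, ← hW.map_mul, toC_apply, hD.group.counit_mul]
        simp [counit_rAct hD.group]
        congr 1
        ring
    have h2 := hW.relRight b h
    rw [AlgHom.toLinearMap_apply] at h2
    rw [← mul_assoc, ← (hW.comm c b).eq, mul_assoc, ← mul_assoc (jB b), h2, h1, toC_apply]
    simp [smul_smul, mul_comm]

include hD

theorem rTensor_toC_comul (c : Module.Dual k B) (h : H) (b : B) :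
    LinearMap.rTensor W hW.toC (comul (jC c * (jH h * jB b))) =
      LinearMap.lTensor _ (LinearMap.mulRight k (jH h * jB b) ∘ₗ jC) (barComul R c) := by
  rw [← hW.equiv_tmul, hW.comul_equiv hD, toC, rTensor_map_equiv, rTensor_projC_comul hD,
    ← LinearMap.lTensor_comp_apply]
  rfl

theorem lTensor_toC_comul (c : Module.Dual k B) (h : H) (b : B) :
    LinearMap.lTensor W hW.toC (comul (jC c * (jH h * jB b))) =
      LinearMap.rTensor _ (LinearMap.mulRight k (jH h * jB b) ∘ₗ mulMap jC jH.toLinearMap)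
        (TensorProduct.map₂ (TensorProduct.mk k _ _).flip (lAct k H B) (↑R⁻¹ : H ⊗[k] H)
          (barComul R c)) := by
  rw [← hW.equiv_tmul, hW.comul_equiv hD, toC, lTensor_map_equiv, lTensor_projC_comul hD,
    ← LinearMap.rTensor_comp_apply]
  congr 2
  apply TensorProduct.ext'
  intro x y
  simp [hW.equiv_tmul, mul_assoc]

theorem rTensor_toB_comul (c : Module.Dual k B) (h : H) (b : B) :
    LinearMap.rTensor W hW.toB (comul (jC c * (jH h * jB b))) =
      LinearMap.lTensor _ (LinearMap.mulLeft k (jC c * jH h) ∘ₗ mulMap jH.toLinearMap jB)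
        (TensorProduct.map₂ (rAct k H B) (TensorProduct.mk k H B) (R : H ⊗[k] H) (comul b)) := by
  rw [← hW.equiv_tmul, hW.comul_equiv hD, toB, rTensor_map_equiv, rTensor_projB_comul hD,
    ← LinearMap.lTensor_comp_apply]
  congr 2
  apply TensorProduct.ext'
  intro x y
  simp [hW.equiv_tmul, mul_assoc]

theorem lTensor_toB_comul (c : Module.Dual k B) (h : H) (b : B) :
    LinearMap.lTensor W hW.toB (comul (jC c * (jH h * jB b))) =
      LinearMap.rTensor _ (LinearMap.mulLeft k (jC c * jH h) ∘ₗ jB) (comul b) := by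
  rw [← hW.equiv_tmul, hW.comul_equiv hD, toB, lTensor_map_equiv, lTensor_projB_comul hD,
    ← LinearMap.rTensor_comp_apply]
  congr 2
  ext x
  simp [hW.equiv_tmul]

/-- Projecting the second tensor factor already removes R⁻¹ and R, so the braided coproduct of `B`
remains. Pairings on W ⊗ W can then be convolved inside `B` and `C̄`. -/
theorem map_toB_comul (x : W) :
    TensorProduct.map hW.toB hW.toB (comul x) = comul (R := k) (hW.toB x) := by
  induction x using hW.toIsSmash.induction with
  | zero => simp
  | add x y hx hy => simp only [map_add, hx, hy]
  | mul c h b =>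
    rw [← LinearMap.rTensor_comp_lTensor, LinearMap.comp_apply, hW.lTensor_toB_comul hD,
      ← LinearMap.rTensor_comp_apply, toB_apply, map_smul, map_smul, smul_smul]
    have : hW.toB ∘ₗ LinearMap.mulLeft k (jC c * jH h) ∘ₗ jB =
        (c 1 * counit (R := k) h) • LinearMap.id := by
      ext a
      simp [toB_apply, smul_smul]
    rw [this, LinearMap.rTensor_smul]
    simp

theorem map_toC_comul (x : W) :
    TensorProduct.map hW.toC hW.toC (comul x) = barComul R (hW.toC x) := by
  induction x using hW.toIsSmash.induction with
  | zero => simp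
  | add x y hx hy => simp only [map_add, hx, hy]
  | mul c h b =>
    rw [← LinearMap.lTensor_comp_rTensor, LinearMap.comp_apply, hW.rTensor_toC_comul hD,
      ← LinearMap.lTensor_comp_apply, toC_apply, map_smul]
    have : hW.toC ∘ₗ LinearMap.mulRight k (jH h * jB b) ∘ₗ jC =
        (counit (R := k) h * counit (R := k) b) • LinearMap.id := by
      refine LinearMap.ext fun c => ?_
      simp [mul_assoc, toC_apply]
    rw [this, LinearMap.lTensor_smul]
    simp

theorem counit_toB (x : W) : counit (R := k) (hW.toB x) = counit (R := k) x := by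
  induction x using hW.toIsSmash.induction with
  | zero => simp
  | add x y hx hy => simp only [map_add, hx, hy]
  | mul c h b =>
    rw [toB_apply, Bialgebra.counit_mul, Bialgebra.counit_mul, hW.counit_C, hW.counit_H,
      hW.counit_B]
    simp

theorem toC_apply_one (x : W) : hW.toC x 1 = counit (R := k) x := by
  induction x using hW.toIsSmash.induction with
  | zero => simp
  | add x y hx hy => simp only [map_add, LinearMap.add_apply, hx, hy]
  | mul c h b =>
    rw [toC_apply, Bialgebra.counit_mul, Bialgebra.counit_mul, hW.counit_C, hW.counit_H,
      hW.counit_B]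
    simp [mul_comm]

/-! #### The two-cocycle -/

omit hD

/-- The two-cocycle `x ⊗ y ↦ ⟨toC y, toB x⟩`. -/
def cocycle : W ⊗[k] W →ₗ[k] k :=
  TensorProduct.lift ((Module.Dual.eval k B).compl₁₂ hW.toB hW.toC)

/-- The inverse two-cocycle `x ⊗ y ↦ ⟨S̄ (toC y), toB x⟩`. -/
def cocycleInv (S : B ≃ₗ[k] B) : W ⊗[k] W →ₗ[k] k :=
  TensorProduct.lift ((Module.Dual.eval k B).compl₁₂ hW.toB (barAntipode S ∘ₗ hW.toC))

theorem cocycle_tmul (x y : W) : hW.cocycle (x ⊗ₜ y) = hW.toC y (hW.toB x) := rfl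

theorem cocycleInv_tmul (x y : W) :
    hW.cocycleInv S (x ⊗ₜ y) = barAntipode S (hW.toC y) (hW.toB x) := rfl

include hD

theorem toB_one : hW.toB (1 : W) = 1 := by
  have := hW.toB_apply counit 1 1
  rw [hW.map_counit, map_one, hW.map_one, one_mul, one_mul, hD.group.counit_one] at this
  simpa using this

theorem toC_one : hW.toC (1 : W) = counit := by
  have := hW.toC_apply counit 1 1
  rw [hW.map_counit, map_one, hW.map_one, one_mul, one_mul, hD.group.counit_one] at this
  simpa using this

/-- The product of `B*` is dual to the coproduct of `B`, so the convolution of the two pairings is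
⟨c₁ S̄c₂, b⟩ with c = toC y and b = toB x. -/
theorem conv_cocycle_cocycleInv : conv hW.cocycle (hW.cocycleInv S) = counit := by
  apply TensorProduct.ext'
  intro x y
  have h1 : ∀ T Y : W ⊗[k] W, mulMap hW.cocycle (hW.cocycleInv S)
      (TensorProduct.tensorTensorTensorComm k W W W W (T ⊗ₜ Y)) =
      dualDistrib k B B (LinearMap.lTensor _ (barAntipode S)
        (TensorProduct.map hW.toC hW.toC Y)) (TensorProduct.map hW.toB hW.toB T) := by
    intro T Y
    induction T with
    | zero => simp
    | add x y hx hy => simp only [map_add, add_tmul, hx, hy]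
    | tmul x x' =>
      induction Y with
      | zero => simp
      | add x y hx hy => simp only [map_add, tmul_add, LinearMap.add_apply, hx, hy]
      | tmul y y' => simp [cocycle_tmul, cocycleInv_tmul]
  have h2 : ∀ (b : B) (T : Module.Dual k B ⊗[k] Module.Dual k B),
      dualDistrib k B B T (comul b) = TensorProduct.lift (dualMul k B) T b := by
    intro b T
    induction T with
    | zero => simp
    | add x y hx hy => simp only [map_add, LinearMap.add_apply, hx, hy]
    | tmul c d => rfl
  rw [conv_apply, TensorProduct.comul_tmul]
  refine (h1 _ _).trans ?_
  rw [hW.map_toB_comul hD, hW.map_toC_comul hD, h2,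
    dualMul_barAntipode_right hD.quasitriangular hD.group, hW.toC_apply_one hD,
    TensorProduct.counit_tmul, LinearMap.smul_apply, hW.counit_toB hD]

theorem conv_cocycleInv_cocycle : conv (hW.cocycleInv S) hW.cocycle = counit := by
  apply TensorProduct.ext'
  intro x y
  have h1 : ∀ T Y : W ⊗[k] W, mulMap (hW.cocycleInv S) hW.cocycle
      (TensorProduct.tensorTensorTensorComm k W W W W (T ⊗ₜ Y)) =
      dualDistrib k B B (LinearMap.rTensor _ (barAntipode S)
        (TensorProduct.map hW.toC hW.toC Y)) (TensorProduct.map hW.toB hW.toB T) := by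
    intro T Y
    induction T with
    | zero => simp
    | add x y hx hy => simp only [map_add, add_tmul, hx, hy]
    | tmul x x' =>
      induction Y with
      | zero => simp
      | add x y hx hy => simp only [map_add, tmul_add, LinearMap.add_apply, hx, hy]
      | tmul y y' => simp [cocycle_tmul, cocycleInv_tmul]
  have h2 : ∀ (b : B) (T : Module.Dual k B ⊗[k] Module.Dual k B),
      dualDistrib k B B T (comul b) = TensorProduct.lift (dualMul k B) T b := by
    intro b T
    induction T with
    | zero => simp
    | add x y hx hy => simp only [map_add, LinearMap.add_apply, hx, hy]
    | tmul c d => rfl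
  rw [conv_apply, TensorProduct.comul_tmul]
  refine (h1 _ _).trans ?_
  rw [hW.map_toB_comul hD, hW.map_toC_comul hD, h2,
    dualMul_barAntipode_left hD.quasitriangular hD.group, hW.toC_apply_one hD,
    TensorProduct.counit_tmul, LinearMap.smul_apply, hW.counit_toB hD]

omit hD in
theorem contract_cocycle (T Y : W ⊗[k] W) :
    TensorProduct.lid k _ (LinearMap.rTensor _ hW.cocycle
        (TensorProduct.tensorTensorTensorComm k W W W W (T ⊗ₜ Y))) =
      TensorProduct.lid k (W ⊗[k] W)
        (LinearMap.rTensor _ (TensorProduct.lift (Module.Dual.eval k B))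
          (TensorProduct.tensorTensorTensorComm k B W _ W (LinearMap.rTensor W hW.toB T ⊗ₜ
            LinearMap.rTensor W hW.toC Y))) := by
  induction T with
  | zero => simp
  | add x y hx hy => simp only [map_add, add_tmul, hx, hy]
  | tmul x x' =>
    induction Y with
    | zero => simp
    | add x y hx hy => simp only [map_add, tmul_add, hx, hy]
    | tmul y y' => simp [cocycle_tmul]

/-- `σ(x₍₁₎, y₍₁₎) toB (x₍₂₎ y₍₂₎)`, for `y = d h a`. -/
theorem toB_leftAct_cocycle (x : W) (d : Module.Dual k B) (h : H) (a : B) :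
    hW.toB (LinearMap.mul' k W (leftAct hW.cocycle (x ⊗ₜ (jC d * (jH h * jB a))))) =
      rAct k H B h (TensorProduct.lid k B (LinearMap.rTensor B d (comul (hW.toB x)))) * a := by
  have h2 : ∀ (T : B ⊗[k] W) (Y : Module.Dual k B ⊗[k] Module.Dual k B),
      hW.toB (LinearMap.mul' k W (TensorProduct.lid k _
      (LinearMap.rTensor _ (TensorProduct.lift (Module.Dual.eval k B))
        (TensorProduct.tensorTensorTensorComm k B W _ W (T ⊗ₜ
          LinearMap.lTensor _ (LinearMap.mulRight k (jH h * jB a) ∘ₗ jC) Y))))) =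
      rAct k H B h (TensorProduct.lid k B (LinearMap.rTensor B
        (TensorProduct.rid k _ (LinearMap.lTensor _ (Module.Dual.eval k B 1) Y))
          (LinearMap.lTensor B hW.toB T))) * a := by
    intro T Y
    induction T with
    | zero => simp
    | add x y hx hy => simp only [map_add, add_tmul, add_mul, hx, hy]
    | tmul x x' =>
      induction Y with
      | zero => simp
      | add x y hx hy =>
        simp only [map_add, tmul_add, LinearMap.rTensor_add, LinearMap.add_apply, add_mul, hx, hy]
      | tmul y y' =>
        simp only [LinearMap.lTensor_tmul, LinearMap.rTensor_tmul, LinearMap.comp_apply,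
          tensorTensorTensorComm_tmul, TensorProduct.lift.tmul, Module.Dual.eval_apply,
          TensorProduct.lid_tmul, map_smul,
          LinearMap.mulRight_apply, LinearMap.mul'_apply, TensorProduct.rid_tmul,
          LinearMap.smul_apply]
        rw [← mul_assoc, ← mul_assoc, hW.toB_mul_B, hW.toB_mul_H, hW.toB_mul_C hD]
        simp [smul_smul, mul_comm]
  -- As `C̄` acts through its counit under `toB`, only c₁ of the coproduct of d is paired; the
  -- counit axiom of `C̄` returns d.
  have h3 : TensorProduct.rid k _ (LinearMap.lTensor _ (Module.Dual.eval k B 1)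
      (barComul R d)) = d := by
    have h2 : (Module.Dual.eval k B 1 : Module.Dual k B →ₗ[k] k) = counit :=
      LinearMap.ext fun c => (hD.counit_eq c).symm
    rw [h2, ← hD.comul_eq]
    simp
  rw [leftAct_apply, TensorProduct.comul_tmul]
  refine (congrArg (fun V => hW.toB (LinearMap.mul' k W V))
    (hW.contract_cocycle _ _)).trans ?_
  rw [hW.rTensor_toC_comul hD, h2, h3, ← hW.map_toB_comul hD, ← LinearMap.lTensor_comp_rTensor]
  rfl

/-- `σ(y₍₁₎, z₍₁₎) toC (y₍₂₎ z₍₂₎)`, for `y = d h a`. -/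
theorem toC_leftAct_cocycle (z : W) (d : Module.Dual k B) (h : H) (a b : B) :
    hW.toC (LinearMap.mul' k W (leftAct hW.cocycle ((jC d * (jH h * jB a)) ⊗ₜ z))) b =
      hW.toC z (rAct k H B h (TensorProduct.lid k B (LinearMap.rTensor B d (comul b))) * a) := by
  set b' := rAct k H B h (TensorProduct.lid k B (LinearMap.rTensor B d (comul b))) with hb'
  have h0 : ∀ c : Module.Dual k B, dualMul k B d c b =
      c (TensorProduct.lid k B (LinearMap.rTensor B d (comul b))) := by
    intro c
    rw [dualMul_apply]
    generalize comul (R := k) b = T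
    induction T with
    | zero => simp
    | add x y hx hy => simp only [map_add, hx, hy]
    | tmul x y => simp
  have h2 : ∀ (Z : B ⊗[k] (H ⊗[k] B)) (Y : Module.Dual k B ⊗[k] W),
      hW.toC (LinearMap.mul' k W (TensorProduct.lid k _
      (LinearMap.rTensor _ (TensorProduct.lift (Module.Dual.eval k B))
        (TensorProduct.tensorTensorTensorComm k B W _ W
          (LinearMap.lTensor _ (LinearMap.mulLeft k (jC d * jH h) ∘ₗ mulMap jH.toLinearMap jB) Z
            ⊗ₜ Y))))) b =
      dualDistrib k B B (LinearMap.lTensor _ hW.toC Y) (LinearMap.lTensor B (ract k H b' ∘ₗ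
        (TensorProduct.rid k H).toLinearMap ∘ₗ LinearMap.lTensor H counit) Z) := by
    intro Z Y
    induction Z with
    | zero => simp
    | add x y hx hy => simp only [map_add, add_tmul, LinearMap.add_apply, hx, hy]
    | tmul x Z =>
      induction Z with
      | zero => simp
      | add x y hx hy => simp only [map_add, add_tmul, tmul_add, LinearMap.add_apply, hx, hy]
      | tmul g a' =>
        induction Y with
        | zero => simp
        | add x y hx hy =>
          simp only [map_add, tmul_add, LinearMap.add_apply, hx, hy]
        | tmul y y' =>
          simp only [LinearMap.lTensor_tmul, LinearMap.rTensor_tmul, LinearMap.comp_apply,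
            tensorTensorTensorComm_tmul, TensorProduct.lift.tmul, Module.Dual.eval_apply,
            TensorProduct.lid_tmul, map_smul, LinearMap.mulLeft_apply, LinearMap.mul'_apply,
            mulMap_tmul, AlgHom.toLinearMap_apply]
          rw [mul_assoc, mul_assoc, mul_assoc, hW.toC_C_mul, hW.toC_H_mul, hW.toC_H_mul,
            hW.toC_B_mul hD]
          simp [h0, lAct_apply, ← hb']
          ring
  have h3 : ∀ (X : H ⊗[k] H) (V : B ⊗[k] B), LinearMap.lTensor B (ract k H b' ∘ₗ
        (TensorProduct.rid k H).toLinearMap ∘ₗ LinearMap.lTensor H counit)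
        (TensorProduct.map₂ (rAct k H B) (TensorProduct.mk k H B) X V) =
      TensorProduct.map₂ (rAct k H B) (rAct k H B) X
        (TensorProduct.rid k B (LinearMap.lTensor B counit V) ⊗ₜ b') := by
    intro X V
    induction X with
    | zero => simp
    | add x y hx hy => simp only [map_add, LinearMap.add_apply, hx, hy]
    | tmul x x' =>
      induction V with
      | zero => simp
      | add x y hx hy => simp only [map_add, add_tmul, hx, hy]
      | tmul v v' => simp [smul_tmul']
  rw [leftAct_apply, TensorProduct.comul_tmul]
  refine (congrArg (fun V => hW.toC (LinearMap.mul' k W V) b)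
    (hW.contract_cocycle _ _)).trans ?_
  -- The R in the coproduct of d h a and the R⁻¹ in the coproduct of `C̄` cancel here, which leaves
  -- toC z evaluated at b' a, in this order.
  rw [hW.rTensor_toB_comul hD, h2, h3, ← LinearMap.comp_apply (LinearMap.lTensor _ _),
    LinearMap.lTensor_comp_rTensor, hW.map_toC_comul hD, dualDistrib_barComul,
    lTensor_counit_comul, TensorProduct.rid_tmul, one_smul, twistedMul_inv_map₂]

/-- For y = d h a, right linearity of `toB` computes one side of the cocycle identity and left
linearity of `toC` the other; both are toC z at ((d(β₁)β₂) ◁ h) a, where β = toB x. -/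
theorem isTwoCocycle : IsTwoCocycle hW.cocycle (hW.cocycleInv S) where
  conv_inv := hW.conv_cocycle_cocycleInv hD
  inv_conv := hW.conv_cocycleInv_cocycle hD
  one_left x := by rw [cocycle_tmul, hW.toB_one hD, hW.toC_apply_one hD]
  one_right x := by rw [cocycle_tmul, hW.toC_one hD, hW.counit_toB hD]
  cocycle x y z := by
    induction y using hW.toIsSmash.induction with
    | zero => simp
    | add x y hx hy => simp only [map_add, tmul_add, add_tmul, hx, hy]
    | mul d h a =>
      rw [cocycle_tmul, cocycle_tmul, hW.toB_leftAct_cocycle hD, hW.toC_leftAct_cocycle hD]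

end IsSmashBialgebra

end Bar

/-! ### Products with group-like behaviour in a twist -/

section TwistProduct

variable {W : Type*} [Ring W] [Bialgebra k W]
variable {V : Type*} [AddCommGroup V] [Module k V] {ρ : W ⊗[k] W →ₗ[k] k} {f : W →ₗ[k] V}
  {G : V →ₗ[k] W →ₗ[k] k}

/-- If ρ sees its first argument only through f, and x is coinvariant for f, then the action of ρ on
x ⊗ y involves only ρ(1, ·) = ε. -/
theorem leftAct_tmul_of_left (hρ : ∀ a b, ρ (a ⊗ₜ b) = G (f a) b) {x : W}
    (hx : LinearMap.rTensor W f (comul x) = f 1 ⊗ₜ x) (h1 : ∀ b, ρ (1 ⊗ₜ b) = counit b) (y : W) :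
    leftAct ρ (x ⊗ₜ y) = x ⊗ₜ y := by
  have h : ∀ T Y : W ⊗[k] W, TensorProduct.lid k _ (LinearMap.rTensor _ ρ
      (TensorProduct.tensorTensorTensorComm k W W W W (T ⊗ₜ Y))) =
      TensorProduct.lid k _ (TensorProduct.map₂ G (TensorProduct.mk k W W)
        (LinearMap.rTensor W f T) Y) := by
    intro T Y
    induction T with
    | zero => simp
    | add x y hx hy => simp only [map_add, add_tmul, LinearMap.add_apply, hx, hy]
    | tmul x x' =>
      induction Y with
      | zero => simp
      | add x y hx hy => simp only [map_add, tmul_add, hx, hy]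
      | tmul y y' => simp [hρ]
  have h2 : G (f 1) = counit := LinearMap.ext fun b => by rw [← hρ, h1]
  rw [leftAct_apply, TensorProduct.comul_tmul]
  refine (h _ _).trans ?_
  rw [hx, TensorProduct.map₂_apply_tmul, h2, ← LinearMap.lTensor_comp_rTensor,
    LinearMap.comp_apply, rTensor_counit_comul]
  simp

theorem leftAct_tmul_of_right (hρ : ∀ a b, ρ (a ⊗ₜ b) = G (f b) a) {y : W}
    (hy : LinearMap.rTensor W f (comul y) = f 1 ⊗ₜ y) (h1 : ∀ a, ρ (a ⊗ₜ 1) = counit a) (x : W) :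
    leftAct ρ (x ⊗ₜ y) = x ⊗ₜ y := by
  have h : ∀ T Y : W ⊗[k] W, TensorProduct.lid k _ (LinearMap.rTensor _ ρ
      (TensorProduct.tensorTensorTensorComm k W W W W (T ⊗ₜ Y))) =
      TensorProduct.lid k _ (TensorProduct.map₂ G (TensorProduct.mk k W W).flip
        (LinearMap.rTensor W f Y) T) := by
    intro T Y
    induction Y with
    | zero => simp
    | add x y hx hy => simp only [map_add, tmul_add, LinearMap.add_apply, hx, hy]
    | tmul x x' =>
      induction T with
      | zero => simp
      | add x y hx hy => simp only [map_add, add_tmul, hx, hy]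
      | tmul y y' => simp [hρ]
  have h2 : G (f 1) = counit := LinearMap.ext fun b => by rw [← hρ, h1]
  rw [leftAct_apply, TensorProduct.comul_tmul]
  refine (h _ _).trans ?_
  rw [hy, TensorProduct.map₂_apply_tmul, h2, ← LinearMap.lTensor_comp_rTensor,
    LinearMap.comp_apply, rTensor_counit_comul]
  simp

theorem rightAct_tmul_of_left (hρ : ∀ a b, ρ (a ⊗ₜ b) = G (f a) b) {x : W}
    (hx : LinearMap.lTensor W f (comul x) = x ⊗ₜ f 1) (h1 : ∀ b, ρ (1 ⊗ₜ b) = counit b) (y : W) :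
    rightAct ρ (x ⊗ₜ y) = x ⊗ₜ y := by
  have h : ∀ T Y : W ⊗[k] W, TensorProduct.rid k _ (LinearMap.lTensor _ ρ
      (TensorProduct.tensorTensorTensorComm k W W W W (T ⊗ₜ Y))) =
      TensorProduct.rid k _ (TensorProduct.map₂ (TensorProduct.mk k W W) G
        (LinearMap.lTensor W f T) Y) := by
    intro T Y
    induction T with
    | zero => simp
    | add x y hx hy => simp only [map_add, add_tmul, LinearMap.add_apply, hx, hy]
    | tmul x x' =>
      induction Y with
      | zero => simp
      | add x y hx hy => simp only [map_add, tmul_add, hx, hy]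
      | tmul y y' => simp [hρ]
  have h2 : G (f 1) = counit := LinearMap.ext fun b => by rw [← hρ, h1]
  rw [rightAct_apply, TensorProduct.comul_tmul]
  refine (h _ _).trans ?_
  rw [hx, TensorProduct.map₂_apply_tmul, h2, ← LinearMap.rTensor_comp_lTensor,
    LinearMap.comp_apply, lTensor_counit_comul]
  simp

theorem rightAct_tmul_of_right (hρ : ∀ a b, ρ (a ⊗ₜ b) = G (f b) a) {y : W}
    (hy : LinearMap.lTensor W f (comul y) = y ⊗ₜ f 1) (h1 : ∀ a, ρ (a ⊗ₜ 1) = counit a) (x : W) :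
    rightAct ρ (x ⊗ₜ y) = x ⊗ₜ y := by
  have h : ∀ T Y : W ⊗[k] W, TensorProduct.rid k _ (LinearMap.lTensor _ ρ
      (TensorProduct.tensorTensorTensorComm k W W W W (T ⊗ₜ Y))) =
      TensorProduct.rid k _ (TensorProduct.map₂ (TensorProduct.mk k W W).flip G
        (LinearMap.lTensor W f Y) T) := by
    intro T Y
    induction Y with
    | zero => simp
    | add x y hx hy => simp only [map_add, tmul_add, LinearMap.add_apply, hx, hy]
    | tmul x x' =>
      induction T with
      | zero => simp
      | add x y hx hy => simp only [map_add, add_tmul, hx, hy]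
      | tmul y y' => simp [hρ]
  have h2 : G (f 1) = counit := LinearMap.ext fun b => by rw [← hρ, h1]
  rw [rightAct_apply, TensorProduct.comul_tmul]
  refine (h _ _).trans ?_
  rw [hy, TensorProduct.map₂_apply_tmul, h2, ← LinearMap.rTensor_comp_lTensor,
    LinearMap.comp_apply, lTensor_counit_comul]
  simp

/-- The linear isomorphism `e` identifies `U` with the twist of `W` by the two-cocycle `σ`. -/
structure IsTwist {U : Type*} [Ring U] [Bialgebra k U] (σ τ : W ⊗[k] W →ₗ[k] k) (e : W ≃ₗ[k] U) :
    Prop where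
  map_one : e 1 = 1
  map_cocycleMul : ∀ x y, e (cocycleMul σ τ (x ⊗ₜ y)) = e x * e y
  counit_map : ∀ x, counit (R := k) (e x) = counit (R := k) x
  comul_map : ∀ x, comul (R := k) (e x) = TensorProduct.map e.toLinearMap e.toLinearMap
    (comul (R := k) x)

/-- Cancelling τ against σ relates the twisted and the untwisted product with one cocycle on each
side. Applied to b ⊗ c it is the source of the exchange relation. -/
theorem cocycleMul_rightAct {σ τ : W ⊗[k] W →ₗ[k] k} (hσ : IsTwoCocycle σ τ) (z : W ⊗[k] W) :
    cocycleMul σ τ (rightAct σ z) = LinearMap.mul' k W (leftAct σ z) := by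
  rw [cocycleMul, LinearMap.comp_apply, LinearMap.comp_apply, ← LinearMap.comp_apply (rightAct τ),
    rightAct_comp_rightAct, hσ.inv_conv, rightAct_counit, LinearMap.id_apply]

end TwistProduct

/-! ### The exchange relation between `B` and `C̄` -/

section Exchange

variable {A : Type*} [Ring A] [Algebra k A]

variable (B) in
/-- `x ⊗ y ↦ ⟨c, b ◁ y⟩ p(x)`. -/
def slotL (p : H →ₗ[k] A) : H ⊗[k] H →ₗ[k] B →ₗ[k] Module.Dual k B →ₗ[k] A :=
  TensorProduct.lift (LinearMap.mk₂ k
    (fun x y => (Module.Dual.eval k B ∘ₗ rAct k H B y).compr₂ (LinearMap.toSpanSingleton k A (p x)))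
    (fun _ _ _ => by ext; simp) (fun r _ _ => by ext; simp [smul_comm r])
    (fun _ _ _ => by ext; simp [add_smul]) (fun _ _ _ => by ext; simp [mul_smul]))

@[simp]
theorem slotL_tmul (p : H →ₗ[k] A) (x y : H) (b : B) (c : Module.Dual k B) :
    slotL B p (x ⊗ₜ y) b c = c (rAct k H B y b) • p x := by
  simp [slotL]

variable (B) in
/-- `x ⊗ y ↦ ⟨c, b ◁ x⟩ p(y)`. -/
def slotR (p : H →ₗ[k] A) : H ⊗[k] H →ₗ[k] B →ₗ[k] Module.Dual k B →ₗ[k] A :=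
  slotL B p ∘ₗ (TensorProduct.comm k H H).toLinearMap

@[simp]
theorem slotR_tmul (p : H →ₗ[k] A) (x y : H) (b : B) (c : Module.Dual k B) :
    slotR B p (x ⊗ₜ y) b c = c (rAct k H B x b) • p y := by
  simp [slotR]

theorem mulMap_smul_left {V W : Type*} [AddCommGroup V] [Module k V] [AddCommGroup W] [Module k W]
    (r : k) (f : V →ₗ[k] A) (g : W →ₗ[k] A) : mulMap (r • f) g = r • mulMap f g := by
  rw [mulMap, TensorProduct.map_smul_left, LinearMap.comp_smul]; rfl

theorem mulMap_smul_right {V W : Type*} [AddCommGroup V] [Module k V] [AddCommGroup W] [Module k W]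
    (r : k) (f : V →ₗ[k] A) (g : W →ₗ[k] A) : mulMap f (r • g) = r • mulMap f g := by
  rw [mulMap, TensorProduct.map_smul_right, LinearMap.comp_smul]; rfl

variable [Coalgebra k (Module.Dual k B)]

/-- `b ↦ c₍₁₎ X⁽¹⁾ ⟨c₍₂₎, b ◁ X⁽²⁾⟩`. -/
def mixL (iC : Module.Dual k B →ₗ[k] A) (iH : H →ₗ[k] A) (X : H ⊗[k] H) (c : Module.Dual k B) :
    B →ₗ[k] A where
  toFun b := conv iC (slotL B iH X b) c
  map_add' x y := by simp [conv, mulMap_add_right]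
  map_smul' r x := by simp [conv, mulMap_smul_right]

/-- `b ↦ ⟨c₍₁₎, b ◁ X⁽¹⁾⟩ X⁽²⁾ c₍₂₎`. -/
def mixR (iC : Module.Dual k B →ₗ[k] A) (iH : H →ₗ[k] A) (X : H ⊗[k] H) (c : Module.Dual k B) :
    B →ₗ[k] A where
  toFun b := conv (slotR B iH X b) iC c
  map_add' x y := by simp [conv, mulMap_add_left]
  map_smul' r x := by simp [conv, mulMap_smul_left]

theorem mixL_apply (iC : Module.Dual k B →ₗ[k] A) (iH : H →ₗ[k] A) (X : H ⊗[k] H)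
    (c : Module.Dual k B) (b : B) : mixL iC iH X c b = mulMap iC (slotL B iH X b) (comul c) := rfl

theorem mixR_apply (iC : Module.Dual k B →ₗ[k] A) (iH : H →ₗ[k] A) (X : H ⊗[k] H)
    (c : Module.Dual k B) (b : B) : mixR iC iH X c b = mulMap (slotR B iH X b) iC (comul c) := rfl

end Exchange

/-! ### Relations of the double, and the products that the twist does not change -/

section Double

variable [FiniteDimensional k B] [Coalgebra k (Module.Dual k B)]
  {R : (H ⊗[k] H)ˣ} {S : B ≃ₗ[k] B}

/-- The bialgebra `U` is the double-bosonisation of `B`. -/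
structure IsDouble {U : Type*} [Ring U] [Bialgebra k U] (R : (H ⊗[k] H)ˣ)
    (iC : Module.Dual k B →ₗ[k] U) (iH : H →ₐ[k] U) (iB : B →ₗ[k] U) : Prop where
  map_dualMul : ∀ c d, iC (dualMul k B c d) = iC c * iC d
  map_counit : iC counit = 1
  map_mul : ∀ a b, iB (a * b) = iB a * iB b
  map_one : iB 1 = 1
  relLeft : RelLeft iC iH.toLinearMap
  relRight : RelRight iB iH.toLinearMap
  /-- `b₍₁₎ c₍₁₎ R⁻⁽¹⁾ ⟨c₍₂₎, b₍₂₎ ◁ R⁻⁽²⁾⟩ = ⟨c₍₁₎, b₍₁₎ ◁ R⁽¹⁾⟩ R⁽²⁾ c₍₂₎ b₍₂₎` -/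
  exchange : ∀ c, conv iB (mixL iC iH.toLinearMap ↑R⁻¹ c) = conv (mixR iC iH.toLinearMap ↑R c) iB
  bijective : Function.Bijective (triple iC iH iB)
  comul_C : ∀ c, comul (R := k) (iC c) = prodC iC iH (inl k U) (inr k U) R c
  comul_H : ∀ h, comul (R := k) (iH h) =
    conv ((inl k U).comp iH).toLinearMap ((inr k U).comp iH).toLinearMap h
  comul_B : ∀ b, comul (R := k) (iB b) = prodB iH iB (inl k U) (inr k U) R b
  counit_C : ∀ c, counit (R := k) (iC c) = c 1
  counit_H : ∀ h, counit (R := k) (iH h) = counit (R := k) h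
  counit_B : ∀ b, counit (R := k) (iB b) = counit (R := k) b

variable {W : Type*} [Ring W] [Bialgebra k W]
  {jC : Module.Dual k B →ₗ[k] W} {jH : H →ₐ[k] W} {jB : B →ₗ[k] W}

namespace IsSmashBialgebra

variable (hW : IsSmashBialgebra R jC jH jB) (hD : IsBarDual R S)

theorem cocycle_eq_left (a b : W) : hW.cocycle (a ⊗ₜ b) =
    ((Module.Dual.eval k B).compl₂ hW.toC) (hW.toB a) b := rfl

theorem cocycle_eq_right (a b : W) : hW.cocycle (a ⊗ₜ b) =
    LinearMap.lcomp k k hW.toB (hW.toC b) a := rfl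

theorem cocycleInv_eq_left (a b : W) : hW.cocycleInv S (a ⊗ₜ b) =
    ((Module.Dual.eval k B).compl₂ (barAntipode S ∘ₗ hW.toC)) (hW.toB a) b := rfl

theorem cocycleInv_eq_right (a b : W) : hW.cocycleInv S (a ⊗ₜ b) =
    (LinearMap.lcomp k k hW.toB ∘ₗ barAntipode S) (hW.toC b) a := rfl

include hD

/-- On products of `C̄` and `H` the `B`-part of the coproduct is 1 ⊗ 1, on which R acts by the
counit. This coinvariance makes the cocycle trivial there. -/
theorem rTensor_toB_comul_CH (c : Module.Dual k B) (h : H) :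
    LinearMap.rTensor W hW.toB (comul (jC c * jH h)) = hW.toB 1 ⊗ₜ (jC c * jH h) := by
  have h1 := hW.rTensor_toB_comul hD c h 1
  have h2 : ∀ X : H ⊗[k] H, LinearMap.lTensor B
      (LinearMap.mulLeft k (jC c * jH h) ∘ₗ mulMap jH.toLinearMap jB)
      (TensorProduct.map₂ (rAct k H B) (TensorProduct.mk k H B) X (1 ⊗ₜ 1)) =
      (1 : B) ⊗ₜ (jC c * jH (h * TensorProduct.lid k H (LinearMap.rTensor H counit X))) := by
    intro X
    induction X with
    | zero => simp
    | add x y hx hy =>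
      simp only [map_add, mul_add, tmul_add, LinearMap.add_apply, hx, hy]
    | tmul x y =>
      simp [one_rAct hD.group, hW.map_one, smul_tmul', Algebra.algebraMap_eq_smul_one]
  rw [hW.map_one, mul_one, hD.group.comul_one, h2,
    (normalized_rmat hD.quasitriangular).left] at h1
  simpa [hW.toB_one hD] using h1

theorem lTensor_toB_comul_CH (c : Module.Dual k B) (h : H) :
    LinearMap.lTensor W hW.toB (comul (jC c * jH h)) = (jC c * jH h) ⊗ₜ hW.toB 1 := by
  have h1 := hW.lTensor_toB_comul hD c h 1
  rw [hW.map_one, mul_one, hD.group.comul_one] at h1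
  simpa [hW.toB_one hD, hW.map_one] using h1

theorem rTensor_toC_comul_HB (h : H) (b : B) :
    LinearMap.rTensor W hW.toC (comul (jH h * jB b)) = hW.toC 1 ⊗ₜ (jH h * jB b) := by
  have h1 := hW.rTensor_toC_comul hD counit h b
  rw [hW.map_counit, one_mul, barComul_counit hD.quasitriangular hD.group] at h1
  simpa [hW.toC_one hD, hW.map_counit] using h1

theorem lTensor_toC_comul_HB (h : H) (b : B) :
    LinearMap.lTensor W hW.toC (comul (jH h * jB b)) = (jH h * jB b) ⊗ₜ hW.toC 1 := by
  have h1 := hW.lTensor_toC_comul hD counit h b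
  have h2 : ∀ X : H ⊗[k] H, LinearMap.rTensor (Module.Dual k B)
      (LinearMap.mulRight k (jH h * jB b) ∘ₗ mulMap jC jH.toLinearMap)
      (TensorProduct.map₂ (TensorProduct.mk k _ _).flip (lAct k H B) X (counit ⊗ₜ counit)) =
      (jH (TensorProduct.rid k H (LinearMap.lTensor H counit X) * h) * jB b) ⊗ₜ
        (counit : Module.Dual k B) := by
    intro X
    induction X with
    | zero => simp
    | add x y hx hy =>
      simp only [map_add, add_mul, add_tmul, LinearMap.add_apply, hx, hy]
    | tmul x y =>
      simp [lAct_counit hD.group, hW.map_counit, smul_tmul', mul_assoc]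
  rw [hW.map_counit, one_mul, barComul_counit hD.quasitriangular hD.group, h2,
    (normalized_rmat_inv hD.quasitriangular).right] at h1
  simpa [hW.toC_one hD] using h1

variable {U : Type*} [Ring U] [Bialgebra k U] {e : W ≃ₗ[k] U}
  (he : IsTwist hW.cocycle (hW.cocycleInv S) e)
include he

/-- Both cocycles are trivial when the first argument lies in C̄H and, in `map_mul_HB`, when the
second lies in HB. What the twist really changes is the product of b followed by c. -/
theorem map_CH_mul (c : Module.Dual k B) (h : H) (y : W) :
    e (jC c * jH h * y) = e (jC c * jH h) * e y := by
  have hσ := hW.isTwoCocycle hD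
  rw [← he.map_cocycleMul, cocycleMul, LinearMap.comp_apply, LinearMap.comp_apply,
    rightAct_tmul_of_left hW.cocycleInv_eq_left (hW.lTensor_toB_comul_CH hD c h)
      (LinearMap.congr_fun hσ.inv_one_left),
    leftAct_tmul_of_left hW.cocycle_eq_left (hW.rTensor_toB_comul_CH hD c h) hσ.one_left,
    LinearMap.mul'_apply]

theorem map_mul_HB (x : W) (h : H) (b : B) :
    e (x * (jH h * jB b)) = e x * e (jH h * jB b) := by
  have hσ := hW.isTwoCocycle hD
  rw [← he.map_cocycleMul, cocycleMul, LinearMap.comp_apply, LinearMap.comp_apply,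
    rightAct_tmul_of_right hW.cocycleInv_eq_right (hW.lTensor_toC_comul_HB hD h b)
      (LinearMap.congr_fun hσ.inv_one_right),
    leftAct_tmul_of_right hW.cocycle_eq_right (hW.rTensor_toC_comul_HB hD h b) hσ.one_right,
    LinearMap.mul'_apply]

end IsSmashBialgebra

end Double

/-! ### The twist satisfies the relations of the double -/

section Double

variable [FiniteDimensional k B] [Coalgebra k (Module.Dual k B)]
  {R : (H ⊗[k] H)ˣ} {S : B ≃ₗ[k] B}
  {W : Type*} [Ring W] [Bialgebra k W]
  {jC : Module.Dual k B →ₗ[k] W} {jH : H →ₐ[k] W} {jB : B →ₗ[k] W}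
  {U : Type*} [Ring U] [Bialgebra k U] {e : W ≃ₗ[k] U}

theorem map_mulMap_of_map_mul {V V' A A' : Type*} [AddCommGroup V] [Module k V] [AddCommGroup V']
    [Module k V'] [Ring A] [Algebra k A] [Ring A'] [Algebra k A'] (e : A →ₗ[k] A') {f : V →ₗ[k] A}
    {g : V' →ₗ[k] A} (h : ∀ x y, e (f x * g y) = e (f x) * e (g y)) (T : V ⊗[k] V') :
    e (mulMap f g T) = mulMap (e ∘ₗ f) (e ∘ₗ g) T := by
  induction T with
  | zero => simp
  | add x y hx hy => simp only [map_add, hx, hy]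
  | tmul x y => simp [h]

namespace IsSmashBialgebra

variable (hW : IsSmashBialgebra R jC jH jB) (hD : IsBarDual R S)
include hD
variable (he : IsTwist hW.cocycle (hW.cocycleInv S) e)
include he

theorem map_C_mul (c : Module.Dual k B) (y : W) : e (jC c * y) = e (jC c) * e y := by
  simpa using hW.map_CH_mul hD he c 1 y

theorem map_H_mul (h : H) (y : W) : e (jH h * y) = e (jH h) * e y := by
  simpa [hW.map_counit] using hW.map_CH_mul hD he counit h y

theorem map_mul_B (x : W) (b : B) : e (x * jB b) = e x * e (jB b) := by
  simpa using hW.map_mul_HB hD he x 1 b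

/-- The inclusion of `H` in the twist. -/
def twistH : H →ₐ[k] U :=
  AlgHom.ofLinearMap (e.toLinearMap ∘ₗ jH.toLinearMap)
    (by simp [he.map_one]) (fun x y => by simp [hW.map_H_mul hD he])

theorem twistH_apply (h : H) : hW.twistH hD he h = e (jH h) := rfl

theorem twistH_toLinearMap : (hW.twistH hD he).toLinearMap = e.toLinearMap ∘ₗ jH.toLinearMap := rfl

theorem relLeft_twist : RelLeft (e.toLinearMap ∘ₗ jC) (hW.twistH hD he).toLinearMap := by
  intro h c
  have h1 := hW.relLeft h c
  rw [twistH_toLinearMap]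
  simp only [LinearMap.comp_apply, LinearEquiv.coe_coe, AlgHom.toLinearMap_apply] at h1 ⊢
  rw [← hW.map_H_mul hD he, h1]
  exact map_mulMap_of_map_mul (f := jC ∘ₗ lact H c) (g := jH.toLinearMap) e.toLinearMap
    (fun x y => hW.map_C_mul hD he _ _) _

theorem relRight_twist : RelRight (e.toLinearMap ∘ₗ jB) (hW.twistH hD he).toLinearMap := by
  intro b h
  have h1 := hW.relRight b h
  have h2 : e (jB b * jH h) = e (jB b) * e (jH h) := by
    simpa [hW.map_one] using hW.map_mul_HB hD he (jB b) h 1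
  rw [twistH_toLinearMap]
  simp only [LinearMap.comp_apply, LinearEquiv.coe_coe, AlgHom.toLinearMap_apply] at h1 ⊢
  rw [← h2, h1]
  exact map_mulMap_of_map_mul (f := jH.toLinearMap) (g := jB ∘ₗ ract k H b) e.toLinearMap
    (fun x y => hW.map_mul_B hD he _ _) _

theorem triple_twist (s : Space k H B) :
    triple (e.toLinearMap ∘ₗ jC) (hW.twistH hD he) (e.toLinearMap ∘ₗ jB) s =
      e (hW.equiv s) := by
  induction s using Space.induction with
  | zero => simp
  | add x y hx hy => simp only [map_add, hx, hy]
  | tmul c h b =>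
    rw [triple_tmul, hW.equiv_tmul, hW.map_C_mul hD he, hW.map_H_mul hD he]
    rfl

theorem exchange_twist (c : Module.Dual k B) :
    conv (e.toLinearMap ∘ₗ jB)
      (mixL (e.toLinearMap ∘ₗ jC) (hW.twistH hD he).toLinearMap ↑R⁻¹ c) =
    conv (mixR (e.toLinearMap ∘ₗ jC) (hW.twistH hD he).toLinearMap ↑R c)
      (e.toLinearMap ∘ₗ jB) := by
  ext b
  -- In U the element b₁c₁ σ(b₂, c₂) equals the image of σ(b₁, c₁) b₂c₂, multiplied in W. Projecting
  -- the coproducts inside σ contributes R⁻¹ on the left, through `l2`, and R on the right, through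
  -- `r1`.
  have key := congrArg e (cocycleMul_rightAct (hW.isTwoCocycle hD) (jB b ⊗ₜ jC c))
  have l1 : LinearMap.lTensor W hW.toB (comul (jB b)) = LinearMap.rTensor B jB (comul b) := by
    have := hW.lTensor_toB_comul hD counit 1 b
    simpa [hW.map_counit] using this
  have l2 : LinearMap.lTensor W hW.toC (comul (jC c)) =
      LinearMap.rTensor _ (mulMap jC jH.toLinearMap)
        (TensorProduct.map₂ (TensorProduct.mk k _ _).flip (lAct k H B) ↑R⁻¹ (barComul R c)) := by
    have := hW.lTensor_toC_comul hD c 1 1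
    simpa [hW.map_one] using this
  have r1 : LinearMap.rTensor W hW.toB (comul (jB b)) = LinearMap.lTensor B
      (mulMap jH.toLinearMap jB)
        (TensorProduct.map₂ (rAct k H B) (TensorProduct.mk k H B) ↑R (comul b)) := by
    have := hW.rTensor_toB_comul hD counit 1 b
    simpa [hW.map_counit] using this
  have r2 : LinearMap.rTensor W hW.toC (comul (jC c)) = LinearMap.lTensor _ jC (barComul R c) := by
    have := hW.rTensor_toC_comul hD c 1 1
    simpa [hW.map_one] using this
  have h1 : ∀ T Y : W ⊗[k] W, TensorProduct.rid k _ (LinearMap.lTensor _ hW.cocycle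
      (TensorProduct.tensorTensorTensorComm k W W W W (T ⊗ₜ Y))) =
      TensorProduct.rid k _ (TensorProduct.map₂ (TensorProduct.mk k W W) (Module.Dual.eval k B)
        (LinearMap.lTensor W hW.toB T) (LinearMap.lTensor W hW.toC Y)) := by
    intro T Y
    induction T with
    | zero => simp
    | add x y hx hy => simp only [map_add, add_tmul, LinearMap.add_apply, hx, hy]
    | tmul x x' =>
      induction Y with
      | zero => simp
      | add x y hx hy => simp only [map_add, tmul_add, hx, hy]
      | tmul y y' => simp [cocycle_tmul]
  have h2 : ∀ T Y : W ⊗[k] W, TensorProduct.lid k _ (LinearMap.rTensor _ hW.cocycle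
      (TensorProduct.tensorTensorTensorComm k W W W W (T ⊗ₜ Y))) =
      TensorProduct.lid k _ (TensorProduct.map₂ (Module.Dual.eval k B) (TensorProduct.mk k W W)
        (LinearMap.rTensor W hW.toB T) (LinearMap.rTensor W hW.toC Y)) := by
    intro T Y
    induction T with
    | zero => simp
    | add x y hx hy => simp only [map_add, add_tmul, LinearMap.add_apply, hx, hy]
    | tmul x x' =>
      induction Y with
      | zero => simp
      | add x y hx hy => simp only [map_add, tmul_add, hx, hy]
      | tmul y y' => simp [cocycle_tmul]
  have h3 : ∀ (X : H ⊗[k] H) (Q : Module.Dual k B ⊗[k] Module.Dual k B) (b₁ b₂ : B),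
      e (cocycleMul hW.cocycle (hW.cocycleInv S) (TensorProduct.rid k _ (TensorProduct.map₂
        (TensorProduct.mk k W W) (Module.Dual.eval k B) (jB b₁ ⊗ₜ b₂)
        (LinearMap.rTensor _ (mulMap jC jH.toLinearMap)
          (TensorProduct.map₂ (TensorProduct.mk k _ _).flip (lAct k H B) X Q))))) =
      e (jB b₁) * mulMap (e.toLinearMap ∘ₗ jC)
        (slotL B (hW.twistH hD he).toLinearMap X b₂) Q := by
    intro X Q b₁ b₂
    induction X with
    | zero => simp
    | add x y hx hy =>
      simp only [map_add, mulMap_add_right, LinearMap.add_apply, mul_add, hx, hy]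
    | tmul x y =>
      induction Q with
      | zero => simp
      | add x y hx hy => simp only [map_add, mul_add, hx, hy]
      | tmul c₁ c₂ =>
        simp [he.map_cocycleMul, hW.map_C_mul hD he, twistH_apply, lAct_apply]
  have h4 : ∀ (X : H ⊗[k] H) (Q : Module.Dual k B ⊗[k] Module.Dual k B) (b₁ b₂ : B),
      e (LinearMap.mul' k W (TensorProduct.lid k _ (TensorProduct.map₂
        (Module.Dual.eval k B) (TensorProduct.mk k W W)
        (LinearMap.lTensor B (mulMap jH.toLinearMap jB)
        (TensorProduct.map₂ (rAct k H B) (TensorProduct.mk k H B) X (b₁ ⊗ₜ b₂)))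
        (LinearMap.lTensor _ jC Q)))) =
      mulMap (slotR B (hW.twistH hD he).toLinearMap X b₁) (e.toLinearMap ∘ₗ jC) Q * e (jB b₂) := by
    intro X Q b₁ b₂
    induction X with
    | zero => simp
    | add x y hx hy =>
      simp only [map_add, mulMap_add_left, LinearMap.add_apply, add_mul, hx, hy]
    | tmul x y =>
      induction Q with
      | zero => simp
      | add x y hx hy => simp only [map_add, add_mul, hx, hy]
      | tmul c₁ c₂ =>
        -- This is a product in W, where b and c commute; only afterwards is it carried to U.
        have : jH y * jB b₂ * jC c₂ = jH y * (jC c₂ * jB b₂) := by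
          rw [mul_assoc, (hW.comm c₂ b₂).eq]
        simp [this, hW.map_H_mul hD he, hW.map_C_mul hD he, twistH_apply, mul_assoc]
  rw [rightAct_apply, leftAct_apply, TensorProduct.comul_tmul] at key
  have key' := ((congrArg (fun z => e (cocycleMul hW.cocycle (hW.cocycleInv S) z))
    (h1 (comul (jB b)) (comul (jC c)))).symm.trans key).trans
    (congrArg (fun z => e (LinearMap.mul' k W z)) (h2 (comul (jB b)) (comul (jC c))))
  rw [l1, l2, r1, r2] at key'
  rw [conv_apply, conv_apply]
  have h5 : ∀ P : B ⊗[k] B, e (cocycleMul hW.cocycle (hW.cocycleInv S)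
      (TensorProduct.rid k _ (TensorProduct.map₂
        (TensorProduct.mk k W W) (Module.Dual.eval k B) (LinearMap.rTensor B jB P)
        (LinearMap.rTensor _ (mulMap jC jH.toLinearMap)
          (TensorProduct.map₂ (TensorProduct.mk k _ _).flip (lAct k H B) ↑R⁻¹
            (barComul R c)))))) =
      mulMap (e.toLinearMap ∘ₗ jB)
      (mixL (e.toLinearMap ∘ₗ jC) (hW.twistH hD he).toLinearMap ↑R⁻¹ c) P := by
    intro P
    induction P with
    | zero => simp
    | add x y hx hy => simp only [map_add, LinearMap.add_apply, hx, hy]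
    | tmul b₁ b₂ => rw [LinearMap.rTensor_tmul, h3, mulMap_tmul, mixL_apply, hD.comul_eq]; rfl
  have h6 : ∀ P : B ⊗[k] B, e (LinearMap.mul' k W (TensorProduct.lid k _ (TensorProduct.map₂
        (Module.Dual.eval k B) (TensorProduct.mk k W W)
        (LinearMap.lTensor B (mulMap jH.toLinearMap jB)
        (TensorProduct.map₂ (rAct k H B) (TensorProduct.mk k H B) ↑R P))
        (LinearMap.lTensor _ jC (barComul R c))))) =
      mulMap (mixR (e.toLinearMap ∘ₗ jC) (hW.twistH hD he).toLinearMap ↑R c)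
        (e.toLinearMap ∘ₗ jB) P := by
    intro P
    induction P with
    | zero => simp
    | add x y hx hy => simp only [map_add, LinearMap.add_apply, hx, hy]
    | tmul b₁ b₂ => rw [h4, mulMap_tmul, mixR_apply, hD.comul_eq]; rfl
  rw [h5, h6] at key'
  exact key'

theorem isDouble_twist : IsDouble R (e.toLinearMap ∘ₗ jC) (hW.twistH hD he)
    (e.toLinearMap ∘ₗ jB) where
  map_dualMul c d := by simp [hW.map_dualMul, hW.map_C_mul hD he]
  map_counit := by simp [hW.map_counit, he.map_one]
  map_mul a b := by simp [hW.map_mul, hW.map_mul_B hD he]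
  map_one := by simp [hW.map_one, he.map_one]
  relLeft := hW.relLeft_twist hD he
  relRight := hW.relRight_twist hD he
  exchange := hW.exchange_twist hD he
  bijective := by
    have : triple (e.toLinearMap ∘ₗ jC) (hW.twistH hD he) (e.toLinearMap ∘ₗ jB) =
        (hW.equiv.trans e).toLinearMap := LinearMap.ext (hW.triple_twist hD he)
    rw [this]
    exact (hW.equiv.trans e).bijective
  comul_C c := by
    have h1 : ∀ (X : H ⊗[k] H) (T : Module.Dual k B ⊗[k] Module.Dual k B),
        TensorProduct.map e.toLinearMap e.toLinearMap (mulMap ((inl k W).toLinearMap ∘ₗ jC)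
          (mulMap ((inl k W).comp jH).toLinearMap ((inr k W).toLinearMap ∘ₗ jC) ∘ₗ
            (LinearMap.lTensorHom H ∘ₗ (lAct k H B).flip).flip X) T) =
        mulMap ((inl k U).toLinearMap ∘ₗ (e.toLinearMap ∘ₗ jC))
          (mulMap ((inl k U).comp (hW.twistH hD he)).toLinearMap
            ((inr k U).toLinearMap ∘ₗ (e.toLinearMap ∘ₗ jC)) ∘ₗ
            (LinearMap.lTensorHom H ∘ₗ (lAct k H B).flip).flip X) T := by
      intro X T
      induction X with
      | zero => simp
      | add x y hx hy =>
        simp only [map_add, LinearMap.comp_add, mulMap_add_right, LinearMap.add_apply, hx, hy]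
      | tmul x y =>
        induction T with
        | zero => simp
        | add x y hx hy => simp only [map_add, hx, hy]
        | tmul a b => simp [inl_apply, inr_apply, hW.map_C_mul hD he, twistH_apply]
    rw [prodC_eq hD.quasitriangular (hW.relLeft_twist hD he) commute_inl_inr, ← h1]
    refine (he.comul_map (jC c)).trans ?_
    rw [hW.comul_C, prodC_eq hD.quasitriangular hW.relLeft commute_inl_inr]
  comul_B b := by
    have h1 : ∀ (X : H ⊗[k] H) (T : B ⊗[k] B),
        TensorProduct.map e.toLinearMap e.toLinearMap
          (mulMap (mulMap ((inl k W).toLinearMap ∘ₗ jB) ((inr k W).comp jH).toLinearMap ∘ₗ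
            (LinearMap.rTensorHom H ∘ₗ (rAct k H B).flip).flip X)
              ((inr k W).toLinearMap ∘ₗ jB) T) =
        mulMap (mulMap ((inl k U).toLinearMap ∘ₗ (e.toLinearMap ∘ₗ jB))
            ((inr k U).comp (hW.twistH hD he)).toLinearMap ∘ₗ
            (LinearMap.rTensorHom H ∘ₗ (rAct k H B).flip).flip X)
              ((inr k U).toLinearMap ∘ₗ (e.toLinearMap ∘ₗ jB)) T := by
      intro X T
      induction X with
      | zero => simp
      | add x y hx hy =>
        simp only [map_add, LinearMap.comp_add, mulMap_add_left, LinearMap.add_apply, hx, hy]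
      | tmul x y =>
        induction T with
        | zero => simp
        | add x y hx hy => simp only [map_add, hx, hy]
        | tmul a b => simp [inl_apply, inr_apply, hW.map_mul_B hD he, twistH_apply]
    rw [prodB_eq hD.quasitriangular (hW.relRight_twist hD he) commute_inl_inr, ← h1]
    refine (he.comul_map (jB b)).trans ?_
    rw [hW.comul_B, prodB_eq hD.quasitriangular hW.relRight commute_inl_inr]
  comul_H h := by
    rw [conv_apply]
    refine (he.comul_map (jH h)).trans ?_
    rw [hW.comul_H, conv_apply]
    generalize comul (R := k) h = T
    induction T with
    | zero => simp
    | add x y hx hy => simp only [map_add, hx, hy]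
    | tmul a b => simp [inl_apply, inr_apply, twistH_apply]
  counit_C c := (he.counit_map _).trans (hW.counit_C c)
  counit_H h := (he.counit_map _).trans (hW.counit_H h)
  counit_B b := (he.counit_map _).trans (hW.counit_B b)

end IsSmashBialgebra

end Double

/-! ### The antipode -/

section ConvInverse

variable {D : Type*} [AddCommGroup D] [Module k D] [Coalgebra k D] {A : Type*} [Ring A]
  [Algebra k A]

theorem conv_conv_conv_inv {α β γ α' β' γ' : D →ₗ[k] A}
    (hα : conv α α' = Algebra.linearMap k A ∘ₗ counit)
    (hβ : conv β β' = Algebra.linearMap k A ∘ₗ counit)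
    (hγ : conv γ γ' = Algebra.linearMap k A ∘ₗ counit) :
    conv (conv α (conv β γ)) (conv γ' (conv β' α')) = Algebra.linearMap k A ∘ₗ counit := by
  have h : ∀ {f g φ : D →ₗ[k] A}, conv f g = Algebra.linearMap k A ∘ₗ counit →
      conv f (conv g φ) = φ := by
    intro f g φ hfg
    rw [conv_assoc, hfg]
    exact conv_counit_left fun _ => rfl
  rw [← conv_assoc, ← conv_assoc, h hγ, h hβ, hα]

end ConvInverse

/-! ### Factorisation of the twist map and the antipode -/

section Double

variable [FiniteDimensional k B] [Coalgebra k (Module.Dual k B)]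
  {R : (H ⊗[k] H)ˣ} {S : B ≃ₗ[k] B}
  {W : Type*} [Ring W] [Bialgebra k W]
  {jC : Module.Dual k B →ₗ[k] W} {jH : H →ₐ[k] W} {jB : B →ₗ[k] W}
  {U : Type*} [Ring U] [Bialgebra k U] {e : W ≃ₗ[k] U}

variable (k H B) in
/-- The projection `c ⊗ h ⊗ b ↦ ⟨c, 1⟩ ε(b) h`. -/
def projH : Space k H B →ₗ[k] H :=
  (TensorProduct.lid k H).toLinearMap ∘ₗ TensorProduct.map (Module.Dual.eval k B 1)
    ((TensorProduct.rid k H).toLinearMap ∘ₗ LinearMap.lTensor H counit)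

theorem projH_tmul (c : Module.Dual k B) (h : H) (b : B) :
    projH k H B (c ⊗ₜ (h ⊗ₜ b)) = c 1 • counit (R := k) b • h := rfl

theorem map_projH_comul (hD : IsBarDual R S) (s : Space k H B) :
    TensorProduct.map (projH k H B) (projH k H B) (DoubleBosonisation.comul R s) =
      comul (projH k H B s) := by
  induction s using Space.induction with
  | zero => simp
  | add x y hx hy => simp only [map_add, hx, hy]
  | tmul c h b =>
  rw [comul_eq_comulTensor, comulTensor_induction (TensorProduct.map (projH k H B) (projH k H B))
    (fun X Y T U V => (LinearMap.mul' k k (TensorProduct.map (Module.Dual.eval k B 1)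
        (Module.Dual.eval k B 1) T) *
        LinearMap.mul' k k (TensorProduct.map counit counit V)) •
      TensorProduct.map (LinearMap.mul k H (TensorProduct.rid k H (LinearMap.lTensor H counit X)))
        ((LinearMap.mul k H).flip (TensorProduct.lid k H (LinearMap.rTensor H counit Y))) U)]
  · rw [(normalized_rmat hD.quasitriangular).left, (normalized_rmat_inv hD.quasitriangular).right]
    have h2 : (Module.Dual.eval k B 1 : Module.Dual k B →ₗ[k] k) = counit :=
      LinearMap.ext fun c => (hD.counit_eq c).symm
    have h3 : LinearMap.mul k H 1 = LinearMap.id := LinearMap.ext one_mul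
    have h3' : (LinearMap.mul k H).flip 1 = LinearMap.id := LinearMap.ext mul_one
    have h4 := LinearMap.congr_fun (counit_conv (counit : Module.Dual k B →ₗ[k] k)) c
    have h5 := LinearMap.congr_fun (counit_conv (counit : B →ₗ[k] k)) b
    rw [conv_apply, mulMap, LinearMap.comp_apply] at h4 h5
    rw [h2, ← hD.comul_eq, h4, h5, projH_tmul, hD.counit_eq]
    simp [smul_smul, h3, h3']
  · intros; simp [TensorProduct.map_add_left]
  · intros; simp [TensorProduct.map_add_right]
  · intros; simp [add_mul, add_smul]
  · intros; simp
  · intros; simp [mul_add, add_smul]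
  · intros; simp
  · intros; simp
  · intros; simp
  · intros; simp
  · intros; simp
  · intros
    simp only [TensorProduct.map_tmul, projH_tmul, lAct_apply_one hD.group,
      counit_rAct hD.group, TensorProduct.rid_tmul, TensorProduct.lid_tmul,
      LinearMap.lTensor_tmul, LinearMap.rTensor_tmul, LinearMap.mul'_apply, Module.Dual.eval_apply,
      LinearMap.mul_apply', LinearMap.flip_apply, smul_mul_assoc, mul_smul_comm,
      tmul_smul, ← smul_tmul', smul_smul]
    congr 1
    ring

namespace IsSmashBialgebra

variable (hW : IsSmashBialgebra R jC jH jB) (hD : IsBarDual R S)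

/-- The projection of the two-sided smash product to `H`. -/
def toH : W →ₗ[k] H := projH k H B ∘ₗ hW.equiv.symm.toLinearMap

theorem toH_apply (c : Module.Dual k B) (h : H) (b : B) :
    hW.toH (jC c * (jH h * jB b)) = c 1 • counit (R := k) b • h := by
  rw [← hW.equiv_tmul, toH, LinearMap.comp_apply, LinearEquiv.coe_coe, LinearEquiv.symm_apply_apply,
    projH_tmul]

include hD

theorem map_toH_comul (x : W) :
    TensorProduct.map hW.toH hW.toH (comul x) = comul (R := k) (hW.toH x) := by
  obtain ⟨s, rfl⟩ := hW.equiv.surjective x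
  have h : ∀ T : Space k H B ⊗[k] Space k H B, TensorProduct.map hW.toH hW.toH
      (TensorProduct.map hW.equiv.toLinearMap hW.equiv.toLinearMap T) =
      TensorProduct.map (projH k H B) (projH k H B) T := by
    intro T
    induction T with
    | zero => simp
    | add x y hx hy => simp only [map_add, hx, hy]
    | tmul x y => simp [toH]
  rw [hW.comul_equiv hD, h, map_projH_comul hD]
  simp [toH]

theorem counit_toH (x : W) : counit (R := k) (hW.toH x) = counit (R := k) x := by
  induction x using hW.toIsSmash.induction with
  | zero => simp
  | add x y hx hy => simp only [map_add, hx, hy]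
  | mul c h b =>
    rw [toH_apply, Bialgebra.counit_mul, Bialgebra.counit_mul, hW.counit_C, hW.counit_H,
      hW.counit_B]
    simp [mul_comm]

section Factorization

variable {A : Type*} [Ring A] [Algebra k A] (gC : Module.Dual k B →ₗ[k] A) (gH : H →ₗ[k] A)
  (gB : B →ₗ[k] A)

theorem conv_toH_toB (c : Module.Dual k B) (h : H) (b : B) :
    conv (gH ∘ₗ hW.toH) (gB ∘ₗ hW.toB) (jC c * (jH h * jB b)) = c 1 • (gH h * gB b) := by
  have h1 : ∀ T : B ⊗[k] B, mulMap (gH ∘ₗ hW.toH) gB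
      (LinearMap.rTensor _ (LinearMap.mulLeft k (jC c * jH h) ∘ₗ jB) T) =
      c 1 • (gH h * gB (TensorProduct.lid k B (LinearMap.rTensor B counit T))) := by
    intro T
    induction T with
    | zero => simp
    | add x y hx hy => simp only [map_add, mul_add, smul_add, hx, hy]
    | tmul x y => simp [toH_apply]
  rw [conv_apply, ← mulMap_lTensor, hW.lTensor_toB_comul hD, h1]
  simp

/-- The three projections recover the factors of c h b, the superfluous parts of the coproduct being
killed by counits. Taken with the inclusions in U, it writes the twist map as a convolution product
whose factors are inverted by the antipodes of `C̄`, `H` and `B`. -/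
theorem conv_toC_toH_toB (c : Module.Dual k B) (h : H) (b : B) :
    conv (gC ∘ₗ hW.toC) (conv (gH ∘ₗ hW.toH) (gB ∘ₗ hW.toB)) (jC c * (jH h * jB b)) =
      gC c * (gH h * gB b) := by
  have h1 : ∀ T : Module.Dual k B ⊗[k] Module.Dual k B, mulMap gC
      (conv (gH ∘ₗ hW.toH) (gB ∘ₗ hW.toB))
      (LinearMap.lTensor _ (LinearMap.mulRight k (jH h * jB b) ∘ₗ jC) T) =
      gC (TensorProduct.rid k _ (LinearMap.lTensor _ (Module.Dual.eval k B 1) T)) *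
        (gH h * gB b) := by
    intro T
    induction T with
    | zero => simp
    | add x y hx hy => simp only [map_add, add_mul, hx, hy]
    | tmul x y =>
      have := hW.conv_toH_toB hD gH gB y h b
      rw [← mul_assoc] at this
      simp [this]
  have h2 : (Module.Dual.eval k B 1 : Module.Dual k B →ₗ[k] k) = counit :=
    LinearMap.ext fun c => (hD.counit_eq c).symm
  rw [conv_apply, ← mulMap_rTensor, hW.rTensor_toC_comul hD, h1, h2, ← hD.comul_eq]
  simp

end Factorization

variable (he : IsTwist hW.cocycle (hW.cocycleInv S) e)
include he

theorem conv_toC_toH_toB_twist : conv ((e.toLinearMap ∘ₗ jC) ∘ₗ hW.toC)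
    (conv ((hW.twistH hD he).toLinearMap ∘ₗ hW.toH) ((e.toLinearMap ∘ₗ jB) ∘ₗ hW.toB)) =
      e.toLinearMap := by
  refine hW.toIsSmash.linearMap_ext fun c h b => ?_
  rw [hW.conv_toC_toH_toB hD]
  exact (hW.triple_twist hD he (c ⊗ₜ (h ⊗ₜ b)))

/-- The convolution inverse of the twist `e : W → U`. -/
def twistInv : W →ₗ[k] U :=
  conv ((e.toLinearMap ∘ₗ jB) ∘ₗ S.toLinearMap ∘ₗ hW.toB)
    (conv ((hW.twistH hD he).toLinearMap ∘ₗ HopfAlgebra.antipode k ∘ₗ hW.toH)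
      ((e.toLinearMap ∘ₗ jC) ∘ₗ barAntipode S ∘ₗ hW.toC))

theorem conv_B_inv {f f' : B →ₗ[k] B} (hf : ∀ b, LinearMap.mul' k B
    (TensorProduct.map f f' (comul b)) = algebraMap k B (counit b)) :
    conv ((e.toLinearMap ∘ₗ jB) ∘ₗ f ∘ₗ hW.toB) ((e.toLinearMap ∘ₗ jB) ∘ₗ f' ∘ₗ hW.toB) =
      Algebra.linearMap k U ∘ₗ counit := by
  ext x
  have hd := hW.isDouble_twist hD he
  have h1 : ∀ T : B ⊗[k] B, mulMap ((e.toLinearMap ∘ₗ jB) ∘ₗ f) ((e.toLinearMap ∘ₗ jB) ∘ₗ f') T =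
      (e.toLinearMap ∘ₗ jB) (LinearMap.mul' k B (TensorProduct.map f f' T)) := by
    intro T
    rw [mulMap, LinearMap.comp_apply]
    induction T with
    | zero => simp
    | add x y hx hy => simp only [map_add, hx, hy]
    | tmul x y =>
      rw [TensorProduct.map_tmul, TensorProduct.map_tmul, LinearMap.mul'_apply,
        LinearMap.mul'_apply, hd.map_mul]
      rfl
  rw [conv_apply, ← LinearMap.comp_assoc, ← LinearMap.comp_assoc, ← mulMap_map,
    hW.map_toB_comul hD, h1, hf, Algebra.algebraMap_eq_smul_one, map_smul, hd.map_one,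
    hW.counit_toB hD, LinearMap.comp_apply, Algebra.linearMap_apply,
    Algebra.algebraMap_eq_smul_one]

theorem conv_C_inv {f f' : Module.Dual k B →ₗ[k] Module.Dual k B}
    (hf : ∀ c, TensorProduct.lift (dualMul k B)
      (TensorProduct.map f f' (barComul R c)) = c 1 • counit) :
    conv ((e.toLinearMap ∘ₗ jC) ∘ₗ f ∘ₗ hW.toC) ((e.toLinearMap ∘ₗ jC) ∘ₗ f' ∘ₗ hW.toC) =
      Algebra.linearMap k U ∘ₗ counit := by
  ext x
  have hd := hW.isDouble_twist hD he
  have h1 : ∀ T : Module.Dual k B ⊗[k] Module.Dual k B,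
      mulMap ((e.toLinearMap ∘ₗ jC) ∘ₗ f) ((e.toLinearMap ∘ₗ jC) ∘ₗ f') T =
      (e.toLinearMap ∘ₗ jC) (TensorProduct.lift (dualMul k B) (TensorProduct.map f f' T)) := by
    intro T
    rw [mulMap, LinearMap.comp_apply]
    induction T with
    | zero => simp
    | add x y hx hy => simp only [map_add, hx, hy]
    | tmul x y =>
      rw [TensorProduct.map_tmul, TensorProduct.map_tmul, LinearMap.mul'_apply,
        TensorProduct.lift.tmul, hd.map_dualMul]
      rfl
  rw [conv_apply, ← LinearMap.comp_assoc, ← LinearMap.comp_assoc, ← mulMap_map,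
    hW.map_toC_comul hD, h1, hf, map_smul, hd.map_counit,
    hW.toC_apply_one hD, LinearMap.comp_apply, Algebra.linearMap_apply,
    Algebra.algebraMap_eq_smul_one]

theorem conv_H_inv {f f' : H →ₗ[k] H} (hf : ∀ h, LinearMap.mul' k H
    (TensorProduct.map f f' (comul h)) = algebraMap k H (counit h)) :
    conv ((hW.twistH hD he).toLinearMap ∘ₗ f ∘ₗ hW.toH)
      ((hW.twistH hD he).toLinearMap ∘ₗ f' ∘ₗ hW.toH) = Algebra.linearMap k U ∘ₗ counit := by
  ext x
  have h1 : ∀ T : H ⊗[k] H, mulMap ((hW.twistH hD he).toLinearMap ∘ₗ f)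
      ((hW.twistH hD he).toLinearMap ∘ₗ f') T =
      hW.twistH hD he (LinearMap.mul' k H (TensorProduct.map f f' T)) := by
    intro T
    rw [mulMap, LinearMap.comp_apply]
    induction T with
    | zero => simp
    | add x y hx hy => simp only [map_add, hx, hy]
    | tmul x y => simp
  rw [conv_apply, ← LinearMap.comp_assoc, ← LinearMap.comp_assoc, ← mulMap_map,
    hW.map_toH_comul hD, h1, hf, hW.counit_toH hD, AlgHom.commutes, LinearMap.comp_apply,
    Algebra.linearMap_apply]

theorem conv_twist_twistInv :
    conv e.toLinearMap (hW.twistInv hD he) = Algebra.linearMap k U ∘ₗ counit := by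
  conv_lhs => rw [← hW.conv_toC_toH_toB_twist hD he]
  refine conv_conv_conv_inv ?_ ?_ ?_
  · exact hW.conv_C_inv hD he (f := LinearMap.id)
      (dualMul_barAntipode_right hD.quasitriangular hD.group)
  · exact hW.conv_H_inv hD he (f := LinearMap.id)
      (fun h => LinearMap.congr_fun HopfAlgebra.mul_antipode_lTensor_comul h)
  · exact hW.conv_B_inv hD he (f := LinearMap.id) hD.group.mul_antipode_right

theorem conv_twistInv_twist :
    conv (hW.twistInv hD he) e.toLinearMap = Algebra.linearMap k U ∘ₗ counit := by
  conv_lhs => rw [← hW.conv_toC_toH_toB_twist hD he]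
  refine conv_conv_conv_inv ?_ ?_ ?_
  · exact hW.conv_B_inv hD he (f' := LinearMap.id) hD.group.mul_antipode_left
  · exact hW.conv_H_inv hD he (f' := LinearMap.id)
      (fun h => LinearMap.congr_fun HopfAlgebra.mul_antipode_rTensor_comul h)
  · exact hW.conv_C_inv hD he (f' := LinearMap.id)
      (dualMul_barAntipode_left hD.quasitriangular hD.group)

/-- The twist is a Hopf algebra. -/
@[reducible]
def twistHopfAlgebra : HopfAlgebra k U where
  -- Since e is a coalgebra isomorphism, a convolution inverse of e : W → U becomes, after
  -- composition with e⁻¹, a convolution inverse of the identity of U.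
  antipode := hW.twistInv hD he ∘ₗ e.symm.toLinearMap
  mul_antipode_rTensor_comul := by
    ext y
    obtain ⟨x, rfl⟩ := e.surjective y
    have h1 : ∀ T : W ⊗[k] W, LinearMap.mul' k U (LinearMap.rTensor U
        (hW.twistInv hD he ∘ₗ e.symm.toLinearMap)
        (TensorProduct.map e.toLinearMap e.toLinearMap T)) =
        mulMap (hW.twistInv hD he) e.toLinearMap T := by
      intro T
      induction T with
      | zero => simp
      | add x y hx hy => simp only [map_add, hx, hy]
      | tmul x y => simp
    rw [LinearMap.comp_apply, LinearMap.comp_apply, he.comul_map, h1, ← conv_apply,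
      hW.conv_twistInv_twist hD he, LinearMap.comp_apply, LinearMap.comp_apply, he.counit_map]
  mul_antipode_lTensor_comul := by
    ext y
    obtain ⟨x, rfl⟩ := e.surjective y
    have h1 : ∀ T : W ⊗[k] W, LinearMap.mul' k U (LinearMap.lTensor U
        (hW.twistInv hD he ∘ₗ e.symm.toLinearMap)
        (TensorProduct.map e.toLinearMap e.toLinearMap T)) =
        mulMap e.toLinearMap (hW.twistInv hD he) T := by
      intro T
      induction T with
      | zero => simp
      | add x y hx hy => simp only [map_add, hx, hy]
      | tmul x y => simp
    rw [LinearMap.comp_apply, LinearMap.comp_apply, he.comul_map, h1, ← conv_apply,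
      hW.conv_twist_twistInv hD he, LinearMap.comp_apply, LinearMap.comp_apply, he.counit_map]

end IsSmashBialgebra

theorem exists_isDouble (hD : IsBarDual R S) : ∃ (U : Type (max u v w)) (_ : Ring U)
    (_ : HopfAlgebra k U) (iC : Module.Dual k B →ₗ[k] U) (iH : H →ₐ[k] U) (iB : B →ₗ[k] U),
    IsDouble R iC iH iB := by
  obtain ⟨W, _, _, jC, jH, jB, hW⟩ := exists_isSmashBialgebra hD
  obtain ⟨U, _, _, e, h1, h2, h3, h4⟩ := (hW.isTwoCocycle hD).exists_twist
  have he : IsTwist hW.cocycle (hW.cocycleInv S) e := ⟨h1, h2, h3, h4⟩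
  exact ⟨U, inferInstance, hW.twistHopfAlgebra hD he, _, _, _, hW.isDouble_twist hD he⟩

end Double

/-! ### The product of the double-bosonisation -/

section Slots

variable {A : Type*} [Ring A] [Algebra k A] {R : (H ⊗[k] H)ˣ} {S : B ≃ₗ[k] B}

/-- `mulMap f g` as a linear map in `g`. -/
def mulMapHom {V V' : Type*} [AddCommGroup V] [Module k V] [AddCommGroup V'] [Module k V']
    (f : V →ₗ[k] A) : (V' →ₗ[k] A) →ₗ[k] V ⊗[k] V' →ₗ[k] A where
  toFun g := mulMap f g
  map_add' _ _ := mulMap_add_right _ _ _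
  map_smul' _ _ := mulMap_smul_right _ _ _

/-- `mulMap f g` as a linear map in `f`. -/
def mulMapHomLeft {V V' : Type*} [AddCommGroup V] [Module k V] [AddCommGroup V'] [Module k V']
    (g : V' →ₗ[k] A) : (V →ₗ[k] A) →ₗ[k] V ⊗[k] V' →ₗ[k] A where
  toFun f := mulMap f g
  map_add' _ _ := mulMap_add_left _ _ _
  map_smul' _ _ := mulMap_smul_left _ _ _

/-- `X⁽¹⁾ ⟨c d, b ◁ X⁽²⟩ = X⁽¹⁾ Y⁽¹⁾ ⟨c, b₍₁₎ ◁ X⁽²⁾⟩ ⟨d, b₍₂₎ ◁ Y⁽²⁾⟩` for `X`, `Y` two copies of `R⁻¹`. -/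
theorem conv_slotL_inv (hR : IsQuasitriangular k (R : H ⊗[k] H))
    (hB : IsBraidedGroup (R : H ⊗[k] H) S.toLinearMap) (iH : H →ₐ[k] A) (c d : Module.Dual k B) :
    conv ((slotL B iH.toLinearMap ↑R⁻¹).flip c) ((slotL B iH.toLinearMap ↑R⁻¹).flip d) =
      (slotL B iH.toLinearMap ↑R⁻¹).flip (dualMul k B c d) := by
  ext b
  let F : B ⊗[k] B → H ⊗[k] (H ⊗[k] H) →ₗ[k] A := fun P =>
    iH.toLinearMap ∘ₗ (TensorProduct.rid k H).toLinearMap ∘ₗ LinearMap.lTensor H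
      (dualDistrib k B B (c ⊗ₜ d) ∘ₗ (TensorProduct.map₂ (rAct k H B) (rAct k H B)).flip P)
  have h1 : ∀ X : H ⊗[k] H, slotL B iH.toLinearMap X b (dualMul k B c d) =
      F (comul b) (LinearMap.lTensor H comul X) := by
    intro X
    induction X with
    | zero => simp
    | add x y hx hy => simp only [map_add, LinearMap.add_apply, hx, hy]
    | tmul x y => simp [F, dualMul_apply, comul_rAct hB]
  have h2 : ∀ (P : B ⊗[k] B) (X Y : H ⊗[k] H), mulMap ((slotL B iH.toLinearMap X).flip c)
      ((slotL B iH.toLinearMap Y).flip d) P = F P (leg12 k X * leg13 k Y) := by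
    intro P X Y
    induction P with
    | zero => simp [F]
    | add x y hx hy =>
      simp only [F, map_add, LinearMap.comp_add, LinearMap.lTensor_add, LinearMap.add_apply,
        LinearMap.comp_apply] at hx hy ⊢
      rw [hx, hy]
    | tmul b₁ b₂ =>
      induction X with
      | zero => simp
      | add x y hx hy =>
        simp only [map_add, LinearMap.flip_apply, mulMap_tmul, LinearMap.add_apply, add_mul]
          at hx hy ⊢
        rw [hx, hy]
      | tmul x x' =>
        induction Y with
        | zero => simp
        | add x y hx hy =>
          simp only [map_add, LinearMap.flip_apply, mulMap_tmul, LinearMap.add_apply, mul_add]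
            at hx hy ⊢
          rw [hx, hy]
        | tmul y y' => simp [F, leg12, leg13, smul_smul, mul_comm]
  rw [conv_apply, h2, ← lTensor_comul_inv hR, ← h1]
  rfl

theorem slotL_counit (hB : IsBraidedGroup (R : H ⊗[k] H) S.toLinearMap) {X : H ⊗[k] H}
    (hX : Normalized X) (iH : H →ₐ[k] A) (b : B) :
    slotL B iH.toLinearMap X b counit = counit (R := k) b • 1 := by
  have h1 : ∀ X : H ⊗[k] H, slotL B iH.toLinearMap X b counit =
      counit (R := k) b • iH (TensorProduct.rid k H (LinearMap.lTensor H counit X)) := by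
    intro X
    induction X with
    | zero => simp
    | add x y hx hy => simp only [map_add, LinearMap.add_apply, smul_add, hx, hy]
    | tmul x y => simp [counit_rAct hB, mul_smul]
  rw [h1, hX.right, _root_.map_one]

end Slots

/-! ### The two contractions in the product formula -/

section Cross

variable {A : Type*} [Ring A] [Algebra k A] {R : (H ⊗[k] H)ˣ} {S : B ≃ₗ[k] B}
  (iC : Module.Dual k B →ₗ[k] A) (iH : H →ₐ[k] A) (iB : B →ₗ[k] A)

/-- `(c ⊗ d, b ⊗ g) ↦ ⟨c, b⟩ d g`. -/
def contractC : Module.Dual k B ⊗[k] Module.Dual k B →ₗ[k] B ⊗[k] H →ₗ[k] A :=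
  (TensorProduct.map₂ LinearMap.id ((LinearMap.mul k A).compl₁₂ iC iH.toLinearMap)).compr₂
    (TensorProduct.lid k A).toLinearMap

/-- `(h ⊗ e, a ⊗ b) ↦ ⟨e, b⟩ h a`. -/
def contractB : H ⊗[k] Module.Dual k B →ₗ[k] B ⊗[k] B →ₗ[k] A :=
  (TensorProduct.map₂ ((LinearMap.mul k A).compl₁₂ iH.toLinearMap iB) LinearMap.id).compr₂
    (TensorProduct.rid k A).toLinearMap

@[simp]
theorem contractC_tmul (c d : Module.Dual k B) (b : B) (g : H) :
    contractC iC iH (c ⊗ₜ d) (b ⊗ₜ g) = c b • (iC d * iH g) := by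
  simp [contractC]

@[simp]
theorem contractB_tmul (e : Module.Dual k B) (a b : B) (h : H) :
    contractB iH iB (h ⊗ₜ e) (a ⊗ₜ b) = e b • (iH h * iB a) := by
  simp [contractB]

theorem triple_contract (P : Module.Dual k B ⊗[k] Module.Dual k B) (P' : H ⊗[k] Module.Dual k B)
    (Q : B ⊗[k] H) (Q' : B ⊗[k] B) :
    triple iC iH iB (contract k H B (P ⊗ₜ P') (Q ⊗ₜ Q')) =
      contractC iC iH P Q * contractB iH iB P' Q' := by
  induction P with
  | zero => simp
  | add x y hx hy => simp only [add_tmul, map_add, LinearMap.add_apply, add_mul, hx, hy]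
  | tmul c d =>
  induction P' with
  | zero => simp
  | add x y hx hy => simp only [tmul_add, map_add, LinearMap.add_apply, mul_add, hx, hy]
  | tmul h e =>
  induction Q with
  | zero => simp
  | add x y hx hy => simp only [add_tmul, map_add, add_mul, hx, hy]
  | tmul b g =>
  induction Q' with
  | zero => simp
  | add x y hx hy => simp only [tmul_add, map_add, mul_add, hx, hy]
  | tmul a a' => 
    simp only [contract, LinearMap.compr₂_apply, TensorProduct.map₂_apply_tmul,
      TensorProduct.map_tmul, TensorProduct.mk_apply, LinearMap.id_apply, LinearEquiv.coe_coe,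
      TensorProduct.lid_tmul, TensorProduct.rid_tmul, ← smul_tmul', tmul_smul, map_smul,
      LinearMap.comp_apply, TensorProduct.assoc_tmul, TensorProduct.assoc_symm_tmul,
      LinearMap.lTensor_tmul, LinearMap.rTensor_tmul, LinearMap.mul'_apply, triple_tmul,
      contractC_tmul, contractB_tmul, smul_mul_assoc, mul_smul_comm, _root_.map_mul, mul_assoc,
      smul_smul, mul_comm]

variable {iC iH iB}

/-- The copy of R acting on two parts of c and the copy acting on b form R₁₃R₁₂ = (id ⊗ Δ)R; the
smash relation then gathers R⁽²⁾ on the left of the remaining part of c. -/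
theorem contractC_act (hR : IsQuasitriangular k (R : H ⊗[k] H)) (hl : RelLeft iC iH.toLinearMap)
    (V : Module.Dual k B ⊗[k] Module.Dual k B) (b : B) :
    contractC iC iH (TensorProduct.map₂ (lAct k H B) (lAct k H B) ↑R V)
      (LinearMap.rTensor H (ract k H b) ↑R) = mulMap (slotR B iH.toLinearMap ↑R b) iC V := by
  induction V with
  | zero => simp
  | add x y hx hy => simp only [map_add, LinearMap.add_apply, hx, hy]
  | tmul c d =>
  let F : H ⊗[k] (H ⊗[k] H) →ₗ[k] A := (TensorProduct.lid k A).toLinearMap ∘ₗ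
    TensorProduct.map (c ∘ₗ ract k H b) (mulMap (iC ∘ₗ lact H d) iH.toLinearMap)
  have h1 : ∀ X : H ⊗[k] H, mulMap (slotR B iH.toLinearMap X b) iC (c ⊗ₜ d) =
      F (LinearMap.lTensor H comul X) := by
    intro X
    rw [mulMap_tmul]
    induction X with
    | zero => simp
    | add x y hx hy => simp only [map_add, LinearMap.add_apply, add_mul, hx, hy]
    | tmul x y =>
      have := hl y d
      simp only [AlgHom.toLinearMap_apply] at this
      simp [F, ← this]
  have h2 : ∀ X Y : H ⊗[k] H, contractC iC iH
      (TensorProduct.map₂ (lAct k H B) (lAct k H B) X (c ⊗ₜ d))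
      (LinearMap.rTensor H (ract k H b) Y) = F (leg13 k Y * leg12 k X) := by
    intro X Y
    induction X with
    | zero => simp
    | add x y hx hy => simp only [map_add, LinearMap.add_apply, mul_add, hx, hy]
    | tmul x x' =>
      induction Y with
      | zero => simp
      | add x y hx hy => simp only [map_add, add_mul, hx, hy]
      | tmul y y' => simp [F, leg12, leg13, lAct_apply, rAct_mul]
  rw [h2, ← hR.comul_right, ← h1]

/-- The two copies of R⁻¹ combine through (Δ ⊗ id)R⁻¹ = R₂₃⁻¹R₁₃⁻¹, and the smash relation puts `B`
before `H`. -/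
theorem contractB_act (hR : IsQuasitriangular k (R : H ⊗[k] H)) (hr : RelRight iB iH.toLinearMap)
    (e : Module.Dual k B) (Q : B ⊗[k] B) :
    contractB iH iB (LinearMap.lTensor H (lact H e) ↑R⁻¹)
      (TensorProduct.map₂ (rAct k H B) (rAct k H B) ↑R⁻¹ Q) =
      mulMap iB ((slotL B iH.toLinearMap ↑R⁻¹).flip e) Q := by
  induction Q with
  | zero => simp
  | add x y hx hy => simp only [map_add, hx, hy]
  | tmul a b =>
  let F : H ⊗[k] (H ⊗[k] H) →ₗ[k] A := (TensorProduct.rid k A).toLinearMap ∘ₗ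
    TensorProduct.map (mulMap iH.toLinearMap (iB ∘ₗ ract k H a)) (e ∘ₗ ract k H b) ∘ₗ
      (TensorProduct.assoc k H H H).symm.toLinearMap
  have h1 : ∀ X : H ⊗[k] H, mulMap iB ((slotL B iH.toLinearMap X).flip e) (a ⊗ₜ b) =
      F (TensorProduct.assoc k H H H (LinearMap.rTensor H comul X)) := by
    intro X
    rw [mulMap_tmul]
    induction X with
    | zero => simp
    | add x y hx hy =>
      simp only [map_add, LinearMap.flip_apply, LinearMap.add_apply, mul_add] at hx hy ⊢
      rw [hx, hy]
    | tmul x y =>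
      have := hr a x
      simp only [AlgHom.toLinearMap_apply] at this
      simp [F, ← this]
  have h2 : ∀ X Y : H ⊗[k] H, contractB iH iB (LinearMap.lTensor H (lact H e) X)
      (TensorProduct.map₂ (rAct k H B) (rAct k H B) Y (a ⊗ₜ b)) = F (leg23 k Y * leg13 k X) := by
    intro X Y
    induction X with
    | zero => simp
    | add x y hx hy => simp only [map_add, LinearMap.add_apply, mul_add, hx, hy]
    | tmul x x' =>
      induction Y with
      | zero => simp
      | add x y hx hy => simp only [map_add, LinearMap.add_apply, add_mul, hx, hy]
      | tmul y y' => simp [F, leg23, leg13, lAct_apply, rAct_mul]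
  rw [h2, ← rTensor_comul_inv hR, ← h1]

end Cross

/-! ### The product formula as a consequence of the exchange relation -/

section Double

variable [FiniteDimensional k B] [Coalgebra k (Module.Dual k B)]
  {R : (H ⊗[k] H)ˣ} {S : B ≃ₗ[k] B}
  {U : Type*} [Ring U] [Bialgebra k U] {iC : Module.Dual k B →ₗ[k] U} {iH : H →ₐ[k] U}
  {iB : B →ₗ[k] U}

/-- Two successive pairings with parts of b merge, by `conv_slotL_inv`, into one pairing of b with
c₂d. -/
theorem conv_mixL_slotL {A : Type*} [Ring A] [Algebra k A] {iC : Module.Dual k B →ₗ[k] A}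
    {iH : H →ₐ[k] A} (hD : IsBarDual R S) (c d : Module.Dual k B) (b : B) :
    conv (mixL iC iH.toLinearMap ↑R⁻¹ c) ((slotL B iH.toLinearMap ↑R⁻¹).flip d) b =
      mulMap iC (slotL B iH.toLinearMap ↑R⁻¹ b ∘ₗ (dualMul k B).flip d) (comul c) := by
  have h1 : ∀ V : Module.Dual k B ⊗[k] Module.Dual k B,
      conv ((mulMapHom iC ∘ₗ slotL B iH.toLinearMap ↑R⁻¹).flip V)
        ((slotL B iH.toLinearMap ↑R⁻¹).flip d) b =
      mulMap iC (slotL B iH.toLinearMap ↑R⁻¹ b ∘ₗ (dualMul k B).flip d) V := by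
    intro V
    induction V with
    | zero => simp [conv]
    | add x y hx hy =>
      rw [map_add, map_add, conv, mulMap_add_left, LinearMap.add_comp, LinearMap.add_apply]
      exact congrArg₂ (· + ·) hx hy
    | tmul c₁ c₂ =>
      have h := LinearMap.congr_fun (conv_slotL_inv hD.quasitriangular hD.group iH c₂ d) b
      rw [LinearMap.flip_apply, conv_apply] at h
      rw [mulMap_tmul, LinearMap.comp_apply, LinearMap.flip_apply, ← h, conv_apply]
      exact (mul_mulMap _ _ _ _ (fun x => rfl) _).symm
  exact h1 (comul c)

namespace IsDouble

variable (hU : IsDouble R iC iH iB) (hD : IsBarDual R S)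
include hU hD

/-- Once the copies of R are gathered, c₁ and c₂ form the right side of the exchange relation.
Replacing it by the left side puts b₁ first, and the pairings that remain merge into one with c₂
S̄c₃. -/
theorem triple_contract_cross (T : Module.Dual k B ⊗[k] Module.Dual k B) (b : B) :
    triple iC iH iB (contract k H B (TensorProduct.map
      (TensorProduct.map₂ (lAct k H B) (lAct k H B) (R : H ⊗[k] H))
      ((LinearMap.lTensorHom H ∘ₗ (lAct k H B).flip).flip (↑R⁻¹ : H ⊗[k] H) ∘ₗ barAntipode S)
      (LinearMap.rTensor (Module.Dual k B) (barComul R) T)) (crossRight R b)) =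
    mulMap iB ((mulMapHom (V' := Module.Dual k B ⊗[k] Module.Dual k B) iC ∘ₗ LinearMap.lcomp k U (TensorProduct.lift (dualMul k B) ∘ₗ
        LinearMap.lTensor _ (barAntipode S)) ∘ₗ slotL B iH.toLinearMap ↑R⁻¹).flip
      (TensorProduct.assoc k _ _ _ (LinearMap.rTensor _ comul T))) (comul b) := by
  induction T with
  | zero => simp [mulMap_zero_right]
  | add x y hx hy =>
    simp only [map_add, LinearMap.add_apply, mulMap_add_right, hx, hy]
  | tmul c e =>
  have h1 : ∀ (V : Module.Dual k B ⊗[k] Module.Dual k B) (P : B ⊗[k] B),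
      triple iC iH iB (contract k H B (TensorProduct.map
        (TensorProduct.map₂ (lAct k H B) (lAct k H B) (R : H ⊗[k] H))
        ((LinearMap.lTensorHom H ∘ₗ (lAct k H B).flip).flip (↑R⁻¹ : H ⊗[k] H) ∘ₗ barAntipode S)
        (V ⊗ₜ e)) (TensorProduct.map
          ((LinearMap.rTensorHom H ∘ₗ (rAct k H B).flip).flip (R : H ⊗[k] H))
          (TensorProduct.map₂ (rAct k H B) (rAct k H B) (↑R⁻¹ : H ⊗[k] H))
          (LinearMap.lTensor B comul P))) =
      mulMap ((mulMapHomLeft iC ∘ₗ slotR B iH.toLinearMap ↑R).flip V)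
        (conv iB ((slotL B iH.toLinearMap ↑R⁻¹).flip (barAntipode S e))) P := by
    intro V P
    induction P with
    | zero => simp
    | add x y hx hy => simp only [map_add, hx, hy]
    | tmul b₁ b₂ =>
      rw [LinearMap.lTensor_tmul, TensorProduct.map_tmul, TensorProduct.map_tmul, triple_contract]
      refine (congrArg₂ (· * ·) (contractC_act hD.quasitriangular hU.relLeft V b₁)
        (contractB_act hD.quasitriangular hU.relRight (barAntipode S e) (comul b₂))).trans ?_
      rfl
  have h2 := h1 (barComul R c) (comul b)
  rw [← hD.comul_eq] at h2
  have h3 : (mulMapHomLeft iC ∘ₗ slotR B iH.toLinearMap ↑R).flip (comul c) =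
      mixR iC iH.toLinearMap ↑R c := rfl
  rw [h3, ← conv_apply, conv_assoc, ← hU.exchange, ← conv_assoc] at h2
  rw [LinearMap.rTensor_tmul, ← hD.comul_eq]
  refine h2.trans ?_
  rw [conv_apply]
  congr 2
  ext b'
  rw [conv_mixL_slotL hD]
  have h4 : ∀ V : Module.Dual k B ⊗[k] Module.Dual k B,
      mulMap iC (slotL B iH.toLinearMap ↑R⁻¹ b' ∘ₗ (dualMul k B).flip (barAntipode S e)) V =
      mulMap (W := Module.Dual k B ⊗[k] Module.Dual k B) iC
        (slotL B iH.toLinearMap ↑R⁻¹ b' ∘ₗ TensorProduct.lift (dualMul k B) ∘ₗ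
          LinearMap.lTensor _ (barAntipode S)) (TensorProduct.assoc k _ _ _ (V ⊗ₜ e)) := by
    intro V
    induction V with
    | zero => simp
    | add x y hx hy => simp only [map_add, add_tmul, hx, hy]
    | tmul c₁ c₂ => simp
  exact h4 (comul c)

/-- The antipode axiom of `C̄` collapses c₂ S̄c₃, so that only bd is left: the product formula is
the exchange relation solved for bd. -/
theorem triple_cross (b : B) (d : Module.Dual k B) :
    triple iC iH iB (cross R S b d) = iB b * iC d := by
  have h0 : cross R S b d = contract k H B (TensorProduct.map
      (TensorProduct.map₂ (lAct k H B) (lAct k H B) (R : H ⊗[k] H))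
      ((LinearMap.lTensorHom H ∘ₗ (lAct k H B).flip).flip (↑R⁻¹ : H ⊗[k] H) ∘ₗ barAntipode S)
      (LinearMap.rTensor (Module.Dual k B) (barComul R) (barComul R d))) (crossRight R b) := rfl
  rw [h0, hU.triple_contract_cross hD, ← hD.comul_eq, coassoc_apply]
  have h2 : ∀ (b' : B) (T : Module.Dual k B ⊗[k] Module.Dual k B),
      mulMap iC ((slotL B iH.toLinearMap ↑R⁻¹ b' ∘ₗ TensorProduct.lift (dualMul k B) ∘ₗ
        LinearMap.lTensor _ (barAntipode S)) ∘ₗ comul) T =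
      counit (R := k) b' • iC (TensorProduct.rid k _ (LinearMap.lTensor _ counit T)) := by
    intro b' T
    induction T with
    | zero => simp
    | add x y hx hy => simp only [map_add, smul_add, hx, hy]
    | tmul c₁ c₂ =>
      rw [mulMap_tmul, LinearMap.comp_apply, LinearMap.comp_apply, LinearMap.comp_apply,
        hD.comul_eq, dualMul_barAntipode_right hD.quasitriangular hD.group, map_smul,
        slotL_counit hD.group (normalized_rmat_inv hD.quasitriangular)]
      simp [hD.counit_eq, smul_smul, mul_comm]
  have h3 : (mulMapHom (V' := Module.Dual k B ⊗[k] Module.Dual k B) iC ∘ₗ LinearMap.lcomp k U (TensorProduct.lift (dualMul k B) ∘ₗ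
        LinearMap.lTensor _ (barAntipode S)) ∘ₗ slotL B iH.toLinearMap ↑R⁻¹).flip
      (LinearMap.lTensor _ comul (comul d)) = LinearMap.toSpanSingleton k U (iC d) ∘ₗ counit := by
    ext b'
    have h5 := mulMap_lTensor iC (slotL B iH.toLinearMap ↑R⁻¹ b' ∘ₗ
      TensorProduct.lift (dualMul k B) ∘ₗ LinearMap.lTensor _ (barAntipode S)) comul (comul d)
    rw [h2, lTensor_counit_comul, TensorProduct.rid_tmul, one_smul] at h5
    exact h5
  have h4 : ∀ P : B ⊗[k] B, mulMap iB (LinearMap.toSpanSingleton k U (iC d) ∘ₗ counit) P =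
      iB (TensorProduct.rid k B (LinearMap.lTensor B counit P)) * iC d := by
    intro P
    induction P with
    | zero => simp
    | add x y hx hy => simp only [map_add, add_mul, hx, hy]
    | tmul x y => simp
  rw [h3, h4]
  simp

omit hD in
theorem triple_smashRight (g : H) (a : B) (s : Space k H B) :
    triple iC iH iB (LinearMap.lTensor _ (smashRight (g ⊗ₜ a)) s) =
      triple iC iH iB s * (iH g * iB a) := by
  induction s using Space.induction with
  | zero => simp
  | add x y hx hy => simp only [map_add, add_mul, hx, hy]
  | tmul c h b =>
    have h1 : ∀ X : H ⊗[k] H, triple iC iH iB (c ⊗ₜ LinearMap.lTensor H ((LinearMap.mul k B).flip a)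
        (TensorProduct.map₂ (LinearMap.mul k H).flip (rAct k H B) X (h ⊗ₜ b))) =
        iC c * (iH h * (mulMap iH.toLinearMap (iB ∘ₗ ract k H b) X * iB a)) := by
      intro X
      induction X with
      | zero => simp
      | add x y hx hy =>
        simp only [map_add, LinearMap.add_apply, tmul_add, mul_add, add_mul, hx, hy]
      | tmul x y => simp [triple_tmul, hU.map_mul, mul_assoc]
    have h2 := hU.relRight b g
    rw [AlgHom.toLinearMap_apply] at h2
    refine (h1 (comul g)).trans ?_
    rw [← h2, triple_tmul]
    simp only [mul_assoc]

omit hD in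
theorem triple_smashLeft (c : Module.Dual k B) (h : H) (s : Space k H B) :
    triple iC iH iB (TensorProduct.assoc k _ _ _ (LinearMap.rTensor B (smashLeft (c ⊗ₜ h))
      ((TensorProduct.assoc k _ _ _).symm s))) = iC c * iH h * triple iC iH iB s := by
  induction s using Space.induction with
  | zero => simp
  | add x y hx hy => simp only [map_add, mul_add, hx, hy]
  | tmul d g b =>
    have h1 : ∀ X : H ⊗[k] H, triple iC iH iB (TensorProduct.assoc k _ _ _
        (LinearMap.rTensor H (dualMul k B c)
          (TensorProduct.map₂ (lAct k H B) (LinearMap.mul k H) X (d ⊗ₜ g)) ⊗ₜ b)) =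
        iC c * mulMap (iC ∘ₗ lact H d) iH.toLinearMap X * (iH g * iB b) := by
      intro X
      induction X with
      | zero => simp
      | add x y hx hy =>
        simp only [map_add, LinearMap.add_apply, add_tmul, mul_add, add_mul, hx, hy]
      | tmul x y => simp [triple_tmul, hU.map_dualMul, mul_assoc]
    have h2 := hU.relLeft h d
    rw [AlgHom.toLinearMap_apply] at h2
    refine (h1 (comul h)).trans ?_
    rw [← h2, triple_tmul]
    simp only [mul_assoc]

theorem triple_mul (x y : Space k H B) :
    triple iC iH iB (DoubleBosonisation.mul R S x y) = triple iC iH iB x * triple iC iH iB y := by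
  induction x using Space.induction with
  | zero => simp
  | add x y hx hy => simp only [map_add, LinearMap.add_apply, add_mul, hx, hy]
  | tmul c h b =>
  induction y using Space.induction with
  | zero => simp
  | add x y hx hy => simp only [map_add, mul_add, hx, hy]
  | tmul d g a =>
    rw [mul_tmul, hU.triple_smashLeft, hU.triple_smashRight, hU.triple_cross hD, triple_tmul,
      triple_tmul]
    simp only [mul_assoc]

theorem comul_triple (s : Space k H B) : comul (R := k) (triple iC iH iB s) =
    TensorProduct.map (triple iC iH iB) (triple iC iH iB) (DoubleBosonisation.comul R s) := by
  induction s using Space.induction with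
  | zero => simp
  | add x y hx hy => simp only [map_add, hx, hy]
  | tmul c h b =>
    rw [map_triple_comul hD hU.relLeft hU.relRight, triple_tmul, Bialgebra.comul_mul,
      Bialgebra.comul_mul, hU.comul_C, hU.comul_H, hU.comul_B]

omit hD in
theorem counit_triple (s : Space k H B) :
    counit (R := k) (triple iC iH iB s) = DoubleBosonisation.counit k H B s := by
  induction s using Space.induction with
  | zero => simp
  | add x y hx hy => simp only [map_add, hx, hy]
  | tmul c h b =>
    rw [triple_tmul, Bialgebra.counit_mul, Bialgebra.counit_mul, hU.counit_C, hU.counit_H,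
      hU.counit_B]
    rfl

end IsDouble

end Double

/-! ### The canonical element of `C̄ ⊗ B` -/

section Canonical

variable {A : Type*} [Ring A] [Algebra k A] {ι : Type*} [Fintype ι] (e : Module.Basis ι k B)

/-- The image `∑ p(fᵃ) q(eₐ)` of the canonical element of `B* ⊗ B`. -/
def canon (p : Module.Dual k B →ₗ[k] A) (q : B →ₗ[k] A) : A := ∑ a, p (e.coord a) * q (e a)

variable (p : Module.Dual k B →ₗ[k] A) (q r : B →ₗ[k] A)

/-- An endomorphism of `B` on one leg of the canonical element equals its transpose on the other
leg. -/
theorem sum_coord_comp (g : B →ₗ[k] B) :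
    ∑ a, p (e.coord a ∘ₗ g) * q (e a) = ∑ a, p (e.coord a) * q (g (e a)) := by
  classical
  have h1 : ∀ a, e.coord a ∘ₗ g = ∑ b, e.coord a (g (e b)) • e.coord b := fun a =>
    (e.sum_dual_apply_smul_coord (e.coord a ∘ₗ g)).symm
  have h2 : ∀ b, g (e b) = ∑ a, e.coord a (g (e b)) • e a := fun b => (e.sum_repr (g (e b))).symm
  calc ∑ a, p (e.coord a ∘ₗ g) * q (e a)
      = ∑ a, ∑ b, e.coord a (g (e b)) • (p (e.coord b) * q (e a)) := by
        refine Finset.sum_congr rfl fun a _ => ?_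
        rw [h1 a, map_sum, Finset.sum_mul]
        simp only [map_smul, smul_mul_assoc]
    _ = ∑ b, ∑ a, e.coord a (g (e b)) • (p (e.coord b) * q (e a)) := Finset.sum_comm
    _ = ∑ b, p (e.coord b) * q (g (e b)) := by
        refine Finset.sum_congr rfl fun b _ => ?_
        conv_rhs => rw [h2 b, map_sum, Finset.mul_sum]
        simp only [map_smul, mul_smul_comm]

theorem dualMul_eq_comp_leftAct (c d : Module.Dual k B) :
    dualMul k B c d = d ∘ₗ leftAct c := by
  rw [comp_leftAct]
  rfl

theorem dualMul_eq_comp_rightAct (c d : Module.Dual k B) :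
    dualMul k B c d = c ∘ₗ rightAct d := by
  rw [comp_rightAct]
  rfl

theorem sum_mul_leftAct (b : B) : ∑ a, q (e a) * r (leftAct (e.coord a) b) = conv q r b := by
  have h : ∀ P : B ⊗[k] B, ∑ a, q (e a) * r (TensorProduct.lid k B
      (LinearMap.rTensor B (e.coord a) P)) = mulMap q r P := by
    intro P
    induction P with
    | zero => simp
    | add x y hx hy => simp only [map_add, mul_add, Finset.sum_add_distrib, hx, hy]
    | tmul x y =>
      conv_rhs => rw [mulMap_tmul, ← e.sum_repr x, map_sum, Finset.sum_mul]
      simp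
  exact h _

/-- The product of `B*` is the transpose of the coproduct of `B`, so q ↦ ∑ p(fᵃ) q(eₐ) turns
convolution into multiplication. -/
theorem canon_conv (hp : ∀ c d, p (dualMul k B c d) = p c * p d) (h : ∀ c b, Commute (p c) (q b)) :
    canon e p (conv q r) = canon e p q * canon e p r := by
  have h1 : ∀ a, ∑ b, p (e.coord b) * (q (e a) * r (leftAct (e.coord a) (e b))) =
      ∑ b, p (e.coord a) * q (e a) * (p (e.coord b) * r (e b)) := by
    intro a
    refine (sum_coord_comp e p (LinearMap.mulLeft k (q (e a)) ∘ₗ r)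
      (leftAct (e.coord a))).symm.trans (Finset.sum_congr rfl fun b _ => ?_)
    rw [← dualMul_eq_comp_leftAct, hp, LinearMap.comp_apply, LinearMap.mulLeft_apply, mul_assoc,
      mul_assoc, ← mul_assoc (q (e a)), ← (h (e.coord b) (e a)).eq, mul_assoc]
  rw [canon, canon, canon, Finset.sum_mul_sum, ← Finset.sum_congr rfl fun a _ => h1 a,
    Finset.sum_comm]
  refine Finset.sum_congr rfl fun b _ => ?_
  rw [← Finset.mul_sum, sum_mul_leftAct]

theorem canon_counit (hp : p counit = 1) :
    canon e p (Algebra.linearMap k A ∘ₗ counit) = 1 := by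
  have h := e.sum_dual_apply_smul_coord (counit : Module.Dual k B)
  rw [← hp]
  conv_rhs => rw [← h, map_sum]
  refine Finset.sum_congr rfl fun a _ => ?_
  rw [map_smul, Algebra.smul_def, LinearMap.comp_apply, Algebra.linearMap_apply, Algebra.commutes]

/-- S is convolution inverse to the identity of `B`, so `canon_conv` makes the exponential ∑ fᵃ ⊗ S
eₐ inverse to the canonical element. -/
theorem canon_antipode_mul {S : B →ₗ[k] B} {R : H ⊗[k] H} (hB : IsBraidedGroup R S)
    (hp : ∀ c d, p (dualMul k B c d) = p c * p d) (hp1 : p counit = 1)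
    (hq : ∀ a b, q (a * b) = q a * q b) (hq1 : q 1 = 1) (h : ∀ c b, Commute (p c) (q b)) :
    canon e p (q ∘ₗ S) * canon e p q = 1 := by
  rw [← canon_conv e p _ _ hp fun c b => h c (S b), ← canon_counit e p hp1]
  congr 1
  ext b
  have h1 : ∀ P : B ⊗[k] B, mulMap (q ∘ₗ S) q P = q (LinearMap.mul' k B (LinearMap.rTensor B S P)) := by
    intro P
    induction P with
    | zero => simp
    | add x y hx hy => simp only [map_add, hx, hy]
    | tmul x y => simp [hq]
  rw [conv_apply, h1, hB.mul_antipode_left, Algebra.algebraMap_eq_smul_one, map_smul, hq1,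
    LinearMap.comp_apply, Algebra.linearMap_apply, Algebra.algebraMap_eq_smul_one]

theorem canon_mul_antipode {S : B →ₗ[k] B} {R : H ⊗[k] H} (hB : IsBraidedGroup R S)
    (hp : ∀ c d, p (dualMul k B c d) = p c * p d) (hp1 : p counit = 1)
    (hq : ∀ a b, q (a * b) = q a * q b) (hq1 : q 1 = 1) (h : ∀ c b, Commute (p c) (q b)) :
    canon e p q * canon e p (q ∘ₗ S) = 1 := by
  rw [← canon_conv e p _ _ hp h, ← canon_counit e p hp1]
  congr 1
  ext b
  have h1 : ∀ P : B ⊗[k] B, mulMap q (q ∘ₗ S) P = q (LinearMap.mul' k B (LinearMap.lTensor B S P)) := by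
    intro P
    induction P with
    | zero => simp
    | add x y hx hy => simp only [map_add, hx, hy]
    | tmul x y => simp [hq]
  rw [conv_apply, h1, hB.mul_antipode_right, Algebra.algebraMap_eq_smul_one, map_smul, hq1,
    LinearMap.comp_apply, Algebra.linearMap_apply, Algebra.algebraMap_eq_smul_one]

end Canonical

/-! ### Multiplication by b on a leg of the canonical element -/

section Pairing

variable [FiniteDimensional k B] [Coalgebra k (Module.Dual k B)]
  {R : (H ⊗[k] H)ˣ} {S : B ≃ₗ[k] B} {A : Type*} [Ring A] [Algebra k A]
  {iC : Module.Dual k B →ₗ[k] A} {iH : H →ₐ[k] A}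

theorem curry_zero_dual : TensorProduct.curry (0 : B ⊗[k] B →ₗ[k] k) = 0 := by
  ext
  simp

theorem curry_zero_dual_flip : (TensorProduct.curry (0 : B ⊗[k] B →ₗ[k] k)).flip = 0 := by
  ext
  simp

/-- R undoes the R⁻¹ in the coproduct of `C̄` and leaves the transpose of the opposite product
without braiding. Multiplication in `B` is thereby expressed through the coproduct of `C̄`. -/
theorem dualDistrib_lAct_barComul (c : Module.Dual k B) (a b : B) :
    dualDistrib k B B (TensorProduct.map₂ (lAct k H B) (lAct k H B) (R : H ⊗[k] H) (barComul R c))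
      (a ⊗ₜ b) = c (b * a) := by
  rw [dualDistrib_lAct, dualDistrib_barComul, twistedMul_inv_map₂]

/-- `⟨c(· (b ◁ R⁽¹⁾))⟩ R⁽²⁾ = ⟨c₍₁₎, b ◁ R⁽¹⁾⟩ R⁽²⁾ c₍₂₎`. -/
theorem mulMap_rightDual (hD : IsBarDual R S) (hl : RelLeft iC iH.toLinearMap)
    (c : Module.Dual k B) (b : B) :
    mulMap (iC ∘ₗ (LinearMap.mul k B).flip.compr₂ c ∘ₗ ract k H b) iH.toLinearMap
      (R : H ⊗[k] H) = mixR iC iH.toLinearMap ↑R c b := by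
  rw [mixR_apply, ← contractC_act hD.quasitriangular hl, hD.comul_eq]
  set V := TensorProduct.map₂ (lAct k H B) (lAct k H B) (R : H ⊗[k] H) (barComul R c) with hV
  have h1 : ∀ (V : Module.Dual k B ⊗[k] Module.Dual k B) (b' : B) (g : H),
      contractC iC iH V (b' ⊗ₜ g) = iC (TensorProduct.curry (dualDistrib k B B V) b') * iH g := by
    intro V b' g
    induction V with
    | zero =>
      rw [map_zero, map_zero, curry_zero_dual, LinearMap.zero_apply, LinearMap.zero_apply, map_zero,
        zero_mul]
    | add x y hx hy =>
      have : TensorProduct.curry (dualDistrib k B B (x + y)) b' =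
          TensorProduct.curry (dualDistrib k B B x) b' +
            TensorProduct.curry (dualDistrib k B B y) b' := by ext; simp
      rw [this, map_add, map_add, LinearMap.add_apply, hx, hy, add_mul]
    | tmul c d =>
      have : TensorProduct.curry (dualDistrib k B B (c ⊗ₜ d)) b' = c b' • d := by ext; simp
      rw [this]
      simp
  have h2 : TensorProduct.curry (dualDistrib k B B V) = (LinearMap.mul k B).flip.compr₂ c := by
    ext x y
    rw [TensorProduct.curry_apply, hV, dualDistrib_lAct_barComul]
    rfl
  generalize (R : H ⊗[k] H) = X
  induction X with
  | zero => simp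
  | add x y hx hy => simp only [map_add, hx, hy]
  | tmul x y =>
    rw [LinearMap.rTensor_tmul, h1, h2]
    rfl

/-- `R⁻⁽¹⁾ ⟨c((b ◁ R⁻⁽²⁾) ·)⟩ = c₍₁₎ R⁻⁽¹⁾ ⟨c₍₂₎, b ◁ R⁻⁽²⁾⟩`. -/
theorem mulMap_leftDual (hD : IsBarDual R S) (hl : RelLeft iC iH.toLinearMap)
    (c : Module.Dual k B) (b : B) :
    mulMap iH.toLinearMap (iC ∘ₗ (LinearMap.mul k B).compr₂ c ∘ₗ ract k H b)
      (↑R⁻¹ : H ⊗[k] H) = mixL iC iH.toLinearMap ↑R⁻¹ c b := by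
  have h1 : ∀ V : Module.Dual k B ⊗[k] Module.Dual k B,
      mulMap iH.toLinearMap (iC ∘ₗ (TensorProduct.curry (dualDistrib k B B
        (TensorProduct.map₂ (lAct k H B) (lAct k H B) (R : H ⊗[k] H) V))).flip ∘ₗ ract k H b)
          (↑R⁻¹ : H ⊗[k] H) = mulMap iC (slotL B iH.toLinearMap (↑R⁻¹ : H ⊗[k] H) b) V := by
    intro V
    induction V with
    | zero =>
      rw [map_zero, map_zero, map_zero, curry_zero_dual_flip, LinearMap.zero_comp,
        LinearMap.comp_zero, mulMap_zero_right, LinearMap.zero_apply]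
    | add x y hx hy =>
      have : ∀ x y : Module.Dual k B ⊗[k] Module.Dual k B,
          (TensorProduct.curry (dualDistrib k B B (x + y))).flip =
          (TensorProduct.curry (dualDistrib k B B x)).flip +
            (TensorProduct.curry (dualDistrib k B B y)).flip := by intros; ext; simp
      rw [map_add, this, LinearMap.add_comp, LinearMap.comp_add, mulMap_add_right,
        LinearMap.add_apply, hx, hy, map_add]
    | tmul c₁ c₂ =>
      let F : H ⊗[k] (H ⊗[k] H) →ₗ[k] A := mulMap (iC ∘ₗ lact H c₁)
        (((slotL B iH.toLinearMap).flip b).flip c₂)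
      have h2 : ∀ X Y : H ⊗[k] H,
          mulMap iH.toLinearMap (iC ∘ₗ (TensorProduct.curry (dualDistrib k B B
            (TensorProduct.map₂ (lAct k H B) (lAct k H B) X (c₁ ⊗ₜ c₂)))).flip ∘ₗ ract k H b) Y =
            F (TensorProduct.assoc k H H H (LinearMap.rTensor H comul Y) * leg13 k X) := by
        intro X Y
        induction X with
        | zero =>
          rw [map_zero, LinearMap.zero_apply, map_zero, map_zero, mul_zero, map_zero,
            curry_zero_dual_flip, LinearMap.zero_comp, LinearMap.comp_zero, mulMap_zero_right,
            LinearMap.zero_apply]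
        | add x y hx hy =>
          have : ∀ x y : Module.Dual k B ⊗[k] Module.Dual k B,
              (TensorProduct.curry (dualDistrib k B B (x + y))).flip =
              (TensorProduct.curry (dualDistrib k B B x)).flip +
                (TensorProduct.curry (dualDistrib k B B y)).flip := by intros; ext; simp
          rw [map_add, LinearMap.add_apply, this, LinearMap.add_comp, LinearMap.comp_add,
            mulMap_add_right, LinearMap.add_apply, hx, hy, map_add, mul_add, map_add]
        | tmul x x' =>
          induction Y with
          | zero => simp
          | add x y hx hy => simp only [map_add, add_mul, hx, hy]
          | tmul y y' =>
            have h3 : (TensorProduct.curry (dualDistrib k B B (TensorProduct.map₂ (lAct k H B)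
                (lAct k H B) (x ⊗ₜ x') (c₁ ⊗ₜ c₂)))).flip (rAct k H B y' b) =
                c₂ (rAct k H B (y' * x') b) • lAct k H B x c₁ := by
              ext; simp [lAct_apply, rAct_mul, mul_comm]
            have h4 : ∀ Z : H ⊗[k] H, c₂ (rAct k H B (y' * x') b) •
                mulMap (iC ∘ₗ lact H (lAct k H B x c₁)) iH.toLinearMap Z =
                F (TensorProduct.assoc k H H H (Z ⊗ₜ y') * leg13 k (x ⊗ₜ x')) := by
              intro Z
              induction Z with
              | zero => simp
              | add x y hx hy => simp only [map_add, add_tmul, add_mul, smul_add, hx, hy]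
              | tmul z z' => simp [F, leg13, lAct_mul]
            have h5 := hl y (lAct k H B x c₁)
            rw [mulMap_tmul, LinearMap.comp_apply, LinearMap.comp_apply, LinearMap.flip_apply (rAct k H B),
              h3, map_smul, mul_smul_comm, h5, h4]
            rfl
      have h6 : leg13 k (↑R⁻¹ : H ⊗[k] H) * leg13 k (R : H ⊗[k] H) = 1 := by
        let G : H ⊗[k] H →ₐ[k] H ⊗[k] (H ⊗[k] H) :=
          Algebra.TensorProduct.map (AlgHom.id k H) Algebra.TensorProduct.includeRight
        have hG : ∀ X, leg13 k X = G X := fun _ => rfl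
        rw [hG, hG, ← _root_.map_mul, Units.inv_mul, _root_.map_one]
      have h7 : ∀ X : H ⊗[k] H, F (leg23 k X) = iC c₁ * slotL B iH.toLinearMap X b c₂ := by
        intro X
        simp [F, leg23]
      -- The R that was inserted to undo the R⁻¹ in the coproduct of `C̄` cancels R₁₃⁻¹ in (Δ ⊗
      -- id)R⁻¹ = R₂₃⁻¹R₁₃⁻¹, and R₂₃⁻¹ is the copy that occurs in `mixL`.
      rw [h2, rTensor_comul_inv hD.quasitriangular, mul_assoc, h6, mul_one, h7]
      rfl
  have h8 : (TensorProduct.curry (dualDistrib k B B (TensorProduct.map₂ (lAct k H B) (lAct k H B)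
      (R : H ⊗[k] H) (barComul R c)))).flip = (LinearMap.mul k B).compr₂ c := by
    ext x y
    rw [LinearMap.flip_apply, TensorProduct.curry_apply, dualDistrib_lAct_barComul]
    rfl
  rw [mixL_apply, ← h1, hD.comul_eq, h8]

end Pairing

/-! ### The quasitriangular structure of the double -/

section Double

variable [FiniteDimensional k B] [Coalgebra k (Module.Dual k B)]
  {R : (H ⊗[k] H)ˣ} {S : B ≃ₗ[k] B} {U : Type*} [Ring U] [Bialgebra k U]
  {iC : Module.Dual k B →ₗ[k] U} {iH : H →ₐ[k] U} {iB : B →ₗ[k] U}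
  {A : Type*} [Ring A] [Algebra k A] {φ₁ φ₂ φ₃ : U →ₐ[k] A}
  {ι : Type*} [Fintype ι] (e : Module.Basis ι k B)

/-- The coproduct of `U` with its two factors mapped to `A`. -/
def slotComul (h : ∀ x y, Commute (φ₁ x) (φ₂ y)) : U →ₐ[k] A :=
  (Algebra.TensorProduct.lift φ₁ φ₂ h).comp (Bialgebra.comulAlgHom k U)

theorem commute_slotComul_left (h : ∀ x y, Commute (φ₁ x) (φ₂ y))
    (h₁₃ : ∀ x y, Commute (φ₁ x) (φ₃ y)) (h₂₃ : ∀ x y, Commute (φ₂ x) (φ₃ y)) (x y : U) :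
    Commute (slotComul h x) (φ₃ y) := by
  have h2 : ∀ X : U ⊗[k] U, Commute (Algebra.TensorProduct.lift φ₁ φ₂ h X) (φ₃ y) := by
    intro X
    induction X with
    | zero => simp
    | add a b ha hb => simpa only [map_add] using ha.add_left hb
    | tmul a b => simpa using (h₁₃ a y).mul_left (h₂₃ b y)
  exact h2 _

theorem commute_slotComul_right (h : ∀ x y, Commute (φ₁ x) (φ₂ y))
    (h₁₃ : ∀ x y, Commute (φ₁ x) (φ₃ y)) (h₂₃ : ∀ x y, Commute (φ₂ x) (φ₃ y)) (x y : U) :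
    Commute (φ₁ x) (slotComul h₂₃ y) := by
  have h2 : ∀ X : U ⊗[k] U, Commute (φ₁ x) (Algebra.TensorProduct.lift φ₂ φ₃ h₂₃ X) := by
    intro X
    induction X with
    | zero => simp
    | add a b ha hb => simpa only [map_add] using ha.add_right hb
    | tmul a b => simpa using (h x a).mul_right (h₁₃ x b)
  exact h2 _

variable (iC iB φ₁ φ₂) in
/-- The image of the canonical element of `C̄ ⊗ B` in the factors `φ₁` and `φ₂`. -/
def slotCanon : A := canon e (φ₁.toLinearMap ∘ₗ iC) (φ₂.toLinearMap ∘ₗ iB)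

variable (iC iB φ₁ φ₂) in
/-- The image of `∑ fᵃ ⊗ S eₐ` in the factors `φ₁` and `φ₂`. -/
def slotExp (S : B ≃ₗ[k] B) : A :=
  canon e (φ₁.toLinearMap ∘ₗ iC) ((φ₂.toLinearMap ∘ₗ iB) ∘ₗ S.toLinearMap)

variable (iC iB φ₁ φ₂) in
/-- `x ↦ ∑ fᵃ ⊗ (eₐ ◁ x)`, in the factors `φ₁` and `φ₂`. -/
def slotCanonAct : H →ₗ[k] A :=
  ∑ a, LinearMap.mulLeft k (φ₁ (iC (e.coord a))) ∘ₗ (φ₂.toLinearMap ∘ₗ iB) ∘ₗ ract k H (e a)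

theorem slotCanonAct_apply (x : H) : slotCanonAct iC iB φ₁ φ₂ e x =
    ∑ a, φ₁ (iC (e.coord a)) * φ₂ (iB (rAct k H B x (e a))) := by
  simp [slotCanonAct]

theorem map_slotExp {A' : Type*} [Ring A'] [Algebra k A'] (ψ : A →ₐ[k] A') :
    ψ (slotExp iC iB φ₁ φ₂ e S) = slotExp iC iB (ψ.comp φ₁) (ψ.comp φ₂) e S := by
  simp [slotExp, canon]

theorem canon_conjMap_right {p : Module.Dual k B →ₗ[k] A} (q : B →ₗ[k] A) {u v : A}
    (h : ∀ c, Commute (p c) u) : canon e p (conjMap u v q) = u * canon e p q * v := by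
  simp only [canon, Finset.mul_sum, Finset.sum_mul, conjMap_apply]
  refine Finset.sum_congr rfl fun a _ => ?_
  rw [← mul_assoc, ← mul_assoc, (h _).eq, mul_assoc u]

namespace IsDouble

variable (hU : IsDouble R iC iH iB) (hD : IsBarDual R S)
  (h : ∀ x y, Commute (φ₁ x) (φ₂ y))

section
include hU

theorem slotComul_C : (slotComul h).toLinearMap ∘ₗ iC = prodC iC iH φ₁ φ₂ R := by
  have h1 : (Algebra.TensorProduct.lift φ₁ φ₂ h).comp (inl k U) = φ₁ := by
    ext x; simp [inl_apply]
  have h2 : (Algebra.TensorProduct.lift φ₁ φ₂ h).comp (inr k U) = φ₂ := by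
    ext x; simp [inr_apply]
  have h3 := map_prodC (R := R) (jC := iC) (jH := iH) (φ₁ := inl k U) (φ₂ := inr k U)
    (Algebra.TensorProduct.lift φ₁ φ₂ h)
  rw [h1, h2] at h3
  rw [← h3]
  ext c
  exact congrArg (Algebra.TensorProduct.lift φ₁ φ₂ h) (hU.comul_C c)

theorem slotComul_B : (slotComul h).toLinearMap ∘ₗ iB = prodB iH iB φ₁ φ₂ R := by
  have h1 : (Algebra.TensorProduct.lift φ₁ φ₂ h).comp (inl k U) = φ₁ := by
    ext x; simp [inl_apply]
  have h2 : (Algebra.TensorProduct.lift φ₁ φ₂ h).comp (inr k U) = φ₂ := by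
    ext x; simp [inr_apply]
  have h3 := map_prodB (R := R) (jH := iH) (jB := iB) (φ₁ := inl k U) (φ₂ := inr k U)
    (Algebra.TensorProduct.lift φ₁ φ₂ h)
  rw [h1, h2] at h3
  rw [← h3]
  ext b
  exact congrArg (Algebra.TensorProduct.lift φ₁ φ₂ h) (hU.comul_B b)

theorem slotComul_H : ((slotComul h).comp iH).toLinearMap =
    conv (φ₁.comp iH).toLinearMap (φ₂.comp iH).toLinearMap := by
  have h1 : (Algebra.TensorProduct.lift φ₁ φ₂ h).comp (inl k U) = φ₁ := by
    ext x; simp [inl_apply]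
  have h2 : (Algebra.TensorProduct.lift φ₁ φ₂ h).comp (inr k U) = φ₂ := by
    ext x; simp [inr_apply]
  have h3 := map_conv (Algebra.TensorProduct.lift φ₁ φ₂ h) ((inl k U).comp iH).toLinearMap
    ((inr k U).comp iH).toLinearMap
  rw [← AlgHom.comp_toLinearMap, ← AlgHom.comp_toLinearMap, ← AlgHom.comp_assoc,
    ← AlgHom.comp_assoc, h1, h2] at h3
  rw [← h3]
  ext x
  exact congrArg (Algebra.TensorProduct.lift φ₁ φ₂ h) (hU.comul_H x)

include hD h in
theorem slotExp_mul_slotCanon :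
    slotExp iC iB φ₁ φ₂ e S * slotCanon iC iB φ₁ φ₂ e = 1 :=
  canon_antipode_mul e _ _ hD.group (fun c d => by simp [hU.map_dualMul])
    (by simp [hU.map_counit]) (fun a b => by simp [hU.map_mul]) (by simp [hU.map_one])
    fun c b => h _ _

include hD h in
theorem slotCanon_mul_slotExp :
    slotCanon iC iB φ₁ φ₂ e * slotExp iC iB φ₁ φ₂ e S = 1 :=
  canon_mul_antipode e _ _ hD.group (fun c d => by simp [hU.map_dualMul])
    (by simp [hU.map_counit]) (fun a b => by simp [hU.map_mul]) (by simp [hU.map_one])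
    fun c b => h _ _

include h

include hD in
/-- `T (b ◁ R⁽¹⁾) R⁽²⁾`, expanded in the basis of the second factor. -/
theorem slotCanon_mul_B (b : B) :
    slotCanon iC iB φ₁ φ₂ e *
        mulMap ((φ₂.toLinearMap ∘ₗ iB) ∘ₗ ract k H b) (φ₁.comp iH).toLinearMap (R : H ⊗[k] H) =
      ∑ a, φ₁ (mixR iC iH.toLinearMap ↑R (e.coord a) b) * φ₂ (iB (e a)) := by
  have h1 : ∀ X : H ⊗[k] H, slotCanon iC iB φ₁ φ₂ e *
      mulMap ((φ₂.toLinearMap ∘ₗ iB) ∘ₗ ract k H b) (φ₁.comp iH).toLinearMap X =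
      ∑ a, φ₁ (mulMap (iC ∘ₗ (LinearMap.mul k B).flip.compr₂ (e.coord a) ∘ₗ ract k H b)
        iH.toLinearMap X) * φ₂ (iB (e a)) := by
    intro X
    induction X with
    | zero => simp
    | add x y hx hy => simp only [map_add, mul_add, add_mul, Finset.sum_add_distrib, hx, hy]
    | tmul x y =>
      have h2 := sum_coord_comp e (φ₁.toLinearMap ∘ₗ iC)
        (LinearMap.mulLeft k (φ₁ (iH y)) ∘ₗ φ₂.toLinearMap ∘ₗ iB)
        ((LinearMap.mul k B).flip (rAct k H B x b))
      rw [slotCanon, canon, Finset.sum_mul]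
      refine Eq.trans (Finset.sum_congr rfl fun a _ => ?_) (h2.symm.trans
        (Finset.sum_congr rfl fun a _ => ?_))
      · simp only [mulMap_tmul, LinearMap.comp_apply, LinearMap.flip_apply,
          AlgHom.toLinearMap_apply, LinearMap.mul_apply', LinearMap.mulLeft_apply, hU.map_mul,
          _root_.map_mul, AlgHom.comp_apply, mul_assoc]
        rw [((h (iH y) (iB (e a))).mul_right (h (iH y) (iB (rAct k H B x b)))).eq, mul_assoc]
      · simp only [mulMap_tmul, LinearMap.comp_apply, AlgHom.toLinearMap_apply,
          LinearMap.mulLeft_apply, _root_.map_mul, mul_assoc]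
        rfl
  rw [h1]
  exact Finset.sum_congr rfl fun a _ => by rw [mulMap_rightDual hD hU.relLeft]

include hD in
/-- `R⁻⁽¹⁾ (b ◁ R⁻⁽²⁾) T`, expanded in the basis of the second factor. -/
theorem B_mul_slotCanon (b : B) :
    mulMap (φ₁.comp iH).toLinearMap ((φ₂.toLinearMap ∘ₗ iB) ∘ₗ ract k H b) (↑R⁻¹ : H ⊗[k] H) *
        slotCanon iC iB φ₁ φ₂ e =
      ∑ a, φ₁ (mixL iC iH.toLinearMap ↑R⁻¹ (e.coord a) b) * φ₂ (iB (e a)) := by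
  have h1 : ∀ X : H ⊗[k] H,
      mulMap (φ₁.comp iH).toLinearMap ((φ₂.toLinearMap ∘ₗ iB) ∘ₗ ract k H b) X *
        slotCanon iC iB φ₁ φ₂ e =
      ∑ a, φ₁ (mulMap iH.toLinearMap (iC ∘ₗ (LinearMap.mul k B).compr₂ (e.coord a) ∘ₗ ract k H b)
        X) * φ₂ (iB (e a)) := by
    intro X
    induction X with
    | zero => simp
    | add x y hx hy => simp only [map_add, add_mul, Finset.sum_add_distrib, hx, hy]
    | tmul x y =>
      have h2 := sum_coord_comp e (LinearMap.mulLeft k (φ₁ (iH x)) ∘ₗ φ₁.toLinearMap ∘ₗ iC)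
        (φ₂.toLinearMap ∘ₗ iB) (LinearMap.mul k B (rAct k H B y b))
      rw [slotCanon, canon, Finset.mul_sum]
      refine Eq.trans (Finset.sum_congr rfl fun a _ => ?_) (h2.symm.trans
        (Finset.sum_congr rfl fun a _ => ?_))
      · simp only [mulMap_tmul, LinearMap.comp_apply, LinearMap.flip_apply,
          AlgHom.toLinearMap_apply, LinearMap.mul_apply', LinearMap.mulLeft_apply, hU.map_mul,
          _root_.map_mul, AlgHom.comp_apply, mul_assoc]
        rw [(h (iC (e.coord a)) (iB (rAct k H B y b))).symm.left_comm]
      · simp only [mulMap_tmul, LinearMap.comp_apply, AlgHom.toLinearMap_apply,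
          LinearMap.mulLeft_apply, _root_.map_mul, mul_assoc]
        rfl
  rw [h1]
  exact Finset.sum_congr rfl fun a _ => by rw [mulMap_leftDual hD hU.relLeft]

-- Read as a combination of the eₐ in the second slot, with c = fᵃ, the left side has coefficients
-- ⟨c₁, b₁ ◁ R⁽¹⁾⟩R⁽²⁾c₂b₂ and the right side b₁c₁R⁻⁽¹⁾⟨c₂, b₂ ◁ R⁻⁽²⁾⟩. Their equality is the
-- exchange relation.
include hD in
theorem slotCanon_mul_prodB (b : B) :
    slotCanon iC iB φ₁ φ₂ e * prodB iH iB φ₂ φ₁ R b =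
      rmat iH φ₁ φ₂ (R : H ⊗[k] H) * prodB iH iB φ₁ φ₂ R b * rmat iH φ₁ φ₂ ↑R⁻¹ *
        slotCanon iC iB φ₁ φ₂ e := by
  have hR := hD.quasitriangular
  have h1 : ∀ P : B ⊗[k] B, slotCanon iC iB φ₁ φ₂ e *
      mulMap (conjMap (rmat iH φ₂ φ₁ ↑R⁻¹) (rmat iH φ₂ φ₁ R) (φ₂.toLinearMap ∘ₗ iB))
        (φ₁.toLinearMap ∘ₗ iB) P =
      ∑ a, φ₁ (mulMap (mixR iC iH.toLinearMap ↑R (e.coord a)) iB P) * φ₂ (iB (e a)) := by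
    intro P
    induction P with
    | zero => simp
    | add x y hx hy => simp only [map_add, mul_add, add_mul, Finset.sum_add_distrib, hx, hy]
    | tmul x y =>
      rw [mulMap_tmul, conj_rmat_B hR hU.relRight (fun x y => (h y x).symm), ← mul_assoc,
        hU.slotCanon_mul_B e hD h, Finset.sum_mul]
      refine Finset.sum_congr rfl fun a _ => ?_
      rw [mulMap_tmul, _root_.map_mul, LinearMap.comp_apply, AlgHom.toLinearMap_apply, mul_assoc,
        mul_assoc, (h (iB y) (iB (e a))).eq]
  have h2 : ∀ P : B ⊗[k] B, rmat iH φ₁ φ₂ (R : H ⊗[k] H) *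
      mulMap (conjMap (rmat iH φ₁ φ₂ ↑R⁻¹) (rmat iH φ₁ φ₂ R) (φ₁.toLinearMap ∘ₗ iB))
        (φ₂.toLinearMap ∘ₗ iB) P * rmat iH φ₁ φ₂ ↑R⁻¹ * slotCanon iC iB φ₁ φ₂ e =
      ∑ a, φ₁ (mulMap iB (mixL iC iH.toLinearMap ↑R⁻¹ (e.coord a)) P) * φ₂ (iB (e a)) := by
    intro P
    induction P with
    | zero => simp
    | add x y hx hy => simp only [map_add, mul_add, add_mul, Finset.sum_add_distrib, hx, hy]
    | tmul x y =>
      have h3 := hU.B_mul_slotCanon e hD h y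
      rw [← conj_rmat_B' hR hU.relRight h] at h3
      have h4 : rmat iH φ₁ φ₂ (R : H ⊗[k] H) * mulMap (conjMap (rmat iH φ₁ φ₂ ↑R⁻¹)
          (rmat iH φ₁ φ₂ R) (φ₁.toLinearMap ∘ₗ iB)) (φ₂.toLinearMap ∘ₗ iB) (x ⊗ₜ y) *
          rmat iH φ₁ φ₂ ↑R⁻¹ = φ₁ (iB x) *
          conjMap (rmat iH φ₁ φ₂ R) (rmat iH φ₁ φ₂ ↑R⁻¹) (φ₂.toLinearMap ∘ₗ iB) y := by
        simp only [mulMap_tmul, conjMap_apply, LinearMap.comp_apply, AlgHom.toLinearMap_apply,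
          ← mul_assoc, rmat_mul_inv h, one_mul]
      rw [h4, mul_assoc, h3, Finset.mul_sum]
      refine Finset.sum_congr rfl fun a _ => ?_
      rw [mulMap_tmul, _root_.map_mul, mul_assoc]
  rw [prodB, conv_apply, h1, prodB, conv_apply, h2]
  refine Finset.sum_congr rfl fun a _ => ?_
  rw [← conv_apply, ← conv_apply, hU.exchange]

-- Dual to `slotCanon_mul_prodB`: the fᵃ are kept in the first slot, and the exchange relation is
-- used in the second slot at b = eₐ.
include hD in
theorem slotCanon_mul_prodC (c : Module.Dual k B) :
    slotCanon iC iB φ₁ φ₂ e * prodC iC iH φ₂ φ₁ R c =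
      rmat iH φ₁ φ₂ (R : H ⊗[k] H) * prodC iC iH φ₁ φ₂ R c * rmat iH φ₁ φ₂ ↑R⁻¹ *
        slotCanon iC iB φ₁ φ₂ e := by
  have hR := hD.quasitriangular
  have h1 : ∀ (X : H ⊗[k] H) (V : Module.Dual k B ⊗[k] Module.Dual k B),
      slotCanon iC iB φ₁ φ₂ e * mulMap (φ₂.toLinearMap ∘ₗ iC)
        (mulMap (φ₂.comp iH).toLinearMap (φ₁.toLinearMap ∘ₗ iC) ∘ₗ
          (LinearMap.lTensorHom H ∘ₗ (lAct k H B).flip).flip X) V =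
      ∑ a, φ₁ (iC (e.coord a)) *
        φ₂ (conv iB ((mulMapHom iC ∘ₗ slotL B iH.toLinearMap X).flip V) (e a)) := by
    intro X V
    induction X with
    | zero =>
      have h0 : (mulMapHom iC ∘ₗ slotL B iH.toLinearMap 0).flip V = 0 := by
        rw [map_zero, LinearMap.comp_zero]
        rfl
      rw [h0]
      simp [conv, mulMap_zero_right]
    | add x y hx hy =>
      have h0 : (mulMapHom iC ∘ₗ slotL B iH.toLinearMap (x + y)).flip V =
          (mulMapHom iC ∘ₗ slotL B iH.toLinearMap x).flip V +
            (mulMapHom iC ∘ₗ slotL B iH.toLinearMap y).flip V := by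
        rw [map_add, LinearMap.comp_add]
        rfl
      rw [h0]
      simp only [conv, map_add, mul_add, LinearMap.comp_add, mulMap_add_right,
        LinearMap.add_apply, LinearMap.add_comp, Finset.sum_add_distrib] at hx hy ⊢
      rw [hx, hy]
    | tmul x y =>
      induction V with
      | zero => simp [conv, mulMap_zero_right]
      | add x y hx hy => simp only [conv, map_add, mul_add, mulMap_add_right, LinearMap.add_comp,
          LinearMap.add_apply, Finset.sum_add_distrib] at hx hy ⊢; rw [hx, hy]
      | tmul c d =>
        have h2 := sum_coord_comp e (φ₁.toLinearMap ∘ₗ iC)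
          (φ₂.toLinearMap ∘ₗ LinearMap.mulRight k (iC c * iH x) ∘ₗ iB)
          (rightAct (lAct k H B y d))
        rw [slotCanon, canon, Finset.sum_mul]
        refine Eq.trans (Finset.sum_congr rfl fun a _ => ?_) (h2.trans
          (Finset.sum_congr rfl fun a _ => ?_))
        · rw [← dualMul_eq_comp_rightAct]
          have h3 := (h (iC (lAct k H B y d)) (iB (e a) * (iC c * iH x))).eq
          simp only [_root_.map_mul, mul_assoc] at h3
          simp [hU.map_dualMul, mul_assoc, h3]
        · rw [conv_apply, rightAct_apply]
          generalize comul (R := k) (e a) = P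
          simp only [LinearMap.comp_apply, AlgHom.toLinearMap_apply]
          congr 2
          induction P with
          | zero => simp
          | add x y hx hy => simp only [map_add, hx, hy]
          | tmul b b' => simp [mulMapHom, lAct_apply, mul_assoc]
  have h2 : ∀ (X : H ⊗[k] H) (V : Module.Dual k B ⊗[k] Module.Dual k B),
      mulMap (mulMap (φ₁.toLinearMap ∘ₗ iC) (φ₂.comp iH).toLinearMap ∘ₗ
          (LinearMap.rTensorHom H ∘ₗ (lAct k H B).flip).flip X) (φ₂.toLinearMap ∘ₗ iC) V *
        slotCanon iC iB φ₁ φ₂ e =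
      ∑ a, φ₁ (iC (e.coord a)) *
        φ₂ (conv ((mulMapHomLeft iC ∘ₗ slotR B iH.toLinearMap X).flip V) iB (e a)) := by
    intro X V
    induction X with
    | zero =>
      have h0 : (mulMapHomLeft iC ∘ₗ slotR B iH.toLinearMap 0).flip V = 0 := by
        rw [map_zero, LinearMap.comp_zero]
        rfl
      rw [h0]
      simp [conv, mulMap_zero_left]
    | add x y hx hy =>
      have h0 : (mulMapHomLeft iC ∘ₗ slotR B iH.toLinearMap (x + y)).flip V =
          (mulMapHomLeft iC ∘ₗ slotR B iH.toLinearMap x).flip V +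
            (mulMapHomLeft iC ∘ₗ slotR B iH.toLinearMap y).flip V := by
        rw [map_add, LinearMap.comp_add]
        rfl
      rw [h0]
      simp only [conv, map_add, mul_add, add_mul, LinearMap.comp_add, mulMap_add_left,
        LinearMap.add_apply, LinearMap.add_comp, Finset.sum_add_distrib] at hx hy ⊢
      rw [hx, hy]
    | tmul x y =>
      induction V with
      | zero => simp [conv, mulMap_zero_left]
      | add x y hx hy => simp only [conv, map_add, add_mul, mul_add, mulMap_add_left, LinearMap.add_comp,
          LinearMap.add_apply, Finset.sum_add_distrib] at hx hy ⊢; rw [hx, hy]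
      | tmul c d =>
        have h2 := sum_coord_comp e (φ₁.toLinearMap ∘ₗ iC)
          (φ₂.toLinearMap ∘ₗ LinearMap.mulLeft k (iH y * iC d) ∘ₗ iB)
          (leftAct (lAct k H B x c))
        rw [slotCanon, canon, Finset.mul_sum]
        refine Eq.trans (Finset.sum_congr rfl fun a _ => ?_) (h2.trans
          (Finset.sum_congr rfl fun a _ => ?_))
        · rw [← dualMul_eq_comp_leftAct]
          simp only [mulMap_tmul, LinearMap.comp_apply, LinearMap.flip_apply,
            LinearMap.coe_rTensorHom, LinearMap.rTensor_tmul, AlgHom.toLinearMap_apply,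
            AlgHom.comp_apply, hU.map_dualMul, _root_.map_mul, LinearMap.mulLeft_apply, mul_assoc]
          rw [(h (iC (e.coord a)) (iC d)).symm.left_comm,
            (h (iC (e.coord a)) (iH y)).symm.left_comm]
        · rw [conv_apply, leftAct_apply]
          generalize comul (R := k) (e a) = P
          simp only [LinearMap.comp_apply, AlgHom.toLinearMap_apply]
          congr 2
          induction P with
          | zero => simp
          | add x y hx hy => simp only [map_add, hx, hy]
          | tmul b b' => simp [mulMapHomLeft, lAct_apply, mul_assoc]
  have h3 : rmat iH φ₁ φ₂ (R : H ⊗[k] H) * prodC iC iH φ₁ φ₂ R c * rmat iH φ₁ φ₂ ↑R⁻¹ =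
      mulMap (mulMap (φ₁.toLinearMap ∘ₗ iC) (φ₂.comp iH).toLinearMap ∘ₗ
          (LinearMap.rTensorHom H ∘ₗ (lAct k H B).flip).flip ↑R) (φ₂.toLinearMap ∘ₗ iC)
        (comul c) := by
    have h4 : ∀ V : Module.Dual k B ⊗[k] Module.Dual k B, rmat iH φ₁ φ₂ (R : H ⊗[k] H) *
        mulMap (φ₁.toLinearMap ∘ₗ iC) (conjMap (rmat iH φ₁ φ₂ ↑R⁻¹) (rmat iH φ₁ φ₂ R)
          (φ₂.toLinearMap ∘ₗ iC)) V * rmat iH φ₁ φ₂ ↑R⁻¹ =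
        mulMap (conjMap (rmat iH φ₁ φ₂ R) (rmat iH φ₁ φ₂ ↑R⁻¹) (φ₁.toLinearMap ∘ₗ iC))
          (φ₂.toLinearMap ∘ₗ iC) V := by
      intro V
      induction V with
      | zero => simp
      | add x y hx hy => simp only [map_add, mul_add, add_mul, hx, hy]
      | tmul x y =>
        simp only [mulMap_tmul, conjMap_apply, mul_assoc, rmat_mul_inv h, mul_one]
    rw [prodC, conv_apply, h4]
    congr 2
    refine LinearMap.ext fun c => (conj_rmat_C' hR hU.relLeft h c).trans ?_
    exact (mulMap_rTensor _ _ _ _).symm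
  rw [h3, h2, prodC_eq hR hU.relLeft (fun x y => (h y x).symm), h1]
  refine Finset.sum_congr rfl fun a _ => ?_
  have h5 : (mulMapHomLeft iC ∘ₗ slotR B iH.toLinearMap ↑R).flip (comul c) =
      mixR iC iH.toLinearMap ↑R c := rfl
  have h6 : (mulMapHom iC ∘ₗ slotL B iH.toLinearMap ↑R⁻¹).flip (comul c) =
      mixL iC iH.toLinearMap ↑R⁻¹ c := rfl
  rw [h5, h6, hU.exchange]

theorem mul_slotCanon_H (x : H) :
    φ₁ (iH x) * slotCanon iC iB φ₁ φ₂ e = mulMap (slotCanonAct iC iB φ₁ φ₂ e)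
      (φ₁.comp iH).toLinearMap (comul x) := by
  have h1 : ∀ X : H ⊗[k] H, ∑ a, mulMap ((φ₁.toLinearMap ∘ₗ iC) ∘ₗ lact H (e.coord a))
      (φ₁.comp iH).toLinearMap X * φ₂ (iB (e a)) =
      mulMap (slotCanonAct iC iB φ₁ φ₂ e) (φ₁.comp iH).toLinearMap X := by
    intro X
    induction X with
    | zero => simp
    | add x y hx hy => simp only [map_add, add_mul, Finset.sum_add_distrib, hx, hy]
    | tmul x y =>
      have h2 := sum_coord_comp e (φ₁.toLinearMap ∘ₗ iC) (φ₂.toLinearMap ∘ₗ iB) (rAct k H B x)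
      have h3 : slotCanonAct iC iB φ₁ φ₂ e x = ∑ a, (φ₁.toLinearMap ∘ₗ iC) (e.coord a) *
        (φ₂.toLinearMap ∘ₗ iB) (rAct k H B x (e a)) := slotCanonAct_apply e _
      rw [mulMap_tmul, h3, ← h2, Finset.sum_mul]
      refine Finset.sum_congr rfl fun a _ => ?_
      rw [mulMap_tmul, mul_assoc, mul_assoc]
      exact congrArg₂ (· * ·) rfl (h (iH y) (iB (e a))).eq
  rw [← h1, slotCanon, canon, Finset.mul_sum]
  refine Finset.sum_congr rfl fun a _ => ?_
  rw [← mul_assoc]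
  exact congrArg (· * _) (hU.relLeft.map φ₁ x (e.coord a))

theorem slotCanon_mul_H (x : H) :
    slotCanon iC iB φ₁ φ₂ e * φ₂ (iH x) = mulMap (φ₂.comp iH).toLinearMap
      (slotCanonAct iC iB φ₁ φ₂ e) (comul x) := by
  have h1 : ∀ X : H ⊗[k] H, ∑ a, φ₁ (iC (e.coord a)) * mulMap (φ₂.comp iH).toLinearMap
      ((φ₂.toLinearMap ∘ₗ iB) ∘ₗ ract k H (e a)) X =
      mulMap (φ₂.comp iH).toLinearMap (slotCanonAct iC iB φ₁ φ₂ e) X := by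
    intro X
    induction X with
    | zero => simp
    | add x y hx hy => simp only [map_add, mul_add, Finset.sum_add_distrib, hx, hy]
    | tmul x y =>
      have h3 : slotCanonAct iC iB φ₁ φ₂ e y = ∑ a, (φ₁.toLinearMap ∘ₗ iC) (e.coord a) *
        (φ₂.toLinearMap ∘ₗ iB) (rAct k H B y (e a)) := slotCanonAct_apply e _
      rw [mulMap_tmul, h3, Finset.mul_sum]
      refine Finset.sum_congr rfl fun a _ => ?_
      rw [mulMap_tmul]
      exact (h (iC (e.coord a)) (iH x)).left_comm _
  rw [← h1, slotCanon, canon, Finset.sum_mul]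
  refine Finset.sum_congr rfl fun a _ => ?_
  rw [mul_assoc]
  exact congrArg (_ * ·) (hU.relRight.map φ₂ (e a) x)

/-- Moving h past fᵃ in the first slot or past eₐ in the second creates the same `slotCanonAct`,
because the two actions are transposes of each other. The parts of h then stand as in Δᵒᵖ(h). -/
theorem commute_slotCanon_H (x : H) : Commute (slotCanon iC iB φ₁ φ₂ e)
    (conv (φ₂.comp iH).toLinearMap (φ₁.comp iH).toLinearMap x) := by
  have h1 : ∀ X : H ⊗[k] H, slotCanon iC iB φ₁ φ₂ e *
      mulMap (φ₂.comp iH).toLinearMap (φ₁.comp iH).toLinearMap X =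
      mulMap (conv (φ₂.comp iH).toLinearMap (slotCanonAct iC iB φ₁ φ₂ e))
        (φ₁.comp iH).toLinearMap X := fun X =>
    mul_mulMap _ _ _ _ (fun x => hU.slotCanon_mul_H e h x) X
  have h2 : ∀ X : H ⊗[k] H, mulMap (φ₂.comp iH).toLinearMap (φ₁.comp iH).toLinearMap X *
      slotCanon iC iB φ₁ φ₂ e =
      mulMap (φ₂.comp iH).toLinearMap (conv (slotCanonAct iC iB φ₁ φ₂ e)
        (φ₁.comp iH).toLinearMap) X := fun X =>
    mulMap_mul_right _ _ _ _ (fun x => hU.mul_slotCanon_H e h x) X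
  rw [commute_iff_eq, conv_apply, h1, h2, ← conv_apply, ← conv_apply, conv_assoc]

-- Both Δᵒᵖ and RΔR⁻¹ are multiplicative, so the three kinds of generators suffice. With T the
-- canonical element this says Δᵒᵖ = T⁻¹RΔR⁻¹T, which is why T⁻¹R is the universal R-matrix.
include hD in
theorem slotCanon_mul_slotComul (x : U) :
    slotCanon iC iB φ₁ φ₂ e * slotComul (fun x y => (h y x).symm) x =
      rmat iH φ₁ φ₂ (R : H ⊗[k] H) * slotComul h x * rmat iH φ₁ φ₂ ↑R⁻¹ *
        slotCanon iC iB φ₁ φ₂ e := by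
  have hm : ∀ x y, slotCanon iC iB φ₁ φ₂ e * slotComul (fun x y => (h y x).symm) x =
      rmat iH φ₁ φ₂ (R : H ⊗[k] H) * slotComul h x * rmat iH φ₁ φ₂ ↑R⁻¹ *
        slotCanon iC iB φ₁ φ₂ e →
      slotCanon iC iB φ₁ φ₂ e * slotComul (fun x y => (h y x).symm) y =
      rmat iH φ₁ φ₂ (R : H ⊗[k] H) * slotComul h y * rmat iH φ₁ φ₂ ↑R⁻¹ *
        slotCanon iC iB φ₁ φ₂ e →
      slotCanon iC iB φ₁ φ₂ e * slotComul (fun x y => (h y x).symm) (x * y) =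
      rmat iH φ₁ φ₂ (R : H ⊗[k] H) * slotComul h (x * y) * rmat iH φ₁ φ₂ ↑R⁻¹ *
        slotCanon iC iB φ₁ φ₂ e := by
    intro x y hx hy
    have h3 : rmat iH φ₁ φ₂ ↑R⁻¹ * rmat iH φ₁ φ₂ (R : H ⊗[k] H) = 1 := rmat_inv_mul h
    rw [_root_.map_mul, ← mul_assoc, hx, mul_assoc, hy, _root_.map_mul]
    simp only [mul_assoc]
    rw [← mul_assoc (rmat iH φ₁ φ₂ ↑R⁻¹) (rmat iH φ₁ φ₂ (R : H ⊗[k] H)), h3, one_mul]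
  obtain ⟨s, rfl⟩ := hU.bijective.surjective x
  induction s using Space.induction with
  | zero => simp
  | add x y hx hy => simp only [map_add, mul_add, add_mul, hx, hy]
  | tmul c g b =>
    rw [triple_tmul]
    refine hm _ _ ?_ (hm _ _ ?_ ?_)
    · have h1 := LinearMap.congr_fun (hU.slotComul_C h) c
      have h2 := LinearMap.congr_fun (hU.slotComul_C fun x y => (h y x).symm) c
      simp only [LinearMap.comp_apply, AlgHom.toLinearMap_apply] at h1 h2
      rw [h1, h2, hU.slotCanon_mul_prodC e hD h]
    · have h1 := LinearMap.congr_fun (hU.slotComul_H h) g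
      have h2 := LinearMap.congr_fun (hU.slotComul_H fun x y => (h y x).symm) g
      simp only [AlgHom.comp_apply, AlgHom.toLinearMap_apply] at h1 h2
      have h3 := conv_mul_mulMap hD.quasitriangular (p := φ₁.comp iH) (q := φ₂.comp iH)
        (fun x y => h _ _) g
      have h4 : rmat iH φ₁ φ₂ (R : H ⊗[k] H) * rmat iH φ₁ φ₂ ↑R⁻¹ = 1 := rmat_mul_inv h
      rw [h1, h2, (hU.commute_slotCanon_H e h g).eq]
      refine congrArg (· * _) ?_
      refine Eq.trans ?_ (congrArg (· * rmat iH φ₁ φ₂ ↑R⁻¹) h3)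
      rw [mul_assoc]
      exact ((congrArg (_ * ·) h4).trans (mul_one _)).symm
    · have h1 := LinearMap.congr_fun (hU.slotComul_B h) b
      have h2 := LinearMap.congr_fun (hU.slotComul_B fun x y => (h y x).symm) b
      simp only [LinearMap.comp_apply, AlgHom.toLinearMap_apply] at h1 h2
      rw [h1, h2, hU.slotCanon_mul_prodB e hD h]

variable (h₁₃ : ∀ x y, Commute (φ₁ x) (φ₃ y)) (h₂₃ : ∀ x y, Commute (φ₂ x) (φ₃ y))
include h₁₃ h₂₃ hD

/-- Expanding c₁R⁻⁽¹⁾ ⊗ (R⁻⁽²⁾ ▷ c₂) over the dual basis in the second slot leaves values of `mixL`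
in the first. By `B_mul_slotCanon`, summing these against the eₐ in the third slot gives T₁₃
multiplied by a conjugate of a basis vector under R₁₃. -/
theorem slotCanon_slotComul_left :
    slotCanon iC iB (slotComul h) φ₃ e =
      rmat iH φ₁ φ₃ (R : H ⊗[k] H) * slotCanon iC iB φ₂ φ₃ e * rmat iH φ₁ φ₃ ↑R⁻¹ *
        slotCanon iC iB φ₁ φ₃ e := by
  have hR := hD.quasitriangular
  have h1 : ∀ c, prodC iC iH φ₁ φ₂ R c =
      ∑ b, φ₁ (mixL iC iH.toLinearMap ↑R⁻¹ c (e b)) * φ₂ (iC (e.coord b)) := by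
    intro c
    have h2 : ∀ (X : H ⊗[k] H) (V : Module.Dual k B ⊗[k] Module.Dual k B),
        mulMap (φ₁.toLinearMap ∘ₗ iC)
          (mulMap (φ₁.comp iH).toLinearMap (φ₂.toLinearMap ∘ₗ iC) ∘ₗ
            (LinearMap.lTensorHom H ∘ₗ (lAct k H B).flip).flip X) V =
        ∑ b, φ₁ (mulMap iC (slotL B iH.toLinearMap X (e b)) V) * φ₂ (iC (e.coord b)) := by
      intro X V
      induction V with
      | zero => simp
      | add x y hx hy => simp only [map_add, add_mul, Finset.sum_add_distrib, hx, hy]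
      | tmul c d =>
        induction X with
        | zero => simp
        | add x y hx hy =>
          simp only [mulMap_tmul, map_add, LinearMap.comp_apply, LinearMap.add_apply, add_mul,
            mul_add, Finset.sum_add_distrib] at hx hy ⊢
          rw [hx, hy]
        | tmul x y =>
          have h3 := e.sum_dual_apply_smul_coord (lAct k H B y d)
          simp only [mulMap_tmul, LinearMap.comp_apply, LinearMap.flip_apply,
            LinearMap.coe_lTensorHom, LinearMap.lTensor_tmul, AlgHom.toLinearMap_apply,
            AlgHom.comp_apply, slotL_tmul, mul_smul_comm, map_smul, smul_mul_assoc]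
          rw [← h3]
          simp only [map_sum, map_smul, Finset.mul_sum, mul_smul_comm, _root_.map_mul, mul_assoc]
          rfl
    rw [prodC_eq hR hU.relLeft h, h2]
    rfl
  have h2 : ∀ b, ∑ a, φ₁ (mixL iC iH.toLinearMap ↑R⁻¹ (e.coord a) (e b)) * φ₂ (iC (e.coord b)) *
      φ₃ (iB (e a)) = rmat iH φ₁ φ₃ (R : H ⊗[k] H) * (φ₂ (iC (e.coord b)) * φ₃ (iB (e b))) *
        rmat iH φ₁ φ₃ ↑R⁻¹ * slotCanon iC iB φ₁ φ₃ e := by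
    intro b
    have h3 := hU.B_mul_slotCanon e hD h₁₃ (e b)
    rw [← conj_rmat_B' hR hU.relRight h₁₃, conjMap_apply] at h3
    have h4 : Commute (rmat iH φ₁ φ₃ (R : H ⊗[k] H)) (φ₂ (iC (e.coord b))) :=
      (commute_mulMap (fun x => (h _ _).symm) (fun x => h₂₃ _ _) _).symm
    rw [← mul_assoc, h4.eq, mul_assoc (φ₂ _), mul_assoc (φ₂ _), mul_assoc (φ₂ _)]
    refine Eq.trans ?_ (congrArg (_ * ·) h3.symm)
    rw [Finset.mul_sum]
    refine Finset.sum_congr rfl fun a _ => ?_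
    rw [(h _ _).eq, mul_assoc]
  rw [slotCanon, canon, hU.slotComul_C h]
  simp only [h1, Finset.sum_mul]
  rw [Finset.sum_comm]
  simp only [LinearMap.comp_apply, AlgHom.toLinearMap_apply, h2]
  simp only [← Finset.sum_mul, ← Finset.mul_sum]
  rfl

/-- The coproduct R⁻¹b₁R · b₂ is a convolution, so `canon_conv` factors the canonical element, and
R₂₃ can be pulled out because it commutes with the first slot. -/
theorem slotCanon_slotComul_right :
    slotCanon iC iB φ₁ (slotComul h₂₃) e =
      rmat iH φ₂ φ₃ (↑R⁻¹ : H ⊗[k] H) * slotCanon iC iB φ₁ φ₂ e * rmat iH φ₂ φ₃ ↑R *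
        slotCanon iC iB φ₁ φ₃ e := by
  rw [slotCanon, hU.slotComul_B h₂₃, prodB, canon_conv e _ _ _
    (fun c d => by simp [hU.map_dualMul]), canon_conjMap_right]
  · rfl
  · exact fun c => commute_mulMap (fun x => h _ _) (fun x => h₁₃ _ _) _
  · intro c b
    refine Commute.mul_right (Commute.mul_right ?_ (h _ _)) ?_ <;>
    exact commute_mulMap (fun x => h _ _) (fun x => h₁₃ _ _) _

/-- The inverse of `slotCanon_slotComul_left`: in every pair of commuting slots the exponential is
inverse to the canonical element. -/
theorem slotExp_slotComul_left :
    slotExp iC iB (slotComul h) φ₃ e S = slotExp iC iB φ₁ φ₃ e S *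
      rmat iH φ₁ φ₃ (R : H ⊗[k] H) * slotExp iC iB φ₂ φ₃ e S * rmat iH φ₁ φ₃ ↑R⁻¹ := by
  refine left_inv_eq_right_inv (hU.slotExp_mul_slotCanon e hD
    (commute_slotComul_left h h₁₃ h₂₃)) ?_
  rw [hU.slotCanon_slotComul_left e hD h h₁₃ h₂₃]
  have h3 : rmat iH φ₁ φ₃ (↑R⁻¹ : H ⊗[k] H) * rmat iH φ₁ φ₃ ↑R = 1 := rmat_inv_mul h₁₃
  have h4 : rmat iH φ₁ φ₃ (R : H ⊗[k] H) * rmat iH φ₁ φ₃ ↑R⁻¹ = 1 := rmat_mul_inv h₁₃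
  have h5 := hU.slotCanon_mul_slotExp e hD h₁₃
  have h6 := hU.slotCanon_mul_slotExp e hD h₂₃
  simp only [mul_assoc]
  rw [← mul_assoc (slotCanon iC iB φ₁ φ₃ e), h5, one_mul, ← mul_assoc (rmat iH φ₁ φ₃ ↑R⁻¹), h3,
    one_mul, ← mul_assoc (slotCanon iC iB φ₂ φ₃ e), h6, one_mul, h4]

theorem slotExp_slotComul_right :
    slotExp iC iB φ₁ (slotComul h₂₃) e S = slotExp iC iB φ₁ φ₃ e S *
      rmat iH φ₂ φ₃ (↑R⁻¹ : H ⊗[k] H) * slotExp iC iB φ₁ φ₂ e S * rmat iH φ₂ φ₃ ↑R := by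
  refine left_inv_eq_right_inv (hU.slotExp_mul_slotCanon e hD
    (commute_slotComul_right h h₁₃ h₂₃)) ?_
  rw [hU.slotCanon_slotComul_right e hD h h₁₃ h₂₃]
  have h3 : rmat iH φ₂ φ₃ (↑R⁻¹ : H ⊗[k] H) * rmat iH φ₂ φ₃ ↑R = 1 := rmat_inv_mul h₂₃
  have h4 : rmat iH φ₂ φ₃ (R : H ⊗[k] H) * rmat iH φ₂ φ₃ ↑R⁻¹ = 1 := rmat_mul_inv h₂₃
  have h5 := hU.slotCanon_mul_slotExp e hD h₁₃
  have h6 := hU.slotCanon_mul_slotExp e hD h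
  simp only [mul_assoc]
  rw [← mul_assoc (slotCanon iC iB φ₁ φ₃ e), h5, one_mul, ← mul_assoc (rmat iH φ₂ φ₃ ↑R), h4,
    one_mul, ← mul_assoc (slotCanon iC iB φ₁ φ₂ e), h6, one_mul, h3]

/-- (Δ ⊗ id)R = R₁₃R₂₃ begins with the R₁₃ that cancels the trailing R₁₃⁻¹. -/
theorem slotExp_mul_rmat_left :
    slotExp iC iB (slotComul h) φ₃ e S * rmat iH (slotComul h) φ₃ (R : H ⊗[k] H) =
      (slotExp iC iB φ₁ φ₃ e S * rmat iH φ₁ φ₃ (R : H ⊗[k] H)) *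
        (slotExp iC iB φ₂ φ₃ e S * rmat iH φ₂ φ₃ (R : H ⊗[k] H)) := by
  rw [hU.slotExp_slotComul_left e hD h h₁₃ h₂₃,
    rmat_left hD.quasitriangular h₂₃ (hU.slotComul_H h)]
  have h3 : rmat iH φ₁ φ₃ (↑R⁻¹ : H ⊗[k] H) * rmat iH φ₁ φ₃ ↑R = 1 := rmat_inv_mul h₁₃
  simp only [mul_assoc]
  rw [← mul_assoc (rmat iH φ₁ φ₃ ↑R⁻¹), h3, one_mul]

theorem slotExp_mul_rmat_right :
    slotExp iC iB φ₁ (slotComul h₂₃) e S * rmat iH φ₁ (slotComul h₂₃) (R : H ⊗[k] H) =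
      (slotExp iC iB φ₁ φ₃ e S * rmat iH φ₁ φ₃ (R : H ⊗[k] H)) *
        (slotExp iC iB φ₁ φ₂ e S * rmat iH φ₁ φ₂ (R : H ⊗[k] H)) := by
  rw [hU.slotExp_slotComul_right e hD h h₁₃ h₂₃,
    rmat_right hD.quasitriangular h₁₃ h₂₃ (hU.slotComul_H h₂₃)]
  have h3 : rmat iH φ₂ φ₃ (↑R⁻¹ : H ⊗[k] H) * rmat iH φ₂ φ₃ ↑R = 1 := rmat_inv_mul h₂₃
  -- R₂₃R₁₃ is R with Δᵒᵖ applied to its first leg, placed in the first two slots, so T₁₂ commutes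
  -- with it, and hence so does T₁₂⁻¹. This allows R₂₃ to be moved to where R₂₃⁻¹ cancels it.
  have h4 : Commute (slotCanon iC iB φ₁ φ₂ e)
      (rmat iH φ₂ φ₃ (R : H ⊗[k] H) * rmat iH φ₁ φ₃ ↑R) := by
    have h5 := mulMap_conv_left hD.quasitriangular (φ₂.comp iH).toLinearMap
      (φ₁.comp iH).toLinearMap (φ₃.comp iH) fun x y => h₁₃ _ _
    rw [rmat, rmat, ← h5]
    refine commute_mulMap (fun x => hU.commute_slotCanon_H e h x) (fun x => ?_) _
    exact Commute.sum_left _ _ _ fun a _ => (h₁₃ _ _).mul_left (h₂₃ _ _)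
  have h6 : Commute (slotExp iC iB φ₁ φ₂ e S)
      (rmat iH φ₂ φ₃ (R : H ⊗[k] H) * rmat iH φ₁ φ₃ ↑R) := by
    have h7 := hU.slotExp_mul_slotCanon e hD h
    have h8 := hU.slotCanon_mul_slotExp e hD h
    exact (show Commute ((Units.mk _ _ h8 h7 : Aˣ) : A) _ from h4).units_inv_left
  simp only [mul_assoc]
  rw [← mul_assoc (rmat iH φ₂ φ₃ (R : H ⊗[k] H)), ← mul_assoc (slotExp iC iB φ₁ φ₂ e S), h6.eq]
  simp only [mul_assoc]
  rw [← mul_assoc (rmat iH φ₂ φ₃ ↑R⁻¹), h3, one_mul]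

end

end IsDouble

end Double

/-! ### The universal R-matrix -/

/-! ### The legs of the universal R-matrix in U ⊗ U ⊗ U -/

section Legs

variable {U : Type*} [Ring U] [HopfAlgebra k U]

theorem leg12_eq_lift (X : U ⊗[k] U) :
    leg12 k X = Algebra.TensorProduct.lift (ι₁ k U) (ι₂ k U) commute_ι₁_ι₂ X := by
  induction X with
  | zero => simp
  | add x y hx hy => simp only [map_add, hx, hy]
  | tmul x y => simp [leg12, ι₁_apply, ι₂_apply]

theorem leg13_eq_lift (X : U ⊗[k] U) :
    leg13 k X = Algebra.TensorProduct.lift (ι₁ k U) (ι₃ k U) commute_ι₁_ι₃ X := by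
  induction X with
  | zero => simp
  | add x y hx hy => simp only [map_add, hx, hy]
  | tmul x y => simp [leg13, ι₁_apply, ι₃_apply]

theorem leg23_eq_lift (X : U ⊗[k] U) :
    leg23 k X = Algebra.TensorProduct.lift (ι₂ k U) (ι₃ k U) commute_ι₂_ι₃ X := by
  induction X with
  | zero => simp
  | add x y hx hy => simp only [map_add, hx, hy]
  | tmul x y => simp [leg23, ι₂_apply, ι₃_apply]

theorem assoc_rTensor_comul (X : U ⊗[k] U) :
    TensorProduct.assoc k U U U (LinearMap.rTensor U comul X) =
      Algebra.TensorProduct.lift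
        (slotComul (φ₁ := ι₁ k U) (φ₂ := ι₂ k U) commute_ι₁_ι₂) (ι₃ k U)
        (commute_slotComul_left (φ₁ := ι₁ k U) (φ₂ := ι₂ k U) (φ₃ := ι₃ k U)
          commute_ι₁_ι₂ commute_ι₁_ι₃ commute_ι₂_ι₃) X := by
  induction X with
  | zero => simp
  | add x y hx hy => simp only [map_add, hx, hy]
  | tmul x y =>
    have h : ∀ Z : U ⊗[k] U, TensorProduct.assoc k U U U (Z ⊗ₜ y) =
        Algebra.TensorProduct.lift (ι₁ k U) (ι₂ k U) commute_ι₁_ι₂ Z * ι₃ k U y := by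
      intro Z
      induction Z with
      | zero => simp
      | add x y hx hy => simp only [add_tmul, map_add, add_mul, hx, hy]
      | tmul x y => simp [ι₁_apply, ι₂_apply, ι₃_apply]
    rw [LinearMap.rTensor_tmul, h, Algebra.TensorProduct.lift_tmul]
    rfl

theorem lTensor_comul (X : U ⊗[k] U) :
    LinearMap.lTensor U comul X =
      Algebra.TensorProduct.lift (ι₁ k U)
        (slotComul (φ₁ := ι₂ k U) (φ₂ := ι₃ k U) commute_ι₂_ι₃)
        (commute_slotComul_right (φ₁ := ι₁ k U) (φ₂ := ι₂ k U) (φ₃ := ι₃ k U)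
          commute_ι₁_ι₂ commute_ι₁_ι₃ commute_ι₂_ι₃) X := by
  induction X with
  | zero => simp
  | add x y hx hy => simp only [map_add, hx, hy]
  | tmul x y =>
    have h : ∀ Z : U ⊗[k] U, x ⊗ₜ[k] Z =
        ι₁ k U x * Algebra.TensorProduct.lift (ι₂ k U) (ι₃ k U) commute_ι₂_ι₃ Z := by
      intro Z
      induction Z with
      | zero => simp
      | add x y hx hy => simp only [tmul_add, map_add, mul_add, hx, hy]
      | tmul x y => simp [ι₁_apply, ι₂_apply, ι₃_apply]
    rw [LinearMap.lTensor_tmul, h, Algebra.TensorProduct.lift_tmul]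
    rfl

end Legs

/-! ### The quasitriangular axioms in U and the explicit formula -/

section Double

variable [FiniteDimensional k B] [Coalgebra k (Module.Dual k B)]
  {R : (H ⊗[k] H)ˣ} {S : B ≃ₗ[k] B} {U : Type*} [Ring U] [HopfAlgebra k U]
  {iC : Module.Dual k B →ₗ[k] U} {iH : H →ₐ[k] U} {iB : B →ₗ[k] U}

namespace IsDouble

variable (hU : IsDouble R iC iH iB) (hD : IsBarDual R S)

/-- The identification of `C̄ ⊗ H ⊗ B` with the double. -/
def equiv : Space k H B ≃ₗ[k] U := LinearEquiv.ofBijective (triple iC iH iB) hU.bijective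

theorem equiv_apply (s : Space k H B) : hU.equiv s = triple iC iH iB s := rfl

theorem equiv_comp_inclC : hU.equiv.toLinearMap ∘ₗ inclC k H B = iC := by
  ext c
  change triple iC iH iB (c ⊗ₜ (1 ⊗ₜ 1)) = _
  simp [triple_tmul, hU.map_one]

theorem equiv_comp_inclH : hU.equiv.toLinearMap ∘ₗ inclH k H B = iH.toLinearMap := by
  ext x
  change triple iC iH iB (counit ⊗ₜ (x ⊗ₜ 1)) = _
  simp [triple_tmul, hU.map_one, hU.map_counit]

theorem equiv_comp_inclB : hU.equiv.toLinearMap ∘ₗ inclB k H B = iB := by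
  ext b
  change triple iC iH iB (counit ⊗ₜ (1 ⊗ₜ b)) = _
  simp [triple_tmul, hU.map_counit]

include hD in
theorem isDoubleBosonisation : IsDoubleBosonisation R S hU.equiv where
  map_one := by
    have h := LinearMap.congr_fun hU.equiv_comp_inclH 1
    exact h.trans (_root_.map_one iH)
  map_mul := hU.triple_mul hD
  counit_map := hU.counit_triple
  comul_map := hU.comul_triple hD

variable {ι : Type*} [Fintype ι] (e : Module.Basis ι k B)

theorem universalR_eq : universalR hU.equiv e (R : H ⊗[k] H) S =
    slotExp iC iB (inl k U) (inr k U) e S * rmat iH (inl k U) (inr k U) R := by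
  rw [universalR, hU.equiv_comp_inclC, hU.equiv_comp_inclB, hU.equiv_comp_inclH]
  congr 1
  · simp [expBar, slotExp, canon, inl_apply, inr_apply]
  · rw [rmat]
    generalize (R : H ⊗[k] H) = X
    induction X with
    | zero => simp
    | add x y hx hy => simp only [map_add, hx, hy]
    | tmul x y => simp [inl_apply, inr_apply]

include hD

/-- Moving S eₐ past the second leg h of R gives h₁ and S eₐ ◁ h₂, and (id ⊗ Δ)R = R₁₃R₁₂ separates
the two copies of R in the explicit formula. -/
theorem map_explicitR : TensorProduct.map hU.equiv.toLinearMap hU.equiv.toLinearMap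
    (explicitR e (R : H ⊗[k] H) S) = universalR hU.equiv e (R : H ⊗[k] H) S := by
  have hR := hD.quasitriangular
  have h1 : ∀ (a : ι) (X Y : H ⊗[k] H),
      TensorProduct.map hU.equiv.toLinearMap hU.equiv.toLinearMap (TensorProduct.map₂
        ((LinearMap.mul k H).flip.compr₂
          (TensorProduct.mk k (Module.Dual k B) (H ⊗[k] B) (e.coord a) ∘ₗ
            (TensorProduct.mk k H B).flip 1))
        (((TensorProduct.mk k H B).compl₂ ((rAct k H B).flip (S (e a)))).compr₂
          (TensorProduct.mk k (Module.Dual k B) (H ⊗[k] B) counit)) X Y) =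
      inl k U (iC (e.coord a)) * mulMap ((inl k U).comp iH).toLinearMap
        (mulMap ((inr k U).comp iH).toLinearMap
          ((inr k U).toLinearMap ∘ₗ iB ∘ₗ ract k H (S (e a))))
        (leg13 k Y * leg12 k X) := by
    intro a X Y
    induction X with
    | zero => simp
    | add x y hx hy => simp only [map_add, LinearMap.add_apply, mul_add, hx, hy]
    | tmul x x' =>
      induction Y with
      | zero => simp
      | add x y hx hy => simp only [map_add, add_mul, mul_add, hx, hy]
      | tmul y y' =>
        simp [leg12, leg13, equiv_apply, triple_tmul, hU.map_one, hU.map_counit, inl_apply,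
          inr_apply]
  rw [universalR_eq, explicitR, map_sum, slotExp, canon, Finset.sum_mul]
  refine Finset.sum_congr rfl fun a _ => ?_
  have h2 := hU.relRight.map (inr k U) (S (e a))
  rw [h1, ← hR.comul_right, mulMap_lTensor, mul_assoc]
  refine congrArg (_ * ·) ?_
  exact (mul_mulMap_of_commute _ _ _ _ (fun x => (commute_inl_inr _ _).symm) h2 _).symm

theorem isUnit_universalR : IsUnit (universalR hU.equiv e (R : H ⊗[k] H) S) := by
  rw [universalR_eq]
  refine IsUnit.mul ?_ ?_
  · exact (Units.mk _ _ (hU.slotExp_mul_slotCanon e hD commute_inl_inr)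
      (hU.slotCanon_mul_slotExp e hD commute_inl_inr)).isUnit
  · exact (Units.mk _ _ (rmat_mul_inv (R := R) (jH := iH) commute_inl_inr)
      (rmat_inv_mul commute_inl_inr)).isUnit

theorem comul_op_universalR (x : U) :
    TensorProduct.comm k U U (comul x) * universalR hU.equiv e (R : H ⊗[k] H) S =
      universalR hU.equiv e (R : H ⊗[k] H) S * comul x := by
  have h1 := hU.slotCanon_mul_slotComul e hD commute_inl_inr x
  have h2 : slotComul (k := k) (U := U) commute_inl_inr x = comul (R := k) x :=
    AlgHom.congr_fun (show Algebra.TensorProduct.lift (inl k U) (inr k U) commute_inl_inr =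
      AlgHom.id k _ by ext <;> simp [inl_apply, inr_apply]) (comul x)
  have h3 : slotComul (k := k) (U := U) (fun x y => (commute_inl_inr y x).symm) x =
      TensorProduct.comm k U U (comul (R := k) x) :=
    AlgHom.congr_fun (show Algebra.TensorProduct.lift (inr k U) (inl k U)
      (fun x y => (commute_inl_inr y x).symm) =
      (Algebra.TensorProduct.comm k U U).toAlgHom by ext <;> simp [inl_apply, inr_apply]) (comul x)
  have h4 := hU.slotExp_mul_slotCanon e hD (S := S) commute_inl_inr
  have h5 := hU.slotCanon_mul_slotExp e hD (S := S) commute_inl_inr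
  have h6 : rmat iH (inl k U) (inr k U) (↑R⁻¹ : H ⊗[k] H) * rmat iH (inl k U) (inr k U) ↑R = 1 :=
    rmat_inv_mul commute_inl_inr
  rw [h2, h3] at h1
  -- The relation TΔᵒᵖ(x) = RΔ(x)R⁻¹T is multiplied by T⁻¹ on the left and by T⁻¹R on the right.
  have h7 := congrArg (fun z => slotExp iC iB (inl k U) (inr k U) e S * z *
    (slotExp iC iB (inl k U) (inr k U) e S * rmat iH (inl k U) (inr k U) R)) h1
  simp only [mul_assoc] at h7
  rw [← mul_assoc (slotCanon iC iB (inl k U) (inr k U) e) (slotExp _ _ _ _ _ _), h5, one_mul, h6,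
    mul_one, ← mul_assoc (slotExp iC iB (inl k U) (inr k U) e S) (slotCanon _ _ _ _ _), h4,
    one_mul] at h7
  rw [universalR_eq, h7, mul_assoc]

omit hD in
theorem lift_universalR {A : Type*} [Ring A] [Algebra k A] {φ₁ φ₂ : U →ₐ[k] A}
    (h : ∀ x y, Commute (φ₁ x) (φ₂ y)) :
    Algebra.TensorProduct.lift φ₁ φ₂ h (universalR hU.equiv e (R : H ⊗[k] H) S) =
      slotExp iC iB φ₁ φ₂ e S * rmat iH φ₁ φ₂ R := by
  have h1 : (Algebra.TensorProduct.lift φ₁ φ₂ h).comp (inl k U) = φ₁ := by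
    ext x; simp [inl_apply]
  have h2 : (Algebra.TensorProduct.lift φ₁ φ₂ h).comp (inr k U) = φ₂ := by
    ext x; simp [inr_apply]
  rw [universalR_eq, _root_.map_mul, map_slotExp, map_rmat, h1, h2]

theorem comul_left_universalR :
    TensorProduct.assoc k U U U (LinearMap.rTensor U comul
      (universalR hU.equiv e (R : H ⊗[k] H) S)) =
    leg13 k (universalR hU.equiv e (R : H ⊗[k] H) S) *
      leg23 k (universalR hU.equiv e (R : H ⊗[k] H) S) := by
  rw [assoc_rTensor_comul, leg13_eq_lift, leg23_eq_lift, hU.lift_universalR, hU.lift_universalR,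
    hU.lift_universalR]
  exact hU.slotExp_mul_rmat_left (φ₁ := ι₁ k U) (φ₂ := ι₂ k U) (φ₃ := ι₃ k U) e hD
    commute_ι₁_ι₂ commute_ι₁_ι₃ commute_ι₂_ι₃

theorem comul_right_universalR :
    LinearMap.lTensor U comul (universalR hU.equiv e (R : H ⊗[k] H) S) =
    leg13 k (universalR hU.equiv e (R : H ⊗[k] H) S) *
      leg12 k (universalR hU.equiv e (R : H ⊗[k] H) S) := by
  rw [lTensor_comul, leg13_eq_lift, leg12_eq_lift, hU.lift_universalR, hU.lift_universalR,
    hU.lift_universalR]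
  exact hU.slotExp_mul_rmat_right (φ₁ := ι₁ k U) (φ₂ := ι₂ k U) (φ₃ := ι₃ k U) e hD
    commute_ι₁_ι₂ commute_ι₁_ι₃ commute_ι₂_ι₃

theorem isQuasitriangular_universalR :
    IsQuasitriangular k (universalR hU.equiv e (R : H ⊗[k] H) S) where
  isUnit := hU.isUnit_universalR hD e
  comul_left := hU.comul_left_universalR hD e
  comul_right := hU.comul_right_universalR hD e
  comul_op := hU.comul_op_universalR hD e

end IsDouble

end Double

end BraidedDouble

end
theorem proposition3p6 {k : Type u} [Field k]
    {H : Type v} [Ring H] [HopfAlgebra k H]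
    (R : (H ⊗[k] H)ˣ) (hR : DoubleBosonisation.IsQuasitriangular k (R : H ⊗[k] H))
    {B : Type w} [Ring B] [Algebra k B] [Coalgebra k B]
    [Module Hᵐᵒᵖ B] [IsScalarTower k Hᵐᵒᵖ B] [FiniteDimensional k B]
    (S : B ≃ₗ[k] B)
    (hB : DoubleBosonisation.IsBraidedGroup (R : H ⊗[k] H) S.toLinearMap) :
    ∃ (U : Type (max u v w)) (_ : Ring U) (_ : HopfAlgebra k U)
      (θ : DoubleBosonisation.Space k H B ≃ₗ[k] U),
      DoubleBosonisation.IsDoubleBosonisation R S θ ∧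
      ∀ (ι : Type x) [Fintype ι] (e : Module.Basis ι k B),
        DoubleBosonisation.IsQuasitriangular k
          (DoubleBosonisation.universalR θ e (R : H ⊗[k] H) S) ∧
        DoubleBosonisation.universalR θ e (R : H ⊗[k] H) S =
          TensorProduct.map θ.toLinearMap θ.toLinearMap
            (DoubleBosonisation.explicitR e (R : H ⊗[k] H) S) := by
  -- The coalgebra structure of `C̄` on `B*` depends on R and on the axioms, so it is installed
  -- locally; with it the coalgebra clauses of `IsBarDual` hold by definition.
  let _ := BraidedDouble.barCoalgebra hR hB
  have hD : BraidedDouble.IsBarDual R S := ⟨hR, hB, fun _ => rfl, fun _ => rfl⟩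
  obtain ⟨U, _, _, iC, iH, iB, hU⟩ := BraidedDouble.exists_isDouble hD
  exact ⟨U, inferInstance, inferInstance, hU.equiv, hU.isDoubleBosonisation hD, fun ι _ e =>
    ⟨hU.isQuasitriangular_universalR hD e, (hU.map_explicitR hD e).symm⟩⟩
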